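/- Let $-3<\gamma<0$. On $\mathbb R^3$ put $\langle v\rangle=(1+|v|^2)^{1/2}$, $\mu(v)=(2\pi)^{-3/2}e^{-|v|^2/2}$, $a_{jk}(v)=(\delta_{jk}|v|^2-v_jv_k)|v|^\gamma$, $\bar a_{jk}=a_{jk}*\mu$ and $A=(\bar a_{jk})_{1\le j,k\le 3}$. For $\theta\in\mathbb R$ and real-valued $u$ let $$\|u\|_{2,\theta}^2=\int_{\mathbb R^3}\langle v\rangle^{2\theta}u^2\,dv,\qquad \|u\|_{A,\theta}^2=\sum_{j,k=1}^3\int_{\mathbb R^3}\langle v\rangle^{2\theta}\Big(\bar a_{jk}\,\partial_ju\,\partial_ku+\tfrac14\bar a_{jk}v_jv_ku^2\Big)dv,$$ with weak derivatives, and let $$\mathcal L u=-\nabla\cdot[A\nabla u]+\Big(A\tfrac v2\cdot\tfrac v2\Big)u-\Big(\nabla\cdot\big[A\tfrac v2\big]\Big)u .$$ Let $T>0$ and $f_0\in L^2(\mathbb R^3)$, and let $f\in L^\infty([0,T];L^2(\mathbb R^3))$ be a weak solution of the linear Landau equation $$\partial_tf+\mathcal Lf=0,\qquad f|_{t=0}=f_0,$$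 that is, $\int_0^T\big(f(t),-\partial_t\varphi(t)+\mathcal L\varphi(t)\big)_{L^2}\,dt=(f_0,\varphi(0))_{L^2}$ for all real-valued $\varphi\in C_c^\infty(\mathbb R\times\mathbb R^3)$ with $\varphi(T,\cdot)=0$. Then, after a modification on a null set of times, $f$ is weakly continuous from $[0,T]$ to $L^2(\mathbb R^3)$ with $f(0)=f_0$; for every $0<t\le\min\{1,T\}$ all weak derivatives $\partial^\alpha f(t)$, $\alpha\in\mathbb N^3$, exist as locally integrable functions; and there is a constant $C>0$, depending only on $\gamma$ and on an upper bound for $\|f_0\|_{L^2}$ (in particular independent of $\alpha$, $t$ and $T$), such that for all $\alpha\in\mathbb N^3$ and all $0<t\le \min\{1,T\}$ $$\big\|t^{\frac{|\alpha|}2}\partial^\alpha f(t)\big\|_{2,\frac{\gamma|\alpha|}2}^2+\int_0^t\big\|\tau^{\frac{|\alpha|}2}\partial^\alpha f(\tau)\big\|_{A,\frac{\gamma|\alpha|}2}^2\,d\tau\le C^{2|\alpha|+2}(\alpha!)^2 .$$ -/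

import Mathlib

open MeasureTheory Set
open scoped ENNReal ContDiff

noncomputable section

namespace Landau

/-- The velocity space `ℝ³` with its Euclidean norm and Lebesgue measure. -/
abbrev V : Type := EuclideanSpace ℝ (Fin 3)

/-- The space `L²(ℝ³)` of real-valued functions. -/
abbrev L2V : Type := Lp ℝ 2 (volume : Measure V)

/-- The Japanese bracket `⟨v⟩ = (1 + |v|²)^{1/2}`. -/
def bracket (v : V) : ℝ := Real.sqrt (1 + ‖v‖ ^ 2)

/-- The absolute Maxwellian `μ(v) = (2π)^{-3/2} exp(-|v|²/2)`. -/
def maxwellian (v : V) : ℝ := (2 * Real.pi) ^ (-(3 / 2 : ℝ)) * Real.exp (-(‖v‖ ^ 2) / 2)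

/-- The Landau kernel `a_{jk}(v) = (δ_{jk} |v|² - v_j v_k) |v|^γ`. -/
def kernel (γ : ℝ) (j k : Fin 3) (v : V) : ℝ :=
  ((if j = k then ‖v‖ ^ 2 else 0) - v j * v k) * ‖v‖ ^ γ

/-- The coefficients `ā_{jk} = a_{jk} * μ` of the matrix `A(v)`. -/
def abar (γ : ℝ) (j k : Fin 3) (v : V) : ℝ :=
  ∫ w : V, kernel γ j k (v - w) * maxwellian w

/-- The classical partial derivative `∂_i u`. -/
def pd (i : Fin 3) (u : V → ℝ) (v : V) : ℝ := fderiv ℝ u v (EuclideanSpace.single i 1)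

/-- The classical derivative `∂^α u = ∂₁^{α₁} ∂₂^{α₂} ∂₃^{α₃} u` for a multi-index `α ∈ ℕ³`. -/
def multiPd (α : Fin 3 → ℕ) (u : V → ℝ) : V → ℝ :=
  (pd 0)^[α 0] ((pd 1)^[α 1] ((pd 2)^[α 2] u))

/-- The length `|α|` of a multi-index. -/
def len (α : Fin 3 → ℕ) : ℕ := ∑ i, α i

/-- The factorial `α! = α₁! α₂! α₃!` of a multi-index. -/
def multiFactorial (α : Fin 3 → ℕ) : ℕ := ∏ i, (α i).factorial

/-- The diffusion part of the linearized Landau operator,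
`𝓛 u = -∇·[A ∇u] + (A v/2 · v/2) u - (∇·[A v/2]) u`. -/
def landauOp (γ : ℝ) (u : V → ℝ) (v : V) : ℝ :=
  - (∑ i, ∑ j, pd i (fun w => abar γ i j w * pd j u w) v)
  + (∑ i, ∑ j, abar γ i j v * (v j / 2) * (v i / 2)) * u v
  - (∑ i, ∑ j, pd i (fun w => abar γ i j w * (w j / 2)) v) * u v

/-- `f ∈ L^∞([0,T]; L²(ℝ³))` is a weak solution on `[0,T]` of the Cauchy problem
`∂_t f + 𝓛 f = 0`, `f|_{t=0} = f₀`: for every smooth compactly supported test function `φ(t,v)`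
with `φ(T) = 0` one has `∫₀ᵀ (f(t), -∂_t φ(t) + 𝓛 φ(t))_{L²} dt = (f₀, φ(0))_{L²}`.
(The operator `𝓛` is formally self-adjoint.) -/
structure IsWeakSolution (γ T : ℝ) (f₀ : L2V) (f : ℝ → L2V) : Prop where
  memLp : MemLp f ∞ (volume.restrict (Ioo 0 T))
  weak_eq : ∀ φ : ℝ → V → ℝ,
    ContDiff ℝ ∞ (Function.uncurry φ) → HasCompactSupport (Function.uncurry φ) →
    (∀ v, φ T v = 0) →
    ∫ t in Ioo 0 T, ∫ v : V, f t v * (- deriv (fun s => φ s v) t + landauOp γ (φ t) v)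
      = ∫ v : V, f₀ v * φ 0 v

/-- `g` is the weak (distributional) derivative `∂^α u` on `ℝ³`. -/
structure HasWeakDeriv (α : Fin 3 → ℕ) (u g : V → ℝ) : Prop where
  locallyIntegrable : LocallyIntegrable g volume
  integral_eq : ∀ φ : V → ℝ, ContDiff ℝ ∞ φ → HasCompactSupport φ →
    ∫ v, u v * multiPd α φ v = (-1) ^ len α * ∫ v, g v * φ v

/-- The squared weighted norm `‖u‖²_{2,θ} = ∫ (⟨v⟩^θ u)² dv`, with values in `[0,∞]`. -/
def sqNormTwo (θ : ℝ) (u : V → ℝ) : ℝ≥0∞ :=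
  ∫⁻ v : V, ENNReal.ofReal ((bracket v ^ θ * u v) ^ 2)

/-- The squared weighted norm
`‖u‖²_{A,θ} = ∑_{j,k} ∫ ⟨v⟩^{2θ} (ā_{jk} ∂_j u ∂_k u + (1/4) ā_{jk} v_j v_k u²) dv`
of a function `u` with gradient `Du`, with values in `[0,∞]`. The integrand, summed over `j` and
`k`, is nonnegative because the matrix `(ā_{jk})` is positive semidefinite. -/
def sqNormA (γ θ : ℝ) (u : V → ℝ) (Du : Fin 3 → V → ℝ) : ℝ≥0∞ :=
  ∫⁻ v : V, ENNReal.ofReal (∑ j, ∑ k, bracket v ^ (2 * θ) *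
    (abar γ j k v * Du j v * Du k v + 1 / 4 * abar γ j k v * v j * v k * u v ^ 2))

end Landau

end

/-! The operator is a degenerate elliptic operator whose coefficients are analytic with uniform
constants, and the weights `t^{|α|/2} ⟨v⟩^{γ|α|/2}` are exactly what its ellipticity can pay for.

Three facts about the coefficients carry the estimate. (1) In `ā = a * μ` every derivative can be
put on `μ`, and Hermite polynomial bounds give `|∂^n μ(w)| ≤ C n! e^{|n|} e^{-|w|²/4}`. Since the
form of `a(z)` is nonnegative, Cauchy–Schwarz under the integral yields `|∂^n A ξ·η| ≤ K^{|n|+1} n!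
√m(ξ) √m(η)`, where `m` is the anisotropic form `mform` (`exists_abarDeriv_form_le`). (2) `A` itself
is bounded below by the same form `m` (`exists_le_abar_form`), so every derivative of `A` is
dominated by `A` without loss in the degenerate direction. (3) Because `a(z)z = 0`, the zeroth order
coefficient is a combination of second derivatives and the trace of `ā` (`potential_eq`). It is at
least `c⟨v⟩^{γ+2} - C⟨v⟩^γ` (`exists_le_potential`), and its derivatives obey factorial bounds of
size `⟨v⟩^{γ+2}` (`exists_potDeriv_le`).

Formally, apply `∂^α` to the equation and test with `t^{|α|} ⟨v⟩^{γ|α|} ∂^α f`. Besides the coercive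
energy there are three contributions. The time weight gives `|α| t^{|α|-1}` times the weighted norm
of `∂^α f`. The velocity weight has a radial gradient, the direction in which `√m` is smallest, and
costs only a constant of size `|α|²` times the same norm. The Leibniz formula gives terms with `∂^β
A` and `∂^{α-β} f`, `β ≠ 0`. For the first two, write `α = α' + e_l`: the energy density controls
`⟨v⟩^γ |∇u|²`, so the norm of `∂^α f` is at most the energy of `∂^{α'} f` with matching weights
(`normD_le_energyD`). If `l` is a largest index, then `|α| α'! ≤ 3 α!` (`exists_lower`), and the
factors `|α|` are absorbed by the factorials. In the Leibniz terms binomials and factorials combine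
to `α!`, and the sum over `β` is geometric in `K / L` (`sum_lowCoeff_mul_wgt_le`). With the
inductive bound `L^{|α|+1} α!` every term carries `1 / L²`, so one large `L`, depending on `γ` and
the bound on the data, closes the induction on `|α|` (`weight_sum_le`, `IsFlow.levelBound_step`).
Order zero is Gronwall's inequality (`IsFlow.level_zero`).

The solution is only `L²`, so the computation is made for `∂^α ρ_n * g` with compactly supported
weights, where `g` is the weakly continuous representative obtained by Riesz representation
(`IsWeakSolution.exists_isFlow`). The energy balance is then exact (`IsFlow.energy_eq`), and the
Friedrichs commutators tend to zero in `L²_loc` as soon as the derivatives up to order `|α|` are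
locally square integrable (`negligible_friedrichs`, `vanishing_errTerm`). Fatou in `n` and monotone
convergence in the cutoff radius give the estimate. Uniform bounds on mollified derivatives produce
the weak derivatives themselves by duality (`exists_hasWeakDeriv_of_frequently_le`): order `|α|` at
every time, order `|α| + 1` at almost every time, which is the regularity that the next step needs.
-/

open MeasureTheory Set
open scoped ENNReal ContDiff

noncomputable section

namespace Landau

open Filter Topology

section

/-! ### Partial derivatives -/

/-- The `i`-th coordinate functional. -/
abbrev coord (i : Fin 3) : V →L[ℝ] ℝ := EuclideanSpace.proj i

/-- The multi-index `e_i`. -/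
abbrev unitIdx (i : Fin 3) : Fin 3 → ℕ := Pi.single i 1

lemma sum_smul_coord_single (c : Fin 3 → ℝ) (i : Fin 3) :
    (∑ l, c l • coord l) (EuclideanSpace.single i (1 : ℝ)) = c i := by
  simp [Pi.single_apply]

lemma sum_apply_single_smul_coord (L : V →L[ℝ] ℝ) :
    L = ∑ l, L (EuclideanSpace.single l (1 : ℝ)) • coord l := by
  ext x
  have hx : x = ∑ l, x l • EuclideanSpace.single l (1 : ℝ) := by
    ext j
    simp [Pi.single_apply]
  conv_lhs => rw [hx]
  simp [mul_comm]

lemma pd_eq_of_hasFDerivAt {u : V → ℝ} {c : Fin 3 → ℝ} {v : V}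
    (h : HasFDerivAt u (∑ l, c l • coord l) v) (i : Fin 3) : pd i u v = c i := by
  rw [pd, h.fderiv, sum_smul_coord_single]

lemma hasFDerivAt_pd {u : V → ℝ} {v : V} (h : DifferentiableAt ℝ u v) :
    HasFDerivAt u (∑ l, pd l u v • coord l) v := by
  have := h.hasFDerivAt
  rwa [sum_apply_single_smul_coord (fderiv ℝ u v)] at this

lemma contDiff_pd {u : V → ℝ} (h : ContDiff ℝ ∞ u) (i : Fin 3) : ContDiff ℝ ∞ (pd i u) := by
  have h1 : ContDiff ℝ ∞ (fderiv ℝ u) := h.fderiv_right (by norm_cast)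
  exact h1.clm_apply contDiff_const

lemma hasCompactSupport_pd {u : V → ℝ} (h : HasCompactSupport u) (i : Fin 3) :
    HasCompactSupport (pd i u) :=
  (h.fderiv ℝ).comp_left (g := fun L : V →L[ℝ] ℝ => L (EuclideanSpace.single i 1)) rfl

lemma pd_comm {u : V → ℝ} (h : ContDiff ℝ ∞ u) (i j : Fin 3) :
    pd i (pd j u) = pd j (pd i u) := by
  funext v
  have hd : DifferentiableAt ℝ (fderiv ℝ u) v :=
    (h.fderiv_right (m := ∞) (by norm_cast)).differentiable (by simp) v
  have key : ∀ a b : Fin 3, pd a (pd b u) v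
      = fderiv ℝ (fderiv ℝ u) v (EuclideanSpace.single a 1) (EuclideanSpace.single b 1) := by
    intro a b
    have : HasFDerivAt (pd b u) ((fderiv ℝ (fderiv ℝ u) v).flip (EuclideanSpace.single b 1)) v :=
      hd.hasFDerivAt.clm_apply (hasFDerivAt_const _ _) |>.congr_fderiv (by ext; simp)
    rw [pd, this.fderiv]
    rfl
  rw [key, key]
  exact (h.contDiffAt.isSymmSndFDerivAt (by
    rw [minSmoothness_of_isRCLikeNormedField]
    exact (WithTop.coe_le_coe.2 le_top : ((2 : ℕ∞) : WithTop ℕ∞) ≤ ((⊤ : ℕ∞) : WithTop ℕ∞)))).eq _ _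

lemma pd_add {u w : V → ℝ} (i : Fin 3) {v : V} (hu : DifferentiableAt ℝ u v)
    (hw : DifferentiableAt ℝ w v) : pd i (fun x => u x + w x) v = pd i u v + pd i w v := by
  rw [pd, fderiv_fun_add hu hw]; rfl

lemma pd_sub {u w : V → ℝ} (i : Fin 3) {v : V} (hu : DifferentiableAt ℝ u v)
    (hw : DifferentiableAt ℝ w v) : pd i (fun x => u x - w x) v = pd i u v - pd i w v := by
  rw [pd, fderiv_fun_sub hu hw]; rfl

lemma pd_mul {u w : V → ℝ} (i : Fin 3) {v : V} (hu : DifferentiableAt ℝ u v)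
    (hw : DifferentiableAt ℝ w v) :
    pd i (fun x => u x * w x) v = pd i u v * w v + u v * pd i w v := by
  rw [pd, fderiv_fun_mul hu hw]
  simp [pd]; ring

lemma pd_const_mul {u : V → ℝ} (i : Fin 3) {v : V} (c : ℝ) (hu : DifferentiableAt ℝ u v) :
    pd i (fun x => c * u x) v = c * pd i u v := by
  rw [pd, fderiv_const_mul hu]; rfl

lemma pd_sum {ι : Type*} (s : Finset ι) {u : ι → V → ℝ} (i : Fin 3) {v : V}
    (hu : ∀ a ∈ s, DifferentiableAt ℝ (u a) v) :
    pd i (fun x => ∑ a ∈ s, u a x) v = ∑ a ∈ s, pd i (u a) v := by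
  rw [pd, fderiv_fun_sum hu]
  simp [pd]

lemma pd_coord (i j : Fin 3) (v : V) : pd i (fun w : V => w j) v = if j = i then 1 else 0 := by
  have : HasFDerivAt (fun w : V => w j) (coord j) v := (coord j).hasFDerivAt
  rw [pd, this.fderiv]
  simp [Pi.single_apply]

lemma contDiff_coord (j : Fin 3) : ContDiff ℝ ∞ (fun w : V => w j) := (coord j).contDiff

/-! ### Families of functions closed under partial derivatives -/

/-- `F n` is the derivative `∂^n F₀` of a smooth function, consistently in `n`. -/
def IsDerivFamily (F : (Fin 3 → ℕ) → V → ℝ) : Prop :=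
  ∀ n v, HasFDerivAt (F n) (∑ l, F (n + unitIdx l) v • coord l) v

namespace IsDerivFamily

variable {F : (Fin 3 → ℕ) → V → ℝ}

lemma pd_eq (hF : IsDerivFamily F) (n : Fin 3 → ℕ) (l : Fin 3) :
    pd l (F n) = F (n + unitIdx l) :=
  funext fun v => pd_eq_of_hasFDerivAt (hF n v) l

lemma contDiff (hF : IsDerivFamily F) (n : Fin 3 → ℕ) : ContDiff ℝ ∞ (F n) := by
  rw [contDiff_infty]
  intro m
  induction m generalizing n with
  | zero =>
    exact contDiff_zero.2 (continuous_iff_continuousAt.2 fun v => (hF n v).continuousAt)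
  | succ m ih =>
    rw [show ((m + 1 : ℕ) : WithTop ℕ∞) = (m : WithTop ℕ∞) + 1 by push_cast; rfl]
    rw [contDiff_succ_iff_hasFDerivAt]
    refine ⟨fun v => ∑ l, F (n + unitIdx l) v • coord l, ?_, hF n⟩
    exact ContDiff.sum fun l _ => (ih _).smul contDiff_const

lemma iterate_pd (hF : IsDerivFamily F) (n : Fin 3 → ℕ) (l : Fin 3) (m : ℕ) :
    (pd l)^[m] (F n) = F (n + m • unitIdx l) := by
  induction m with
  | zero => simp
  | succ m ih =>
    rw [Function.iterate_succ_apply', ih, hF.pd_eq, add_assoc, succ_nsmul]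

lemma multiPd_eq (hF : IsDerivFamily F) (n α : Fin 3 → ℕ) :
    multiPd α (F n) = F (n + α) := by
  rw [multiPd, hF.iterate_pd, hF.iterate_pd, hF.iterate_pd]
  congr 1
  funext i
  fin_cases i <;> simp [Pi.single_apply]

end IsDerivFamily

lemma contDiff_iterate_pd {u : V → ℝ} (h : ContDiff ℝ ∞ u) (i : Fin 3) (m : ℕ) :
    ContDiff ℝ ∞ ((pd i)^[m] u) := by
  induction m with
  | zero => simpa
  | succ m ih => rw [Function.iterate_succ_apply']; exact contDiff_pd ih i

lemma contDiff_multiPd {u : V → ℝ} (h : ContDiff ℝ ∞ u) (α : Fin 3 → ℕ) :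
    ContDiff ℝ ∞ (multiPd α u) :=
  contDiff_iterate_pd (contDiff_iterate_pd (contDiff_iterate_pd h _ _) _ _) _ _

lemma hasCompactSupport_iterate_pd {u : V → ℝ} (h : HasCompactSupport u) (i : Fin 3) (m : ℕ) :
    HasCompactSupport ((pd i)^[m] u) := by
  induction m with
  | zero => simpa
  | succ m ih => rw [Function.iterate_succ_apply']; exact hasCompactSupport_pd ih i

lemma hasCompactSupport_multiPd {u : V → ℝ} (h : HasCompactSupport u) (α : Fin 3 → ℕ) :
    HasCompactSupport (multiPd α u) :=
  hasCompactSupport_iterate_pd (hasCompactSupport_iterate_pd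
    (hasCompactSupport_iterate_pd h _ _) _ _) _ _

lemma pd_iterate_comm {u : V → ℝ} (h : ContDiff ℝ ∞ u) (i j : Fin 3) (m : ℕ) :
    pd i ((pd j)^[m] u) = (pd j)^[m] (pd i u) := by
  induction m with
  | zero => rfl
  | succ m ih =>
    rw [Function.iterate_succ_apply', pd_comm (contDiff_iterate_pd h _ _), ih,
      Function.iterate_succ_apply']

lemma multiPd_zero (u : V → ℝ) : multiPd 0 u = u := rfl

lemma pd_multiPd {u : V → ℝ} (h : ContDiff ℝ ∞ u) (α : Fin 3 → ℕ) (l : Fin 3) :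
    pd l (multiPd α u) = multiPd (α + unitIdx l) u := by
  have h2 := contDiff_iterate_pd h 2 (α 2)
  have h1 := contDiff_iterate_pd h2 1 (α 1)
  fin_cases l
  · simp [multiPd, Function.iterate_succ_apply']
  · simp only [multiPd]
    rw [pd_iterate_comm h1]
    simp [Function.iterate_succ_apply']
  · simp only [multiPd]
    rw [pd_iterate_comm h1, pd_iterate_comm h2]
    simp [Function.iterate_succ_apply']

lemma isDerivFamily_multiPd {u : V → ℝ} (h : ContDiff ℝ ∞ u) :
    IsDerivFamily (fun n => multiPd n u) := by
  intro n v
  have := hasFDerivAt_pd (((contDiff_multiPd h n).differentiable (by simp)) v)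
  simpa only [pd_multiPd h n] using! this

lemma multiPd_pd {u : V → ℝ} (h : ContDiff ℝ ∞ u) (α : Fin 3 → ℕ) (l : Fin 3) :
    multiPd α (pd l u) = multiPd (α + unitIdx l) u := by
  have hF := isDerivFamily_multiPd h
  have h1 := hF.multiPd_eq (unitIdx l) α
  have h2 : pd l u = multiPd (unitIdx l) u := by
    have := pd_multiPd h 0 l
    rwa [multiPd_zero, zero_add] at this
  rw [h2, add_comm α]
  exact h1

lemma multiPd_multiPd {u : V → ℝ} (h : ContDiff ℝ ∞ u) (α β : Fin 3 → ℕ) :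
    multiPd α (multiPd β u) = multiPd (β + α) u :=
  (isDerivFamily_multiPd h).multiPd_eq β α

lemma len_add (α β : Fin 3 → ℕ) : len (α + β) = len α + len β := by
  simp [len, Finset.sum_add_distrib]

lemma len_unitIdx (i : Fin 3) : len (unitIdx i) = 1 := by
  simp [len]

end

section

/-! ### Derivatives of the Gaussian -/

/-- The Appell property. It turns the differential recurrence for Hermite polynomials into the
three-term recurrence `He_{n+2} = x He_{n+1} - (n+1) He_n`, which can be iterated for bounds. -/
lemma derivative_hermite (n : ℕ) : Polynomial.derivative (Polynomial.hermite (n + 1)) =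
    ((n : Polynomial ℤ) + 1) * Polynomial.hermite n := by
  induction n with
  | zero => simp [Polynomial.hermite_one, Polynomial.hermite_zero]
  | succ n ih =>
    conv_lhs => rw [Polynomial.hermite_succ]
    rw [map_sub, Polynomial.derivative_mul, Polynomial.derivative_X, ih,
      Polynomial.derivative_mul]
    conv_rhs => rw [Polynomial.hermite_succ]
    conv_lhs => rw [Polynomial.hermite_succ]
    simp
    ring

/-- Crude, but `y^n ≤ n! e^y` with `y = |x| + n` turns this into one factorial times a geometric
factor, which is all that analyticity asks for. -/
lemma abs_hermite_le (x : ℝ) (n : ℕ) :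
    |Polynomial.aeval x (Polynomial.hermite n)| ≤ (|x| + n) ^ n := by
  induction n using Nat.strong_induction_on with
  | _ n ih =>
    match n with
    | 0 => simp [Polynomial.hermite_zero]
    | 1 => simp [Polynomial.hermite_one]
    | n + 2 =>
      have h1 := ih (n + 1) (by omega)
      have h0 := ih n (by omega)
      have hx := abs_nonneg x
      have hn : (0 : ℝ) ≤ n := by positivity
      rw [Polynomial.hermite_succ, derivative_hermite]
      simp only [map_sub, map_mul, Polynomial.aeval_X, map_add, map_natCast, map_one]
      push_cast at h1 ⊢
      calc _ ≤ |x| * |Polynomial.aeval x (Polynomial.hermite (n + 1))|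
            + (n + 1) * |Polynomial.aeval x (Polynomial.hermite n)| := by
            refine (abs_sub _ _).trans ?_
            rw [abs_mul, abs_mul, abs_of_nonneg (by positivity : (0 : ℝ) ≤ n + 1)]
        _ ≤ |x| * (|x| + (n + 1)) ^ (n + 1) + (|x| + (n + 1)) * (|x| + (n + 1)) ^ n := by
            have h3 : (|x| + (n : ℝ)) ^ n ≤ (|x| + (n + 1)) ^ n :=
              pow_le_pow_left₀ (by positivity) (by linarith) _
            have h4 := h0.trans h3
            have h5 : (n : ℝ) + 1 ≤ |x| + (n + 1) := by linarith
            gcongr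
        _ = (|x| + 1) * (|x| + (n + 1)) ^ (n + 1) := by ring
        _ ≤ (|x| + (n + 2)) * (|x| + (n + 2)) ^ (n + 1) := by
            gcongr <;> linarith
        _ = _ := by ring

/-- The `n`-th derivative of `exp (-x²/2)`. -/
def gaussDeriv (n : ℕ) : ℝ → ℝ := deriv^[n] (fun y => Real.exp (-(y ^ 2 / 2)))

lemma hasDerivAt_gaussDeriv (n : ℕ) (x : ℝ) :
    HasDerivAt (gaussDeriv n) (gaussDeriv (n + 1) x) x := by
  have h : ContDiff ℝ ∞ (gaussDeriv n) :=
    ContDiff.iterate_deriv n (by fun_prop)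
  have := (h.differentiable (by simp) x).hasDerivAt
  rwa [show gaussDeriv (n + 1) x = deriv (gaussDeriv n) x by
    simp only [gaussDeriv, Function.iterate_succ_apply']]

lemma abs_gaussDeriv_le (n : ℕ) (x : ℝ) :
    |gaussDeriv n x| ≤ n.factorial * Real.exp n * (Real.exp 1 * Real.exp (-(x ^ 2 / 4))) := by
  rw [gaussDeriv, Polynomial.deriv_gaussian_eq_hermite_mul_gaussian, abs_mul, abs_mul, abs_pow,
    abs_neg, abs_one, one_pow, one_mul, abs_of_pos (Real.exp_pos _)]
  have h1 : (|x| + n) ^ n ≤ n.factorial * Real.exp (|x| + n) := by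
    have := Real.pow_div_factorial_le_exp (x := |x| + n) (by positivity) n
    rwa [div_le_iff₀ (by positivity), mul_comm] at this
  -- Half of the Gaussian exponent pays for `e^{|x|}`; the other half remains for integrability.
  have h2 : |x| - x ^ 2 / 2 ≤ 1 - x ^ 2 / 4 := by
    nlinarith [sq_nonneg (|x| - 2), sq_abs x]
  calc _ ≤ n.factorial * Real.exp (|x| + n) * Real.exp (-(x ^ 2 / 2)) := by
        gcongr; exact (abs_hermite_le x n).trans h1
    _ = n.factorial * Real.exp n * Real.exp (|x| - x ^ 2 / 2) := by
        rw [mul_assoc, mul_assoc, ← Real.exp_add, ← Real.exp_add]; ring_nf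
    _ ≤ n.factorial * Real.exp n * Real.exp (1 - x ^ 2 / 4) := by gcongr
    _ = _ := by rw [← Real.exp_add]; ring_nf

/-- The derivative `∂^n μ` of the Maxwellian. -/
def maxDeriv (n : Fin 3 → ℕ) (w : V) : ℝ :=
  (2 * Real.pi) ^ (-(3 / 2 : ℝ)) * ∏ i, gaussDeriv (n i) (w i)

lemma norm_sq_eq_sum (w : V) : ‖w‖ ^ 2 = ∑ i, w i ^ 2 := by
  rw [EuclideanSpace.norm_sq_eq]; simp

lemma maxDeriv_zero : maxDeriv 0 = maxwellian := by
  funext w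
  simp only [maxDeriv, maxwellian, gaussDeriv, Pi.zero_apply, Function.iterate_zero, id]
  rw [← Real.exp_sum, norm_sq_eq_sum]
  congr 2
  simp [Finset.sum_div, Finset.sum_neg_distrib, neg_div]

lemma isDerivFamily_maxDeriv : IsDerivFamily maxDeriv := by
  intro n v
  have h : ∀ i, HasFDerivAt (fun w : V => gaussDeriv (n i) (w i))
      (gaussDeriv (n i + 1) (v i) • coord i) v := fun i =>
    (hasDerivAt_gaussDeriv (n i) (v i)).comp_hasFDerivAt v (coord i).hasFDerivAt
  have hp := (HasFDerivAt.finsetProd (u := Finset.univ) fun i _ => h i).const_mul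
    ((2 * Real.pi) ^ (-(3 / 2 : ℝ)))
  refine hp.congr_fderiv ?_
  rw [Finset.smul_sum]
  refine Finset.sum_congr rfl fun l _ => ?_
  rw [smul_smul, smul_smul]
  congr 1
  rw [maxDeriv, ← Finset.mul_prod_erase Finset.univ _ (Finset.mem_univ l), mul_assoc]
  congr 1
  rw [mul_comm]
  congr 1
  · simp
  · refine Finset.prod_congr rfl fun i hi => ?_
    simp [Finset.ne_of_mem_erase hi]

lemma abs_maxDeriv_le (n : Fin 3 → ℕ) (w : V) :
    |maxDeriv n w| ≤ multiFactorial n * Real.exp (len n) * Real.exp 3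
      * Real.exp (-(‖w‖ ^ 2 / 4)) := by
  have hpi : (2 * Real.pi) ^ (-(3 / 2 : ℝ)) ≤ 1 :=
    Real.rpow_le_one_of_one_le_of_nonpos (by linarith [Real.pi_gt_three]) (by norm_num)
  rw [maxDeriv, abs_mul, Finset.abs_prod, abs_of_pos (by positivity)]
  calc _ ≤ 1 * ∏ i, ((n i).factorial * Real.exp (n i)
        * (Real.exp 1 * Real.exp (-(w i ^ 2 / 4)))) := by
        gcongr with i; exact abs_gaussDeriv_le _ _
    _ = _ := by
        rw [one_mul, Finset.prod_mul_distrib, Finset.prod_mul_distrib, Finset.prod_mul_distrib,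
          ← Real.exp_sum, ← Real.exp_sum, norm_sq_eq_sum, multiFactorial, len]
        push_cast
        have h3 : ∑ _i : Fin 3, (1 : ℝ) = 3 := by simp
        rw [h3, ← Real.exp_sum]
        simp only [Finset.sum_div, Finset.sum_neg_distrib]
        ring

/-! ### Integrals of singular kernels against Gaussians -/

lemma one_add_norm_sq_pos (v : V) : 0 < 1 + ‖v‖ ^ 2 := by positivity

lemma bracket_pos (v : V) : 0 < bracket v := Real.sqrt_pos.2 (one_add_norm_sq_pos v)

lemma bracket_sq (v : V) : bracket v ^ 2 = 1 + ‖v‖ ^ 2 :=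
  Real.sq_sqrt (one_add_norm_sq_pos v).le

lemma one_le_bracket (v : V) : 1 ≤ bracket v := by
  rw [bracket, Real.one_le_sqrt]; nlinarith [sq_nonneg ‖v‖]

lemma bracket_rpow (v : V) (s : ℝ) : bracket v ^ s = (1 + ‖v‖ ^ 2) ^ (s / 2) := by
  rw [bracket, Real.sqrt_eq_rpow, ← Real.rpow_mul (one_add_norm_sq_pos v).le]
  congr 1; ring

lemma one_add_norm_sq_le (v w : V) :
    1 + ‖v‖ ^ 2 ≤ 2 * (1 + ‖v - w‖ ^ 2) * (1 + ‖w‖ ^ 2) := by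
  have h : ‖v‖ ≤ ‖v - w‖ + ‖w‖ := by simpa using norm_add_le (v - w) w
  nlinarith [sq_nonneg (‖v - w‖ - ‖w‖), norm_nonneg v, norm_nonneg (v - w), norm_nonneg w,
    mul_nonneg (sq_nonneg ‖v - w‖) (sq_nonneg ‖w‖)]

lemma integrable_gaussian {b : ℝ} (hb : 0 < b) :
    Integrable (fun w : V => Real.exp (-(b * ‖w‖ ^ 2))) := by
  have := (GaussianFourier.integrable_cexp_neg_mul_sq_norm_add (V := V) (b := b)
    (by simpa using hb) 0 0).norm
  refine this.congr (Eventually.of_forall fun w => ?_)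
  simp only [Complex.norm_exp]
  congr 1
  simp [← Complex.ofReal_pow, ← Complex.ofReal_mul]

lemma integrable_ball_norm_rpow {γ : ℝ} (hγ : -3 < γ) :
    Integrable ((Metric.ball (0 : V) 1).indicator fun z => ‖z‖ ^ γ) := by
  rw [integrable_indicator_iff Metric.isOpen_ball.measurableSet]
  refine integrableOn_ball_of_norm_le_rpow (C := 1) (α := -γ) (by simp) (by simp; linarith) ?_
    (by exact (measurable_norm.pow_const γ).aestronglyMeasurable)
  refine Eventually.of_forall fun z => ?_
  rw [neg_neg, one_mul, Real.norm_of_nonneg (by positivity)]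

lemma one_add_rpow_le_exp {s b : ℝ} (hs : 0 < s) (hb : 0 < b) :
    ∃ C : ℝ, 0 < C ∧ ∀ x : ℝ, 0 ≤ x → (1 + x) ^ s ≤ C * Real.exp (b * x) := by
  have hc : 0 < b / s := by positivity
  refine ⟨(b / s) ^ (-s) * Real.exp b, by positivity, fun x hx => ?_⟩
  have h1 : 1 + x ≤ (b / s)⁻¹ * Real.exp (b / s * (1 + x)) := by
    rw [inv_mul_eq_div, le_div_iff₀ hc]
    nlinarith [Real.add_one_le_exp (b / s * (1 + x))]
  calc (1 + x) ^ s ≤ ((b / s)⁻¹ * Real.exp (b / s * (1 + x))) ^ s := by gcongr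
    _ = (b / s) ^ (-s) * Real.exp b * Real.exp (b * x) := by
      rw [Real.mul_rpow (by positivity) (by positivity), Real.inv_rpow hc.le,
        ← Real.rpow_neg hc.le, ← Real.exp_mul, mul_assoc (_ ^ _) (Real.exp b), ← Real.exp_add]
      congr 2
      field_simp

/-- Peetre's inequality moves `⟨v⟩^{-γ}` onto `z = v - w` and `w`. The factor in `w` is absorbed by
half of the Gaussian. The factor in `z` makes `‖z‖^γ` bounded for `‖z‖ ≥ 1`, and near the origin
`‖z‖^γ` is integrable because `γ > -3`. -/
lemma exists_bound_singular_gaussian {γ : ℝ} (hγ : -3 < γ) (hγ' : γ < 0) {b : ℝ} (hb : 0 < b) :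
    (∀ v : V, Integrable fun w : V => ‖v - w‖ ^ γ * Real.exp (-(b * ‖w‖ ^ 2))) ∧
    ∃ C : ℝ, 0 < C ∧ ∀ v : V,
      ∫ w : V, ‖v - w‖ ^ γ * Real.exp (-(b * ‖w‖ ^ 2)) ≤ C * bracket v ^ γ := by
  set s := -γ / 2 with hs
  have hs0 : 0 < s := by rw [hs]; linarith
  obtain ⟨C, hC, hCb⟩ := one_add_rpow_le_exp hs0 (half_pos hb)
  set h : V → ℝ := (Metric.ball (0 : V) 1).indicator fun z => ‖z‖ ^ γ with hh
  have hint := integrable_ball_norm_rpow hγ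
  have hg := integrable_gaussian (half_pos hb)
  have hh0 : ∀ z, 0 ≤ h z := fun z => indicator_nonneg (fun _ _ => by positivity) z
  have key : ∀ v w : V, bracket v ^ (-γ) * (‖v - w‖ ^ γ * Real.exp (-(b * ‖w‖ ^ 2)))
      ≤ 4 ^ s * C * (h (v - w) + Real.exp (-(b / 2 * ‖w‖ ^ 2))) := by
    intro v w
    set z := v - w with hz
    have h1 : bracket v ^ (-γ) ≤ 2 ^ s * (1 + ‖z‖ ^ 2) ^ s * (1 + ‖w‖ ^ 2) ^ s := by
      rw [bracket_rpow, ← Real.mul_rpow (by positivity) (by positivity),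
        ← Real.mul_rpow (by positivity) (by positivity)]
      exact Real.rpow_le_rpow (by positivity) (one_add_norm_sq_le v w) hs0.le
    have h2 : (1 + ‖z‖ ^ 2) ^ s * ‖z‖ ^ γ ≤ 2 ^ s * (h z + 1) := by
      by_cases hz1 : ‖z‖ < 1
      · have : h z = ‖z‖ ^ γ := indicator_of_mem (by simpa using hz1) _
        rw [this]
        have h4 : (1 + ‖z‖ ^ 2) ^ s ≤ 2 ^ s :=
          Real.rpow_le_rpow (by positivity) (by nlinarith [norm_nonneg z]) hs0.le
        have h5 : 0 ≤ ‖z‖ ^ γ := by positivity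
        calc _ ≤ 2 ^ s * ‖z‖ ^ γ := by gcongr
          _ ≤ _ := by gcongr; linarith
      · push Not at hz1
        have h4 : (1 + ‖z‖ ^ 2) ^ s ≤ 2 ^ s * ‖z‖ ^ (-γ) := by
          calc _ ≤ (2 * ‖z‖ ^ 2) ^ s :=
                Real.rpow_le_rpow (by positivity) (by nlinarith) hs0.le
            _ = _ := by
                rw [Real.mul_rpow (by norm_num) (by positivity), ← Real.rpow_natCast ‖z‖ 2,
                  ← Real.rpow_mul (by positivity)]
                congr 2; rw [hs]; push_cast; ring
        have h5 : ‖z‖ ^ (-γ) * ‖z‖ ^ γ = 1 := by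
          rw [← Real.rpow_add (by linarith)]; simp
        calc _ ≤ 2 ^ s * ‖z‖ ^ (-γ) * ‖z‖ ^ γ := by gcongr
          _ = 2 ^ s * 1 := by rw [mul_assoc, h5]
          _ ≤ _ := by gcongr; linarith [hh0 z]
    have h3 : (1 + ‖w‖ ^ 2) ^ s * Real.exp (-(b * ‖w‖ ^ 2))
        ≤ C * Real.exp (-(b / 2 * ‖w‖ ^ 2)) := by
      calc _ ≤ C * Real.exp (b / 2 * ‖w‖ ^ 2) * Real.exp (-(b * ‖w‖ ^ 2)) := by
            gcongr; exact hCb _ (by positivity)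
        _ = _ := by rw [mul_assoc, ← Real.exp_add]; ring_nf
    have h6 : Real.exp (-(b / 2 * ‖w‖ ^ 2)) ≤ 1 := Real.exp_le_one_iff.2 (by
      have : 0 ≤ b / 2 * ‖w‖ ^ 2 := by positivity
      linarith)
    calc _ ≤ 2 ^ s * (1 + ‖z‖ ^ 2) ^ s * (1 + ‖w‖ ^ 2) ^ s
          * (‖z‖ ^ γ * Real.exp (-(b * ‖w‖ ^ 2))) := by gcongr
      _ = 2 ^ s * ((1 + ‖z‖ ^ 2) ^ s * ‖z‖ ^ γ)
          * ((1 + ‖w‖ ^ 2) ^ s * Real.exp (-(b * ‖w‖ ^ 2))) := by ring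
      _ ≤ 2 ^ s * (2 ^ s * (h z + 1)) * (C * Real.exp (-(b / 2 * ‖w‖ ^ 2))) := by
          have := hh0 z
          gcongr
      _ = 4 ^ s * C * ((h z) * Real.exp (-(b / 2 * ‖w‖ ^ 2))
            + Real.exp (-(b / 2 * ‖w‖ ^ 2))) := by
          rw [show (4 : ℝ) = 2 * 2 by norm_num, Real.mul_rpow (by norm_num) (by norm_num)]; ring
      _ ≤ 4 ^ s * C * (h z * 1 + Real.exp (-(b / 2 * ‖w‖ ^ 2))) := by
          have := hh0 z
          gcongr
      _ = _ := by rw [mul_one]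
  have hI : ∀ v : V, Integrable fun w : V =>
      4 ^ s * C * (h (v - w) + Real.exp (-(b / 2 * ‖w‖ ^ 2))) := fun v =>
    ((hint.comp_sub_left v).add hg).const_mul _
  have hI2 : ∀ v : V, Integrable fun w : V =>
      bracket v ^ (-γ) * (‖v - w‖ ^ γ * Real.exp (-(b * ‖w‖ ^ 2))) := fun v => by
    refine (hI v).mono' (by fun_prop) (Eventually.of_forall fun w => ?_)
    rw [Real.norm_of_nonneg]
    · exact key v w
    · have := bracket_pos v
      positivity
  have hb1 : ∀ v : V, bracket v ^ γ * bracket v ^ (-γ) = 1 := fun v => by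
    rw [← Real.rpow_add (bracket_pos v)]; simp
  refine ⟨fun v => ?_, 4 ^ s * C * ((∫ z, h z) + ∫ w : V, Real.exp (-(b / 2 * ‖w‖ ^ 2))) + 1,
    ?_, fun v => ?_⟩
  · have := (hI2 v).const_mul (bracket v ^ γ)
    refine this.congr (Eventually.of_forall fun w => ?_)
    simp only
    rw [← mul_assoc, hb1, one_mul]
  · have h1 : 0 ≤ ∫ z, h z := integral_nonneg hh0
    have h2 : 0 ≤ ∫ w : V, Real.exp (-(b / 2 * ‖w‖ ^ 2)) :=
      integral_nonneg fun w => (Real.exp_pos _).le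
    positivity
  · have h1 := integral_mono (hI2 v) (hI v) (key v)
    rw [integral_const_mul, integral_const_mul, integral_add (hint.comp_sub_left v) hg,
      integral_sub_left_eq_self h volume v] at h1
    have h2 := bracket_pos v
    calc _ = bracket v ^ γ * (bracket v ^ (-γ)
          * ∫ w : V, ‖v - w‖ ^ γ * Real.exp (-(b * ‖w‖ ^ 2))) := by
          rw [← mul_assoc, hb1, one_mul]
      _ ≤ bracket v ^ γ * (4 ^ s * C * ((∫ z, h z) + ∫ w : V, Real.exp (-(b / 2 * ‖w‖ ^ 2)))) := by
          gcongr
      _ ≤ _ := by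
          have : 0 < bracket v ^ γ := by positivity
          linarith

end

section

/-! ### Convolutions of singular kernels with derivatives of the Maxwellian -/

/-- A kernel which is at most `|z|^γ (1 + |z|²)` up to a constant. -/
def KernelBound (γ : ℝ) (κ : V → ℝ) : Prop :=
  Measurable κ ∧ ∃ C : ℝ, 0 ≤ C ∧ ∀ z, |κ z| ≤ C * (‖z‖ ^ γ * (1 + ‖z‖ ^ 2))

/-- The convolution `κ * ∂^n μ`. -/
def convMax (κ : V → ℝ) (n : Fin 3 → ℕ) (v : V) : ℝ := ∫ w : V, κ (v - w) * maxDeriv n w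

lemma continuous_maxDeriv (n : Fin 3 → ℕ) : Continuous (maxDeriv n) :=
  (isDerivFamily_maxDeriv.contDiff n).continuous

lemma one_add_mul_exp_le {x : ℝ} (b : ℝ) (hb : 0 < b) (hb1 : b ≤ 1) :
    (1 + x) * Real.exp (-(2 * b * x)) ≤ b⁻¹ * Real.exp (-(b * x)) := by
  have h1 : 1 + x ≤ b⁻¹ * Real.exp (b * x) := by
    rw [inv_mul_eq_div, le_div_iff₀ hb]
    nlinarith [Real.add_one_le_exp (b * x)]
  calc _ ≤ b⁻¹ * Real.exp (b * x) * Real.exp (-(2 * b * x)) := by gcongr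
    _ = _ := by rw [mul_assoc, ← Real.exp_add]; ring_nf

variable {γ : ℝ}

/-- The majorant is uniform for `v` in the unit ball around `v₀`, as needed to differentiate under
the integral sign. -/
lemma KernelBound.exists_dominating {κ : V → ℝ} (hκ : KernelBound γ κ) (n : Fin 3 → ℕ) :
    ∃ K : ℝ, 0 ≤ K ∧ ∀ v₀ v z : V, ‖v - v₀‖ ≤ 1 → |κ z * maxDeriv n (v - z)| ≤
      K * (1 + ‖v₀‖ ^ 2) * (‖z‖ ^ γ * Real.exp (-(1 / 16 * ‖v₀ - z‖ ^ 2))) := by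
  obtain ⟨-, C, hC0, hC⟩ := hκ
  set A : ℝ := multiFactorial n * Real.exp (len n) * Real.exp 3 with hA
  have hA0 : 0 ≤ A := by positivity
  refine ⟨C * 2 * A * Real.exp (1 / 4) * 16, by positivity, fun v₀ v z hv => ?_⟩
  set y := v₀ - z with hy
  have h1 : 1 + ‖z‖ ^ 2 ≤ 2 * (1 + ‖y‖ ^ 2) * (1 + ‖v₀‖ ^ 2) := by
    have := one_add_norm_sq_le z v₀
    rwa [norm_sub_rev] at this
  have h2 : Real.exp (-(‖v - z‖ ^ 2 / 4)) ≤ Real.exp (1 / 4) * Real.exp (-(1 / 8 * ‖y‖ ^ 2)) := by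
    rw [← Real.exp_add]
    apply Real.exp_le_exp.2
    have h3 : ‖y‖ ≤ 1 + ‖v - z‖ := by
      calc ‖y‖ = ‖(v₀ - v) + (v - z)‖ := by rw [hy]; congr 1; abel
        _ ≤ ‖v₀ - v‖ + ‖v - z‖ := norm_add_le _ _
        _ ≤ _ := by rw [norm_sub_rev]; linarith
    nlinarith [norm_nonneg y, norm_nonneg (v - z), sq_nonneg (1 - ‖v - z‖)]
  have h4 := one_add_mul_exp_le (x := ‖y‖ ^ 2) (1 / 16) (by norm_num) (by norm_num)
  have h5 : (2 : ℝ) * (1 / 16) = 1 / 8 := by norm_num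
  rw [h5] at h4
  rw [abs_mul]
  calc _ ≤ C * (‖z‖ ^ γ * (1 + ‖z‖ ^ 2)) * (A * Real.exp (-(‖v - z‖ ^ 2 / 4))) := by
        gcongr
        · exact hC z
        · exact abs_maxDeriv_le n _
    _ ≤ C * (‖z‖ ^ γ * (2 * (1 + ‖y‖ ^ 2) * (1 + ‖v₀‖ ^ 2)))
        * (A * (Real.exp (1 / 4) * Real.exp (-(1 / 8 * ‖y‖ ^ 2)))) := by gcongr
    _ = C * 2 * A * Real.exp (1 / 4) * (1 + ‖v₀‖ ^ 2) * ‖z‖ ^ γ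
        * ((1 + ‖y‖ ^ 2) * Real.exp (-(1 / 8 * ‖y‖ ^ 2))) := by ring
    _ ≤ C * 2 * A * Real.exp (1 / 4) * (1 + ‖v₀‖ ^ 2) * ‖z‖ ^ γ
        * ((1 / 16)⁻¹ * Real.exp (-(1 / 16 * ‖y‖ ^ 2))) := by gcongr
    _ = _ := by ring

/-- In this form the variable `v` sits in the Gaussian factor only, so differentiation in `v` never
touches the singular kernel. -/
lemma convMax_eq (κ : V → ℝ) (n : Fin 3 → ℕ) (v : V) :
    convMax κ n v = ∫ z : V, κ z * maxDeriv n (v - z) := by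
  rw [convMax, ← integral_sub_left_eq_self (fun z => κ z * maxDeriv n (v - z)) volume v]
  simp

lemma integrable_dominating (hγ : -3 < γ) (hγ' : γ < 0) (v : V) :
    Integrable fun z : V => ‖z‖ ^ γ * Real.exp (-(1 / 16 * ‖v - z‖ ^ 2)) := by
  have := ((exists_bound_singular_gaussian hγ hγ' (b := 1 / 16) (by norm_num)).1 v).comp_sub_left v
  simpa using! this

lemma KernelBound.integrable (hγ : -3 < γ) (hγ' : γ < 0) {κ : V → ℝ} (hκ : KernelBound γ κ)
    (n : Fin 3 → ℕ) (v : V) : Integrable fun z : V => κ z * maxDeriv n (v - z) := by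
  obtain ⟨K, -, hK⟩ := hκ.exists_dominating n
  refine ((integrable_dominating hγ hγ' v).const_mul (K * (1 + ‖v‖ ^ 2))).mono' ?_
    (Eventually.of_forall fun z => hK v v z (by simp))
  have := continuous_maxDeriv n
  exact (hκ.1.mul (by fun_prop)).aestronglyMeasurable

lemma KernelBound.integrable' (hγ : -3 < γ) (hγ' : γ < 0) {κ : V → ℝ} (hκ : KernelBound γ κ)
    (n : Fin 3 → ℕ) (v : V) : Integrable fun w : V => κ (v - w) * maxDeriv n w := by
  simpa using (hκ.integrable hγ hγ' n v).comp_sub_left v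

lemma KernelBound.isDerivFamily (hγ : -3 < γ) (hγ' : γ < 0) {κ : V → ℝ} (hκ : KernelBound γ κ) :
    IsDerivFamily (convMax κ) := by
  intro n v
  choose K hK0 hK using hκ.exists_dominating
  have hi := fun l => hκ.integrable hγ hγ' (n + unitIdx l) v
  have hmeas : ∀ m x, AEStronglyMeasurable (fun z : V => κ z * maxDeriv m (x - z)) volume :=
    fun m x => (hκ.integrable hγ hγ' m x).aestronglyMeasurable
  let F' : V → V → V →L[ℝ] ℝ :=
    fun x z => ∑ l, (κ z * maxDeriv (n + unitIdx l) (x - z)) • coord l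
  let B : V → ℝ := fun z => ∑ l, K (n + unitIdx l) * (1 + ‖v‖ ^ 2)
      * (‖z‖ ^ γ * Real.exp (-(1 / 16 * ‖v - z‖ ^ 2))) * ‖coord l‖
  have hF' : AEStronglyMeasurable (F' v) volume := by
    change AEStronglyMeasurable
      (fun z => ∑ l, (κ z * maxDeriv (n + unitIdx l) (v - z)) • coord l) volume
    refine Finset.aestronglyMeasurable_fun_sum _ fun l _ => ?_
    exact ((hi l).smul_const (coord l)).aestronglyMeasurable
  have hB : Integrable B := by
    refine integrable_finsetSum _ fun l _ => ?_
    exact ((integrable_dominating hγ hγ' v).const_mul _).mul_const _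
  have hbd : ∀ᵐ z ∂(volume : Measure V), ∀ x ∈ Metric.ball v 1, ‖F' x z‖ ≤ B z := by
    refine Eventually.of_forall fun z x hx => ?_
    refine (norm_sum_le _ _).trans (Finset.sum_le_sum fun l _ => ?_)
    rw [norm_smul]
    exact mul_le_mul_of_nonneg_right (hK _ v x z (by
      rw [← dist_eq_norm]; exact (Metric.mem_ball.1 hx).le)) (norm_nonneg _)
  have hdiff : ∀ᵐ z ∂(volume : Measure V), ∀ x ∈ Metric.ball v 1,
      HasFDerivAt (fun x => κ z * maxDeriv n (x - z)) (F' x z) x := by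
    refine Eventually.of_forall fun z x _ => ?_
    have h1 : HasFDerivAt (fun x : V => x - z) (ContinuousLinearMap.id ℝ V) x :=
      (hasFDerivAt_id x).sub_const z
    have h2 := (isDerivFamily_maxDeriv n (x - z)).comp x h1
    rw [ContinuousLinearMap.comp_id] at h2
    refine (h2.const_mul (κ z)).congr_fderiv ?_
    simp only [F', Finset.smul_sum, smul_smul]
  have key := hasFDerivAt_integral_of_dominated_of_fderiv_le
    (Metric.ball_mem_nhds v one_pos) (Eventually.of_forall fun x => hmeas n x)
    (hκ.integrable hγ hγ' n v) hF' hbd hB hdiff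
  have h4 : ∫ z, F' v z = ∑ l, convMax κ (n + unitIdx l) v • coord l := by
    simp only [F']
    rw [integral_finsetSum]
    · refine Finset.sum_congr rfl fun l _ => ?_
      rw [integral_smul_const, convMax_eq]
    · intro l _
      exact (hi l).smul_const (coord l)
  rw [h4] at key
  have h3 : convMax κ n = fun x => ∫ z : V, κ z * maxDeriv n (x - z) := funext (convMax_eq κ n)
  rw [h3]
  exact key

/-! ### The quadratic forms -/

/-- The bilinear form `|z|² ξ·η - (z·ξ)(z·η)`. -/
def bform (z : V) (ξ η : Fin 3 → ℝ) : ℝ :=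
  (∑ i, z i ^ 2) * (∑ i, ξ i * η i) - (∑ i, z i * ξ i) * (∑ i, z i * η i)

/-- The quadratic form `⟨v⟩^γ (|ξ|² + |v|²|ξ|² - (v·ξ)²)`, comparable to `A(v)ξ·ξ`. -/
def mform (γ : ℝ) (v : V) (ξ : Fin 3 → ℝ) : ℝ :=
  bracket v ^ γ * (∑ i, ξ i ^ 2 + bform v ξ ξ)

lemma bform_self_nonneg (z : V) (ξ : Fin 3 → ℝ) : 0 ≤ bform z ξ ξ := by
  simp only [bform, Fin.sum_univ_three]
  nlinarith [sq_nonneg (z 0 * ξ 1 - z 1 * ξ 0), sq_nonneg (z 0 * ξ 2 - z 2 * ξ 0),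
    sq_nonneg (z 1 * ξ 2 - z 2 * ξ 1)]

/-- Parallelogram identity in `v ± w`, with the nonnegative term at `v + w` dropped. -/
lemma bform_sub_self_le (v w : V) (ξ : Fin 3 → ℝ) :
    bform (v - w) ξ ξ ≤ 2 * bform v ξ ξ + 2 * (‖w‖ ^ 2 * ∑ i, ξ i ^ 2) := by
  have h : bform (v - w) ξ ξ + bform (v + w) ξ ξ = 2 * bform v ξ ξ + 2 * bform w ξ ξ := by
    simp only [bform, Fin.sum_univ_three, PiLp.sub_apply, PiLp.add_apply]; ring
  have h2 : bform w ξ ξ ≤ ‖w‖ ^ 2 * ∑ i, ξ i ^ 2 := by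
    rw [norm_sq_eq_sum]
    simp only [bform, ← pow_two]
    nlinarith [sq_nonneg (∑ i, w i * ξ i)]
  linarith [bform_self_nonneg (v + w) ξ]

/-- Cauchy–Schwarz for a nonnegative form, in additive form with a free parameter. The additive form
survives integration against the signed weight `∂^n μ`; the parameter is optimised only afterwards.
-/
lemma abs_bform_le (z : V) (ξ η : Fin 3 → ℝ) {s : ℝ} (hs : 0 < s) :
    |bform z ξ η| ≤ (s * bform z ξ ξ + s⁻¹ * bform z η η) / 2 := by
  have h : ∀ ε : ℝ, ε ^ 2 = 1 →
      0 ≤ s⁻¹ * (s ^ 2 * bform z ξ ξ + 2 * ε * s * bform z ξ η + bform z η η) := by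
    intro ε hε
    have : s ^ 2 * bform z ξ ξ + 2 * ε * s * bform z ξ η + bform z η η
        = bform z (fun i => s * ξ i + ε * η i) (fun i => s * ξ i + ε * η i) := by
      have e2 : bform z η η = ε ^ 2 * bform z η η := by rw [hε, one_mul]
      rw [e2]
      simp only [bform, Fin.sum_univ_three]; ring
    rw [this]
    exact mul_nonneg (by positivity) (bform_self_nonneg _ _)
  have h1 := h 1 (by norm_num)
  have h2 := h (-1) (by norm_num)
  have e : ∀ ε : ℝ, s⁻¹ * (s ^ 2 * bform z ξ ξ + 2 * ε * s * bform z ξ η + bform z η η)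
      = s * bform z ξ ξ + 2 * ε * bform z ξ η + s⁻¹ * bform z η η := by
    intro ε; field_simp
  rw [e] at h1 h2
  rw [abs_le]
  constructor <;> linarith

lemma mform_nonneg (γ : ℝ) (v : V) (ξ : Fin 3 → ℝ) : 0 ≤ mform γ v ξ := by
  have := bform_self_nonneg v ξ
  have := bracket_pos v
  have : 0 ≤ ∑ i, ξ i ^ 2 := Finset.sum_nonneg fun i _ => sq_nonneg _
  rw [mform]; positivity

lemma sum_kernel (γ : ℝ) (z : V) (ξ η : Fin 3 → ℝ) :
    ∑ i, ∑ j, kernel γ i j z * ξ i * η j = ‖z‖ ^ γ * bform z ξ η := by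
  simp only [kernel, bform, norm_sq_eq_sum, Fin.sum_univ_three]
  simp
  ring

lemma measurable_kernel (γ : ℝ) (i j : Fin 3) : Measurable (kernel γ i j) := by
  unfold kernel
  have h : ∀ i : Fin 3, Measurable fun v : V => v i := fun i => (contDiff_coord i).continuous.measurable
  have h2 : Measurable fun v : V => if i = j then ‖v‖ ^ 2 else 0 := by
    split_ifs <;> fun_prop
  exact (h2.sub ((h i).mul (h j))).mul (measurable_norm.pow_const γ)

lemma abs_coord_le (z : V) (i : Fin 3) : |z i| ≤ ‖z‖ := by
  simpa using PiLp.norm_apply_le z i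

lemma kernelBound_kernel (γ : ℝ) (i j : Fin 3) : KernelBound γ (kernel γ i j) := by
  refine ⟨measurable_kernel γ i j, 2, by norm_num, fun z => ?_⟩
  have h1 : |z i * z j| ≤ ‖z‖ ^ 2 := by
    rw [abs_mul, pow_two]
    gcongr <;> exact abs_coord_le z _
  have h2 : |if i = j then ‖z‖ ^ 2 else 0| ≤ ‖z‖ ^ 2 := by
    split_ifs
    · rw [abs_of_nonneg (by positivity)]
    · simpa using sq_nonneg ‖z‖
  rw [kernel, abs_mul, abs_of_nonneg (by positivity : 0 ≤ ‖z‖ ^ γ)]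
  calc _ ≤ (‖z‖ ^ 2 + ‖z‖ ^ 2) * ‖z‖ ^ γ := by
        gcongr
        exact (abs_sub _ _).trans (add_le_add h2 h1)
    _ ≤ _ := by
        have : 0 ≤ ‖z‖ ^ γ := by positivity
        nlinarith

/-- The derivatives `∂^n ā_{ij}`. -/
def abarDeriv (γ : ℝ) (i j : Fin 3) : (Fin 3 → ℕ) → V → ℝ := convMax (kernel γ i j)

lemma abarDeriv_zero (γ : ℝ) (i j : Fin 3) : abarDeriv γ i j 0 = abar γ i j := by
  funext v; rw [abarDeriv, convMax, maxDeriv_zero]; rfl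

lemma isDerivFamily_abarDeriv (hγ : -3 < γ) (hγ' : γ < 0) (i j : Fin 3) :
    IsDerivFamily (abarDeriv γ i j) := (kernelBound_kernel γ i j).isDerivFamily hγ hγ'

lemma multiPd_abar (hγ : -3 < γ) (hγ' : γ < 0) (i j : Fin 3) (α : Fin 3 → ℕ) :
    multiPd α (abar γ i j) = abarDeriv γ i j α := by
  rw [← abarDeriv_zero, (isDerivFamily_abarDeriv hγ hγ' i j).multiPd_eq, zero_add]

lemma contDiff_abar (hγ : -3 < γ) (hγ' : γ < 0) (i j : Fin 3) : ContDiff ℝ ∞ (abar γ i j) := by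
  rw [← abarDeriv_zero]; exact (isDerivFamily_abarDeriv hγ hγ' i j).contDiff 0

lemma sum_abarDeriv (hγ : -3 < γ) (hγ' : γ < 0) (n : Fin 3 → ℕ) (v : V) (ξ η : Fin 3 → ℝ) :
    ∑ i, ∑ j, abarDeriv γ i j n v * ξ i * η j
      = ∫ w : V, ‖v - w‖ ^ γ * bform (v - w) ξ η * maxDeriv n w := by
  have hi := fun i j => (kernelBound_kernel γ i j).integrable' hγ hγ' n v
  have hij : ∀ i j,
      Integrable fun w => kernel γ i j (v - w) * ξ i * η j * maxDeriv n w := fun i j =>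
    (((hi i j).mul_const (ξ i)).mul_const (η j)).congr
      (Eventually.of_forall fun w => by simp only; ring)
  simp only [← sum_kernel, Finset.sum_mul]
  rw [integral_finsetSum _ fun i _ => integrable_finsetSum _ fun j _ => hij i j]
  refine Finset.sum_congr rfl fun i _ => ?_
  rw [integral_finsetSum _ fun j _ => hij i j]
  refine Finset.sum_congr rfl fun j _ => ?_
  rw [abarDeriv, convMax, ← integral_mul_const, ← integral_mul_const]
  refine integral_congr_ae (Eventually.of_forall fun w => ?_)
  simp only; ring

lemma measurable_bform_sub (v : V) (ξ η : Fin 3 → ℝ) :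
    Measurable fun w : V => bform (v - w) ξ η := by
  have : Continuous fun w : V => bform (v - w) ξ η := by
    unfold bform
    fun_prop
  exact this.measurable

/-- Shifting `v` by `w` costs a factor `1 + ‖w‖²` in the form, which the Gaussian absorbs. -/
lemma exists_form_integral_le (hγ : -3 < γ) (hγ' : γ < 0) : ∃ K : ℝ, 0 < K ∧ ∀ v ξ,
    Integrable (fun w : V => ‖v - w‖ ^ γ * bform (v - w) ξ ξ * Real.exp (-(‖w‖ ^ 2 / 4))) ∧
    ∫ w : V, ‖v - w‖ ^ γ * bform (v - w) ξ ξ * Real.exp (-(‖w‖ ^ 2 / 4)) ≤ K * mform γ v ξ := by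
  obtain ⟨hint, C, hC, hb⟩ := exists_bound_singular_gaussian hγ hγ' (b := 1 / 8) (by norm_num)
  refine ⟨16 * C, by positivity, fun v ξ => ?_⟩
  set X := ∑ i, ξ i ^ 2 with hX
  have hX0 : 0 ≤ X := Finset.sum_nonneg fun i _ => sq_nonneg _
  have hq := bform_self_nonneg v ξ
  have hle : ∀ w : V, ‖v - w‖ ^ γ * bform (v - w) ξ ξ * Real.exp (-(‖w‖ ^ 2 / 4)) ≤
      16 * (X + bform v ξ ξ) * (‖v - w‖ ^ γ * Real.exp (-(1 / 8 * ‖w‖ ^ 2))) := by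
    intro w
    have h1 := bform_sub_self_le v w ξ
    have h2 := one_add_mul_exp_le (x := ‖w‖ ^ 2) (1 / 8) (by norm_num) (by norm_num)
    rw [show (2 : ℝ) * (1 / 8) * ‖w‖ ^ 2 = ‖w‖ ^ 2 / 4 by ring] at h2
    calc _ ≤ ‖v - w‖ ^ γ * (2 * (X + bform v ξ ξ) * (1 + ‖w‖ ^ 2))
          * Real.exp (-(‖w‖ ^ 2 / 4)) := by
          gcongr
          have := mul_nonneg hq (sq_nonneg ‖w‖)
          nlinarith
      _ = 2 * (X + bform v ξ ξ) * ‖v - w‖ ^ γ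
          * ((1 + ‖w‖ ^ 2) * Real.exp (-(‖w‖ ^ 2 / 4))) := by ring
      _ ≤ 2 * (X + bform v ξ ξ) * ‖v - w‖ ^ γ
          * ((1 / 8)⁻¹ * Real.exp (-(1 / 8 * ‖w‖ ^ 2))) := by gcongr
      _ = _ := by ring
  have hI := (hint v).const_mul (16 * (X + bform v ξ ξ))
  have hI2 : Integrable
      (fun w : V => ‖v - w‖ ^ γ * bform (v - w) ξ ξ * Real.exp (-(‖w‖ ^ 2 / 4))) := by
    refine hI.mono' ?_ (Eventually.of_forall fun w => ?_)
    · have := measurable_bform_sub v ξ ξ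
      have h3 : Measurable fun w : V => ‖v - w‖ ^ γ :=
        (measurable_norm.comp (measurable_const.sub measurable_id)).pow_const γ
      exact ((h3.mul this).mul (by fun_prop)).aestronglyMeasurable
    · rw [Real.norm_of_nonneg]
      · exact hle w
      · have := bform_self_nonneg (v - w) ξ
        positivity
  refine ⟨hI2, (integral_mono hI2 hI hle).trans ?_⟩
  rw [integral_const_mul, mform]
  calc _ ≤ 16 * (X + bform v ξ ξ) * (C * bracket v ^ γ) := by gcongr; exact hb v
    _ = _ := by ring

/-- The optimal parameter is `s = x / a`. If `a = 0`, a large `s` contradicts `x > 0`. -/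
lemma sq_le_mul_of_forall_le {x a b : ℝ} (hx : 0 ≤ x) (ha : 0 ≤ a) (hb : 0 ≤ b)
    (h : ∀ s : ℝ, 0 < s → x ≤ (s * a + s⁻¹ * b) / 2) : x ^ 2 ≤ a * b := by
  rcases hx.eq_or_lt with rfl | hx
  · simpa using mul_nonneg ha hb
  rcases ha.eq_or_lt with rfl | ha
  · exfalso
    have := h ((b + 1) / x) (by positivity)
    rw [inv_div] at this
    have h2 : x / (b + 1) * b ≤ x := by
      rw [div_mul_eq_mul_div, div_le_iff₀ (by positivity)]; nlinarith
    linarith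
  · have := h (x / a) (by positivity)
    rw [inv_div, div_mul_cancel₀ _ ha.ne'] at this
    have h3 : x ≤ a / x * b := by linarith
    rw [div_mul_eq_mul_div, le_div_iff₀ hx] at h3
    nlinarith

lemma multiFactorial_pos (n : Fin 3 → ℕ) : 0 < multiFactorial n :=
  Finset.prod_pos fun i _ => Nat.factorial_pos _

/-- The form of `∂^n A` is controlled by `mform`, with analytic constants. -/
lemma exists_abarDeriv_form_le (hγ : -3 < γ) (hγ' : γ < 0) : ∃ K : ℝ, 1 ≤ K ∧
    ∀ (n : Fin 3 → ℕ) (v : V) (ξ η : Fin 3 → ℝ),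
      |∑ i, ∑ j, abarDeriv γ i j n v * ξ i * η j| ≤
        K ^ (len n + 1) * multiFactorial n * (√(mform γ v ξ) * √(mform γ v η)) := by
  obtain ⟨K, hK, hKb⟩ := exists_form_integral_le hγ hγ'
  -- One factor `e` for each derivative, from the Gaussian bound, and `e³ K` for the remaining
  -- constants.
  refine ⟨max (Real.exp 1) (Real.exp 3 * K), le_max_of_le_left (by
    have := Real.add_one_le_exp (1 : ℝ); linarith), fun n v ξ η => ?_⟩
  set L := max (Real.exp 1) (Real.exp 3 * K) with hL
  set c : ℝ := multiFactorial n * Real.exp (len n) * Real.exp 3 with hc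
  have hc0 : 0 < c := by have := multiFactorial_pos n; positivity
  have hξ := mform_nonneg γ v ξ
  have hη := mform_nonneg γ v η
  have h1 : |∑ i, ∑ j, abarDeriv γ i j n v * ξ i * η j| ^ 2
      ≤ (c * K * mform γ v ξ) * (c * K * mform γ v η) := by
    -- The Young inequality for `bform` is integrated with `s` fixed, so that only the two diagonal
    -- forms, already bounded by `mform`, appear.
    refine sq_le_mul_of_forall_le (abs_nonneg _) (by positivity) (by positivity) fun s hs => ?_
    rw [sum_abarDeriv hγ hγ']
    obtain ⟨i1, b1⟩ := hKb v ξ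
    obtain ⟨i2, b2⟩ := hKb v η
    rw [← Real.norm_eq_abs]
    calc _ ≤ ∫ w : V, c * ((s * (‖v - w‖ ^ γ * bform (v - w) ξ ξ * Real.exp (-(‖w‖ ^ 2 / 4)))
            + s⁻¹ * (‖v - w‖ ^ γ * bform (v - w) η η * Real.exp (-(‖w‖ ^ 2 / 4)))) / 2) := by
          refine norm_integral_le_of_norm_le (((i1.const_mul s).add (i2.const_mul s⁻¹)).div_const 2
            |>.const_mul c) (Eventually.of_forall fun w => ?_)
          rw [norm_mul, norm_mul, Real.norm_of_nonneg (by positivity : 0 ≤ ‖v - w‖ ^ γ)]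
          calc _ ≤ ‖v - w‖ ^ γ * ((s * bform (v - w) ξ ξ + s⁻¹ * bform (v - w) η η) / 2)
                * (c * Real.exp (-(‖w‖ ^ 2 / 4))) := by
                have e1 := abs_bform_le (v - w) ξ η hs
                have e2 := abs_maxDeriv_le n w
                have e3 : 0 ≤ ‖v - w‖ ^ γ := by positivity
                rw [Real.norm_eq_abs, Real.norm_eq_abs]
                exact mul_le_mul (mul_le_mul_of_nonneg_left e1 e3) e2 (abs_nonneg _)
                  (mul_nonneg e3 ((abs_nonneg _).trans e1))
            _ = _ := by ring
      _ = c * ((s * (∫ w : V, ‖v - w‖ ^ γ * bform (v - w) ξ ξ * Real.exp (-(‖w‖ ^ 2 / 4)))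
            + s⁻¹ * ∫ w : V, ‖v - w‖ ^ γ * bform (v - w) η η * Real.exp (-(‖w‖ ^ 2 / 4))) / 2) := by
          rw [integral_const_mul, integral_div, integral_add (i1.const_mul s) (i2.const_mul s⁻¹),
            integral_const_mul, integral_const_mul]
      _ ≤ c * ((s * (K * mform γ v ξ) + s⁻¹ * (K * mform γ v η)) / 2) := by gcongr
      _ = _ := by ring
  have h2 : |∑ i, ∑ j, abarDeriv γ i j n v * ξ i * η j|
      ≤ c * K * (√(mform γ v ξ) * √(mform γ v η)) := by
    refine abs_le_of_sq_le_sq' ?_ (by positivity) |>.2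
    rw [mul_pow, mul_pow (√(mform γ v ξ)), Real.sq_sqrt hξ, Real.sq_sqrt hη]
    linarith
  refine h2.trans (mul_le_mul_of_nonneg_right ?_ (by positivity))
  calc c * K = Real.exp 1 ^ len n * (Real.exp 3 * K) * multiFactorial n := by
        rw [hc, ← Real.exp_nat_mul, mul_one]; ring
    _ ≤ L ^ len n * L * multiFactorial n := by
        gcongr
        · exact le_max_left _ _
        · exact le_max_right _ _
    _ = _ := by ring

end

section

variable {γ : ℝ}

/-! ### Coercivity of the diffusion matrix -/

lemma bform_self_eq (w : V) (ξ : Fin 3 → ℝ) : bform w ξ ξ =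
    ‖w‖ ^ 2 * ‖(WithLp.toLp 2 ξ : V)‖ ^ 2 - inner ℝ w (WithLp.toLp 2 ξ : V) ^ 2 := by
  rw [norm_sq_eq_sum, norm_sq_eq_sum]
  simp only [bform, PiLp.inner_apply, Fin.sum_univ_three]
  simp
  ring

lemma integrableOn_ball_of_continuous {f : V → ℝ} (hf : Continuous f) (r : ℝ) :
    IntegrableOn f (Metric.ball 0 r) :=
  (hf.locallyIntegrable.integrableOn_isCompact (isCompact_closedBall 0 r)).mono_set
    Metric.ball_subset_closedBall

lemma setIntegral_ball_comp_isometry (e : V ≃ₗᵢ[ℝ] V) (f : V → ℝ) (r : ℝ) :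
    ∫ w in Metric.ball (0 : V) r, f (e w) = ∫ w in Metric.ball (0 : V) r, f w := by
  have := e.measurePreserving.setIntegral_preimage_emb
    e.toHomeomorph.measurableEmbedding f (Metric.ball 0 r)
  rw [← this]
  congr 2
  ext x
  simp

/-- Rotation invariance: a reflection carries `ξ` to a multiple of the first basis vector and
preserves the ball. What is left is `|ξ|²` times the integral of `|w|² - w_0²`, which is positive.
-/
lemma exists_ball_integral_bform : ∃ c : ℝ, 0 < c ∧ ∀ ξ : Fin 3 → ℝ,
    ∫ w in Metric.ball (0 : V) 1, bform w ξ ξ = c * ∑ i, ξ i ^ 2 := by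
  let e0 : V := EuclideanSpace.single 0 1
  have hc : Continuous fun w : V => ‖w‖ ^ 2 - w 0 ^ 2 := by fun_prop
  refine ⟨∫ w in Metric.ball (0 : V) 1, (‖w‖ ^ 2 - w 0 ^ 2), ?_, fun ξ => ?_⟩
  · have hnn : ∀ w : V, 0 ≤ ‖w‖ ^ 2 - w 0 ^ 2 := fun w => by
      rw [norm_sq_eq_sum, Fin.sum_univ_three]
      nlinarith [sq_nonneg (w 1), sq_nonneg (w 2)]
    rw [setIntegral_pos_iff_support_of_nonneg_ae (Eventually.of_forall hnn)
      (integrableOn_ball_of_continuous hc 1)]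
    have hopen : IsOpen (Function.support (fun w : V => ‖w‖ ^ 2 - w 0 ^ 2) ∩ Metric.ball 0 1) :=
      hc.isOpen_support.inter Metric.isOpen_ball
    refine hopen.measure_pos _ ⟨EuclideanSpace.single 1 (1 / 2), ?_, ?_⟩
    · simp
    · simp only [Metric.mem_ball, dist_zero_right, EuclideanSpace.norm_single]
      norm_num
  · set x : V := WithLp.toLp 2 ξ with hx
    have hn : ‖x‖ = ‖‖x‖ • e0‖ := by simp [e0, norm_smul]
    set R := Submodule.reflection (ℝ ∙ (x - ‖x‖ • e0))ᗮ with hR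
    have hRx : R x = ‖x‖ • e0 := Submodule.reflection_sub hn
    have h1 : ∀ w : V, bform (R w) ξ ξ = ‖x‖ ^ 2 * (‖w‖ ^ 2 - w 0 ^ 2) := by
      intro w
      have h2 : inner ℝ (R w) x = ‖x‖ * w 0 := by
        have : x = R (R x) := (Submodule.reflection_reflection _ _).symm
        conv_lhs => rw [this]
        rw [LinearIsometryEquiv.inner_map_map, hRx, inner_smul_right]
        simp [e0, EuclideanSpace.inner_single_right]
      rw [bform_self_eq, ← hx, h2, LinearIsometryEquiv.norm_map]
      ring
    rw [← setIntegral_ball_comp_isometry R]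
    simp only [h1]
    rw [integral_const_mul, norm_sq_eq_sum, mul_comm]

lemma continuous_bform {f : V → V} (hf : Continuous f) (ξ η : Fin 3 → ℝ) :
    Continuous fun w => bform (f w) ξ η := by
  unfold bform; fun_prop

/-- Averaging over `w` and `-w` removes the cross terms, so the integral is exactly the volume of
the ball times `bform v ξ ξ` plus the isotropic contribution of the preceding lemma. -/
lemma exists_ball_integral_bform_sub : ∃ c : ℝ, 0 < c ∧ ∀ (v : V) (ξ : Fin 3 → ℝ),
    c * (∑ i, ξ i ^ 2 + bform v ξ ξ) ≤ ∫ w in Metric.ball (0 : V) 1, bform (v - w) ξ ξ := by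
  obtain ⟨c, hc, hcb⟩ := exists_ball_integral_bform
  have hvol : 0 < (volume : Measure V).real (Metric.ball 0 1) := by
    refine ENNReal.toReal_pos (Metric.isOpen_ball.measure_pos _ ⟨0, by simp⟩).ne' ?_
    exact measure_ball_lt_top.ne
  refine ⟨min c ((volume : Measure V).real (Metric.ball 0 1)), lt_min hc hvol, fun v ξ => ?_⟩
  have i1 := integrableOn_ball_of_continuous (continuous_bform (f := fun w => v - w)
    (by fun_prop) ξ ξ) 1
  have i2 := integrableOn_ball_of_continuous (continuous_bform (f := fun w => v + w)
    (by fun_prop) ξ ξ) 1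
  have i3 : IntegrableOn (fun w : V => bform w ξ ξ) (Metric.ball 0 1) :=
    integrableOn_ball_of_continuous (continuous_bform continuous_id ξ ξ) 1
  have i4 : IntegrableOn (fun _ : V => 2 * bform v ξ ξ) (Metric.ball 0 1) :=
    integrableOn_const measure_ball_lt_top.ne
  have hsym : ∫ w in Metric.ball (0 : V) 1, bform (v + w) ξ ξ
      = ∫ w in Metric.ball (0 : V) 1, bform (v - w) ξ ξ := by
    have := setIntegral_ball_comp_isometry (LinearIsometryEquiv.neg ℝ)
      (fun w => bform (v - w) ξ ξ) 1
    simpa using this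
  have hadd : ∫ w in Metric.ball (0 : V) 1, (bform (v - w) ξ ξ + bform (v + w) ξ ξ)
      = ∫ w in Metric.ball (0 : V) 1, (2 * bform v ξ ξ + 2 * bform w ξ ξ) := by
    congr 1; funext w
    simp only [bform, Fin.sum_univ_three, PiLp.sub_apply, PiLp.add_apply]; ring
  rw [integral_add i1 i2, hsym, integral_add i4 (i3.const_mul 2),
    integral_const_mul 2 fun w => bform w ξ ξ, setIntegral_const] at hadd
  have h3 := hcb ξ
  rw [h3, smul_eq_mul] at hadd
  have h4 : ∫ w in Metric.ball (0 : V) 1, bform (v - w) ξ ξ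
      = (volume : Measure V).real (Metric.ball 0 1) * bform v ξ ξ + c * ∑ i, ξ i ^ 2 := by linarith
  rw [h4, mul_add, add_comm]
  have := bform_self_nonneg v ξ
  have : 0 ≤ ∑ i, ξ i ^ 2 := Finset.sum_nonneg fun i _ => sq_nonneg _
  gcongr
  · exact min_le_right _ _
  · exact min_le_left _ _

lemma maxwellian_nonneg (w : V) : 0 ≤ maxwellian w := by
  unfold maxwellian; positivity

/-- The integrand is nonnegative, so the convolution may be restricted to the unit ball. There `μ`
is bounded below, and `‖v - w‖^γ ≥ 2^{γ/2} ⟨v⟩^γ` because `γ < 0`. -/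
lemma exists_le_abar_form (hγ : -3 < γ) (hγ' : γ < 0) : ∃ c : ℝ, 0 < c ∧
    ∀ (v : V) (ξ : Fin 3 → ℝ), c * mform γ v ξ ≤ ∑ i, ∑ j, abar γ i j v * ξ i * ξ j := by
  obtain ⟨c, hc, hcb⟩ := exists_ball_integral_bform_sub
  set m : ℝ := (2 * Real.pi) ^ (-(3 / 2 : ℝ)) * Real.exp (-(1 / 2)) with hm
  have hm0 : 0 < m := by positivity
  refine ⟨c * m * 2 ^ (γ / 2), by positivity, fun v ξ => ?_⟩
  have hs := sum_abarDeriv hγ hγ' 0 v ξ ξ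
  simp only [abarDeriv_zero, maxDeriv_zero] at hs
  have hi : Integrable fun w => ‖v - w‖ ^ γ * bform (v - w) ξ ξ * maxwellian w := by
    obtain ⟨K, -, h⟩ := exists_form_integral_le hγ hγ'
    have h3 := (h v ξ).1.const_mul ((multiFactorial 0 : ℝ) * Real.exp (len 0) * Real.exp 3)
    refine h3.mono' ?_ (Eventually.of_forall fun w => ?_)
    · have h3 : Measurable fun w : V => ‖v - w‖ ^ γ :=
        (measurable_norm.comp (measurable_const.sub measurable_id)).pow_const γ
      have := (continuous_maxDeriv 0).measurable
      rw [maxDeriv_zero] at this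
      exact ((h3.mul (measurable_bform_sub v ξ ξ)).mul this).aestronglyMeasurable
    · have h4 := abs_maxDeriv_le 0 w
      rw [maxDeriv_zero] at h4
      have := bform_self_nonneg (v - w) ξ
      rw [Real.norm_eq_abs, abs_mul, abs_of_nonneg (by positivity)]
      calc _ ≤ _ := mul_le_mul_of_nonneg_left h4 (by positivity)
        _ = _ := by ring
  rw [hs]
  have hnn : ∀ w, 0 ≤ ‖v - w‖ ^ γ * bform (v - w) ξ ξ * maxwellian w := fun w => by
    have := bform_self_nonneg (v - w) ξ
    have := maxwellian_nonneg w
    positivity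
  have hb := bracket_pos v
  have i1 := integrableOn_ball_of_continuous (continuous_bform (f := fun w => v - w)
    (by fun_prop) ξ ξ) 1
  calc _ = m * 2 ^ (γ / 2) * bracket v ^ γ * (c * (∑ i, ξ i ^ 2 + bform v ξ ξ)) := by
        rw [mform]; ring
    _ ≤ m * 2 ^ (γ / 2) * bracket v ^ γ * ∫ w in Metric.ball (0 : V) 1, bform (v - w) ξ ξ := by
        gcongr; exact hcb v ξ
    _ = ∫ w in Metric.ball (0 : V) 1, m * 2 ^ (γ / 2) * bracket v ^ γ * bform (v - w) ξ ξ := by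
        rw [integral_const_mul]
    _ ≤ ∫ w in Metric.ball (0 : V) 1, ‖v - w‖ ^ γ * bform (v - w) ξ ξ * maxwellian w := by
        refine setIntegral_mono_on (i1.const_mul _) hi.integrableOn
          Metric.isOpen_ball.measurableSet fun w hw => ?_
        have hw1 : ‖w‖ < 1 := by simpa using hw
        -- At `w = v` the power `0 ^ γ` is zero by convention and the lower bound for it fails, but
        -- the form vanishes there.
        rcases eq_or_ne (v - w) 0 with h0 | h0
        · simp [h0, bform]
        have hq := bform_self_nonneg (v - w) ξ
        have h1 : m ≤ maxwellian w := by
          rw [hm, maxwellian]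
          gcongr
          nlinarith [norm_nonneg w]
        have h2 : 2 ^ (γ / 2) * bracket v ^ γ ≤ ‖v - w‖ ^ γ := by
          have hz : 0 < ‖v - w‖ := norm_pos_iff.2 h0
          have h3 : ‖v - w‖ ^ γ = (‖v - w‖ ^ 2) ^ (γ / 2) := by
            rw [← Real.rpow_natCast, ← Real.rpow_mul hz.le]; congr 1; push_cast; ring
          rw [bracket_rpow, ← Real.mul_rpow (by norm_num) (by positivity), h3]
          refine Real.rpow_le_rpow_of_nonpos (by positivity) ?_ (by linarith)
          have h5 := norm_sub_le v w
          nlinarith [norm_nonneg w, norm_nonneg v, sq_nonneg (‖v‖ - 1)]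
        calc _ = (2 ^ (γ / 2) * bracket v ^ γ) * bform (v - w) ξ ξ * m := by ring
          _ ≤ _ := by gcongr
    _ ≤ _ := setIntegral_le_integral hi (Eventually.of_forall hnn)

/-! ### The potential of the Landau operator -/

/-- The zeroth order coefficient of the Landau operator. -/
def potential (γ : ℝ) (v : V) : ℝ :=
  (∑ i, ∑ j, abar γ i j v * (v j / 2) * (v i / 2))
    - ∑ i, ∑ j, pd i (fun w => abar γ i j w * (w j / 2)) v

lemma landauOp_eq (γ : ℝ) (u : V → ℝ) (v : V) : landauOp γ u v =
    - (∑ i, ∑ j, pd i (fun w => abar γ i j w * pd j u w) v) + potential γ v * u v := by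
  rw [landauOp, potential]; ring

lemma maxDeriv_unitIdx (j : Fin 3) (w : V) : maxDeriv (unitIdx j) w = -(w j * maxwellian w) := by
  rw [← maxDeriv_zero, maxDeriv, maxDeriv]
  have h : ∀ i, gaussDeriv (unitIdx j i) (w i)
      = (if i = j then -w j else 1) * gaussDeriv ((0 : Fin 3 → ℕ) i) (w i) := by
    intro i
    by_cases hij : i = j
    · subst hij
      simp only [Pi.single_eq_same, if_true, gaussDeriv]
      rw [Polynomial.deriv_gaussian_eq_hermite_mul_gaussian]
      simp [Polynomial.hermite_one]
    · simp [hij]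
  simp only [h, Finset.prod_mul_distrib, Finset.prod_ite_eq', Finset.mem_univ, if_true]
  ring

lemma abarDeriv_symm (γ : ℝ) (i j : Fin 3) : abarDeriv γ i j = abarDeriv γ j i := by
  funext n v
  simp only [abarDeriv, convMax, kernel]
  congr 1; funext w
  simp only [eq_comm (a := i), mul_comm ((v - w) i)]

lemma sum_kernel_mul_self (γ : ℝ) (i : Fin 3) (z : V) : ∑ j, kernel γ i j z * z j = 0 := by
  simp only [kernel, norm_sq_eq_sum, Fin.sum_univ_three]
  fin_cases i <;> simp <;> ring

/-- Since `∂_j μ = -w_j μ` and `a(v - w)(v - w) = 0`, the factor `w` under the integral can be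
replaced by `v`. -/
lemma sum_abarDeriv_unitIdx (hγ : -3 < γ) (hγ' : γ < 0) (i : Fin 3) (v : V) :
    ∑ j, abarDeriv γ i j (unitIdx j) v = -∑ j, abar γ i j v * v j := by
  have hi0 := fun j => (kernelBound_kernel γ i j).integrable' hγ hγ' 0 v
  have hi1 := fun j => (kernelBound_kernel γ i j).integrable' hγ hγ' (unitIdx j) v
  simp only [abarDeriv, convMax, ← abarDeriv_zero]
  rw [← integral_finsetSum _ fun j _ => hi1 j]
  simp_rw [← integral_mul_const]
  rw [← integral_finsetSum _ fun j _ => (hi0 j).mul_const _, ← integral_neg]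
  congr 1; funext w
  have h := sum_kernel_mul_self γ i (v - w)
  simp only [maxDeriv_unitIdx, maxDeriv_zero, PiLp.sub_apply, mul_sub, Finset.sum_sub_distrib] at h ⊢
  have e1 : ∑ j, kernel γ i j (v - w) * -(w j * maxwellian w)
      = -((∑ j, kernel γ i j (v - w) * w j) * maxwellian w) := by
    rw [Finset.sum_mul, ← Finset.sum_neg_distrib]
    exact Finset.sum_congr rfl fun j _ => by ring
  have e2 : ∑ j, kernel γ i j (v - w) * maxwellian w * v j
      = (∑ j, kernel γ i j (v - w) * v j) * maxwellian w := by
    rw [Finset.sum_mul]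
    exact Finset.sum_congr rfl fun j _ => by ring
  rw [e1, e2, sub_eq_zero.1 h]

/-- The double divergence `∑ ∂_i ∂_j ā_{ij}`. -/
def doubleDiv (γ : ℝ) (v : V) : ℝ := ∑ i, ∑ j, abarDeriv γ i j (unitIdx j + unitIdx i) v

lemma pd_sum_abar_mul_coord (hγ : -3 < γ) (hγ' : γ < 0) (i : Fin 3) (v : V) :
    pd i (fun w => ∑ j, abar γ i j w * w j) v = -∑ j, abarDeriv γ i j (unitIdx j + unitIdx i) v := by
  have h : (fun w => ∑ j, abar γ i j w * w j)
      = fun w => ∑ j, (-1) * abarDeriv γ i j (unitIdx j) w := by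
    funext w
    rw [← Finset.mul_sum, sum_abarDeriv_unitIdx hγ hγ']; ring
  have hd := fun j => ((isDerivFamily_abarDeriv hγ hγ' i j).contDiff (unitIdx j)).differentiable
    (by simp) v
  rw [h, pd_sum _ _ fun j _ => (hd j).const_mul _, ← Finset.sum_neg_distrib]
  refine Finset.sum_congr rfl fun j _ => ?_
  rw [pd_const_mul _ _ (hd j), (isDerivFamily_abarDeriv hγ hγ' i j).pd_eq]; ring

lemma pd_sum_abar_mul_coord' (hγ : -3 < γ) (hγ' : γ < 0) (i : Fin 3) (v : V) :
    pd i (fun w => ∑ j, abar γ i j w * w j) v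
      = (∑ j, abarDeriv γ i j (unitIdx i) v * v j) + abar γ i i v := by
  have hd := fun j => (contDiff_abar hγ hγ' i j).differentiable (by simp) v
  have hc := fun j => (contDiff_coord j).differentiable (by simp) v
  rw [pd_sum _ _ fun j _ => (hd j).fun_mul (hc j)]
  simp only [fun j => pd_mul i (hd j) (hc j), pd_coord, Finset.sum_add_distrib]
  congr 1
  · refine Finset.sum_congr rfl fun j _ => ?_
    rw [← abarDeriv_zero, (isDerivFamily_abarDeriv hγ hγ' i j).pd_eq, zero_add]
  · simp

/-- The quantity `∂_i ∑_j ā_{ij} v_j` is computed in two ways, by the divergence identity above and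
by the product rule; then one sums over `i`. -/
lemma sum_abar_mul_coord_mul_coord (hγ : -3 < γ) (hγ' : γ < 0) (v : V) :
    ∑ i, ∑ j, abar γ i j v * v j * v i = doubleDiv γ v + ∑ i, abar γ i i v := by
  have h1 : ∀ i, (∑ j, abarDeriv γ i j (unitIdx i) v * v j) + abar γ i i v
      = -∑ j, abarDeriv γ i j (unitIdx j + unitIdx i) v := fun i => by
    rw [← pd_sum_abar_mul_coord' hγ hγ', pd_sum_abar_mul_coord hγ hγ']
  have h2 := Finset.sum_congr (rfl : (Finset.univ : Finset (Fin 3)) = _) fun i _ => h1 i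
  rw [Finset.sum_add_distrib, Finset.sum_neg_distrib, Finset.sum_comm] at h2
  have h3 : ∀ j, ∑ i, abarDeriv γ i j (unitIdx i) v * v j = -∑ i, abar γ j i v * v i * v j := by
    intro j
    have := sum_abarDeriv_unitIdx hγ hγ' j v
    simp only [abarDeriv_symm γ j] at this
    rw [← Finset.sum_mul, this, neg_mul, Finset.sum_mul]
  rw [Finset.sum_congr rfl fun j _ => h3 j, Finset.sum_neg_distrib] at h2
  rw [doubleDiv]
  linarith

/-- The form that shows positivity: a quarter of `A v·v`, of size `⟨v⟩^{γ+2}`, plus a double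
divergence that will prove to be of lower order. -/
lemma potential_eq_form (hγ : -3 < γ) (hγ' : γ < 0) (v : V) : potential γ v =
    1 / 4 * (∑ i, ∑ j, abar γ i j v * v j * v i) + 1 / 2 * doubleDiv γ v := by
  have hd := fun i j => (contDiff_abar hγ hγ' i j).differentiable (by simp) v
  have hc := fun j => (contDiff_coord j).differentiable (by simp) v
  have h1 : ∀ i, ∑ j, pd i (fun w => abar γ i j w * (w j / 2)) v
      = -(1 / 2 * ∑ j, abarDeriv γ i j (unitIdx j + unitIdx i) v) := by
    intro i
    have h2 := pd_sum_abar_mul_coord hγ hγ' i v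
    rw [pd_sum _ _ fun j _ => (hd i j).fun_mul (hc j)] at h2
    rw [← mul_neg, ← h2, Finset.mul_sum]
    refine Finset.sum_congr rfl fun j _ => ?_
    rw [← pd_const_mul _ _ ((hd i j).fun_mul (hc j))]
    congr 1; funext w; ring
  rw [potential, Finset.sum_congr rfl fun i _ => h1 i, doubleDiv, Finset.sum_neg_distrib,
    Finset.mul_sum, Finset.mul_sum]
  rw [sub_neg_eq_add]
  congr 1
  refine Finset.sum_congr rfl fun i _ => ?_
  rw [Finset.mul_sum]
  refine Finset.sum_congr rfl fun j _ => ?_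
  ring

/-- The form suited to differentiation: no polynomial factor `v_j` is left, so the factorial bounds
for `∂^n ā` pass directly to the potential. -/
lemma potential_eq (hγ : -3 < γ) (hγ' : γ < 0) (v : V) : potential γ v =
    3 / 4 * doubleDiv γ v + 1 / 4 * ∑ i, abar γ i i v := by
  rw [potential_eq_form hγ hγ', sum_abar_mul_coord_mul_coord hγ hγ']; ring

/-- The derivatives of the potential. -/
def potDeriv (γ : ℝ) (n : Fin 3 → ℕ) (v : V) : ℝ :=
  3 / 4 * (∑ i, ∑ j, abarDeriv γ i j (n + (unitIdx j + unitIdx i)) v)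
    + 1 / 4 * ∑ i, abarDeriv γ i i n v

lemma potDeriv_zero (hγ : -3 < γ) (hγ' : γ < 0) : potDeriv γ 0 = potential γ := by
  funext v
  rw [potential_eq hγ hγ', potDeriv, doubleDiv]
  simp only [zero_add, abarDeriv_zero]

lemma isDerivFamily_potDeriv (hγ : -3 < γ) (hγ' : γ < 0) : IsDerivFamily (potDeriv γ) := by
  intro n v
  have h := fun i j m => isDerivFamily_abarDeriv hγ hγ' i j m v
  have := ((HasFDerivAt.fun_sum fun i (_ : i ∈ Finset.univ) =>
    HasFDerivAt.fun_sum fun j (_ : j ∈ Finset.univ) =>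
      h i j (n + (unitIdx j + unitIdx i))).const_mul (3 / 4 : ℝ)).add
    ((HasFDerivAt.fun_sum fun i (_ : i ∈ Finset.univ) => h i i n).const_mul (1 / 4 : ℝ))
  refine this.congr_fderiv ?_
  simp only [potDeriv, add_right_comm n]
  simp only [Fin.sum_univ_three]
  module

lemma multiPd_potential (hγ : -3 < γ) (hγ' : γ < 0) (α : Fin 3 → ℕ) :
    multiPd α (potential γ) = potDeriv γ α := by
  rw [← potDeriv_zero hγ hγ', (isDerivFamily_potDeriv hγ hγ').multiPd_eq, zero_add]

lemma contDiff_potential (hγ : -3 < γ) (hγ' : γ < 0) : ContDiff ℝ ∞ (potential γ) := by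
  rw [← potDeriv_zero hγ hγ']; exact (isDerivFamily_potDeriv hγ hγ').contDiff 0

end

section

variable {γ : ℝ}

/-! ### The divergence of the Landau kernel -/

/-- The regularised radial factor `(|z|² + δ)^{γ/2}`. -/
def regPow (γ δ : ℝ) (z : V) : ℝ := (‖z‖ ^ 2 + δ) ^ (γ / 2)

/-- The regularised Landau kernel. -/
def regKernel (γ δ : ℝ) (i j : Fin 3) (z : V) : ℝ :=
  ((if i = j then ‖z‖ ^ 2 else 0) - z i * z j) * regPow γ δ z

lemma pd_norm_sq (i : Fin 3) (v : V) : pd i (fun w : V => ‖w‖ ^ 2) v = 2 * v i := by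
  rw [pd, ((hasStrictFDerivAt_norm_sq v).hasFDerivAt).fderiv]
  simp [EuclideanSpace.inner_single_right]

lemma hasFDerivAt_regPow (γ : ℝ) {δ : ℝ} (hδ : 0 < δ) (z : V) :
    HasFDerivAt (regPow γ δ)
      (∑ l, (γ * (‖z‖ ^ 2 + δ) ^ (γ / 2 - 1) * z l) • coord l) z := by
  have hd : DifferentiableAt ℝ (fun w : V => ‖w‖ ^ 2) z :=
    (hasStrictFDerivAt_norm_sq z).hasFDerivAt.differentiableAt
  have h1 := hasFDerivAt_pd hd
  have h2 := (h1.add_const δ).rpow_const (p := γ / 2) (Or.inl (by positivity))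
  refine h2.congr_fderiv ?_
  rw [Finset.smul_sum]
  refine Finset.sum_congr rfl fun l _ => ?_
  rw [smul_smul, pd_norm_sq]
  congr 1; ring

lemma differentiable_polyPart (i j : Fin 3) :
    Differentiable ℝ fun z : V => (if i = j then ‖z‖ ^ 2 else 0) - z i * z j := by
  have h1 : Differentiable ℝ fun z : V => if i = j then ‖z‖ ^ 2 else 0 := by
    split_ifs
    · exact fun z => (hasStrictFDerivAt_norm_sq z).hasFDerivAt.differentiableAt
    · exact differentiable_const 0
  exact h1.fun_sub (((contDiff_coord i).differentiable (by simp)).fun_mul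
    ((contDiff_coord j).differentiable (by simp)))

lemma pd_polyPart (i j k : Fin 3) (z : V) :
    pd k (fun z : V => (if i = j then ‖z‖ ^ 2 else 0) - z i * z j) z
      = (if i = j then 2 * z k else 0) - ((if i = k then z j else 0) + (if j = k then z i else 0)) := by
  have h1 : Differentiable ℝ fun z : V => if i = j then ‖z‖ ^ 2 else 0 := by
    split_ifs
    · exact fun z => (hasStrictFDerivAt_norm_sq z).hasFDerivAt.differentiableAt
    · exact differentiable_const 0
  have hc := fun i => (contDiff_coord i).differentiable (by simp)
  rw [pd_sub _ (h1 z) ((hc i z).fun_mul (hc j z)), pd_mul _ (hc i z) (hc j z), pd_coord, pd_coord]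
  congr 1
  · split_ifs
    · exact pd_norm_sq k z
    · simp [pd]
  · simp

lemma differentiable_regKernel {δ : ℝ} (hδ : 0 < δ) (i j : Fin 3) :
    Differentiable ℝ (regKernel γ δ i j) :=
  (differentiable_polyPart i j).fun_mul fun z => (hasFDerivAt_regPow γ hδ z).differentiableAt

lemma pd_regKernel {δ : ℝ} (hδ : 0 < δ) (i j k : Fin 3) (z : V) :
    pd k (regKernel γ δ i j) z =
      ((if i = j then 2 * z k else 0) - ((if i = k then z j else 0) + (if j = k then z i else 0)))
        * regPow γ δ z + ((if i = j then ‖z‖ ^ 2 else 0) - z i * z j)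
        * (γ * (‖z‖ ^ 2 + δ) ^ (γ / 2 - 1) * z k) := by
  have h := hasFDerivAt_regPow γ hδ z
  have := pd_mul k (differentiable_polyPart i j z) h.differentiableAt
  rw [pd_polyPart, pd_eq_of_hasFDerivAt h] at this
  exact this

/-- The gradient of the radial factor is parallel to `z`, which the matrix `|z|² I - z ⊗ z`
annihilates. Only the divergence of the polynomial part survives, for every `δ`. -/
lemma sum_pd_regKernel {δ : ℝ} (hδ : 0 < δ) (i : Fin 3) (z : V) :
    ∑ j, pd j (regKernel γ δ i j) z = -2 * (z i * regPow γ δ z) := by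
  simp only [pd_regKernel hδ, norm_sq_eq_sum, Fin.sum_univ_three]
  fin_cases i <;> simp <;> ring

lemma abs_polyPart_le (i j : Fin 3) (z : V) :
    |(if i = j then ‖z‖ ^ 2 else 0) - z i * z j| ≤ 2 * ‖z‖ ^ 2 := by
  have h1 : |z i * z j| ≤ ‖z‖ ^ 2 := by
    rw [abs_mul, pow_two]
    gcongr <;> exact abs_coord_le z _
  have h2 : |if i = j then ‖z‖ ^ 2 else 0| ≤ ‖z‖ ^ 2 := by
    split_ifs
    · rw [abs_of_nonneg (by positivity)]
    · simpa using sq_nonneg ‖z‖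
  exact (abs_sub _ _).trans (by linarith)

lemma abs_regPow_le (hγ' : γ < 0) {δ : ℝ} (hδ : 0 < δ) (z : V) :
    |regPow γ δ z| ≤ δ ^ (γ / 2) := by
  rw [regPow, abs_of_nonneg (by positivity)]
  exact Real.rpow_le_rpow_of_nonpos hδ (by nlinarith [sq_nonneg ‖z‖]) (by linarith)

lemma abs_regKernel_le (hγ' : γ < 0) {δ : ℝ} (hδ : 0 < δ) (i j : Fin 3) (z : V) :
    |regKernel γ δ i j z| ≤ 2 * δ ^ (γ / 2) * (1 + ‖z‖ ^ 2) ^ 2 := by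
  rw [regKernel, abs_mul]
  calc _ ≤ 2 * ‖z‖ ^ 2 * δ ^ (γ / 2) := by
        gcongr
        · exact abs_polyPart_le i j z
        · exact abs_regPow_le hγ' hδ z
    _ = 2 * δ ^ (γ / 2) * ‖z‖ ^ 2 := by ring
    _ ≤ _ := by gcongr; nlinarith [sq_nonneg ‖z‖, sq_nonneg (‖z‖ ^ 2)]

lemma exists_abs_pd_regKernel_le (hγ' : γ < 0) {δ : ℝ} (hδ : 0 < δ) (i j k : Fin 3) :
    ∃ K : ℝ, 0 ≤ K ∧ ∀ z, |pd k (regKernel γ δ i j) z| ≤ K * (1 + ‖z‖ ^ 2) ^ 2 := by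
  refine ⟨4 * δ ^ (γ / 2) + 2 * (|γ| * δ ^ (γ / 2 - 1)), by positivity, fun z => ?_⟩
  rw [pd_regKernel hδ]
  have hz : ∀ i, |z i| ≤ ‖z‖ := abs_coord_le z
  have hn := norm_nonneg z
  have h1 : |(if i = j then 2 * z k else 0)
      - ((if i = k then z j else 0) + (if j = k then z i else 0))| ≤ 4 * ‖z‖ := by
    have a1 : |if i = j then 2 * z k else 0| ≤ 2 * ‖z‖ := by
      split_ifs
      · rw [abs_mul, abs_two]; linarith [hz k]
      · simpa using hn
    have a2 : |if i = k then z j else 0| ≤ ‖z‖ := by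
      split_ifs
      · exact hz j
      · simpa using hn
    have a3 : |if j = k then z i else 0| ≤ ‖z‖ := by
      split_ifs
      · exact hz i
      · simpa using hn
    calc _ ≤ _ := abs_sub _ _
      _ ≤ 2 * ‖z‖ + (‖z‖ + ‖z‖) := by
          gcongr
          exact (abs_add_le _ _).trans (add_le_add a2 a3)
      _ = _ := by ring
  have h2 : (‖z‖ ^ 2 + δ) ^ (γ / 2 - 1) ≤ δ ^ (γ / 2 - 1) :=
    Real.rpow_le_rpow_of_nonpos hδ (by nlinarith [sq_nonneg ‖z‖]) (by linarith)
  have h3 : ‖z‖ ≤ (1 + ‖z‖ ^ 2) ^ 2 := by nlinarith [sq_nonneg (‖z‖ - 1), sq_nonneg (‖z‖ ^ 2)]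
  have h4 : ‖z‖ ^ 2 * ‖z‖ ≤ (1 + ‖z‖ ^ 2) ^ 2 := by
    nlinarith [sq_nonneg (‖z‖ - 1), sq_nonneg (‖z‖ ^ 2), mul_nonneg (sq_nonneg ‖z‖) (sq_nonneg (‖z‖ - 1))]
  calc _ ≤ 4 * ‖z‖ * δ ^ (γ / 2) + 2 * ‖z‖ ^ 2 * (|γ| * δ ^ (γ / 2 - 1) * ‖z‖) := by
        refine (abs_add_le _ _).trans ?_
        rw [abs_mul, abs_mul, abs_mul, abs_mul, abs_of_nonneg
          (by positivity : 0 ≤ (‖z‖ ^ 2 + δ) ^ (γ / 2 - 1))]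
        gcongr
        · exact abs_regPow_le hγ' hδ z
        · exact abs_polyPart_le i j z
        · exact hz k
    _ = 4 * δ ^ (γ / 2) * ‖z‖ + 2 * (|γ| * δ ^ (γ / 2 - 1)) * (‖z‖ ^ 2 * ‖z‖) := by ring
    _ ≤ 4 * δ ^ (γ / 2) * (1 + ‖z‖ ^ 2) ^ 2
          + 2 * (|γ| * δ ^ (γ / 2 - 1)) * (1 + ‖z‖ ^ 2) ^ 2 := by gcongr
    _ = _ := by ring

lemma integrable_poly_maxDeriv (n : Fin 3 → ℕ) (v : V) {f : V → ℝ} (hf : AEStronglyMeasurable f)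
    {K : ℝ} (hK : 0 ≤ K) (h : ∀ z, |f z| ≤ K * (1 + ‖z‖ ^ 2) ^ 2) :
    Integrable fun z => f z * maxDeriv n (v - z) := by
  set A : ℝ := multiFactorial n * Real.exp (len n) * Real.exp 3 with hA
  have hg := ((integrable_gaussian (b := 1 / 16) (by norm_num)).comp_sub_left v).const_mul
    (K * 4 * (1 + ‖v‖ ^ 2) ^ 2 * A * (8 * 16))
  refine hg.mono' ?_ (Eventually.of_forall fun z => ?_)
  · have := continuous_maxDeriv n
    exact hf.mul (by fun_prop : Continuous fun z => maxDeriv n (v - z)).aestronglyMeasurable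
  · set y := v - z with hy
    have h1 : 1 + ‖z‖ ^ 2 ≤ 2 * (1 + ‖y‖ ^ 2) * (1 + ‖v‖ ^ 2) := by
      have := one_add_norm_sq_le z v
      rwa [norm_sub_rev] at this
    have h2 := one_add_mul_exp_le (x := ‖y‖ ^ 2) (1 / 8) (by norm_num) (by norm_num)
    have h3 := one_add_mul_exp_le (x := ‖y‖ ^ 2) (1 / 16) (by norm_num) (by norm_num)
    rw [show (2 : ℝ) * (1 / 8) * ‖y‖ ^ 2 = ‖y‖ ^ 2 / 4 by ring] at h2
    rw [show (2 : ℝ) * (1 / 16) * ‖y‖ ^ 2 = 1 / 8 * ‖y‖ ^ 2 by ring] at h3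
    rw [Real.norm_eq_abs, abs_mul]
    calc _ ≤ K * (2 * (1 + ‖y‖ ^ 2) * (1 + ‖v‖ ^ 2)) ^ 2 * (A * Real.exp (-(‖y‖ ^ 2 / 4))) := by
          gcongr
          · exact (h z).trans (by gcongr)
          · exact abs_maxDeriv_le n y
      _ = K * 4 * (1 + ‖v‖ ^ 2) ^ 2 * A * ((1 + ‖y‖ ^ 2)
          * ((1 + ‖y‖ ^ 2) * Real.exp (-(‖y‖ ^ 2 / 4)))) := by ring
      _ ≤ K * 4 * (1 + ‖v‖ ^ 2) ^ 2 * A * ((1 + ‖y‖ ^ 2)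
          * ((1 / 8)⁻¹ * Real.exp (-(1 / 8 * ‖y‖ ^ 2)))) := by gcongr
      _ = K * 4 * (1 + ‖v‖ ^ 2) ^ 2 * A * (8 * ((1 + ‖y‖ ^ 2)
          * Real.exp (-(1 / 8 * ‖y‖ ^ 2)))) := by
          rw [show ((1 : ℝ) / 8)⁻¹ = 8 by norm_num]; ring
      _ ≤ K * 4 * (1 + ‖v‖ ^ 2) ^ 2 * A * (8 * ((1 / 16)⁻¹ * Real.exp (-(1 / 16 * ‖y‖ ^ 2)))) := by
          gcongr
      _ = _ := by norm_num; ring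

lemma pd_maxDeriv_sub (n : Fin 3 → ℕ) (v : V) (l : Fin 3) (z : V) :
    pd l (fun z => maxDeriv n (v - z)) z = -maxDeriv (n + unitIdx l) (v - z) := by
  have h1 : HasFDerivAt (fun x : V => v - x) (-ContinuousLinearMap.id ℝ V) z :=
    (hasFDerivAt_id z).const_sub v
  have h2 := (isDerivFamily_maxDeriv n (v - z)).comp z h1
  have h3 : HasFDerivAt (fun z => maxDeriv n (v - z))
      (∑ l, (-maxDeriv (n + unitIdx l) (v - z)) • coord l) z := by
    refine h2.congr_fderiv ?_
    rw [ContinuousLinearMap.comp_neg, ContinuousLinearMap.comp_id, ← Finset.sum_neg_distrib]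
    exact Finset.sum_congr rfl fun l _ => (neg_smul _ _).symm
  exact pd_eq_of_hasFDerivAt h3 l

/-- For `δ > 0` the kernel is differentiable with polynomially bounded derivatives, so integration
by parts against the Gaussian is licit. The limit `δ → 0` is taken afterwards. -/
lemma integral_regKernel (hγ' : γ < 0) {δ : ℝ} (hδ : 0 < δ) (i : Fin 3) (v : V) :
    ∑ j, ∫ z, regKernel γ δ i j z * maxDeriv (unitIdx j) (v - z)
      = -2 * ∫ z : V, z i * regPow γ δ z * maxDeriv 0 (v - z) := by
  choose K hK0 hK using fun j => exists_abs_pd_regKernel_le hγ' hδ i j j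
  have hmeas : ∀ j, AEStronglyMeasurable (regKernel γ δ i j) := fun j =>
    (differentiable_regKernel hδ i j).continuous.aestronglyMeasurable
  have hmeas' : ∀ j, AEStronglyMeasurable (pd j (regKernel γ δ i j)) := fun j =>
    (measurable_fderiv_apply_const ℝ _ _).aestronglyMeasurable
  have hreg : ∀ j z, |regKernel γ δ i j z| ≤ 2 * δ ^ (γ / 2) * (1 + ‖z‖ ^ 2) ^ 2 :=
    fun j z => abs_regKernel_le hγ' hδ i j z
  have hint := fun j => integrable_poly_maxDeriv 0 v (hmeas' j) (hK0 j) (hK j)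
  have key : ∀ j, ∫ z, regKernel γ δ i j z * maxDeriv (unitIdx j) (v - z)
      = ∫ z, pd j (regKernel γ δ i j) z * maxDeriv 0 (v - z) := by
    intro j
    have h0 := integrable_poly_maxDeriv 0 v (hmeas j) (by positivity) (hreg j)
    have h1 := integrable_poly_maxDeriv (unitIdx j) v (hmeas j) (by positivity) (hreg j)
    have hd : Differentiable ℝ fun z => maxDeriv 0 (v - z) :=
      ((isDerivFamily_maxDeriv.contDiff 0).comp (contDiff_const.sub contDiff_id)).differentiable
        (by simp)
    have hp : ∀ z, fderiv ℝ (fun z => maxDeriv 0 (v - z)) z (EuclideanSpace.single j 1)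
        = -maxDeriv (unitIdx j) (v - z) := fun z => by
      have := pd_maxDeriv_sub 0 v j z
      rwa [zero_add] at this
    have := integral_mul_fderiv_eq_neg_fderiv_mul_of_integrable (μ := (volume : Measure V))
      (f := regKernel γ δ i j) (g := fun z => maxDeriv 0 (v - z))
      (v := EuclideanSpace.single j 1) (hint j)
      (by simp only [hp, mul_neg]; exact h1.neg) h0
      (fun z _ => differentiable_regKernel hδ i j z) (fun z _ => hd z)
    simp only [hp, mul_neg, integral_neg, neg_inj] at this
    exact this
  rw [Finset.sum_congr rfl fun j _ => key j, ← integral_finsetSum _ fun j _ => hint j,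
    ← integral_const_mul]
  congr 1; funext z
  rw [← Finset.sum_mul, sum_pd_regKernel hδ]; ring

lemma regPow_le (hγ' : γ < 0) {δ : ℝ} (hδ : 0 < δ) {z : V} (hz : z ≠ 0) :
    regPow γ δ z ≤ ‖z‖ ^ γ := by
  have hz' := norm_pos_iff.2 hz
  have h3 : ‖z‖ ^ γ = (‖z‖ ^ 2) ^ (γ / 2) := by
    rw [← Real.rpow_natCast, ← Real.rpow_mul hz'.le]; congr 1; push_cast; ring
  rw [h3, regPow]
  exact Real.rpow_le_rpow_of_nonpos (by positivity) (by linarith) (by linarith)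

lemma tendsto_regPow (γ : ℝ) {z : V} (hz : z ≠ 0) :
    Tendsto (fun m : ℕ => regPow γ (1 / ((m : ℝ) + 1)) z) atTop (𝓝 (‖z‖ ^ γ)) := by
  have hz' := norm_pos_iff.2 hz
  have h3 : ‖z‖ ^ γ = (‖z‖ ^ 2 + 0) ^ (γ / 2) := by
    rw [add_zero, ← Real.rpow_natCast, ← Real.rpow_mul hz'.le]; congr 1; push_cast; ring
  rw [h3]
  exact (tendsto_const_nhds.add tendsto_one_div_add_atTop_nhds_zero_nat).rpow_const
    (Or.inl (by positivity))

lemma kernelBound_coord (γ : ℝ) (i : Fin 3) : KernelBound γ fun z => z i * ‖z‖ ^ γ := by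
  refine ⟨(contDiff_coord i).continuous.measurable.mul (measurable_norm.pow_const γ),
    1, zero_le_one, fun z => ?_⟩
  have h0 : 0 ≤ ‖z‖ ^ γ := by positivity
  rw [abs_mul, abs_of_nonneg h0, one_mul, mul_comm]
  gcongr
  exact (abs_coord_le z i).trans (by nlinarith [sq_nonneg (‖z‖ - 1)])

/-- The divergence of the matrix `A`, computed by differentiating the kernel. -/
lemma sum_abarDeriv_unitIdx_eq (hγ : -3 < γ) (hγ' : γ < 0) (i : Fin 3) (v : V) :
    ∑ j, abarDeriv γ i j (unitIdx j) v = -2 * convMax (fun z => z i * ‖z‖ ^ γ) 0 v := by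
  simp only [abarDeriv, convMax_eq]
  -- Dominated convergence, with the singular kernel as majorant: `(‖z‖² + δ)^{γ/2} ≤ ‖z‖^γ` for `z
  -- ≠ 0` because `γ < 0`. At `z = 0` the polynomial factors vanish.
  have hlim : ∀ (κ : V → ℝ) (κ' : ℕ → V → ℝ) (n : Fin 3 → ℕ), KernelBound γ κ →
      (∀ m, AEStronglyMeasurable (κ' m)) → (∀ m z, |κ' m z| ≤ |κ z|) →
      (∀ z, Tendsto (fun m => κ' m z) atTop (𝓝 (κ z))) →
      Tendsto (fun m => ∫ z, κ' m z * maxDeriv n (v - z)) atTop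
        (𝓝 (∫ z, κ z * maxDeriv n (v - z))) := by
    intro κ κ' n hκ hm hle ht
    refine tendsto_integral_of_dominated_convergence (fun z => ‖κ z * maxDeriv n (v - z)‖)
      (fun m => ?_) (hκ.integrable hγ hγ' n v).norm (fun m => Eventually.of_forall fun z => ?_)
      (Eventually.of_forall fun z => (ht z).mul_const _)
    · have := continuous_maxDeriv n
      exact (hm m).mul (by fun_prop : Continuous fun z => maxDeriv n (v - z)).aestronglyMeasurable
    · rw [norm_mul, norm_mul]
      gcongr
      exact hle m z
  have hδ : ∀ m : ℕ, (0 : ℝ) < 1 / ((m : ℝ) + 1) := fun m => by positivity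
  have hdr : ∀ m : ℕ, Continuous (regPow γ (1 / ((m : ℝ) + 1))) := fun m =>
    continuous_iff_continuousAt.2 fun z => (hasFDerivAt_regPow γ (hδ m) z).continuousAt
  have t1 := tendsto_finsetSum Finset.univ fun j _ =>
    hlim (kernel γ i j) (fun m => regKernel γ (1 / ((m : ℝ) + 1)) i j) (unitIdx j)
      (kernelBound_kernel γ i j)
      (fun m => (differentiable_regKernel (hδ m) i j).continuous.aestronglyMeasurable)
      (fun m z => by
        rw [regKernel, kernel, abs_mul, abs_mul]
        rcases eq_or_ne z 0 with rfl | hz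
        · simp
        · refine mul_le_mul_of_nonneg_left ?_ (abs_nonneg _)
          rw [regPow, abs_of_nonneg (by positivity), abs_of_nonneg (by positivity)]
          exact regPow_le hγ' (hδ m) hz)
      (fun z => by
        rcases eq_or_ne z 0 with rfl | hz
        · simp [regKernel, kernel]
        · exact (tendsto_regPow γ hz).const_mul _)
  have t2 := (hlim (fun z => z i * ‖z‖ ^ γ) (fun m z => z i * regPow γ (1 / ((m : ℝ) + 1)) z) 0
      (kernelBound_coord γ i)
      (fun m => ((contDiff_coord i).continuous.mul (hdr m)).aestronglyMeasurable)
      (fun m z => by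
        rw [abs_mul, abs_mul]
        rcases eq_or_ne z 0 with rfl | hz
        · simp
        · refine mul_le_mul_of_nonneg_left ?_ (abs_nonneg _)
          rw [regPow, abs_of_nonneg (by positivity), abs_of_nonneg (by positivity)]
          exact regPow_le hγ' (hδ m) hz)
      (fun z => by
        rcases eq_or_ne z 0 with rfl | hz
        · simp
        · exact (tendsto_regPow γ hz).const_mul _)).const_mul (-2)
  simp only [fun m => integral_regKernel hγ' (hδ m) i v] at t1
  exact tendsto_nhds_unique t1 t2

/-- One of the two derivatives has been taken on the kernel, which lowers its growth by one power;
only the other one falls on `μ`. -/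
lemma doubleDiv_eq (hγ : -3 < γ) (hγ' : γ < 0) (v : V) :
    doubleDiv γ v = -2 * ∑ i, convMax (fun z => z i * ‖z‖ ^ γ) (unitIdx i) v := by
  rw [doubleDiv, Finset.mul_sum]
  refine Finset.sum_congr rfl fun i _ => ?_
  have h : (fun w => ∑ j, abarDeriv γ i j (unitIdx j) w)
      = fun w => -2 * convMax (fun z => z i * ‖z‖ ^ γ) 0 w :=
    funext fun w => sum_abarDeriv_unitIdx_eq hγ hγ' i w
  have hF := (kernelBound_coord γ i).isDerivFamily hγ hγ'
  have h2 := congrArg (fun f => pd i f v) h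
  simp only at h2
  rw [pd_const_mul _ _ ((hF.contDiff 0).differentiable (by simp) v), hF.pd_eq, zero_add,
    pd_sum _ _ fun j _ => ((isDerivFamily_abarDeriv hγ hγ' i j).contDiff _).differentiable
      (by simp) v] at h2
  rw [← h2]
  refine Finset.sum_congr rfl fun j _ => ?_
  rw [(isDerivFamily_abarDeriv hγ hγ' i j).pd_eq]

lemma maxwellian_le (w : V) : maxwellian w ≤ Real.exp (-(‖w‖ ^ 2 / 2)) := by
  rw [maxwellian, neg_div]
  have hpi : (2 * Real.pi) ^ (-(3 / 2 : ℝ)) ≤ 1 :=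
    Real.rpow_le_one_of_one_le_of_nonpos (by linarith [Real.pi_gt_three]) (by norm_num)
  exact mul_le_of_le_one_left (Real.exp_pos _).le hpi

/-- The growth `⟨v⟩^{γ+1}`, against the `⟨v⟩^{γ+2}` of the general bound for derivatives of `ā`, is
what makes the double divergence a perturbation of `A v·v`. -/
lemma exists_abs_doubleDiv_le (hγ : -3 < γ) (hγ' : γ < 0) : ∃ C : ℝ, 0 < C ∧
    ∀ v, |doubleDiv γ v| ≤ C * (bracket v ^ γ * bracket v) := by
  obtain ⟨hint, C, hC, hb⟩ := exists_bound_singular_gaussian hγ hγ' (b := 1 / 4) (by norm_num)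
  refine ⟨48 * C, by positivity, fun v => ?_⟩
  have h1 : ∀ i, |convMax (fun z => z i * ‖z‖ ^ γ) (unitIdx i) v|
      ≤ 8 * C * (bracket v ^ γ * bracket v) := by
    intro i
    rw [convMax, ← Real.norm_eq_abs]
    have hv : ‖v‖ ≤ bracket v := by
      rw [bracket]; exact Real.le_sqrt_of_sq_le (by linarith)
    have hv1 := one_le_bracket v
    refine (norm_integral_le_of_norm_le ((hint v).const_mul (8 * bracket v))
      (Eventually.of_forall fun w => ?_)).trans ?_
    · rw [maxDeriv_unitIdx, Real.norm_eq_abs, abs_mul, abs_mul, abs_neg, abs_mul,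
        abs_of_nonneg (maxwellian_nonneg w), abs_of_nonneg (by positivity : 0 ≤ ‖v - w‖ ^ γ)]
      have a1 : |(v - w) i| ≤ bracket v * (1 + ‖w‖) := by
        refine (abs_coord_le _ i).trans ((norm_sub_le v w).trans ?_)
        nlinarith [norm_nonneg w]
      have a2 := abs_coord_le w i
      have h2 := one_add_mul_exp_le (x := ‖w‖ ^ 2) (1 / 4) (by norm_num) (by norm_num)
      rw [show (2 : ℝ) * (1 / 4) * ‖w‖ ^ 2 = ‖w‖ ^ 2 / 2 by ring] at h2
      have hw := norm_nonneg w
      calc _ ≤ bracket v * (1 + ‖w‖) * ‖v - w‖ ^ γ * (‖w‖ * Real.exp (-(‖w‖ ^ 2 / 2))) := by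
            have a4 := maxwellian_nonneg w
            have a5 := maxwellian_le w
            have a6 : 0 ≤ ‖v - w‖ ^ γ := by positivity
            exact mul_le_mul (mul_le_mul_of_nonneg_right a1 a6) (mul_le_mul a2 a5 a4 hw)
              (mul_nonneg (abs_nonneg _) a4) (by positivity)
        _ = bracket v * ‖v - w‖ ^ γ * ((1 + ‖w‖) * ‖w‖ * Real.exp (-(‖w‖ ^ 2 / 2))) := by ring
        _ ≤ bracket v * ‖v - w‖ ^ γ * (2 * (1 + ‖w‖ ^ 2) * Real.exp (-(‖w‖ ^ 2 / 2))) := by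
            have a7 : (1 + ‖w‖) * ‖w‖ ≤ 2 * (1 + ‖w‖ ^ 2) := by nlinarith [sq_nonneg (‖w‖ - 1)]
            exact mul_le_mul_of_nonneg_left
              (mul_le_mul_of_nonneg_right a7 (Real.exp_pos _).le) (by positivity)
        _ = 2 * bracket v * ‖v - w‖ ^ γ * ((1 + ‖w‖ ^ 2) * Real.exp (-(‖w‖ ^ 2 / 2))) := by ring
        _ ≤ 2 * bracket v * ‖v - w‖ ^ γ * ((1 / 4)⁻¹ * Real.exp (-(1 / 4 * ‖w‖ ^ 2))) := by
            gcongr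
        _ = _ := by norm_num; ring
    · rw [integral_const_mul]
      calc _ ≤ 8 * bracket v * (C * bracket v ^ γ) := by gcongr; exact hb v
        _ = _ := by ring
  rw [doubleDiv_eq hγ hγ', abs_mul]
  calc _ ≤ |(-2 : ℝ)| * ∑ i : Fin 3, 8 * C * (bracket v ^ γ * bracket v) := by
        gcongr
        exact (Finset.abs_sum_le_sum_abs _ _).trans (Finset.sum_le_sum fun i _ => h1 i)
    _ = _ := by simp; ring

lemma bracket_rpow_add_two (γ : ℝ) (v : V) :
    bracket v ^ (γ + 2) = bracket v ^ γ * bracket v ^ 2 := by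
  rw [Real.rpow_add (bracket_pos v)]; norm_num

lemma exists_le_potential (hγ : -3 < γ) (hγ' : γ < 0) : ∃ c C : ℝ, 0 < c ∧ 0 < C ∧
    ∀ v, c * bracket v ^ (γ + 2) - C * bracket v ^ γ ≤ potential γ v := by
  obtain ⟨c, hc, hcb⟩ := exists_le_abar_form hγ hγ'
  obtain ⟨D, hD, hDb⟩ := exists_abs_doubleDiv_le hγ hγ'
  refine ⟨c / 8, c / 4 + D ^ 2 / c, by positivity, by positivity, fun v => ?_⟩
  have h1 := hcb v (fun i => v i)
  have h2 := (abs_le.1 (hDb v)).1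
  have h3 : mform γ v (fun i => v i) = bracket v ^ γ * (bracket v ^ 2 - 1) := by
    rw [mform, bracket_sq, norm_sq_eq_sum]
    simp only [bform, Fin.sum_univ_three]; ring
  have h4 : ∑ i, ∑ j, abar γ i j v * v i * v j = ∑ i, ∑ j, abar γ i j v * v j * v i :=
    Finset.sum_congr rfl fun i _ => Finset.sum_congr rfl fun j _ => by ring
  rw [h3, h4] at h1
  rw [potential_eq_form hγ hγ', bracket_rpow_add_two]
  set X := bracket v ^ γ with hX
  set b := bracket v
  have hX0 : 0 < X := Real.rpow_pos_of_pos (bracket_pos v) _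
  -- Young's inequality: the perturbation is absorbed by part of the coercive term, at the price of
  -- a multiple of `⟨v⟩^γ`.
  have h5 : D * b ≤ c / 4 * b ^ 2 + D ^ 2 / c := by
    have : 0 ≤ c / 4 * (b - 2 * D / c) ^ 2 := by positivity
    have e : c / 4 * (b - 2 * D / c) ^ 2 = c / 4 * b ^ 2 - D * b + D ^ 2 / c := by
      field_simp; ring
    linarith
  have h6 := mul_le_mul_of_nonneg_left h5 hX0.le
  have h7 : 0 < X * (D ^ 2 / c) := by positivity
  nlinarith

lemma sum_single_form (a : Fin 3 → Fin 3 → ℝ) (i j : Fin 3) :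
    ∑ i', ∑ j', a i' j' * (Pi.single i 1 : Fin 3 → ℝ) i' * (Pi.single j 1 : Fin 3 → ℝ) j'
      = a i j := by
  rw [Finset.sum_eq_single i, Finset.sum_eq_single j] <;> simp +contextual [Pi.single_apply]

lemma mform_single_le (γ : ℝ) (v : V) (i : Fin 3) :
    mform γ v (Pi.single i 1) ≤ bracket v ^ (γ + 2) := by
  rw [mform, bracket_rpow_add_two, bracket_sq, norm_sq_eq_sum]
  have hX0 : 0 < bracket v ^ γ := Real.rpow_pos_of_pos (bracket_pos v) _
  gcongr
  · simp [Pi.single_apply]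
  · simp only [bform]
    have : (∑ k, (Pi.single i 1 : Fin 3 → ℝ) k * (Pi.single i 1 : Fin 3 → ℝ) k) = 1 := by
      simp [Pi.single_apply]
    rw [this, mul_one]
    nlinarith [sq_nonneg (∑ k, v k * (Pi.single i 1 : Fin 3 → ℝ) k)]

lemma exists_abarDeriv_le (hγ : -3 < γ) (hγ' : γ < 0) : ∃ K : ℝ, 1 ≤ K ∧
    ∀ (n : Fin 3 → ℕ) (i j : Fin 3) (v : V),
      |abarDeriv γ i j n v| ≤ K ^ (len n + 1) * multiFactorial n * bracket v ^ (γ + 2) := by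
  obtain ⟨K, hK, h⟩ := exists_abarDeriv_form_le hγ hγ'
  refine ⟨K, hK, fun n i j v => ?_⟩
  have h1 := h n v (Pi.single i 1) (Pi.single j 1)
  rw [sum_single_form (fun i j => abarDeriv γ i j n v)] at h1
  refine h1.trans ?_
  have h0 : 0 < bracket v ^ (γ + 2) := Real.rpow_pos_of_pos (bracket_pos v) _
  gcongr
  calc _ ≤ √(bracket v ^ (γ + 2)) * √(bracket v ^ (γ + 2)) := by
        gcongr <;> exact mform_single_le γ v _
    _ = _ := Real.mul_self_sqrt h0.le

lemma multiFactorial_add_unitIdx_le (n : Fin 3 → ℕ) (i : Fin 3) :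
    (multiFactorial (n + unitIdx i) : ℝ) ≤ 2 ^ (len n) * multiFactorial n := by
  have h1 : multiFactorial (n + unitIdx i) = (n i + 1) * multiFactorial n := by
    rw [multiFactorial, multiFactorial, ← Finset.mul_prod_erase Finset.univ _ (Finset.mem_univ i),
      ← Finset.mul_prod_erase Finset.univ (fun j => (n j).factorial) (Finset.mem_univ i),
      ← mul_assoc]
    congr 1
    · simp [Nat.factorial_succ]
    · exact Finset.prod_congr rfl fun j hj => by simp [Finset.ne_of_mem_erase hj]
  have h2 : n i ≤ len n := Finset.single_le_sum (fun _ _ => Nat.zero_le _) (Finset.mem_univ i)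
  have h3 : n i + 1 ≤ 2 ^ len n := (Nat.succ_le_of_lt (Nat.lt_of_le_of_lt h2 Nat.lt_two_pow_self))
  rw [h1]
  push_cast
  gcongr
  exact_mod_cast h3

lemma exists_potDeriv_le (hγ : -3 < γ) (hγ' : γ < 0) : ∃ K : ℝ, 1 ≤ K ∧
    ∀ (n : Fin 3 → ℕ) (v : V),
      |potDeriv γ n v| ≤ K ^ (len n + 1) * multiFactorial n * bracket v ^ (γ + 2) := by
  obtain ⟨K, hK, h⟩ := exists_abarDeriv_le hγ hγ'
  -- The two extra derivatives cost `K²` and at most `2 · 4^{|n|}` in the factorials. The nine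
  -- double terms and three trace terms, with weights 3/4 and 1/4, add up to less than 16.
  refine ⟨16 * K ^ 3, by nlinarith [one_le_pow₀ hK (n := 3)], fun n v => ?_⟩
  have h0 : 0 < bracket v ^ (γ + 2) := Real.rpow_pos_of_pos (bracket_pos v) _
  set X : ℝ := multiFactorial n * bracket v ^ (γ + 2) with hX
  have hX0 : 0 ≤ X := by positivity
  have hK0 : 0 < K := by linarith
  have a1 : ∀ i j, |abarDeriv γ i j (n + (unitIdx j + unitIdx i)) v|
      ≤ 2 * (4 * K) ^ (len n) * K ^ 3 * X := by
    intro i j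
    refine (h _ i j v).trans ?_
    rw [← add_assoc, len_add, len_add, len_unitIdx, len_unitIdx]
    have e1 := multiFactorial_add_unitIdx_le (n + unitIdx j) i
    have e2 := multiFactorial_add_unitIdx_le n j
    rw [len_add, len_unitIdx] at e1
    calc _ ≤ K ^ (len n + 1 + 1 + 1) * (2 ^ (len n + 1) * (2 ^ (len n) * multiFactorial n))
          * bracket v ^ (γ + 2) := by
          gcongr
          exact e1.trans (by gcongr)
      _ = _ := by
          rw [show (4 : ℝ) * K = 2 * 2 * K by ring]
          simp only [mul_pow, pow_succ]; ring
  have a2 : ∀ i, |abarDeriv γ i i n v| ≤ (4 * K) ^ (len n) * K ^ 3 * X := by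
    intro i
    refine (h n i i v).trans ?_
    calc _ = K ^ (len n) * K * X := by rw [hX]; ring
      _ ≤ (4 * K) ^ (len n) * K ^ 3 * X := by
          gcongr
          · linarith
          · exact le_self_pow₀ hK (by norm_num)
  have b1 : |∑ i, ∑ j, abarDeriv γ i j (n + (unitIdx j + unitIdx i)) v|
      ≤ ∑ _i : Fin 3, ∑ _j : Fin 3, 2 * (4 * K) ^ (len n) * K ^ 3 * X :=
    (Finset.abs_sum_le_sum_abs _ _).trans (Finset.sum_le_sum fun i _ =>
      (Finset.abs_sum_le_sum_abs _ _).trans (Finset.sum_le_sum fun j _ => a1 i j))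
  have b2 : |∑ i, abarDeriv γ i i n v| ≤ ∑ _i : Fin 3, (4 * K) ^ (len n) * K ^ 3 * X :=
    (Finset.abs_sum_le_sum_abs _ _).trans (Finset.sum_le_sum fun i _ => a2 i)
  simp only [Finset.sum_const, Finset.card_univ, Fintype.card_fin, nsmul_eq_mul] at b1 b2
  push_cast at b1 b2
  have hY : 0 ≤ (4 * K) ^ (len n) * K ^ 3 * X := by positivity
  calc _ ≤ 3 / 4 * |∑ i, ∑ j, abarDeriv γ i j (n + (unitIdx j + unitIdx i)) v|
        + 1 / 4 * |∑ i, abarDeriv γ i i n v| := by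
        rw [potDeriv]
        refine (abs_add_le _ _).trans ?_
        rw [abs_mul, abs_mul]; norm_num
    _ ≤ 16 * ((4 * K) ^ (len n) * K ^ 3 * X) := by linarith
    _ ≤ 16 * ((16 * K ^ 3) ^ (len n) * K ^ 3 * X) := by
        gcongr
        · norm_num
        · exact le_self_pow₀ hK (by norm_num)
    _ = _ := by rw [hX]; ring

end

section

/-! ### Integration by parts and convolutions -/

lemma integral_mul_pd {u φ : V → ℝ} (hu : ContDiff ℝ 1 u) (hφ : ContDiff ℝ 1 φ)
    (hc : HasCompactSupport φ) (i : Fin 3) :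
    ∫ v, u v * pd i φ v = -∫ v, pd i u v * φ v := by
  have hpu : Continuous (pd i u) := (hu.continuous_fderiv one_ne_zero).clm_apply continuous_const
  have hpφ : Continuous (pd i φ) := (hφ.continuous_fderiv one_ne_zero).clm_apply continuous_const
  exact integral_mul_fderiv_eq_neg_fderiv_mul_of_integrable
    ((hpu.mul hφ.continuous).integrable_of_hasCompactSupport hc.mul_left)
    ((hu.continuous.mul hpφ).integrable_of_hasCompactSupport (hasCompactSupport_pd hc i).mul_left)
    ((hu.continuous.mul hφ.continuous).integrable_of_hasCompactSupport hc.mul_left)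
    (fun x _ => hu.differentiable one_ne_zero x) (fun x _ => hφ.differentiable one_ne_zero x)

/-- The convolution `h * ρ` of real functions. -/
def conv (h ρ : V → ℝ) (v : V) : ℝ := ∫ w, h w * ρ (v - w)

lemma conv_eq_convolution (h ρ : V → ℝ) :
    conv h ρ = convolution h ρ (ContinuousLinearMap.lsmul ℝ ℝ) volume := rfl

variable {h ρ : V → ℝ}

lemma contDiff_conv (hh : LocallyIntegrable h) (hρ : ContDiff ℝ ∞ ρ) (hc : HasCompactSupport ρ) :
    ContDiff ℝ ∞ (conv h ρ) := by
  rw [conv_eq_convolution]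
  exact hc.contDiff_convolution_right _ hh hρ

lemma pd_conv (hh : LocallyIntegrable h) (hρ : ContDiff ℝ ∞ ρ) (hc : HasCompactSupport ρ)
    (i : Fin 3) : pd i (conv h ρ) = conv h (pd i ρ) := by
  funext v
  have h1 := hc.hasFDerivAt_convolution_right (ContinuousLinearMap.lsmul ℝ ℝ) hh
    (hρ.of_le (by exact_mod_cast le_top)) v
  rw [pd, conv_eq_convolution, h1.fderiv, convolution_precompR_apply _ hh (hc.fderiv ℝ)
    (hρ.continuous_fderiv (by simp))]
  rfl

lemma multiPd_conv (hh : LocallyIntegrable h) (hρ : ContDiff ℝ ∞ ρ) (hc : HasCompactSupport ρ)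
    (α : Fin 3 → ℕ) : multiPd α (conv h ρ) = conv h (multiPd α ρ) := by
  have key : ∀ (i : Fin 3) (m : ℕ) (σ : V → ℝ), ContDiff ℝ ∞ σ → HasCompactSupport σ →
      (pd i)^[m] (conv h σ) = conv h ((pd i)^[m] σ) := by
    intro i m
    induction m with
    | zero => intros; rfl
    | succ m ih =>
      intro σ h1 h2
      rw [Function.iterate_succ_apply, pd_conv hh h1 h2, ih _ (contDiff_pd h1 i)
        (hasCompactSupport_pd h2 i), Function.iterate_succ_apply]
  have c2 := contDiff_iterate_pd hρ 2 (α 2)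
  have s2 := hasCompactSupport_iterate_pd hc 2 (α 2)
  rw [multiPd, key _ _ _ hρ hc, key _ _ _ c2 s2,
    key _ _ _ (contDiff_iterate_pd c2 1 _) (hasCompactSupport_iterate_pd s2 1 _)]
  rfl

lemma integrable_mul_of_hasCompactSupport (hh : LocallyIntegrable h) (hρ : Continuous ρ)
    (hc : HasCompactSupport ρ) : Integrable fun w => h w * ρ w := by
  have := hh.integrable_smul_right_of_hasCompactSupport hρ hc
  simpa [smul_eq_mul] using this

lemma hasCompactSupport_comp_sub_left (hc : HasCompactSupport ρ) (v : V) :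
    HasCompactSupport fun w => ρ (v - w) :=
  hc.comp_homeomorph (Homeomorph.subLeft v)

lemma integrable_conv (hh : LocallyIntegrable h) (hρ : Continuous ρ) (hc : HasCompactSupport ρ)
    (v : V) : Integrable fun w => h w * ρ (v - w) :=
  integrable_mul_of_hasCompactSupport hh (by fun_prop) (hasCompactSupport_comp_sub_left hc v)

lemma locallyIntegrable_smooth_mul {a : V → ℝ} (ha : Continuous a) (hh : LocallyIntegrable h) :
    LocallyIntegrable fun w => a w * h w := by
  have := hh.smul_continuous ha
  simpa [smul_eq_mul, mul_comm] using this

lemma pd_comp_sub_left (hρ : ContDiff ℝ 1 ρ) (i : Fin 3) (v w : V) :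
    pd i (fun w => ρ (v - w)) w = -pd i ρ (v - w) := by
  have h1 : HasFDerivAt (fun x : V => v - x) (-ContinuousLinearMap.id ℝ V) w :=
    (hasFDerivAt_id w).const_sub v
  have h2 := (hρ.differentiable one_ne_zero (v - w)).hasFDerivAt.comp w h1
  have h3 : HasFDerivAt (fun w => ρ (v - w)) (-fderiv ℝ ρ (v - w)) w := by
    refine h2.congr_fderiv ?_
    ext; simp
  rw [pd, h3.fderiv]
  simp [pd]

lemma pd_neg (u : V → ℝ) (i : Fin 3) (v : V) : pd i (fun w => -u w) v = -pd i u v := by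
  rw [pd, fderiv_fun_neg]; rfl

lemma multiPd_comp_sub_left (hρ : ContDiff ℝ ∞ ρ) (α : Fin 3 → ℕ) (v : V) :
    multiPd α (fun w => ρ (v - w)) = fun w => (-1) ^ len α * multiPd α ρ (v - w) := by
  have hF : IsDerivFamily fun n w => (-1) ^ len n * multiPd n ρ (v - w) := by
    intro n w
    have h1 : HasFDerivAt (fun x : V => v - x) (-ContinuousLinearMap.id ℝ V) w :=
      (hasFDerivAt_id w).const_sub v
    have h2 := ((isDerivFamily_multiPd hρ n (v - w)).comp w h1).const_mul ((-1 : ℝ) ^ len n)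
    refine h2.congr_fderiv ?_
    rw [ContinuousLinearMap.comp_neg, ContinuousLinearMap.comp_id, ← Finset.sum_neg_distrib,
      Finset.smul_sum]
    refine Finset.sum_congr rfl fun l _ => ?_
    simp only [← neg_smul, smul_smul]
    rw [len_add, len_unitIdx, pow_succ]
    congr 1; ring
  have := hF.multiPd_eq 0 α
  simpa [multiPd_zero, len] using this

/-! ### Mollifiers -/

/-- A fixed bump function at the origin. -/
def bump0 : ContDiffBump (0 : V) := ⟨1 / 2, 1, by norm_num, by norm_num⟩

/-- A mollifier supported in the unit ball. -/
def moll0 : V → ℝ := bump0.normed volume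

/-- The scaled mollifiers, supported in the ball of radius `1 / (n + 2)`. -/
def moll (n : ℕ) (y : V) : ℝ := ((n : ℝ) + 2) ^ 3 * moll0 (((n : ℝ) + 2) • y)

lemma contDiff_moll0 : ContDiff ℝ ∞ moll0 := bump0.contDiff_normed (n := ⊤)

lemma contDiff_moll (n : ℕ) : ContDiff ℝ ∞ (moll n) :=
  contDiff_const.mul (contDiff_moll0.comp (contDiff_id.const_smul ((n : ℝ) + 2)))

lemma hasCompactSupport_moll (n : ℕ) : HasCompactSupport (moll n) := by
  have h : HasCompactSupport moll0 := bump0.hasCompactSupport_normed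
  have hn : ((n : ℝ) + 2) ≠ 0 := by positivity
  exact (h.comp_smul hn).mul_left

lemma integral_moll (n : ℕ) : ∫ y, moll n y = 1 := by
  simp only [moll]
  rw [integral_const_mul, Measure.integral_comp_smul]
  have h1 : ∫ x, moll0 x = 1 := bump0.integral_normed
  have hn : (0 : ℝ) < (n : ℝ) + 2 := by positivity
  rw [h1]
  simp only [finrank_euclideanSpace, Fintype.card_fin, smul_eq_mul, mul_one]
  rw [abs_of_pos (by positivity)]
  field_simp

lemma moll_eq_zero {n : ℕ} {y : V} (hy : 1 / ((n : ℝ) + 2) ≤ ‖y‖) : moll n y = 0 := by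
  have hn : (0 : ℝ) < (n : ℝ) + 2 := by positivity
  have h1 : ((n : ℝ) + 2) • y ∉ Function.support moll0 := by
    rw [moll0, bump0.support_normed_eq]
    simp only [Metric.mem_ball, dist_zero_right, not_lt, norm_smul, Real.norm_of_nonneg hn.le]
    change 1 ≤ _
    rw [div_le_iff₀ hn] at hy
    linarith
  rw [moll, Function.notMem_support.1 h1, mul_zero]

lemma pd_moll (n : ℕ) (i : Fin 3) (y : V) :
    pd i (moll n) y = ((n : ℝ) + 2) ^ 4 * pd i moll0 (((n : ℝ) + 2) • y) := by
  have h1 : HasFDerivAt (fun x : V => ((n : ℝ) + 2) • x)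
      (((n : ℝ) + 2) • ContinuousLinearMap.id ℝ V) y := (hasFDerivAt_id y).fun_const_smul _
  have h2 := ((contDiff_moll0.differentiable (by simp) (((n : ℝ) + 2) • y)).hasFDerivAt.comp y
    h1).const_mul (((n : ℝ) + 2) ^ 3)
  have h3 : HasFDerivAt (moll n) _ y := h2
  rw [pd, h3.fderiv]
  simp [pd]
  ring

lemma pd_moll_eq_zero {n : ℕ} {y : V} (hy : 1 / ((n : ℝ) + 2) < ‖y‖) (i : Fin 3) :
    pd i (moll n) y = 0 := by
  have : moll n =ᶠ[𝓝 y] fun _ => 0 := by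
    filter_upwards [(isOpen_lt continuous_const continuous_norm).mem_nhds hy] with z hz
    exact moll_eq_zero hz.le
  rw [pd, this.fderiv_eq]; simp

lemma exists_moll_bound : ∃ C : ℝ, 0 < C ∧ ∀ (n : ℕ) (y : V),
    |moll n y| ≤ C * ((n : ℝ) + 2) ^ 3 ∧ ∀ i, |pd i (moll n) y| ≤ C * ((n : ℝ) + 2) ^ 4 := by
  have hs : HasCompactSupport moll0 := bump0.hasCompactSupport_normed
  obtain ⟨C0, h0⟩ := hs.exists_bound_of_continuous contDiff_moll0.continuous
  choose C1 h1 using fun i => (hasCompactSupport_pd hs i).exists_bound_of_continuous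
    (contDiff_pd contDiff_moll0 i).continuous
  have hC0 : 0 ≤ C0 := (norm_nonneg _).trans (h0 0)
  have hC1 : ∀ i, 0 ≤ C1 i := fun i => (norm_nonneg _).trans (h1 i 0)
  refine ⟨C0 + ∑ i, C1 i + 1, by have := Finset.sum_nonneg fun i (_ : i ∈ Finset.univ) => hC1 i
                                 positivity, fun n y => ⟨?_, fun i => ?_⟩⟩
  · have := Finset.sum_nonneg fun i (_ : i ∈ Finset.univ) => hC1 i
    rw [moll, abs_mul, abs_of_pos (by positivity), mul_comm]
    gcongr
    exact (h0 _).trans (by linarith)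
  · have := Finset.single_le_sum (fun i _ => hC1 i) (Finset.mem_univ i)
    rw [pd_moll, abs_mul, abs_of_pos (by positivity), mul_comm]
    gcongr
    exact (h1 i _).trans (by linarith)

/-! ### Convergence of approximate kernels in `L²_loc` -/

/-- The squared `L²` norm on a ball. -/
def ballSq (R : ℝ) (D : V → ℝ) : ℝ≥0∞ := ∫⁻ v in Metric.ball (0 : V) R, ‖D v‖ₑ ^ 2

/-- Local square integrability. -/
def L2Loc (D : V → ℝ) : Prop := AEStronglyMeasurable D ∧ ∀ R, ballSq R D ≠ ⊤

lemma sq_lintegral_le {α : Type*} [MeasurableSpace α] {μ : Measure α} {g : α → ℝ≥0∞}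
    (hg : AEMeasurable g μ) : (∫⁻ a, g a ∂μ) ^ 2 ≤ μ univ * ∫⁻ a, g a ^ 2 ∂μ := by
  have h := ENNReal.lintegral_mul_le_Lp_mul_Lq μ Real.HolderConjugate.two_two
    (f := fun _ => 1) aemeasurable_const hg
  simp only [Pi.mul_apply, one_mul, ENNReal.one_rpow, lintegral_one] at h
  calc _ ≤ (μ univ ^ (1 / 2 : ℝ) * (∫⁻ a, g a ^ (2 : ℝ) ∂μ) ^ (1 / 2 : ℝ)) ^ 2 := by gcongr
    _ = _ := by
      rw [mul_pow, ← ENNReal.rpow_natCast, ← ENNReal.rpow_natCast, ← ENNReal.rpow_mul,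
        ← ENNReal.rpow_mul]
      norm_num

lemma L2Loc.memLp {D : V → ℝ} (hD : L2Loc D) (R : ℝ) :
    MemLp ((Metric.ball (0 : V) R).indicator D) 2 volume := by
  rw [memLp_indicator_iff_restrict Metric.isOpen_ball.measurableSet]
  refine ⟨hD.1.restrict, ?_⟩
  rw [eLpNorm_lt_top_iff_lintegral_rpow_enorm_lt_top (by norm_num) (by norm_num)]
  have := hD.2 R
  simpa [ballSq, lt_top_iff_ne_top] using this

lemma L2Loc.integrableOn_ball {D : V → ℝ} (hD : L2Loc D) (R : ℝ) :
    IntegrableOn D (Metric.ball 0 R) := by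
  have h := (memLp_indicator_iff_restrict Metric.isOpen_ball.measurableSet).1 (hD.memLp R)
  have : IsFiniteMeasure ((volume : Measure V).restrict (Metric.ball 0 R)) :=
    ⟨by simpa using (measure_ball_lt_top (μ := (volume : Measure V)) (x := 0) (r := R))⟩
  exact h.integrable (by norm_num)

lemma L2Loc.locallyIntegrable {D : V → ℝ} (hD : L2Loc D) : LocallyIntegrable D := by
  intro x
  refine ⟨Metric.ball 0 (‖x‖ + 1), Metric.isOpen_ball.mem_nhds (by simp), hD.integrableOn_ball _⟩

/-- The `L²` modulus of continuity on a ball. -/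
def shiftSq (R : ℝ) (D : V → ℝ) (y : V) : ℝ≥0∞ :=
  ∫⁻ v in Metric.ball (0 : V) R, ‖D (v - y) - D v‖ₑ ^ 2

lemma norm_sq_real (a : ℝ) : ‖a‖ ^ 2 = a ^ 2 := by rw [Real.norm_eq_abs, sq_abs]

lemma enorm_sub_sq_le (a b : ℝ) : ‖a - b‖ₑ ^ 2 ≤ 2 * (‖a‖ₑ ^ 2 + ‖b‖ₑ ^ 2) := by
  have h : (a - b) ^ 2 ≤ 2 * (a ^ 2 + b ^ 2) := by nlinarith [sq_nonneg (a + b)]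
  simp only [← ofReal_norm, ← ENNReal.ofReal_pow (norm_nonneg _), norm_sq_real]
  rw [← ENNReal.ofReal_add (by positivity) (by positivity),
    show (2 : ℝ≥0∞) = ENNReal.ofReal 2 by simp, ← ENNReal.ofReal_mul (by norm_num)]
  exact ENNReal.ofReal_le_ofReal h

lemma lintegral_ball_comp_sub_le (D : V → ℝ) {R : ℝ} {y : V} (hy : ‖y‖ < 1) :
    ∫⁻ v in Metric.ball (0 : V) R, ‖D (v - y)‖ₑ ^ 2 ≤ ballSq (R + 1) D := by
  rw [ballSq, ← lintegral_indicator Metric.isOpen_ball.measurableSet,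
    ← lintegral_indicator Metric.isOpen_ball.measurableSet,
    ← lintegral_sub_right_eq_self ((Metric.ball (0 : V) (R + 1)).indicator _) y]
  refine lintegral_mono fun v => ?_
  by_cases hv : v ∈ Metric.ball (0 : V) R
  · have hv2 : v - y ∈ Metric.ball (0 : V) (R + 1) := by
      simp only [Metric.mem_ball, dist_zero_right] at hv ⊢
      exact (norm_sub_le v y).trans_lt (by linarith)
    rw [indicator_of_mem hv, indicator_of_mem hv2]
  · rw [indicator_of_notMem hv]; exact zero_le

lemma shiftSq_le {D : V → ℝ} (hD : AEStronglyMeasurable D) {R : ℝ} {y : V} (hy : ‖y‖ < 1) :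
    shiftSq R D y ≤ 4 * ballSq (R + 1) D := by
  have hm : AEMeasurable (fun v => ‖D v‖ₑ ^ 2) ((volume : Measure V).restrict (Metric.ball 0 R)) :=
    (hD.restrict.enorm).pow_const 2
  calc shiftSq R D y ≤ ∫⁻ v in Metric.ball (0 : V) R, 2 * (‖D (v - y)‖ₑ ^ 2 + ‖D v‖ₑ ^ 2) :=
        lintegral_mono fun v => enorm_sub_sq_le _ _
    _ = 2 * ((∫⁻ v in Metric.ball (0 : V) R, ‖D (v - y)‖ₑ ^ 2) + ballSq R D) := by
        rw [lintegral_const_mul' _ _ (by norm_num), lintegral_add_right' _ hm]; rfl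
    _ ≤ 2 * (ballSq (R + 1) D + ballSq (R + 1) D) := by
        gcongr
        · exact lintegral_ball_comp_sub_le D hy
        · exact lintegral_mono_set (Metric.ball_subset_ball (by linarith))
    _ = _ := by ring

/-- Continuity of translations in `L²`, applied to `D` restricted to a ball of radius `R + 1`;
translations by less than 1 do not notice this truncation on the ball of radius `R`. -/
lemma exists_shiftSq_le {D : V → ℝ} (hD : L2Loc D) (R : ℝ) {ε : ℝ≥0∞} (hε : 0 < ε) :
    ∃ δ : ℝ, 0 < δ ∧ ∀ y : V, ‖y‖ < δ → shiftSq R D y ≤ ε := by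
  set F := (hD.memLp (R + 1)).toLp with hF
  let g : V → C(V, V) := fun y => ⟨fun v => v - y, by fun_prop⟩
  have hg : Continuous g := by
    refine ContinuousMap.continuous_of_continuous_uncurry g ?_
    change Continuous fun p : V × V => p.2 - p.1
    fun_prop
  have hgm : ∀ y, MeasurePreserving (g y) (volume : Measure V) volume :=
    fun y => measurePreserving_sub_right volume y
  have hc : Continuous fun y => Lp.compMeasurePreserving (g y) (hgm y) F :=
    continuous_const.compMeasurePreservingLp hg hgm (by norm_num)
  have hc2 : Continuous fun y => ‖Lp.compMeasurePreserving (g y) (hgm y) F - F‖ₑ ^ 2 :=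
    (ENNReal.continuous_pow 2).comp (hc.sub continuous_const).enorm
  have key : ∀ y, ‖Lp.compMeasurePreserving (g y) (hgm y) F - F‖ₑ ^ 2
      = ∫⁻ v, ‖(Metric.ball (0 : V) (R + 1)).indicator D (v - y)
        - (Metric.ball (0 : V) (R + 1)).indicator D v‖ₑ ^ 2 := by
    intro y
    rw [Lp.enorm_def, eLpNorm_eq_lintegral_rpow_enorm_toReal (by norm_num) (by norm_num),
      ← ENNReal.rpow_natCast, ← ENNReal.rpow_mul]
    simp only [ENNReal.toReal_ofNat, Nat.cast_ofNat, one_div, inv_mul_cancel₀ (two_ne_zero (α := ℝ)),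
      ENNReal.rpow_one, ENNReal.rpow_two]
    refine lintegral_congr_ae ?_
    have h1 := Lp.coeFn_sub (Lp.compMeasurePreserving (g y) (hgm y) F) F
    have h2 := Lp.coeFn_compMeasurePreserving F (hgm y)
    have h3 := (hD.memLp (R + 1)).coeFn_toLp
    have h4 := (hgm y).quasiMeasurePreserving.ae_eq_comp h3
    filter_upwards [h1, h2, h3, h4] with v a1 a2 a3 a4
    rw [a1, Pi.sub_apply, a2, hF, a3]
    rw [Function.comp_apply] at a4 ⊢
    rw [a4]
    rfl
  have h0 : ‖Lp.compMeasurePreserving (g 0) (hgm 0) F - F‖ₑ ^ 2 = 0 := by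
    rw [key]; simp
  have hev := hc2.tendsto 0
  rw [h0] at hev
  obtain ⟨δ, hδ, hball⟩ := Metric.eventually_nhds_iff.1 (hev.eventually (gt_mem_nhds hε))
  refine ⟨min δ 1, lt_min hδ one_pos, fun y hy => ?_⟩
  refine le_trans ?_ (hball (y := y) (by simpa using hy.trans_le (min_le_left _ _))).le
  rw [key, shiftSq, ← lintegral_indicator Metric.isOpen_ball.measurableSet]
  refine lintegral_mono fun v => ?_
  by_cases hv : v ∈ Metric.ball (0 : V) R
  · have hy1 := hy.trans_le (min_le_right _ _)
    have hv2 : v - y ∈ Metric.ball (0 : V) (R + 1) := by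
      simp only [Metric.mem_ball, dist_zero_right] at hv ⊢
      exact (norm_sub_le v y).trans_lt (by linarith)
    have hv3 : v ∈ Metric.ball (0 : V) (R + 1) := Metric.ball_subset_ball (by linarith) hv
    rw [indicator_of_mem hv, indicator_of_mem hv2, indicator_of_mem hv3]
  · rw [indicator_of_notMem hv]; exact zero_le

/-- Operators with kernels concentrated near the diagonal, acting on differences. -/
lemma ballSq_kernel_le {D : V → ℝ} (hD : AEStronglyMeasurable D) {R C : ℝ} (hC : 0 ≤ C) (n : ℕ)
    {κ : V → V → ℝ}
    (hκ : ∀ v ∈ Metric.ball (0 : V) R, ∀ w, |κ v w| ≤ C * ((n : ℝ) + 2) ^ 3)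
    (hκ0 : ∀ v w, 1 / ((n : ℝ) + 2) < ‖v - w‖ → κ v w = 0) {B : ℝ≥0∞}
    (hB : ∀ y : V, ‖y‖ ≤ 1 / ((n : ℝ) + 2) → shiftSq R D y ≤ B) :
    ballSq R (fun v => ∫ w, κ v w * (D w - D v))
      ≤ ENNReal.ofReal C ^ 2 * volume (Metric.closedBall (0 : V) 1) ^ 2 * B := by
  set r : ℝ := 1 / ((n : ℝ) + 2) with hr
  have hn : (0 : ℝ) < (n : ℝ) + 2 := by positivity
  have hr0 : 0 < r := by positivity
  set c : ℝ≥0∞ := ENNReal.ofReal (C * ((n : ℝ) + 2) ^ 3) with hc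
  set S := Metric.closedBall (0 : V) r with hS
  have hSm : MeasurableSet S := Metric.isClosed_closedBall.measurableSet
  have hdiff : AEStronglyMeasurable (fun p : V × V => D (p.1 - p.2) - D p.1)
      ((volume : Measure V).prod volume) :=
    (hD.comp_quasiMeasurePreserving (quasiMeasurePreserving_sub volume volume)).sub
      hD.comp_fst
  have hpt : ∀ v ∈ Metric.ball (0 : V) R, ‖∫ w, κ v w * (D w - D v)‖ₑ ^ 2
      ≤ c ^ 2 * (volume S * ∫⁻ y in S, ‖D (v - y) - D v‖ₑ ^ 2) := by
    intro v hv
    have h1 : ‖∫ w, κ v w * (D w - D v)‖ₑ ≤ c * ∫⁻ y in S, ‖D (v - y) - D v‖ₑ := by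
      calc _ ≤ ∫⁻ w, ‖κ v w * (D w - D v)‖ₑ := enorm_integral_le_lintegral_enorm _
        _ = ∫⁻ y, ‖κ v (v - y) * (D (v - y) - D v)‖ₑ :=
            (lintegral_sub_left_eq_self (fun w => ‖κ v w * (D w - D v)‖ₑ) v).symm
        _ ≤ ∫⁻ y, S.indicator (fun y => c * ‖D (v - y) - D v‖ₑ) y := by
            refine lintegral_mono fun y => ?_
            by_cases hy : y ∈ S
            · rw [indicator_of_mem hy, enorm_mul]
              gcongr
              rw [hc, ← ofReal_norm]
              exact ENNReal.ofReal_le_ofReal (hκ v hv _)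
            · have : κ v (v - y) = 0 := hκ0 v _ (by
                rw [sub_sub_cancel]
                simpa [hS] using hy)
              simp [this]
        _ = _ := by
            rw [lintegral_indicator hSm, lintegral_const_mul' _ _ ENNReal.ofReal_ne_top]
    have hm : AEMeasurable (fun y => ‖D (v - y) - D v‖ₑ) ((volume : Measure V).restrict S) := by
      have : AEStronglyMeasurable (fun y => D (v - y)) volume :=
        hD.comp_measurePreserving (Measure.measurePreserving_sub_left volume v)
      exact (this.sub aestronglyMeasurable_const).restrict.enorm
    calc _ ≤ (c * ∫⁻ y in S, ‖D (v - y) - D v‖ₑ) ^ 2 := by gcongr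
      _ = c ^ 2 * (∫⁻ y in S, ‖D (v - y) - D v‖ₑ) ^ 2 := mul_pow _ _ _
      _ ≤ _ := by
          gcongr
          simpa using sq_lintegral_le hm
  have hvol : volume S = ENNReal.ofReal (r ^ 3) * volume (Metric.closedBall (0 : V) 1) := by
    rw [hS, Measure.addHaar_closedBall' volume 0 hr0.le]
    simp
  -- The size `(n+2)³` of the kernel and the volume of the ball of radius `1/(n+2)` compensate, so
  -- the bound does not depend on `n`.
  have hcv : c * volume S = ENNReal.ofReal C * volume (Metric.closedBall (0 : V) 1) := by
    rw [hvol, ← mul_assoc, hc, ← ENNReal.ofReal_mul (by positivity)]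
    congr 2
    rw [hr]; field_simp
  have hcT : c ^ 2 * volume S ≠ ⊤ :=
    ENNReal.mul_ne_top (ENNReal.pow_ne_top ENNReal.ofReal_ne_top)
      (isCompact_closedBall _ _).measure_lt_top.ne
  calc _ ≤ ∫⁻ v in Metric.ball (0 : V) R,
        (c ^ 2 * volume S) * ∫⁻ y in S, ‖D (v - y) - D v‖ₑ ^ 2 := by
        refine setLIntegral_mono' Metric.isOpen_ball.measurableSet fun v hv => ?_
        rw [mul_assoc]
        exact hpt v hv
    _ = (c ^ 2 * volume S) * ∫⁻ y in S, shiftSq R D y := by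
        rw [lintegral_const_mul' _ _ hcT]
        congr 1
        refine lintegral_lintegral_swap ?_
        rw [Measure.prod_restrict]
        exact (hdiff.restrict.enorm).pow_const 2
    _ ≤ (c ^ 2 * volume S) * ∫⁻ y in S, B := by
        refine mul_le_mul_right (setLIntegral_mono' hSm fun y hy => hB y ?_) _
        simpa [hS] using hy
    _ = (c * volume S) ^ 2 * B := by
        rw [setLIntegral_const]; ring
    _ = _ := by rw [hcv, mul_pow]

lemma volume_closedBall_ne_top (r : ℝ) : volume (Metric.closedBall (0 : V) r) ≠ ⊤ :=
  (isCompact_closedBall _ _).measure_lt_top.ne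

/-- Sequences of operators that converge to zero in `L²_loc`, with a uniform bound. -/
def Negligible (S : ℕ → (V → ℝ) → V → ℝ) : Prop :=
  ∀ R, ∃ C : ℝ≥0∞, C ≠ ⊤ ∧ ∀ D, L2Loc D →
    (∀ n, ballSq R (S n D) ≤ C * ballSq (R + 1) D) ∧
      Tendsto (fun n => ballSq R (S n D)) atTop (𝓝 0)

/-- Such kernels are uniformly bounded on `L²_loc`, and they act on the differences `D w - D v`.
Hence the continuity of translations gives both the uniform bound and the convergence to zero. -/
lemma negligible_kernel {κ : ℕ → V → V → ℝ}
    (hκ : ∀ R, ∃ C, 0 ≤ C ∧ ∀ n, ∀ v ∈ Metric.ball (0 : V) R, ∀ w,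
      |κ n v w| ≤ C * ((n : ℝ) + 2) ^ 3)
    (hκ0 : ∀ (n : ℕ) v w, 1 / ((n : ℝ) + 2) < ‖v - w‖ → κ n v w = 0) :
    Negligible fun n D v => ∫ w, κ n v w * (D w - D v) := by
  intro R
  obtain ⟨C, hC, hb⟩ := hκ R
  set A : ℝ≥0∞ := ENNReal.ofReal C ^ 2 * volume (Metric.closedBall (0 : V) 1) ^ 2 with hA
  have hAT : A ≠ ⊤ := ENNReal.mul_ne_top (ENNReal.pow_ne_top ENNReal.ofReal_ne_top)
    (ENNReal.pow_ne_top (volume_closedBall_ne_top 1))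
  have hlt : ∀ n : ℕ, 1 / ((n : ℝ) + 2) < 1 := fun n => by
    rw [div_lt_one (by positivity)]; have : (0 : ℝ) ≤ n := n.cast_nonneg
    linarith
  refine ⟨A * 4, ENNReal.mul_ne_top hAT (by norm_num), fun D hD => ⟨fun n => ?_, ?_⟩⟩
  · rw [mul_assoc]
    exact ballSq_kernel_le hD.1 hC n (hb n) (hκ0 n)
      fun y hy => shiftSq_le hD.1 (hy.trans_lt (hlt n))
  · rw [ENNReal.tendsto_nhds_zero]
    intro ε hε
    by_cases hA0 : A = 0
    · refine Eventually.of_forall fun n => ?_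
      refine (ballSq_kernel_le hD.1 hC n (hb n) (hκ0 n)
        fun y hy => shiftSq_le hD.1 (hy.trans_lt (hlt n))).trans ?_
      rw [← hA, hA0, zero_mul]; exact zero_le
    · obtain ⟨δ, hδ, hs⟩ := exists_shiftSq_le hD R (ENNReal.div_pos hε.ne' hAT)
      have hlim : Tendsto (fun n : ℕ => 1 / ((n : ℝ) + 2)) atTop (𝓝 0) := by
        exact tendsto_const_nhds.div_atTop
          (tendsto_atTop_add_const_right _ (2 : ℝ) tendsto_natCast_atTop_atTop)
      filter_upwards [hlim.eventually (gt_mem_nhds hδ)] with n hn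
      refine (ballSq_kernel_le hD.1 hC n (hb n) (hκ0 n)
        fun y hy => hs y (hy.trans_lt hn)).trans ?_
      rw [← hA]
      exact ENNReal.mul_div_le

lemma ballSq_add_le {R : ℝ} {D E : V → ℝ} (hD : AEStronglyMeasurable D) :
    ballSq R (fun v => D v + E v) ≤ 2 * (ballSq R D + ballSq R E) := by
  have hm : AEMeasurable (fun v => ‖D v‖ₑ ^ 2) ((volume : Measure V).restrict (Metric.ball 0 R)) :=
    (hD.restrict.enorm).pow_const 2
  calc _ ≤ ∫⁻ v in Metric.ball (0 : V) R, 2 * (‖D v‖ₑ ^ 2 + ‖E v‖ₑ ^ 2) :=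
        lintegral_mono fun v => by simpa using enorm_sub_sq_le (D v) (-E v)
    _ = _ := by
        rw [lintegral_const_mul' _ _ (by norm_num), lintegral_add_left' hm]; rfl

lemma ballSq_mul_le {R C : ℝ} {a D : V → ℝ} (ha : ∀ v ∈ Metric.ball (0 : V) R, |a v| ≤ C) :
    ballSq R (fun v => a v * D v) ≤ ENNReal.ofReal C ^ 2 * ballSq R D := by
  rw [ballSq, ballSq, ← lintegral_const_mul' _ _ (ENNReal.pow_ne_top ENNReal.ofReal_ne_top)]
  refine setLIntegral_mono' Metric.isOpen_ball.measurableSet fun v hv => ?_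
  rw [enorm_mul, mul_pow]
  gcongr
  rw [← ofReal_norm]
  exact ENNReal.ofReal_le_ofReal (ha v hv)

lemma exists_ball_bound {a : V → ℝ} (ha : Continuous a) (R : ℝ) :
    ∃ C, 0 ≤ C ∧ ∀ v ∈ Metric.ball (0 : V) R, |a v| ≤ C := by
  obtain ⟨C, hC⟩ := (isCompact_closedBall (0 : V) R).exists_bound_of_continuousOn ha.continuousOn
  exact ⟨max C 0, le_max_right _ _, fun v hv =>
    (hC v (Metric.ball_subset_closedBall hv)).trans (le_max_left _ _)⟩

lemma L2Loc.mul {a D : V → ℝ} (hD : L2Loc D) (ha : Continuous a) : L2Loc fun v => a v * D v := by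
  refine ⟨ha.aestronglyMeasurable.mul hD.1, fun R => ?_⟩
  obtain ⟨C, -, hC⟩ := exists_ball_bound ha R
  exact ((ballSq_mul_le hC).trans_lt (ENNReal.mul_lt_top
    (ENNReal.pow_lt_top ENNReal.ofReal_lt_top) (hD.2 R).lt_top)).ne

lemma Negligible.add {S T : ℕ → (V → ℝ) → V → ℝ} (hS : Negligible S) (hT : Negligible T)
    (hm : ∀ n D, L2Loc D → AEStronglyMeasurable (S n D)) :
    Negligible fun n D v => S n D v + T n D v := by
  intro R
  obtain ⟨C1, hC1, h1⟩ := hS R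
  obtain ⟨C2, hC2, h2⟩ := hT R
  refine ⟨2 * (C1 + C2), by finiteness, fun D hD => ⟨fun n => ?_, ?_⟩⟩
  · refine (ballSq_add_le (hm n D hD)).trans ?_
    rw [mul_assoc, add_mul]
    gcongr
    exacts [(h1 D hD).1 n, (h2 D hD).1 n]
  · have := ENNReal.Tendsto.const_mul ((h1 D hD).2.add (h2 D hD).2) (a := 2)
      (Or.inr (by norm_num))
    rw [add_zero, mul_zero] at this
    exact tendsto_of_tendsto_of_tendsto_of_le_of_le tendsto_const_nhds this
      (fun _ => zero_le) fun n => ballSq_add_le (hm n D hD)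

lemma Negligible.mul_left {S : ℕ → (V → ℝ) → V → ℝ} (hS : Negligible S) {a : V → ℝ}
    (ha : Continuous a) : Negligible fun n D v => a v * S n D v := by
  intro R
  obtain ⟨C, hC, h1⟩ := hS R
  obtain ⟨A, -, hA⟩ := exists_ball_bound ha R
  refine ⟨ENNReal.ofReal A ^ 2 * C, by finiteness, fun D hD => ⟨fun n => ?_, ?_⟩⟩
  · refine (ballSq_mul_le hA).trans ?_
    rw [mul_assoc]
    gcongr
    exact (h1 D hD).1 n
  · have := ENNReal.Tendsto.const_mul (h1 D hD).2 (a := ENNReal.ofReal A ^ 2)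
      (Or.inr (by finiteness))
    rw [mul_zero] at this
    exact tendsto_of_tendsto_of_tendsto_of_le_of_le tendsto_const_nhds this
      (fun _ => zero_le) fun n => ballSq_mul_le hA

lemma Negligible.congr {S T : ℕ → (V → ℝ) → V → ℝ} (hS : Negligible S)
    (h : ∀ n D, L2Loc D → ∀ v, S n D v = T n D v) : Negligible T := by
  intro R
  obtain ⟨C, hC, h1⟩ := hS R
  refine ⟨C, hC, fun D hD => ?_⟩
  have : ∀ n, S n D = T n D := fun n => funext (h n D hD)
  simpa only [this] using h1 D hD

end

/-! ### Commutators of mollification with multiplication and differentiation -/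

section

lemma hasCompactSupport_moll_sub (n : ℕ) (v : V) : HasCompactSupport fun w => moll n (v - w) :=
  hasCompactSupport_comp_sub_left (hasCompactSupport_moll n) v

lemma integral_moll_sub (n : ℕ) (v : V) : ∫ w, moll n (v - w) = 1 := by
  rw [integral_sub_left_eq_self (fun y => moll n y), integral_moll]

lemma continuous_conv {h : V → ℝ} (hh : L2Loc h) (n : ℕ) : Continuous (conv h (moll n)) :=
  (contDiff_conv hh.locallyIntegrable (contDiff_moll n) (hasCompactSupport_moll n)).continuous

lemma negligible_conv_sub : Negligible fun n D v => conv D (moll n) v - D v := by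
  obtain ⟨C, hC, hb⟩ := exists_moll_bound
  refine (negligible_kernel (κ := fun n v w => moll n (v - w)) (fun R => ⟨C, hC.le, fun n v _ w =>
    (hb n _).1⟩) (fun n v w h => moll_eq_zero h.le)).congr fun n D hD v => ?_
  have h1 := integrable_conv hD.locallyIntegrable (contDiff_moll n).continuous
    (hasCompactSupport_moll n) v
  have h2 : Integrable fun w => moll n (v - w) :=
    ((contDiff_moll n).continuous.comp (by fun_prop)).integrable_of_hasCompactSupport
      (hasCompactSupport_moll_sub n v)
  calc ∫ w, moll n (v - w) * (D w - D v) = ∫ w, (D w * moll n (v - w) - D v * moll n (v - w)) := by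
        congr 1; ext w; ring
    _ = _ := by
        rw [integral_sub h1 (h2.const_mul _), integral_const_mul, integral_moll_sub, mul_one]; rfl

lemma Negligible.comp_mul {S : ℕ → (V → ℝ) → V → ℝ} (hS : Negligible S) {a : V → ℝ}
    (ha : Continuous a) : Negligible fun n D => S n (fun w => a w * D w) := by
  intro R
  obtain ⟨C, hC, h1⟩ := hS R
  obtain ⟨A, -, hA⟩ := exists_ball_bound ha (R + 1)
  refine ⟨C * ENNReal.ofReal A ^ 2, by finiteness, fun D hD => ⟨fun n => ?_,
    (h1 _ (hD.mul ha)).2⟩⟩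
  refine ((h1 _ (hD.mul ha)).1 n).trans ?_
  rw [mul_assoc]
  gcongr
  exact ballSq_mul_le hA

/-- Multiplication by a smooth function almost commutes with mollification. -/
lemma negligible_comm {a : V → ℝ} (ha : Continuous a) :
    Negligible fun n D v => conv (fun w => a w * D w) (moll n) v - a v * conv D (moll n) v := by
  have hm : ∀ n D, L2Loc D → AEStronglyMeasurable (fun v => conv D (moll n) v - D v) :=
    fun n D hD => (continuous_conv hD n).aestronglyMeasurable.sub hD.1
  refine ((negligible_conv_sub.comp_mul ha).add (negligible_conv_sub.mul_left ha.neg)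
    fun n D hD => hm n _ (hD.mul ha)).congr fun n D hD v => ?_
  simp only [Pi.neg_apply]
  ring

lemma exists_lipschitz_ball {a : V → ℝ} (ha : ContDiff ℝ ∞ a) (R : ℝ) : ∃ L, 0 ≤ L ∧
    ∀ v ∈ Metric.ball (0 : V) R, ∀ w ∈ Metric.ball (0 : V) R, |a w - a v| ≤ L * ‖w - v‖ := by
  have hc : Continuous (fderiv ℝ a) := ha.continuous_fderiv (by simp)
  obtain ⟨L, hL⟩ := (isCompact_closedBall (0 : V) R).exists_bound_of_continuousOn hc.continuousOn
  refine ⟨max L 0, le_max_right _ _, fun v hv w hw => ?_⟩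
  exact (convex_ball (0 : V) R).norm_image_sub_le_of_norm_fderiv_le
    (fun x _ => ha.differentiable (by simp) x)
    (fun x hx => (hL x (Metric.ball_subset_closedBall hx)).trans (le_max_left _ _)) hv hw

/-- The Friedrichs commutator of `∂_i (a ·)` with mollification. -/
def friedrichs (a : V → ℝ) (i : Fin 3) (n : ℕ) (D : V → ℝ) (v : V) : ℝ :=
  pd i (conv (fun w => a w * D w) (moll n)) v - conv (fun w => pd i a w * D w) (moll n) v
    - a v * pd i (conv D (moll n)) v

lemma continuous_friedrichs {a D : V → ℝ} (ha : ContDiff ℝ ∞ a) (hD : L2Loc D) (i : Fin 3)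
    (n : ℕ) : Continuous (friedrichs a i n D) := by
  have h1 : ∀ h : V → ℝ, L2Loc h → Continuous (pd i (conv h (moll n))) := fun h hh =>
    (contDiff_pd (contDiff_conv hh.locallyIntegrable (contDiff_moll n)
      (hasCompactSupport_moll n)) i).continuous
  exact ((h1 _ (hD.mul ha.continuous)).sub
    (continuous_conv (hD.mul (contDiff_pd ha i).continuous) n)).sub (ha.continuous.mul (h1 _ hD))

/-- The commutator has kernel `(a w - a v) ∂_i ρ_n(v - w) - ∂_i a(w) ρ_n(v - w)`. The Lipschitz
bound on `a` gains the factor `1/(n+2)` that differentiating `ρ_n` loses, so the kernel has the size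
required by `negligible_kernel`. -/
lemma negligible_friedrichs {a : V → ℝ} (ha : ContDiff ℝ ∞ a) (i : Fin 3) :
    Negligible (friedrichs a i) := by
  obtain ⟨C, hC, hb⟩ := exists_moll_bound
  have hpa := contDiff_pd ha i
  refine (negligible_kernel (κ := fun n v w => (a w - a v) * pd i (moll n) (v - w)
    - pd i a w * moll n (v - w)) (fun R => ?_) (fun n v w h => ?_)).congr fun n D hD v => ?_
  · obtain ⟨L, hL0, hL⟩ := exists_lipschitz_ball ha (R + 1)
    obtain ⟨A, hA0, hA⟩ := exists_ball_bound hpa.continuous (R + 1)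
    refine ⟨(L + A) * C, by positivity, fun n v hv w => ?_⟩
    have hn : (0 : ℝ) < (n : ℝ) + 2 := by positivity
    rcases lt_or_ge (1 / ((n : ℝ) + 2)) ‖v - w‖ with h | h
    · rw [pd_moll_eq_zero h, moll_eq_zero h.le]
      simp only [mul_zero, sub_zero, abs_zero]; positivity
    · have hlt : 1 / ((n : ℝ) + 2) < 1 := by
        rw [div_lt_one hn]; have : (0 : ℝ) ≤ n := n.cast_nonneg
        linarith
      have hvR : v ∈ Metric.ball (0 : V) (R + 1) := Metric.ball_subset_ball (by linarith) hv
      have hwR : w ∈ Metric.ball (0 : V) (R + 1) := by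
        simp only [Metric.mem_ball, dist_zero_right] at hv ⊢
        have := norm_sub_le v (v - w)
        rw [sub_sub_cancel] at this
        linarith
      have e1 : |(a w - a v) * pd i (moll n) (v - w)|
          ≤ (L * (1 / ((n : ℝ) + 2))) * (C * ((n : ℝ) + 2) ^ 4) := by
        rw [abs_mul]
        have := (hL v hvR w hwR).trans (mul_le_mul_of_nonneg_left
          (norm_sub_rev v w ▸ h) hL0)
        exact mul_le_mul this ((hb n _).2 i) (abs_nonneg _) (by positivity)
      have e2 : |pd i a w * moll n (v - w)| ≤ A * (C * ((n : ℝ) + 2) ^ 3) := by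
        rw [abs_mul]
        exact mul_le_mul (hA w hwR) (hb n _).1 (abs_nonneg _) hA0
      calc _ ≤ _ := abs_sub _ _
        _ ≤ _ := add_le_add e1 e2
        _ = _ := by field_simp
  · simp only [pd_moll_eq_zero h, moll_eq_zero h.le, mul_zero, sub_zero]
  · have hρ := contDiff_moll n
    have hs := hasCompactSupport_moll n
    have hDl := hD.locallyIntegrable
    have haD := (hD.mul ha.continuous).locallyIntegrable
    have hpD := (hD.mul hpa.continuous).locallyIntegrable
    have hp := contDiff_pd hρ i
    have hps := hasCompactSupport_pd hs i
    have i1 := integrable_conv haD hp.continuous hps v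
    have i2 := integrable_conv hpD hρ.continuous hs v
    have i3 := (integrable_conv hDl hp.continuous hps v).const_mul (a v)
    -- The kernel has zero integral in `w`, by integration by parts. This permits replacing `D w` by
    -- `D w - D v`.
    have hz : ∫ w, ((a w - a v) * pd i (moll n) (v - w) - pd i a w * moll n (v - w)) = 0 := by
      have j1 : Integrable fun w => (a w - a v) * pd i (moll n) (v - w) :=
        ((ha.continuous.sub continuous_const).mul
          (hp.continuous.comp (by fun_prop))).integrable_of_hasCompactSupport
          (hasCompactSupport_comp_sub_left hps v).mul_left
      have j2 : Integrable fun w => pd i a w * moll n (v - w) :=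
        (hpa.continuous.mul (hρ.continuous.comp (by fun_prop))).integrable_of_hasCompactSupport
          (hasCompactSupport_comp_sub_left hs v).mul_left
      have h := integral_mul_pd (u := fun w => a w - a v) (φ := fun w => moll n (v - w))
        ((ha.of_le (by exact_mod_cast le_top)).sub contDiff_const)
        ((hρ.of_le (by exact_mod_cast le_top)).comp (by fun_prop))
        (hasCompactSupport_comp_sub_left hs v) i
      have e1 : ∀ w, pd i (fun w => moll n (v - w)) w = -pd i (moll n) (v - w) := fun w =>
        pd_comp_sub_left (hρ.of_le (by exact_mod_cast le_top)) i v w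
      have e2 : ∀ w, pd i (fun w => a w - a v) w = pd i a w := fun w => by
        rw [pd, fderiv_sub_const]; rfl
      simp only [e1, e2, mul_neg, integral_neg, neg_inj] at h
      rw [integral_sub j1 j2, h, sub_self]
    rw [friedrichs, pd_conv haD hρ hs, pd_conv hDl hρ hs]
    have i4 : Integrable fun w => ((a w - a v) * pd i (moll n) (v - w)
        - pd i a w * moll n (v - w)) * D w := by
      refine ((i1.sub i2).sub i3).congr (Eventually.of_forall fun w => ?_)
      simp only [Pi.sub_apply]; ring
    have i5 : Integrable fun w => ((a w - a v) * pd i (moll n) (v - w)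
        - pd i a w * moll n (v - w)) * D v := by
      refine Integrable.mul_const ?_ _
      exact (((ha.continuous.sub continuous_const).mul (hp.continuous.comp
        (by fun_prop))).integrable_of_hasCompactSupport
          (hasCompactSupport_comp_sub_left hps v).mul_left).sub
        ((hpa.continuous.mul (hρ.continuous.comp (by fun_prop))).integrable_of_hasCompactSupport
          (hasCompactSupport_comp_sub_left hs v).mul_left)
    simp only [mul_sub (_ - _)]
    rw [integral_sub i4 i5, integral_mul_const, hz, zero_mul, sub_zero]
    simp only [conv]
    rw [← integral_sub i1 i2, ← integral_const_mul]
    refine Eq.trans ?_ (integral_sub (i1.sub i2) i3)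
    refine integral_congr_ae (Eventually.of_forall fun w => ?_)
    simp only [Pi.sub_apply]
    ring

end

section

/-! ### Weak derivatives -/

lemma multiPd_add {u w : V → ℝ} (hu : ContDiff ℝ ∞ u) (hw : ContDiff ℝ ∞ w) (α : Fin 3 → ℕ) :
    multiPd α (fun v => u v + w v) = fun v => multiPd α u v + multiPd α w v := by
  have hF : IsDerivFamily fun n v => multiPd n u v + multiPd n w v := fun n v => by
    have := (isDerivFamily_multiPd hu n v).add (isDerivFamily_multiPd hw n v)
    simpa only [← Finset.sum_add_distrib, ← add_smul] using! this
  have := hF.multiPd_eq 0 α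
  simpa [multiPd_zero] using this

lemma multiPd_const_mul {u : V → ℝ} (c : ℝ) (hu : ContDiff ℝ ∞ u) (α : Fin 3 → ℕ) :
    multiPd α (fun v => c * u v) = fun v => c * multiPd α u v := by
  have hF : IsDerivFamily fun n v => c * multiPd n u v := fun n v => by
    have := (isDerivFamily_multiPd hu n v).const_mul c
    simpa only [Finset.smul_sum, smul_smul] using! this
  have := hF.multiPd_eq 0 α
  simpa [multiPd_zero] using this

lemma pd_eq_multiPd {u : V → ℝ} (h : ContDiff ℝ ∞ u) (l : Fin 3) :
    pd l u = multiPd (unitIdx l) u := by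
  have := pd_multiPd h 0 l
  rwa [multiPd_zero, zero_add] at this

lemma multiIdx_induction {P : (Fin 3 → ℕ) → Prop} (h0 : P 0)
    (h1 : ∀ α l, P α → P (α + unitIdx l)) (α : Fin 3 → ℕ) : P α := by
  have key : ∀ (l : Fin 3) (m : ℕ) (β : Fin 3 → ℕ), P β → P (β + Pi.single l m) := by
    intro l m β hβ
    induction m with
    | zero => simpa using hβ
    | succ m ih =>
      have := h1 _ l ih
      rwa [add_assoc, unitIdx, ← Pi.single_add] at this
  have := key 2 (α 2) _ (key 1 (α 1) _ (key 0 (α 0) _ h0))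
  convert this using 1
  ext i; fin_cases i <;> simp

namespace HasWeakDeriv

variable {α β : Fin 3 → ℕ} {u D E : V → ℝ}

lemma congr (hD : HasWeakDeriv α u D) (h : D =ᵐ[volume] E) : HasWeakDeriv α u E := by
  refine ⟨hD.locallyIntegrable.congr h, fun φ h1 h2 => ?_⟩
  rw [hD.integral_eq φ h1 h2]
  congr 1
  refine integral_congr_ae ?_
  filter_upwards [h] with v hv
  rw [hv]

lemma trans (hD : HasWeakDeriv α u D) (hE : HasWeakDeriv β D E) : HasWeakDeriv (α + β) u E := by
  refine ⟨hE.locallyIntegrable, fun φ h1 h2 => ?_⟩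
  have := hD.integral_eq (multiPd β φ) (contDiff_multiPd h1 β) (hasCompactSupport_multiPd h2 β)
  rw [multiPd_multiPd h1, hE.integral_eq φ h1 h2, add_comm β] at this
  rw [this, len_add, pow_add, mul_assoc]

lemma of_add (hD : HasWeakDeriv α u D) (hE : HasWeakDeriv (α + β) u E) : HasWeakDeriv β D E := by
  refine ⟨hE.locallyIntegrable, fun φ h1 h2 => ?_⟩
  have := hD.integral_eq (multiPd β φ) (contDiff_multiPd h1 β) (hasCompactSupport_multiPd h2 β)
  rw [multiPd_multiPd h1, add_comm β, hE.integral_eq φ h1 h2, len_add, pow_add, mul_assoc] at this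
  exact (mul_left_cancel₀ (pow_ne_zero _ (by norm_num)) this).symm

lemma zero (hu : LocallyIntegrable u) : HasWeakDeriv 0 u u :=
  ⟨hu, fun φ _ _ => by simp [multiPd_zero, len]⟩

lemma conv_multiPd {ρ : V → ℝ} (hD : HasWeakDeriv α u D) (hρ : ContDiff ℝ ∞ ρ)
    (hc : HasCompactSupport ρ) : conv u (multiPd α ρ) = conv D ρ := by
  funext v
  have h := hD.integral_eq (fun w => ρ (v - w)) (hρ.comp (by fun_prop))
    (hasCompactSupport_comp_sub_left hc v)
  rw [multiPd_comp_sub_left hρ] at h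
  simp only [mul_left_comm (u _)] at h
  rw [integral_const_mul] at h
  exact mul_left_cancel₀ (pow_ne_zero _ (by norm_num)) h

lemma multiPd_conv_eq {ρ : V → ℝ} (hD : HasWeakDeriv α u D) (hu : LocallyIntegrable u)
    (hρ : ContDiff ℝ ∞ ρ) (hc : HasCompactSupport ρ) : multiPd α (conv u ρ) = conv D ρ := by
  rw [multiPd_conv hu hρ hc, hD.conv_multiPd hρ hc]

lemma of_smooth (hu : ContDiff ℝ ∞ u) : HasWeakDeriv α u (multiPd α u) := by
  induction α using multiIdx_induction with
  | h0 => exact zero hu.continuous.locallyIntegrable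
  | h1 α l ih =>
    refine ih.trans ⟨(contDiff_multiPd hu _).continuous.locallyIntegrable, fun φ h1 h2 => ?_⟩
    rw [← pd_eq_multiPd h1, integral_mul_pd ((contDiff_multiPd hu α).of_le
      (by exact_mod_cast le_top)) (h1.of_le (by exact_mod_cast le_top)) h2, pd_multiPd hu,
      len_unitIdx]
    ring

end HasWeakDeriv

/-! ### Existence of weak derivatives from bounds by duality -/

lemma sq_lintegral_mul_le {X : Type*} [MeasurableSpace X] {μ : Measure X} {f g : X → ℝ≥0∞}
    (hf : AEMeasurable f μ) (hg : AEMeasurable g μ) :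
    (∫⁻ a, f a * g a ∂μ) ^ 2 ≤ (∫⁻ a, f a ^ 2 ∂μ) * ∫⁻ a, g a ^ 2 ∂μ := by
  have h := ENNReal.lintegral_mul_le_Lp_mul_Lq μ Real.HolderConjugate.two_two hf hg
  calc _ ≤ ((∫⁻ a, f a ^ (2 : ℝ) ∂μ) ^ (1 / 2 : ℝ) * (∫⁻ a, g a ^ (2 : ℝ) ∂μ) ^ (1 / 2 : ℝ)) ^ 2 := by
        gcongr; exact h
    _ = _ := by
      rw [mul_pow, ← ENNReal.rpow_natCast, ← ENNReal.rpow_natCast, ← ENNReal.rpow_mul,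
        ← ENNReal.rpow_mul]
      norm_num

lemma contDiff_bracket_rpow (s : ℝ) : ContDiff ℝ ∞ fun v => bracket v ^ s := by
  simp only [bracket_rpow]
  exact (contDiff_const.add (contDiff_norm_sq ℝ)).rpow_const_of_ne
    fun v => (one_add_norm_sq_pos v).ne'

/-- The space of test functions. -/
def testSpace : Submodule ℝ (V → ℝ) where
  carrier := {φ | ContDiff ℝ ∞ φ ∧ HasCompactSupport φ}
  add_mem' h1 h2 := ⟨h1.1.add h2.1, h1.2.add h2.2⟩
  zero_mem' := ⟨contDiff_const, HasCompactSupport.zero⟩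
  smul_mem' c φ h := ⟨h.1.const_smul c, h.2.smul_left (f := fun _ => c)⟩

lemma memLp_weight_test (s : ℝ) (φ : testSpace) :
    MemLp (fun v => bracket v ^ s * φ.1 v) 2 volume :=
  ((contDiff_bracket_rpow s).continuous.mul φ.2.1.continuous).memLp_of_hasCompactSupport
    φ.2.2.mul_left

/-- The weighted embedding of test functions in `L²`. -/
def weightEmb (s : ℝ) : testSpace →ₗ[ℝ] L2V where
  toFun φ := (memLp_weight_test s φ).toLp
  map_add' φ ψ := by
    rw [← MemLp.toLp_add]
    refine MemLp.toLp_congr _ _ (Eventually.of_forall fun v => ?_)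
    simp [mul_add]
  map_smul' c φ := by
    rw [RingHom.id_apply, ← MemLp.toLp_const_smul]
    refine MemLp.toLp_congr _ _ (Eventually.of_forall fun v => ?_)
    simp [mul_left_comm]

lemma denseRange_weightEmb (s : ℝ) : DenseRange (weightEmb s) := by
  refine (Lp.dense_hasCompactSupport_contDiff (μ := (volume : Measure V)) (F := ℝ) (p := 2)
    (by norm_num)).mono ?_
  rintro f ⟨g, hfg, hg1, hg2⟩
  set φ : testSpace :=
    ⟨fun v => bracket v ^ (-s) * g v, (contDiff_bracket_rpow _).mul hg2, hg1.mul_left⟩ with hφ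
  refine ⟨φ, ?_⟩
  refine Lp.ext ((memLp_weight_test s φ).coeFn_toLp.trans (EventuallyEq.trans ?_ hfg.symm))
  refine Eventually.of_forall fun v => ?_
  simp only
  rw [← mul_assoc, ← Real.rpow_add (bracket_pos v), add_neg_cancel, Real.rpow_zero, one_mul]

lemma integral_sq_eq_norm_sq (F : L2V) : ∫ v, F v ^ 2 = ‖F‖ ^ 2 := by
  rw [← real_inner_self_eq_norm_sq, L2.inner_def]
  congr 1; ext v; simp [sq]

lemma lintegral_sq_eq_norm_sq (F : L2V) : ∫⁻ v, ENNReal.ofReal (F v ^ 2) = ENNReal.ofReal (‖F‖ ^ 2) := by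
  rw [← integral_sq_eq_norm_sq, ofReal_integral_eq_lintegral_ofReal]
  · exact (Lp.memLp F).integrable_sq
  · exact Eventually.of_forall fun v => sq_nonneg _

lemma norm_weightEmb_sq (s : ℝ) (φ : testSpace) :
    ‖weightEmb s φ‖ ^ 2 = ∫ v, (bracket v ^ s * φ.1 v) ^ 2 := by
  rw [← integral_sq_eq_norm_sq]
  refine integral_congr_ae ?_
  filter_upwards [(memLp_weight_test s φ).coeFn_toLp] with v hv
  change ((memLp_weight_test s φ).toLp) v ^ 2 = _
  rw [hv]

/-- The pairing of a locally integrable function with a derivative of a test function. -/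
def pairing {u : V → ℝ} (hu : LocallyIntegrable u) (α : Fin 3 → ℕ) : testSpace →ₗ[ℝ] ℝ where
  toFun φ := ∫ v, u v * multiPd α φ.1 v
  map_add' φ ψ := by
    have h : ∀ χ : testSpace, Integrable fun v => u v * multiPd α χ.1 v := fun χ =>
      integrable_mul_of_hasCompactSupport hu (contDiff_multiPd χ.2.1 α).continuous
        (hasCompactSupport_multiPd χ.2.2 α)
    rw [← integral_add (h φ) (h ψ)]
    have := multiPd_add φ.2.1 ψ.2.1 α
    congr 1; ext v
    rw [show (φ + ψ).1 = fun v => φ.1 v + ψ.1 v from rfl, this]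
    ring
  map_smul' c φ := by
    rw [RingHom.id_apply, smul_eq_mul, ← integral_const_mul]
    have := multiPd_const_mul c φ.2.1 α
    congr 1; ext v
    rw [show (c • φ).1 = fun v => c * φ.1 v from rfl, this]
    ring

/-- The hypothesis says that the pairing is a bounded functional of `⟨v⟩^{-θ} φ`. Such functions are
dense in `L²`, so Riesz representation gives `F` in `L²`, and the derivative is `(-1)^{|α|} ⟨v⟩^{-θ}
F`. -/
lemma exists_hasWeakDeriv_of_pairing_le {u : V → ℝ} (hu : LocallyIntegrable u) (α : Fin 3 → ℕ)
    (θ : ℝ) {B : ℝ} (hB : 0 ≤ B)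
    (h : ∀ φ, ContDiff ℝ ∞ φ → HasCompactSupport φ →
      (∫ v, u v * multiPd α φ v) ^ 2 ≤ B * ∫ v, (bracket v ^ (-θ) * φ v) ^ 2) :
    ∃ D, HasWeakDeriv α u D ∧ sqNormTwo θ D ≤ ENNReal.ofReal B := by
  have hn : ∀ φ : testSpace, ‖pairing hu α φ‖ ≤ √B * ‖weightEmb (-θ) φ‖ := by
    intro φ
    refine abs_le_of_sq_le_sq ?_ (by positivity)
    rw [mul_pow, Real.sq_sqrt hB, norm_weightEmb_sq]
    exact h φ.1 φ.2.1 φ.2.2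
  have hd := denseRange_weightEmb (-θ)
  set Λ := (pairing hu α).extendOfNorm (weightEmb (-θ)) with hΛ
  have hΛn : ‖Λ‖ ≤ √B := LinearMap.opNorm_extendOfNorm_le hd (Real.sqrt_nonneg B) hn
  set F : L2V := (InnerProductSpace.toDual ℝ L2V).symm Λ with hF
  have hFn : ‖F‖ ≤ √B := by rwa [hF, LinearIsometryEquiv.norm_map]
  have hpair : ∀ φ : testSpace, ∫ v, u v * multiPd α φ.1 v
      = ∫ v, F v * (bracket v ^ (-θ) * φ.1 v) := by
    intro φ
    have h1 : Λ (weightEmb (-θ) φ) = pairing hu α φ :=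
      LinearMap.extendOfNorm_eq hd ⟨_, hn⟩ φ
    have h2 : inner ℝ F (weightEmb (-θ) φ) = Λ (weightEmb (-θ) φ) := by
      rw [hF, InnerProductSpace.toDual_symm_apply]
    rw [h1, L2.inner_def] at h2
    change pairing hu α φ = _
    rw [← h2]
    refine integral_congr_ae ?_
    filter_upwards [(memLp_weight_test (-θ) φ).coeFn_toLp] with v hv
    change inner ℝ (F v) (((memLp_weight_test (-θ) φ).toLp) v) = _
    rw [hv]
    simp [mul_comm]
  have hFl : LocallyIntegrable F := (Lp.memLp F).locallyIntegrable (by norm_num)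
  refine ⟨fun v => ((-1) ^ len α * bracket v ^ (-θ)) * F v, ⟨?_, fun φ h1 h2 => ?_⟩, ?_⟩
  · exact locallyIntegrable_smooth_mul
      (continuous_const.mul (contDiff_bracket_rpow _).continuous) hFl
  · rw [hpair ⟨φ, h1, h2⟩, ← integral_const_mul]
    have : ((-1 : ℝ) ^ len α) * (-1) ^ len α = 1 := by
      rw [← mul_pow]; norm_num
    congr 1; ext v
    simp only
    linear_combination (-(bracket v ^ (-θ)) * F v * φ v) * this
  · have e : ∀ v, (bracket v ^ θ * (((-1) ^ len α * bracket v ^ (-θ)) * F v)) ^ 2 = F v ^ 2 := by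
      intro v
      have h1 : bracket v ^ θ * bracket v ^ (-θ) = 1 := by
        rw [← Real.rpow_add (bracket_pos v), add_neg_cancel, Real.rpow_zero]
      have h2 : ((-1 : ℝ) ^ len α) ^ 2 = 1 := by rw [← pow_mul, mul_comm, pow_mul]; norm_num
      calc _ = ((-1 : ℝ) ^ len α) ^ 2 * (bracket v ^ θ * bracket v ^ (-θ)) ^ 2 * F v ^ 2 := by ring
        _ = _ := by rw [h1, h2]; ring
    rw [sqNormTwo]
    simp only [e]
    rw [lintegral_sq_eq_norm_sq]
    refine ENNReal.ofReal_le_ofReal ?_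
    calc ‖F‖ ^ 2 ≤ √B ^ 2 := by gcongr
      _ = B := Real.sq_sqrt hB

lemma sq_integral_mul_le {h ψ : V → ℝ} (hh : AEStronglyMeasurable h) {R : ℝ}
    (hψ : Continuous ψ) (hs : ∀ v, v ∉ Metric.ball (0 : V) R → ψ v = 0) :
    ‖∫ v, h v * ψ v‖ₑ ^ 2 ≤ ballSq R h * ∫⁻ v, ‖ψ v‖ₑ ^ 2 := by
  have h1 : ‖∫ v, h v * ψ v‖ₑ ≤ ∫⁻ v in Metric.ball (0 : V) R, ‖h v‖ₑ * ‖ψ v‖ₑ := by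
    refine (enorm_integral_le_lintegral_enorm _).trans ?_
    rw [← lintegral_indicator Metric.isOpen_ball.measurableSet]
    refine lintegral_mono fun v => ?_
    by_cases hv : v ∈ Metric.ball (0 : V) R
    · rw [indicator_of_mem hv, enorm_mul]
    · simp [hs v hv]
  calc _ ≤ (∫⁻ v in Metric.ball (0 : V) R, ‖h v‖ₑ * ‖ψ v‖ₑ) ^ 2 := by gcongr
    _ ≤ _ := sq_lintegral_mul_le hh.restrict.enorm hψ.aestronglyMeasurable.restrict.enorm
    _ ≤ _ := mul_le_mul' le_rfl (lintegral_mono' Measure.restrict_le_self le_rfl)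

lemma exists_ball_support {ψ : V → ℝ} (hc : HasCompactSupport ψ) :
    ∃ R, 0 < R ∧ ∀ v, v ∉ Metric.ball (0 : V) R → ψ v = 0 := by
  obtain ⟨R, hR⟩ := hc.isCompact.isBounded.subset_ball (0 : V)
  refine ⟨max R 1, by positivity, fun v hv => ?_⟩
  by_contra h
  exact hv (Metric.ball_subset_ball (le_max_left _ _) (hR (subset_tsupport _ h)))

lemma tendsto_integral_conv_mul {u ψ : V → ℝ} (hu : L2Loc u) (hψ : Continuous ψ)
    (hc : HasCompactSupport ψ) :
    Tendsto (fun n => ∫ v, conv u (moll n) v * ψ v) atTop (𝓝 (∫ v, u v * ψ v)) := by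
  obtain ⟨R, -, hR⟩ := exists_ball_support hc
  obtain ⟨C, -, h⟩ := negligible_conv_sub R
  have hlim := (h u hu).2
  have hfin : ∫⁻ v, ‖ψ v‖ₑ ^ 2 ≠ ⊤ := by
    have := (hψ.memLp_of_hasCompactSupport (p := 2) (μ := volume) hc).2
    rw [eLpNorm_lt_top_iff_lintegral_rpow_enorm_lt_top (by norm_num) (by norm_num)] at this
    simpa using this.ne
  rw [tendsto_iff_edist_tendsto_0]
  have h2 : Tendsto (fun n => ballSq R (fun v => conv u (moll n) v - u v) * ∫⁻ v, ‖ψ v‖ₑ ^ 2)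
      atTop (𝓝 0) := by
    have := ENNReal.Tendsto.mul_const hlim (b := ∫⁻ v, ‖ψ v‖ₑ ^ 2) (Or.inr hfin)
    rwa [zero_mul] at this
  have h3 : Tendsto (fun n => edist (∫ v, conv u (moll n) v * ψ v) (∫ v, u v * ψ v) ^ 2)
      atTop (𝓝 0) := by
    refine tendsto_of_tendsto_of_tendsto_of_le_of_le tendsto_const_nhds h2 (fun _ => zero_le)
      fun n => ?_
    have i1 := integrable_mul_of_hasCompactSupport (continuous_conv hu n).locallyIntegrable hψ hc
    have i2 := integrable_mul_of_hasCompactSupport hu.locallyIntegrable hψ hc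
    simp only
    rw [edist_eq_enorm_sub, ← integral_sub i1 i2]
    simp only [← sub_mul]
    exact sq_integral_mul_le ((continuous_conv hu n).aestronglyMeasurable.sub hu.1) hψ hR
  have h4 := (ENNReal.continuous_rpow_const (y := 1 / 2)).tendsto 0 |>.comp h3
  rw [ENNReal.zero_rpow_of_pos (by norm_num)] at h4
  refine h4.congr fun n => ?_
  rw [Function.comp_apply, ← ENNReal.rpow_natCast, ← ENNReal.rpow_mul]
  norm_num

/-- Bounds along a subsequence, which may depend on the ball and on `b`, suffice, because the
pairings of the mollifications with a fixed test function converge. This is the form in which bounds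
come out of Fatou's lemma. -/
lemma exists_hasWeakDeriv_of_frequently_le {u : V → ℝ} (hu : L2Loc u) (α : Fin 3 → ℕ)
    (θ : ℝ) {B : ℝ} (hB : 0 ≤ B)
    (h : ∀ r b, B < b → ∃ᶠ n in atTop, ∫⁻ v in Metric.ball (0 : V) r,
      ENNReal.ofReal ((bracket v ^ θ * multiPd α (conv u (moll n)) v) ^ 2) ≤ ENNReal.ofReal b) :
    ∃ D, HasWeakDeriv α u D ∧ sqNormTwo θ D ≤ ENNReal.ofReal B := by
  refine exists_hasWeakDeriv_of_pairing_le hu.locallyIntegrable α θ hB fun φ h1 h2 => ?_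
  set N := ∫ v, (bracket v ^ (-θ) * φ v) ^ 2 with hN
  have hN0 : 0 ≤ N := integral_nonneg fun v => sq_nonneg _
  have hNe : ∫⁻ v, ‖bracket v ^ (-θ) * φ v‖ₑ ^ 2 = ENNReal.ofReal N := by
    rw [hN, ofReal_integral_eq_lintegral_ofReal
      (((memLp_weight_test (-θ) ⟨φ, h1, h2⟩)).integrable_sq)
      (Eventually.of_forall fun v => sq_nonneg _)]
    refine lintegral_congr fun v => ?_
    rw [← ofReal_norm, ← ENNReal.ofReal_pow (norm_nonneg _), norm_sq_real]
  obtain ⟨R, hR0, hR⟩ := exists_ball_support h2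
  have key : ∀ b, B < b → (∫ v, u v * multiPd α φ v) ^ 2 ≤ b * N := by
    intro b hb
    have hlim := (tendsto_integral_conv_mul hu (contDiff_multiPd h1 α).continuous
      (hasCompactSupport_multiPd h2 α)).pow 2
    refine le_of_tendsto_of_frequently hlim ((h R b hb).mono fun n hn => ?_)
    have hU : ContDiff ℝ ∞ (conv u (moll n)) :=
      contDiff_conv hu.locallyIntegrable (contDiff_moll n) (hasCompactSupport_moll n)
    have e1 : (∫ v, conv u (moll n) v * multiPd α φ v) ^ 2
        = (∫ v, (bracket v ^ θ * multiPd α (conv u (moll n)) v) * (bracket v ^ (-θ) * φ v)) ^ 2 := by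
      rw [(HasWeakDeriv.of_smooth hU (α := α)).integral_eq φ h1 h2, mul_pow, ← pow_mul,
        mul_comm _ 2, pow_mul, neg_one_sq, one_pow, one_mul]
      congr 2; ext v
      have : bracket v ^ θ * bracket v ^ (-θ) = 1 := by
        rw [← Real.rpow_add (bracket_pos v), add_neg_cancel, Real.rpow_zero]
      linear_combination (-(multiPd α (conv u (moll n)) v * φ v)) * this
    rw [e1]
    have hc1 : Continuous fun v => bracket v ^ θ * multiPd α (conv u (moll n)) v :=
      (contDiff_bracket_rpow θ).continuous.mul (contDiff_multiPd hU α).continuous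
    have h3 := sq_integral_mul_le (h := fun v => bracket v ^ θ * multiPd α (conv u (moll n)) v)
      (ψ := fun v => bracket v ^ (-θ) * φ v) hc1.aestronglyMeasurable
      ((contDiff_bracket_rpow _).continuous.mul h1.continuous) (R := R)
      (fun v hv => by rw [hR v hv, mul_zero])
    rw [hNe] at h3
    have h4 : ballSq R (fun v => bracket v ^ θ * multiPd α (conv u (moll n)) v)
        ≤ ENNReal.ofReal b := by
      refine le_trans (le_of_eq ?_) hn
      refine lintegral_congr fun v => ?_
      rw [← ofReal_norm, ← ENNReal.ofReal_pow (norm_nonneg _), norm_sq_real]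
    have h5 := h3.trans (mul_le_mul_left h4 _)
    rw [← ofReal_norm, ← ENNReal.ofReal_pow (norm_nonneg _), norm_sq_real,
      ← ENNReal.ofReal_mul (hB.trans hb.le)] at h5
    exact (ENNReal.ofReal_le_ofReal_iff (mul_nonneg (hB.trans hb.le) hN0)).1 h5
  refine le_of_forall_gt_imp_ge_of_dense fun x hx => ?_
  have hN1 : 0 < N + 1 := by linarith
  -- The slack is divided by `N + 1` rather than `N`, since `N` may vanish.
  have hb : B < B + (x - B * N) / (N + 1) := by
    have : 0 < (x - B * N) / (N + 1) := div_pos (by linarith) hN1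
    linarith
  refine (key _ hb).trans ?_
  have h6 : (x - B * N) / (N + 1) * N ≤ x - B * N := by
    rw [div_mul_eq_mul_div, div_le_iff₀ hN1]
    nlinarith
  linarith

end

section

/-! ### The Leibniz formula -/

/-- The multi-indices `β ≤ α`. -/
def box (α : Fin 3 → ℕ) : Finset (Fin 3 → ℕ) := Fintype.piFinset fun i => Finset.range (α i + 1)

lemma mem_box {α β : Fin 3 → ℕ} : β ∈ box α ↔ β ≤ α := by
  simp [box, Pi.le_def]

/-- The multi-index binomial coefficient. -/
def binom (α β : Fin 3 → ℕ) : ℕ := ∏ i, (α i).choose (β i)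

lemma sum_box (α : Fin 3 → ℕ) (F : (Fin 3 → ℕ) → ℝ) :
    ∑ β ∈ box α, F β = ∑ p ∈ Finset.range (α 2 + 1), ∑ q ∈ Finset.range (α 1 + 1),
      ∑ r ∈ Finset.range (α 0 + 1), F ![r, q, p] := by
  simp only [← Finset.sum_product']
  refine Finset.sum_nbij' (fun β => (β 2, β 1, β 0)) (fun p => ![p.2.2, p.2.1, p.1]) ?_ ?_ ?_ ?_ ?_
  · intro β hβ
    rw [mem_box] at hβ
    simpa [Nat.lt_succ_iff] using ⟨hβ 2, hβ 1, hβ 0⟩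
  · intro p hp
    simp only [Finset.mem_product, Finset.mem_range, Nat.lt_succ_iff] at hp
    rw [mem_box]
    intro i
    fin_cases i
    exacts [hp.2.2, hp.2.1, hp.1]
  · intro β _
    ext i; fin_cases i <;> rfl
  · intro p _; rfl
  · intro β _
    congr 1
    ext i; fin_cases i <;> rfl

/-- A doubly indexed family on which derivatives act as on products. -/
def IsProductFamily (X : (Fin 3 → ℕ) → (Fin 3 → ℕ) → V → ℝ) : Prop :=
  ∀ β δ, ContDiff ℝ ∞ (X β δ) ∧ ∀ l v,
    pd l (X β δ) v = X (β + unitIdx l) δ v + X β (δ + unitIdx l) v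

namespace IsProductFamily

variable {X : (Fin 3 → ℕ) → (Fin 3 → ℕ) → V → ℝ}

lemma pd_sum (hX : IsProductFamily X) {ι : Type*} (s : Finset ι) (c : ι → ℝ)
    (f g : ι → Fin 3 → ℕ) (l : Fin 3) (v : V) :
    pd l (fun w => ∑ p ∈ s, c p * X (f p) (g p) w) v
      = ∑ p ∈ s, c p * (X (f p + unitIdx l) (g p) v + X (f p) (g p + unitIdx l) v) := by
  rw [Landau.pd_sum s l fun p _ => ((hX _ _).1.differentiable (by simp) v).const_mul _]
  refine Finset.sum_congr rfl fun p _ => ?_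
  rw [pd_const_mul l _ ((hX _ _).1.differentiable (by simp) v), (hX _ _).2]

/-- The binomial theorem in a single direction, by Pascal's rule. The abstract family lets the three
directions be treated one after another without naming the factors. -/
lemma iterate_pd (hX : IsProductFamily X) (l : Fin 3) (m : ℕ) (β δ : Fin 3 → ℕ) :
    (pd l)^[m] (X β δ) = fun v => ∑ p ∈ Finset.range (m + 1),
      (m.choose p : ℝ) * X (β + Pi.single l p) (δ + Pi.single l (m - p)) v := by
  induction m with
  | zero => funext v; simp
  | succ m ih =>
    rw [Function.iterate_succ_apply', ih]
    funext v
    have hs := Finset.sum_choose_succ_mul (R := ℝ) (fun p q =>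
      X (β + Pi.single l p) (δ + Pi.single l q) v) m
    rw [hX.pd_sum, show m + 1 + 1 = m + 2 from rfl, hs, ← Finset.sum_add_distrib]
    refine Finset.sum_congr rfl fun p hp => ?_
    have hp' : m - p + 1 = m + 1 - p := by
      have := Finset.mem_range.1 hp; omega
    have e1 : β + Pi.single l p + unitIdx l = β + Pi.single l (p + 1) := by
      rw [add_assoc, unitIdx, ← Pi.single_add]
    have e2 : δ + Pi.single l (m - p) + unitIdx l = δ + Pi.single l (m + 1 - p) := by
      rw [add_assoc, unitIdx, ← Pi.single_add, hp']
    rw [e1, e2]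
    ring

end IsProductFamily

lemma iterate_pd_sum {ι : Type*} (s : Finset ι) (c : ι → ℝ) {f : ι → V → ℝ}
    (hf : ∀ p, ContDiff ℝ ∞ (f p)) (l : Fin 3) (m : ℕ) :
    (pd l)^[m] (fun v => ∑ p ∈ s, c p * f p v) = fun v => ∑ p ∈ s, c p * (pd l)^[m] (f p) v := by
  induction m with
  | zero => rfl
  | succ m ih =>
    rw [Function.iterate_succ_apply', ih]
    funext v
    have hd : ∀ p, DifferentiableAt ℝ ((pd l)^[m] (f p)) v := fun p =>
      (contDiff_iterate_pd (hf p) l m).differentiable (by simp) v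
    rw [Landau.pd_sum s l fun p _ => (hd p).const_mul _]
    refine Finset.sum_congr rfl fun p _ => ?_
    rw [pd_const_mul l _ (hd p), Function.iterate_succ_apply']

lemma IsProductFamily.multiPd_eq {X : (Fin 3 → ℕ) → (Fin 3 → ℕ) → V → ℝ}
    (hX : IsProductFamily X) (α : Fin 3 → ℕ) (v : V) :
    multiPd α (X 0 0) v = ∑ β ∈ box α, (binom α β : ℝ) * X β (α - β) v := by
  rw [multiPd, hX.iterate_pd, iterate_pd_sum _ _ fun p => (hX _ _).1]
  simp only [hX.iterate_pd]
  have hs : ∀ p : ℕ, ContDiff ℝ ∞ fun v => ∑ q ∈ Finset.range (α 1 + 1),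
      ((α 1).choose q : ℝ) * X (0 + Pi.single 2 p + Pi.single 1 q)
        (0 + Pi.single 2 (α 2 - p) + Pi.single 1 (α 1 - q)) v := fun p =>
    ContDiff.sum fun q _ => contDiff_const.mul (hX _ _).1
  rw [iterate_pd_sum _ _ hs]
  have h0 : ∀ p : ℕ, (pd 0)^[α 0] (fun v => ∑ q ∈ Finset.range (α 1 + 1),
      ((α 1).choose q : ℝ) * X (0 + Pi.single 2 p + Pi.single 1 q)
        (0 + Pi.single 2 (α 2 - p) + Pi.single 1 (α 1 - q)) v) = _ := fun p =>
    iterate_pd_sum _ _ (fun q => (hX _ _).1) 0 (α 0)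
  simp only [h0, hX.iterate_pd, Finset.mul_sum]
  rw [sum_box]
  refine Finset.sum_congr rfl fun p _ => Finset.sum_congr rfl fun q _ =>
    Finset.sum_congr rfl fun r _ => ?_
  have e1 : ![r, q, p] = 0 + Pi.single 2 p + Pi.single 1 q + Pi.single 0 r := by
    ext i; fin_cases i <;> simp
  have e2 : α - ![r, q, p] = 0 + Pi.single 2 (α 2 - p) + Pi.single 1 (α 1 - q)
      + Pi.single 0 (α 0 - r) := by
    ext i; fin_cases i <;> simp
  rw [e2, ← e1]
  simp only [binom, Fin.prod_univ_three, Nat.cast_mul]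
  simp
  ring

lemma multiPd_mul {b u : V → ℝ} (hb : ContDiff ℝ ∞ b) (hu : ContDiff ℝ ∞ u) (α : Fin 3 → ℕ)
    (v : V) : multiPd α (fun w => b w * u w) v
      = ∑ β ∈ box α, (binom α β : ℝ) * (multiPd β b v * multiPd (α - β) u v) := by
  have hX : IsProductFamily fun β δ v => multiPd β b v * multiPd δ u v := fun β δ => by
    refine ⟨(contDiff_multiPd hb β).mul (contDiff_multiPd hu δ), fun l v => ?_⟩
    rw [pd_mul l ((contDiff_multiPd hb β).differentiable (by simp) v)
      ((contDiff_multiPd hu δ).differentiable (by simp) v), pd_multiPd hb, pd_multiPd hu]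
  simpa [multiPd_zero] using hX.multiPd_eq α v

/-- The Leibniz formula for mollifications of weakly differentiable functions. -/
lemma conv_mul_multiPd {u b ρ : V → ℝ} {D : (Fin 3 → ℕ) → V → ℝ} {α : Fin 3 → ℕ} (hu : L2Loc u)
    (hb : ContDiff ℝ ∞ b) (hD : ∀ δ ≤ α, HasWeakDeriv δ u (D δ) ∧ L2Loc (D δ))
    (hρ : ContDiff ℝ ∞ ρ) (hc : HasCompactSupport ρ) (v : V) :
    conv (fun w => b w * u w) (multiPd α ρ) v
      = ∑ β ∈ box α, (binom α β : ℝ) * conv (fun w => multiPd β b w * D (α - β) w) ρ v := by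
  -- The formula is classical for the smooth functions `conv u (moll m)`. Both sides converge as `m
  -- → ∞`, the outer mollifier `ρ` being kept fixed.
  have hlim : ∀ (E c σ : V → ℝ), L2Loc E → Continuous c → Continuous σ → HasCompactSupport σ →
      Tendsto (fun m => conv (fun w => c w * conv E (moll m) w) σ v) atTop
        (𝓝 (conv (fun w => c w * E w) σ v)) := by
    intro E c σ hE hc hσ hs
    have := tendsto_integral_conv_mul hE (ψ := fun w => c w * σ (v - w))
      (hc.mul (hσ.comp (by fun_prop))) (hasCompactSupport_comp_sub_left hs v).mul_left
    simp only [conv, mul_assoc, mul_left_comm (c _)] at this ⊢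
    exact this
  have hρα := (contDiff_multiPd hρ α).continuous
  have h1 := hlim u b _ hu hb.continuous hρα (hasCompactSupport_multiPd hc α)
  have h2 : Tendsto (fun m => ∑ β ∈ box α, (binom α β : ℝ) *
      conv (fun w => multiPd β b w * conv (D (α - β)) (moll m) w) ρ v) atTop
      (𝓝 (∑ β ∈ box α, (binom α β : ℝ) * conv (fun w => multiPd β b w * D (α - β) w) ρ v)) := by
    refine tendsto_finsetSum _ fun β _ => Tendsto.const_mul _ ?_
    exact hlim _ _ _ (hD _ tsub_le_self).2 (contDiff_multiPd hb β).continuous hρ.continuous hc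
  refine tendsto_nhds_unique h1 (h2.congr fun m => ?_)
  have hU : ContDiff ℝ ∞ (conv u (moll m)) :=
    contDiff_conv hu.locallyIntegrable (contDiff_moll m) (hasCompactSupport_moll m)
  have hbU := hb.mul hU
  have hl : ∀ β, conv (D (α - β)) (moll m) = multiPd (α - β) (conv u (moll m)) := fun β =>
    ((hD _ tsub_le_self).1.multiPd_conv_eq hu.locallyIntegrable (contDiff_moll m)
      (hasCompactSupport_moll m)).symm
  rw [(HasWeakDeriv.of_smooth hbU (α := α)).conv_multiPd hρ hc]
  have i1 : ∀ β, Integrable fun w => multiPd β b w * multiPd (α - β) (conv u (moll m)) w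
      * ρ (v - w) := fun β =>
    integrable_conv (((contDiff_multiPd hb β).mul
      (contDiff_multiPd hU (α - β))).continuous.locallyIntegrable) hρ.continuous hc v
  simp only [hl]
  change _ = ∫ w, multiPd α (fun x => b x * conv u (moll m) x) w * ρ (v - w)
  simp only [multiPd_mul hb hU, Finset.sum_mul, mul_assoc (binom α _ : ℝ)]
  rw [integral_finsetSum _ fun β _ => (i1 β).const_mul _]
  simp only [integral_const_mul]
  rfl

end

section

/-! ### The mollified equation -/

/-- The commutator of multiplication by `a` with mollification. -/
def mulComm (a : V → ℝ) (n : ℕ) (D : V → ℝ) (v : V) : ℝ :=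
  conv (fun w => a w * D w) (moll n) v - a v * conv D (moll n) v

/-- The flux `∂^α ρ_n * (ā_{ij} ∂_i g)` in expanded form. -/
def fluxPart (γ : ℝ) (n : ℕ) (D : (Fin 3 → ℕ) → V → ℝ) (α : Fin 3 → ℕ) (i j : Fin 3) (v : V) : ℝ :=
  ∑ β ∈ box α, (binom α β : ℝ) * (abarDeriv γ i j β v * pd i (conv (D (α - β)) (moll n)) v
    + friedrichs (abarDeriv γ i j β) i n (D (α - β)) v)

/-- The flux `∂^α ρ_n * (ā_{ij} ∂_i g)`. -/
def fluxRaw (γ : ℝ) (n : ℕ) (g : V → ℝ) (α : Fin 3 → ℕ) (i j : Fin 3) (v : V) : ℝ :=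
  pd i (conv (fun w => abar γ i j w * g w) (multiPd α (moll n))) v
    - conv (fun w => pd i (abar γ i j) w * g w) (multiPd α (moll n)) v

/-- The potential term `∂^α ρ_n * (W g)` in expanded form. -/
def potPart (γ : ℝ) (n : ℕ) (D : (Fin 3 → ℕ) → V → ℝ) (α : Fin 3 → ℕ) (v : V) : ℝ :=
  ∑ β ∈ box α, (binom α β : ℝ) * (potDeriv γ β v * conv (D (α - β)) (moll n) v
    + mulComm (potDeriv γ β) n (D (α - β)) v)

/-- The time derivative of `∂^α (ρ_n * g)` at `v`, for a solution `g`. -/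
def rate (γ : ℝ) (n : ℕ) (g : V → ℝ) (α : Fin 3 → ℕ) (v : V) : ℝ :=
  -∫ w, g w * landauOp γ (fun x => multiPd α (moll n) (v - x)) w

section

variable {γ : ℝ} {g : V → ℝ} {D : (Fin 3 → ℕ) → V → ℝ} {α : Fin 3 → ℕ}

/-- `D δ` is the weak derivative `∂^δ g`, locally square integrable, for all `δ ≤ α`. -/
def HasWeakDerivsUpTo (α : Fin 3 → ℕ) (g : V → ℝ) (D : (Fin 3 → ℕ) → V → ℝ) : Prop :=
  ∀ δ ≤ α, HasWeakDeriv δ g (D δ) ∧ L2Loc (D δ)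

/-- The raw flux uses `ā ∂_i g = ∂_i (ā g) - (∂_i ā) g`, so it makes sense for `g` in `L²_loc`.
Distributing `∂^α` by the Leibniz formula leaves, for each `β`, the expected product and one
Friedrichs commutator. -/
lemma fluxPart_eq (hγ : -3 < γ) (hγ' : γ < 0) (hg : L2Loc g) (hD : HasWeakDerivsUpTo α g D) (n : ℕ)
    (i j : Fin 3) (v : V) : fluxPart γ n D α i j v = fluxRaw γ n g α i j v := by
  have hρ := contDiff_moll n
  have hs := hasCompactSupport_moll n
  have ha := contDiff_abar hγ hγ' i j
  have hF := isDerivFamily_abarDeriv hγ hγ' i j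
  have e1 : conv (fun w => abar γ i j w * g w) (multiPd α (moll n)) = fun v =>
      ∑ β ∈ box α, (binom α β : ℝ) *
        conv (fun w => multiPd β (abar γ i j) w * D (α - β) w) (moll n) v :=
    funext fun v => conv_mul_multiPd hg ha hD hρ hs v
  have hl : ∀ β, L2Loc fun w => multiPd β (abar γ i j) w * D (α - β) w := fun β =>
    (hD _ tsub_le_self).2.mul (contDiff_multiPd ha β).continuous
  have hdiff : ∀ β, DifferentiableAt ℝ
      (conv (fun w => multiPd β (abar γ i j) w * D (α - β) w) (moll n)) v := fun β =>
    (contDiff_conv (hl β).locallyIntegrable hρ hs).differentiable (by simp) v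
  rw [fluxRaw, e1, conv_mul_multiPd hg (contDiff_pd ha i) hD hρ hs, pd_sum _ _ fun β _ =>
    (hdiff β).const_mul _, ← Finset.sum_sub_distrib]
  refine Finset.sum_congr rfl fun β _ => ?_
  rw [pd_const_mul _ _ (hdiff β), multiPd_pd ha, ← pd_multiPd ha, multiPd_abar hγ hγ', friedrichs]
  ring

lemma potPart_eq (hγ : -3 < γ) (hγ' : γ < 0) (hg : L2Loc g) (hD : HasWeakDerivsUpTo α g D) (n : ℕ)
    (v : V) : potPart γ n D α v = conv (fun w => potential γ w * g w) (multiPd α (moll n)) v := by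
  rw [conv_mul_multiPd hg (contDiff_potential hγ hγ') hD (contDiff_moll n)
    (hasCompactSupport_moll n), potPart]
  refine Finset.sum_congr rfl fun β _ => ?_
  rw [mulComm, multiPd_potential hγ hγ']
  ring

lemma contDiff_fluxRaw (hγ : -3 < γ) (hγ' : γ < 0) (hg : L2Loc g) (α : Fin 3 → ℕ)
    (n : ℕ) (i j : Fin 3) : ContDiff ℝ ∞ (fluxRaw γ n g α i j) := by
  have ha := contDiff_abar hγ hγ' i j
  have hρ := contDiff_multiPd (contDiff_moll n) α
  have hs := hasCompactSupport_multiPd (hasCompactSupport_moll n) α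
  exact (contDiff_pd (contDiff_conv (hg.mul ha.continuous).locallyIntegrable hρ hs) i).sub
    (contDiff_conv (hg.mul (contDiff_pd ha i).continuous).locallyIntegrable hρ hs)

lemma contDiff_fluxPart (hγ : -3 < γ) (hγ' : γ < 0) (hg : L2Loc g) (hD : HasWeakDerivsUpTo α g D)
    (n : ℕ) (i j : Fin 3) : ContDiff ℝ ∞ (fluxPart γ n D α i j) := by
  rw [show fluxPart γ n D α i j = _ from funext (fluxPart_eq hγ hγ' hg hD n i j)]
  exact contDiff_fluxRaw hγ hγ' hg α n i j

lemma contDiff_potPart (hγ : -3 < γ) (hγ' : γ < 0) (hg : L2Loc g) (hD : HasWeakDerivsUpTo α g D)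
    (n : ℕ) : ContDiff ℝ ∞ (potPart γ n D α) := by
  rw [show potPart γ n D α = _ from funext (potPart_eq hγ hγ' hg hD n)]
  exact contDiff_conv (hg.mul (contDiff_potential hγ hγ').continuous).locallyIntegrable
    (contDiff_multiPd (contDiff_moll n) α) (hasCompactSupport_multiPd (hasCompactSupport_moll n) α)

lemma landauOp_comp_sub_left (hγ : -3 < γ) (hγ' : γ < 0) {σ : V → ℝ} (hσ : ContDiff ℝ ∞ σ)
    (v w : V) : landauOp γ (fun x => σ (v - x)) w
      = (∑ i, ∑ j, (pd i (abar γ i j) w * pd j σ (v - w)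
          - abar γ i j w * pd j (pd i σ) (v - w))) + potential γ w * σ (v - w) := by
  rw [landauOp_eq]
  congr 1
  simp only [← Finset.sum_neg_distrib]
  refine Finset.sum_congr rfl fun i _ => Finset.sum_congr rfl fun j _ => ?_
  have h1 : ∀ x, pd j (fun x => σ (v - x)) x = -pd j σ (v - x) := fun x =>
    pd_comp_sub_left (hσ.of_le (by exact_mod_cast le_top)) j v x
  have h2 := contDiff_pd hσ j
  have h3 : ContDiff ℝ ∞ fun x => pd j σ (v - x) := h2.comp (by fun_prop)
  have ha := contDiff_abar hγ hγ' i j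
  simp only [h1, mul_neg]
  rw [pd_neg, neg_neg, pd_mul i (ha.differentiable (by simp) w) (h3.differentiable (by simp) w),
    pd_comp_sub_left (h2.of_le (by exact_mod_cast le_top)) i v w, pd_comm hσ i j]
  ring

lemma pd_fluxRaw (hγ : -3 < γ) (hγ' : γ < 0) (hg : L2Loc g) (α : Fin 3 → ℕ) (n : ℕ) (i j : Fin 3)
    (v : V) : pd j (fluxRaw γ n g α i j) v
      = conv (fun w => abar γ i j w * g w) (pd j (pd i (multiPd α (moll n)))) v
        - conv (fun w => pd i (abar γ i j) w * g w) (pd j (multiPd α (moll n))) v := by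
  have hσ : ContDiff ℝ ∞ (multiPd α (moll n)) := contDiff_multiPd (contDiff_moll n) α
  have hs : HasCompactSupport (multiPd α (moll n)) :=
    hasCompactSupport_multiPd (hasCompactSupport_moll n) α
  have hal : LocallyIntegrable fun w => abar γ i j w * g w :=
    (hg.mul (contDiff_abar hγ hγ' i j).continuous).locallyIntegrable
  have hpal : LocallyIntegrable fun w => pd i (abar γ i j) w * g w :=
    (hg.mul (contDiff_pd (contDiff_abar hγ hγ' i j) i).continuous).locallyIntegrable
  change pd j (fun v => pd i (conv (fun w => abar γ i j w * g w) (multiPd α (moll n))) v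
    - conv (fun w => pd i (abar γ i j) w * g w) (multiPd α (moll n)) v) v = _
  rw [pd_sub j ((contDiff_pd (contDiff_conv hal hσ hs) i).differentiable (by simp) v)
      ((contDiff_conv hpal hσ hs).differentiable (by simp) v),
    pd_conv hpal hσ hs, pd_conv hal hσ hs, pd_conv hal (contDiff_pd hσ i)
      (hasCompactSupport_pd hs i)]

lemma rate_eq_raw (hγ : -3 < γ) (hγ' : γ < 0) (hg : L2Loc g) (α : Fin 3 → ℕ) (n : ℕ)
    (v : V) : rate γ n g α v = (∑ i, ∑ j, pd j (fluxRaw γ n g α i j) v)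
      - conv (fun w => potential γ w * g w) (multiPd α (moll n)) v := by
  set σ := multiPd α (moll n) with hσd
  have hσ : ContDiff ℝ ∞ σ := contDiff_multiPd (contDiff_moll n) α
  have hs : HasCompactSupport σ := hasCompactSupport_multiPd (hasCompactSupport_moll n) α
  have hal : ∀ i j, LocallyIntegrable fun w => abar γ i j w * g w := fun i j =>
    (hg.mul (contDiff_abar hγ hγ' i j).continuous).locallyIntegrable
  have hpal : ∀ i j, LocallyIntegrable fun w => pd i (abar γ i j) w * g w := fun i j =>
    (hg.mul (contDiff_pd (contDiff_abar hγ hγ' i j) i).continuous).locallyIntegrable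
  have hWl : LocallyIntegrable fun w => potential γ w * g w :=
    (hg.mul (contDiff_potential hγ hγ').continuous).locallyIntegrable
  have e : ∀ i j, pd j (fluxRaw γ n g α i j) v
      = conv (fun w => abar γ i j w * g w) (pd j (pd i σ)) v
        - conv (fun w => pd i (abar γ i j) w * g w) (pd j σ) v :=
    fun i j => pd_fluxRaw hγ hγ' hg α n i j v
  have I1 : ∀ i j, Integrable fun w => abar γ i j w * g w * pd j (pd i σ) (v - w) := fun i j =>
    integrable_conv (hal i j) (contDiff_pd (contDiff_pd hσ i) j).continuous
      (hasCompactSupport_pd (hasCompactSupport_pd hs i) j) v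
  have I2 : ∀ i j, Integrable fun w => pd i (abar γ i j) w * g w * pd j σ (v - w) := fun i j =>
    integrable_conv (hpal i j) (contDiff_pd hσ j).continuous (hasCompactSupport_pd hs j) v
  have I3 : Integrable fun w => potential γ w * g w * σ (v - w) :=
    integrable_conv hWl hσ.continuous hs v
  rw [rate]
  simp only [e, conv, ← hσd]
  simp only [landauOp_comp_sub_left hγ hγ' hσ]
  have I4 : ∀ i j, Integrable fun w => pd i (abar γ i j) w * g w * pd j σ (v - w)
      - abar γ i j w * g w * pd j (pd i σ) (v - w) := fun i j => (I2 i j).sub (I1 i j)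
  have e3 : ∀ w, g w * ((∑ i, ∑ j, (pd i (abar γ i j) w * pd j σ (v - w)
      - abar γ i j w * pd j (pd i σ) (v - w))) + potential γ w * σ (v - w))
      = (∑ i, ∑ j, (pd i (abar γ i j) w * g w * pd j σ (v - w)
        - abar γ i j w * g w * pd j (pd i σ) (v - w))) + potential γ w * g w * σ (v - w) := by
    intro w
    rw [mul_add, Finset.mul_sum]
    congr 1
    · refine Finset.sum_congr rfl fun i _ => ?_
      rw [Finset.mul_sum]
      refine Finset.sum_congr rfl fun j _ => ?_
      ring
    · ring
  simp only [e3]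
  rw [integral_add (integrable_finsetSum _ fun i _ => integrable_finsetSum _ fun j _ => I4 i j) I3,
    integral_finsetSum _ fun i _ => integrable_finsetSum _ fun j _ => I4 i j]
  have e4 : ∀ i, ∫ w, (∑ j, (pd i (abar γ i j) w * g w * pd j σ (v - w)
      - abar γ i j w * g w * pd j (pd i σ) (v - w)))
      = ∑ j, ((∫ w, pd i (abar γ i j) w * g w * pd j σ (v - w))
        - ∫ w, abar γ i j w * g w * pd j (pd i σ) (v - w)) := by
    intro i
    rw [integral_finsetSum _ fun j _ => I4 i j]
    exact Finset.sum_congr rfl fun j _ => integral_sub (I2 i j) (I1 i j)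
  simp only [e4]
  rw [neg_add, ← Finset.sum_neg_distrib, ← sub_eq_add_neg]
  congr 1
  refine Finset.sum_congr rfl fun i _ => ?_
  rw [← Finset.sum_neg_distrib]
  exact Finset.sum_congr rfl fun j _ => by ring

lemma rate_eq (hγ : -3 < γ) (hγ' : γ < 0) (hg : L2Loc g) (hD : HasWeakDerivsUpTo α g D) (n : ℕ)
    (v : V) : rate γ n g α v
      = (∑ i, ∑ j, pd j (fluxPart γ n D α i j) v) - potPart γ n D α v := by
  have e : ∀ i j, fluxPart γ n D α i j = fluxRaw γ n g α i j := fun i j =>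
    funext (fluxPart_eq hγ hγ' hg hD n i j)
  simp only [e, potPart_eq hγ hγ' hg hD, rate_eq_raw hγ hγ' hg]

lemma contDiff_rate (hγ : -3 < γ) (hγ' : γ < 0) (hg : L2Loc g) (α : Fin 3 → ℕ) (n : ℕ) :
    ContDiff ℝ ∞ (rate γ n g α) := by
  rw [show rate γ n g α = _ from funext (rate_eq_raw hγ hγ' hg α n)]
  exact (ContDiff.sum fun i _ => ContDiff.sum fun j _ =>
    contDiff_pd (contDiff_fluxRaw hγ hγ' hg α n i j) j).sub
      (contDiff_conv (hg.mul (contDiff_potential hγ hγ').continuous).locallyIntegrable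
    (contDiff_multiPd (contDiff_moll n) α) (hasCompactSupport_multiPd (hasCompactSupport_moll n) α))

/-- The localized energy identity. -/
lemma integral_mul_rate (hγ : -3 < γ) (hγ' : γ < 0) (hg : L2Loc g) (hD : HasWeakDerivsUpTo α g D)
    (n : ℕ) {p U : V → ℝ} (hp : ContDiff ℝ 1 p) (hs : HasCompactSupport p) (hU : ContDiff ℝ ∞ U) :
    ∫ v, p v ^ 2 * U v * rate γ n g α v
      = ∫ v, -((∑ i, ∑ j, fluxPart γ n D α i j v * (p v ^ 2 * pd j U v + 2 * p v * pd j p v * U v))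
        + p v ^ 2 * U v * potPart γ n D α v) := by
  have hU1 : ContDiff ℝ 1 U := hU.of_le (by exact_mod_cast le_top)
  have hφ : ContDiff ℝ 1 fun v => p v ^ 2 * U v := (hp.pow 2).mul hU1
  have hφs : HasCompactSupport fun v => p v ^ 2 * U v := by
    have : HasCompactSupport fun v => p v * (p v * U v) := hs.mul_right
    simpa only [sq, mul_assoc] using this
  have hF := contDiff_fluxPart hγ hγ' hg hD n
  have e1 : ∀ j v, pd j (fun v => p v ^ 2 * U v) v
      = p v ^ 2 * pd j U v + 2 * p v * pd j p v * U v := by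
    intro j v
    have h1 : DifferentiableAt ℝ p v := hp.differentiable one_ne_zero v
    simp only [sq]
    rw [pd_mul j (h1.fun_mul h1) (hU1.differentiable one_ne_zero v), pd_mul j h1 h1]
    ring
  have e2 : ∀ i j, ∫ v, pd j (fluxPart γ n D α i j) v * (p v ^ 2 * U v)
      = -∫ v, fluxPart γ n D α i j v * (p v ^ 2 * pd j U v + 2 * p v * pd j p v * U v) := by
    intro i j
    have := integral_mul_pd ((hF i j).of_le (by exact_mod_cast le_top)) hφ hφs j
    simp only [e1] at this
    rw [this, neg_neg]
  have hpdφ : ∀ j, Continuous fun v => p v ^ 2 * pd j U v + 2 * p v * pd j p v * U v := by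
    intro j
    have hc : Continuous (pd j p) := (hp.continuous_fderiv one_ne_zero).clm_apply continuous_const
    have hc2 : Continuous (pd j U) := (contDiff_pd hU j).continuous
    have := hp.continuous
    have := hU.continuous
    fun_prop
  have hpdφs : ∀ j, HasCompactSupport fun v => p v ^ 2 * pd j U v + 2 * p v * pd j p v * U v := by
    intro j
    have := hasCompactSupport_pd hφs j
    rwa [show pd j (fun v => p v ^ 2 * U v) = _ from funext (e1 j)] at this
  have I1 : ∀ i j, Integrable fun v => pd j (fluxPart γ n D α i j) v * (p v ^ 2 * U v) :=
    fun i j => ((contDiff_pd (hF i j) j).continuous.mul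
      hφ.continuous).integrable_of_hasCompactSupport hφs.mul_left
  have I2 : ∀ i j, Integrable fun v => fluxPart γ n D α i j v
      * (p v ^ 2 * pd j U v + 2 * p v * pd j p v * U v) :=
    fun i j => ((hF i j).continuous.mul (hpdφ j)).integrable_of_hasCompactSupport
      (hpdφs j).mul_left
  have I3 : Integrable fun v => p v ^ 2 * U v * potPart γ n D α v :=
    (hφ.continuous.mul (contDiff_potPart hγ hγ' hg hD n).continuous).integrable_of_hasCompactSupport
      hφs.mul_right
  have e3 : ∀ v, p v ^ 2 * U v * rate γ n g α v
      = (∑ i, ∑ j, pd j (fluxPart γ n D α i j) v * (p v ^ 2 * U v))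
        - p v ^ 2 * U v * potPart γ n D α v := by
    intro v
    rw [rate_eq hγ hγ' hg hD, mul_sub, Finset.mul_sum]
    simp only [Finset.sum_mul, mul_comm (p v ^ 2 * U v)]
  simp only [e3]
  rw [integral_sub (integrable_finsetSum _ fun i _ => integrable_finsetSum _ fun j _ => I1 i j) I3,
    integral_neg, integral_add (integrable_finsetSum _ fun i _ => integrable_finsetSum _
      fun j _ => I2 i j) I3, integral_finsetSum _ fun i _ => integrable_finsetSum _ fun j _ => I1 i j,
    integral_finsetSum _ fun i _ => integrable_finsetSum _ fun j _ => I2 i j]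
  have e4 : ∀ i, ∫ v, (∑ j, pd j (fluxPart γ n D α i j) v * (p v ^ 2 * U v))
      = -∫ v, (∑ j, fluxPart γ n D α i j v * (p v ^ 2 * pd j U v + 2 * p v * pd j p v * U v)) := by
    intro i
    rw [integral_finsetSum _ fun j _ => I1 i j, integral_finsetSum _ fun j _ => I2 i j,
      ← Finset.sum_neg_distrib]
    exact Finset.sum_congr rfl fun j _ => e2 i j
  simp only [e4, Finset.sum_neg_distrib]
  ring

end

end

section

/-! ### The pointwise energy inequality -/

/-- The gradient as a vector. -/
def grad (u : V → ℝ) (v : V) : Fin 3 → ℝ := fun i => pd i u v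

/-- The energy density `⟨v⟩^γ (|ξ|² + |v|²|ξ|² - (v·ξ)²) + ⟨v⟩^{γ+2} x²`. -/
def edens (γ : ℝ) (v : V) (ξ : Fin 3 → ℝ) (x : ℝ) : ℝ :=
  mform γ v ξ + bracket v ^ (γ + 2) * x ^ 2

/-- The lower order terms in the energy inequality. -/
def lowerTerms (γ K : ℝ) (n : ℕ) (D : (Fin 3 → ℕ) → V → ℝ) (α : Fin 3 → ℕ) (v : V) : ℝ :=
  ∑ β ∈ (box α).erase 0, (binom α β : ℝ) * (K ^ (len β + 1) * multiFactorial β) *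
    (√(mform γ v (grad (conv (D (α - β)) (moll n)) v))
      + bracket v ^ (γ / 2 + 1) * |conv (D (α - β)) (moll n) v|)

/-- The commutator errors in the energy inequality. -/
def commTerms (γ : ℝ) (n : ℕ) (D : (Fin 3 → ℕ) → V → ℝ) (α : Fin 3 → ℕ) (v : V) : ℝ :=
  bracket v ^ (-(γ / 2)) * ∑ β ∈ box α, (binom α β : ℝ) *
    ((∑ i, ∑ j, |friedrichs (abarDeriv γ i j β) i n (D (α - β)) v|)
      + |mulComm (potDeriv γ β) n (D (α - β)) v|)

lemma mform_self (γ : ℝ) (v : V) : mform γ v (fun i => v i) = bracket v ^ γ * ‖v‖ ^ 2 := by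
  rw [mform, bform, norm_sq_eq_sum]
  simp only [sq]; ring

lemma sqrt_mform_self (γ : ℝ) (v : V) :
    √(mform γ v (fun i => v i)) = bracket v ^ (γ / 2) * ‖v‖ := by
  have h : bracket v ^ γ = (bracket v ^ (γ / 2)) ^ 2 := by
    rw [← Real.rpow_natCast, ← Real.rpow_mul (bracket_pos v).le]; norm_num
  rw [mform_self, h, ← mul_pow, Real.sqrt_sq]
  have := Real.rpow_nonneg (bracket_pos v).le (γ / 2)
  positivity

lemma abs_le_sqrt_mform (γ : ℝ) (v : V) (ξ : Fin 3 → ℝ) (j : Fin 3) :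
    |ξ j| ≤ bracket v ^ (-(γ / 2)) * √(mform γ v ξ) := by
  have hb := bracket_pos v
  have h1 : bracket v ^ γ * ξ j ^ 2 ≤ mform γ v ξ := by
    rw [mform]
    have h2 := Finset.single_le_sum (f := fun i => ξ i ^ 2) (fun i _ => sq_nonneg _)
      (Finset.mem_univ j)
    have h3 := bform_self_nonneg v ξ
    have := Real.rpow_nonneg hb.le γ
    gcongr
    linarith
  have h2 : |ξ j| = bracket v ^ (-(γ / 2)) * √(bracket v ^ γ * ξ j ^ 2) := by
    rw [Real.sqrt_mul (Real.rpow_nonneg hb.le _), Real.sqrt_sq_eq_abs, Real.sqrt_eq_rpow,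
      ← Real.rpow_mul hb.le, ← mul_assoc, ← Real.rpow_add hb]
    ring_nf; simp
  rw [h2]
  have := Real.rpow_nonneg hb.le (-(γ / 2))
  gcongr

lemma binom_zero (α : Fin 3 → ℕ) : binom α 0 = 1 := by simp [binom]

lemma zero_mem_box (α : Fin 3 → ℕ) : 0 ∈ box α := mem_box.2 (zero_le (a := α))

lemma sum_form_lin (A : Fin 3 → Fin 3 → ℝ) (ξ η ζ : Fin 3 → ℝ) (s t : ℝ) :
    ∑ i, ∑ j, A i j * ξ i * (s * η j + t * ζ j)
      = s * (∑ i, ∑ j, A i j * ξ i * η j) + t * ∑ i, ∑ j, A i j * ξ i * ζ j := by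
  simp only [Finset.mul_sum, ← Finset.sum_add_distrib]
  refine Finset.sum_congr rfl fun i _ => Finset.sum_congr rfl fun j _ => by ring

/-- `X` and `Y` stand for the square roots of the gradient and potential parts of the weighted
energy, `z` for the term produced by the derivative of the weight, and `Q` for the lower order terms
and commutators. -/
lemma young_energy {c C K Λ X Y z Q : ℝ} (hc : 0 < c) :
    -(c * X ^ 2) - c * Y ^ 2 + C * z ^ 2 + 2 * K * Λ * X * z + (X + 2 * Λ * z + Y) * Q
      ≤ -(c / 2 * (X ^ 2 + Y ^ 2)) + (C + (4 * K ^ 2 / c + 1) * Λ ^ 2) * z ^ 2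
        + (2 / c + 1) * Q ^ 2 := by
  have h1 : 2 * K * Λ * X * z ≤ c / 4 * X ^ 2 + 4 * K ^ 2 / c * Λ ^ 2 * z ^ 2 := by
    have := sq_nonneg (c * X - 4 * K * Λ * z)
    rw [← sub_nonneg]
    have e : c / 4 * X ^ 2 + 4 * K ^ 2 / c * Λ ^ 2 * z ^ 2 - 2 * K * Λ * X * z
        = (c * X - 4 * K * Λ * z) ^ 2 / (4 * c) := by field_simp; ring
    rw [e]; positivity
  have h2 : X * Q ≤ c / 4 * X ^ 2 + 1 / c * Q ^ 2 := by
    rw [← sub_nonneg]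
    have e : c / 4 * X ^ 2 + 1 / c * Q ^ 2 - X * Q = (c * X - 2 * Q) ^ 2 / (4 * c) := by
      field_simp; ring
    rw [e]; positivity
  have h3 : Y * Q ≤ c / 2 * Y ^ 2 + 1 / c * Q ^ 2 := by
    rw [← sub_nonneg]
    have e : c / 2 * Y ^ 2 + 1 / c * Q ^ 2 - Y * Q
        = ((c * Y - Q) ^ 2 + Q ^ 2) / (2 * c) := by
      field_simp; ring
    rw [e]; positivity
  have h4 : 2 * Λ * z * Q ≤ Λ ^ 2 * z ^ 2 + Q ^ 2 := by nlinarith [sq_nonneg (Λ * z - Q)]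
  have e5 : 2 / c * Q ^ 2 = 1 / c * Q ^ 2 + 1 / c * Q ^ 2 := by ring
  nlinarith [h1, h2, h3, h4, e5]

lemma young_energy' {c C K Λ P a b z L M : ℝ} (hc : 0 < c) (hC : 0 ≤ C) :
    -(c * (P * a) ^ 2) - c * (P * b) ^ 2 + C * z ^ 2 + 2 * K * Λ * (P * a) * z
        + (P * a + 2 * Λ * z + P * b) * (P * (L + M))
      ≤ -(c / 2 * (P ^ 2 * (a ^ 2 + b ^ 2))) + (C + 4 * K ^ 2 / c + 1 + 2 * (2 / c + 1)) *
        ((1 + Λ ^ 2) * z ^ 2 + P ^ 2 * (L ^ 2 + M ^ 2)) := by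
  have hy := young_energy (C := C) (K := K) (Λ := Λ) (X := P * a) (Y := P * b) (z := z)
    (Q := P * (L + M)) hc
  have hQ : (P * (L + M)) ^ 2 ≤ 2 * (P ^ 2 * (L ^ 2 + M ^ 2)) := by
    nlinarith [mul_nonneg (sq_nonneg P) (sq_nonneg (L - M))]
  have hLM : 0 ≤ P ^ 2 * (L ^ 2 + M ^ 2) := by positivity
  have hk : 0 ≤ 4 * K ^ 2 / c := by positivity
  have hk2 : 0 ≤ 2 / c := by positivity
  have e1 : (C + (4 * K ^ 2 / c + 1) * Λ ^ 2) * z ^ 2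
      ≤ (C + 4 * K ^ 2 / c + 1 + 2 * (2 / c + 1)) * ((1 + Λ ^ 2) * z ^ 2) := by
    rw [← mul_assoc]
    refine mul_le_mul_of_nonneg_right ?_ (sq_nonneg z)
    generalize 4 * K ^ 2 / c = k at *
    generalize 2 / c = k2 at *
    have h1 := mul_nonneg hC (sq_nonneg Λ)
    have h2 := mul_nonneg hk2 (sq_nonneg Λ)
    have h3 := sq_nonneg Λ
    linarith
  have e2 : (2 / c + 1) * (P * (L + M)) ^ 2
      ≤ (C + 4 * K ^ 2 / c + 1 + 2 * (2 / c + 1)) * (P ^ 2 * (L ^ 2 + M ^ 2)) := by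
    calc _ ≤ (2 / c + 1) * (2 * (P ^ 2 * (L ^ 2 + M ^ 2))) := by gcongr
      _ = (2 * (2 / c + 1)) * (P ^ 2 * (L ^ 2 + M ^ 2)) := by ring
      _ ≤ _ := by
          gcongr
          linarith
  have e8 : c / 2 * ((P * a) ^ 2 + (P * b) ^ 2) = c / 2 * (P ^ 2 * (a ^ 2 + b ^ 2)) := by ring
  linarith

-- Here `P` is the value of the weight, `q v` its gradient and `Ω` a larger weight, needed because a
-- cutoff does not bound its own derivative. The terms with `β = 0` give coercivity. As the gradient
-- of the weight is radial and `√(mform γ v v) = ⟨v⟩^{γ/2} ‖v‖`, the hypothesis on `q` makes its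
-- contribution a multiple of `Λ Ω ⟨v⟩^{γ/2} |U|`, so only `⟨v⟩^γ` appears in the remainder. The
-- remaining products are split by Young's inequality, and no constant depends on `α`.
set_option maxHeartbeats 2000000 in
lemma exists_energy_pointwise {γ : ℝ} (hγ : -3 < γ) (hγ' : γ < 0) : ∃ c C K : ℝ, 0 < c ∧ 0 < C ∧
    1 ≤ K ∧ ∀ (α : Fin 3 → ℕ) (D : (Fin 3 → ℕ) → V → ℝ) (n : ℕ) (v : V) (P q Ω Λ : ℝ),
      0 ≤ P → P ≤ Ω → 0 ≤ Λ → |q| * ‖v‖ ≤ Λ * Ω →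
      -((∑ i, ∑ j, fluxPart γ n D α i j v * (P ^ 2 * pd j (conv (D α) (moll n)) v
          + 2 * P * (q * v j) * conv (D α) (moll n) v))
        + P ^ 2 * conv (D α) (moll n) v * potPart γ n D α v)
      ≤ -(c * (P ^ 2 * edens γ v (grad (conv (D α) (moll n)) v) (conv (D α) (moll n) v)))
        + C * ((1 + Λ ^ 2) * (Ω ^ 2 * bracket v ^ γ * conv (D α) (moll n) v ^ 2)
          + P ^ 2 * (lowerTerms γ K n D α v ^ 2 + commTerms γ n D α v ^ 2)) := by
  obtain ⟨K1, hK1, hA⟩ := exists_abarDeriv_form_le hγ hγ'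
  obtain ⟨K2, hK2, hW⟩ := exists_potDeriv_le hγ hγ'
  obtain ⟨c0, hc0, hA0⟩ := exists_le_abar_form hγ hγ'
  obtain ⟨c1, C1, hc1, hC1, hW0⟩ := exists_le_potential hγ hγ'
  set K := max K1 K2 with hKd
  have hK : 1 ≤ K := hK1.trans (le_max_left _ _)
  set c := min c0 c1 with hcd
  have hc : 0 < c := lt_min hc0 hc1
  refine ⟨c / 2, C1 + 4 * K ^ 2 / c + 1 + 2 * (2 / c + 1), K, by positivity, by positivity, hK,
    fun α D n v P q Ω Λ hP hPΩ hΛ hq => ?_⟩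
  set U := conv (D α) (moll n) v with hU
  set ξ := grad (conv (D α) (moll n)) v with hξ
  have hbp := bracket_pos v
  set bh := bracket v ^ (γ / 2) with hbh
  have hbh0 : 0 < bh := Real.rpow_pos_of_pos hbp _
  have hbi : bracket v ^ (-(γ / 2)) = bh⁻¹ := Real.rpow_neg hbp.le _
  have hb1 : bracket v ^ (γ / 2 + 1) = bh * bracket v := by
    rw [Real.rpow_add hbp, Real.rpow_one]
  have hb2 : bracket v ^ (γ + 2) = bh ^ 2 * bracket v ^ 2 := by
    rw [hbh, ← Real.rpow_natCast, ← Real.rpow_natCast, ← Real.rpow_mul hbp.le,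
      ← Real.rpow_add hbp]
    norm_num
  have hbγ : bracket v ^ γ = bh ^ 2 := by
    rw [hbh, ← Real.rpow_natCast, ← Real.rpow_mul hbp.le]; norm_num
  have hbr := one_le_bracket v
  have hΩ : 0 ≤ Ω := hP.trans hPΩ
  set a := √(mform γ v ξ) with ha
  have ha0 : 0 ≤ a := Real.sqrt_nonneg _
  set b := bh * bracket v * |U| with hb
  have hb0 : 0 ≤ b := by positivity
  set z := Ω * bh * |U| with hz
  have hz0 : 0 ≤ z := by positivity
  set S1 := fun β => √(mform γ v (grad (conv (D (α - β)) (moll n)) v)) with hS1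
  set S2 := fun β => bh * bracket v * |conv (D (α - β)) (moll n) v| with hS2
  have hS10 : ∀ β, 0 ≤ S1 β := fun β => Real.sqrt_nonneg _
  have hS20 : ∀ β, 0 ≤ S2 β := fun β => by simp only [hS2]; positivity
  set F := fun β => ∑ i, ∑ j, |friedrichs (abarDeriv γ i j β) i n (D (α - β)) v| with hF
  set G := fun β => |mulComm (potDeriv γ β) n (D (α - β)) v| with hG
  have hF0 : ∀ β, 0 ≤ F β := fun β => Finset.sum_nonneg fun i _ => Finset.sum_nonneg fun j _ =>
    abs_nonneg _
  have hG0 : ∀ β, 0 ≤ G β := fun β => abs_nonneg _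
  set m := fun β => K ^ (len β + 1) * (multiFactorial β : ℝ) with hm
  have hm0 : ∀ β, 0 ≤ m β := fun β => by simp only [hm]; positivity
  have hL : lowerTerms γ K n D α v = ∑ β ∈ (box α).erase 0, (binom α β : ℝ) * m β *
      (S1 β + S2 β) := by
    rw [lowerTerms, hb1]
  have hCm : commTerms γ n D α v = bh⁻¹ * ∑ β ∈ box α, (binom α β : ℝ) * (F β + G β) := by
    rw [commTerms, hbi]
  set L := lowerTerms γ K n D α v
  set M := commTerms γ n D α v
  have hqv : |q| * |U| * (bh * ‖v‖) ≤ Λ * z := by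
    calc _ = (|q| * ‖v‖) * (bh * |U|) := by ring
      _ ≤ (Λ * Ω) * (bh * |U|) := by gcongr
      _ = _ := by rw [hz]; ring
  have hKK : ∀ (K' : ℝ) (β : Fin 3 → ℕ), 1 ≤ K' → K' ≤ K →
      K' ^ (len β + 1) * (multiFactorial β : ℝ) ≤ m β := by
    intro K' β h1 h2
    simp only [hm]
    gcongr
  -- the bilinear form on a test vector
  have hform : ∀ (β : Fin 3 → ℕ) (χ : Fin 3 → ℝ),
      |∑ i, ∑ j, abarDeriv γ i j β v * χ i * (P ^ 2 * ξ j + 2 * P * q * U * v j)|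
        ≤ m β * √(mform γ v χ) * (P ^ 2 * a + 2 * P * (Λ * z)) := by
    intro β χ
    rw [sum_form_lin (fun i j => abarDeriv γ i j β v) χ ξ (fun j => v j)]
    have h1 := (hA β v χ ξ).trans (mul_le_mul_of_nonneg_right (hKK K1 β hK1 (le_max_left _ _))
      (by positivity))
    have h2 := (hA β v χ (fun j => v j)).trans (mul_le_mul_of_nonneg_right
      (hKK K1 β hK1 (le_max_left _ _)) (by positivity))
    rw [sqrt_mform_self, ← hbh] at h2
    have hX : 0 ≤ m β * √(mform γ v χ) := mul_nonneg (hm0 β) (Real.sqrt_nonneg _)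
    calc _ ≤ |P ^ 2 * (∑ i, ∑ j, abarDeriv γ i j β v * χ i * ξ j)|
          + |2 * P * q * U * (∑ i, ∑ j, abarDeriv γ i j β v * χ i * v j)| := abs_add_le _ _
      _ ≤ P ^ 2 * (m β * (√(mform γ v χ) * a))
          + 2 * P * |q| * |U| * (m β * (√(mform γ v χ) * (bh * ‖v‖))) := by
          rw [abs_mul, abs_mul, abs_mul, abs_mul, abs_of_nonneg (sq_nonneg P),
            abs_of_nonneg (by positivity : 0 ≤ 2 * P)]
          gcongr
      _ = (m β * √(mform γ v χ)) * (P ^ 2 * a + 2 * P * (|q| * |U| * (bh * ‖v‖))) := by ring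
      _ ≤ _ := by gcongr
  have hη : ∀ j, |P ^ 2 * ξ j + 2 * P * q * U * v j| ≤ bh⁻¹ * (P ^ 2 * a + 2 * P * (Λ * z)) := by
    intro j
    have h1 := abs_le_sqrt_mform γ v ξ j
    rw [hbi] at h1
    have h2 : |q| * |U| * |v j| ≤ bh⁻¹ * (Λ * z) := by
      have h3 := abs_coord_le v j
      calc _ ≤ |q| * |U| * ‖v‖ := by gcongr
        _ = bh⁻¹ * (|q| * |U| * (bh * ‖v‖)) := by field_simp
        _ ≤ _ := by gcongr
    calc _ ≤ |P ^ 2 * ξ j| + |2 * P * q * U * v j| := abs_add_le _ _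
      _ = P ^ 2 * |ξ j| + 2 * P * (|q| * |U| * |v j|) := by
          rw [abs_mul, abs_mul, abs_mul, abs_mul, abs_of_nonneg (sq_nonneg P),
            abs_of_nonneg (by positivity : 0 ≤ 2 * P)]
          ring
      _ ≤ P ^ 2 * (bh⁻¹ * a) + 2 * P * (bh⁻¹ * (Λ * z)) := by gcongr
      _ = _ := by ring
  have hFη : ∀ β, |∑ i, ∑ j, friedrichs (abarDeriv γ i j β) i n (D (α - β)) v *
      (P ^ 2 * ξ j + 2 * P * q * U * v j)| ≤ F β * (bh⁻¹ * (P ^ 2 * a + 2 * P * (Λ * z))) := by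
    intro β
    simp only [hF, Finset.sum_mul]
    refine (Finset.abs_sum_le_sum_abs _ _).trans (Finset.sum_le_sum fun i _ => ?_)
    refine (Finset.abs_sum_le_sum_abs _ _).trans (Finset.sum_le_sum fun j _ => ?_)
    rw [abs_mul]
    exact mul_le_mul_of_nonneg_left (hη j) (abs_nonneg _)
  -- expansion of the flux term
  have hflux : (∑ i, ∑ j, fluxPart γ n D α i j v * (P ^ 2 * pd j (conv (D α) (moll n)) v
        + 2 * P * (q * v j) * U))
      = (∑ β ∈ box α, (binom α β : ℝ) * ∑ i, ∑ j, abarDeriv γ i j β v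
          * grad (conv (D (α - β)) (moll n)) v i * (P ^ 2 * ξ j + 2 * P * q * U * v j))
        + ∑ β ∈ box α, (binom α β : ℝ) * ∑ i, ∑ j, friedrichs (abarDeriv γ i j β) i n (D (α - β)) v
          * (P ^ 2 * ξ j + 2 * P * q * U * v j) := by
    rw [← Finset.sum_add_distrib]
    simp only [fluxPart, Finset.sum_mul]
    have e : ∀ i, ∑ j, ∑ β ∈ box α, (binom α β : ℝ) * (abarDeriv γ i j β v
        * pd i (conv (D (α - β)) (moll n)) v + friedrichs (abarDeriv γ i j β) i n (D (α - β)) v)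
          * (P ^ 2 * pd j (conv (D α) (moll n)) v + 2 * P * (q * v j) * U)
        = ∑ β ∈ box α, ∑ j, (binom α β : ℝ) * (abarDeriv γ i j β v
        * pd i (conv (D (α - β)) (moll n)) v + friedrichs (abarDeriv γ i j β) i n (D (α - β)) v)
          * (P ^ 2 * pd j (conv (D α) (moll n)) v + 2 * P * (q * v j) * U) := fun i =>
      Finset.sum_comm
    simp only [e]
    rw [Finset.sum_comm]
    refine Finset.sum_congr rfl fun β _ => ?_
    simp only [Finset.mul_sum, ← Finset.sum_add_distrib]
    refine Finset.sum_congr rfl fun i _ => Finset.sum_congr rfl fun j _ => ?_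
    simp only [hξ, grad]
    ring
  have hpot : P ^ 2 * U * potPart γ n D α v
      = (∑ β ∈ box α, (binom α β : ℝ) * (P ^ 2 * U * potDeriv γ β v
          * conv (D (α - β)) (moll n) v))
        + ∑ β ∈ box α, (binom α β : ℝ) * (P ^ 2 * U * mulComm (potDeriv γ β) n (D (α - β)) v) := by
    rw [← Finset.sum_add_distrib, potPart, Finset.mul_sum]
    refine Finset.sum_congr rfl fun β _ => by ring
  have hPz : P ^ 2 * a + 2 * P * (Λ * z) = P * (P * a + 2 * Λ * z) := by ring
  -- the five groups of terms
  have t1 : -(∑ β ∈ box α, (binom α β : ℝ) * ∑ i, ∑ j, abarDeriv γ i j β v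
      * grad (conv (D (α - β)) (moll n)) v i * (P ^ 2 * ξ j + 2 * P * q * U * v j))
      ≤ -(c * (P * a) ^ 2) + 2 * K * Λ * (P * a) * z
        + (∑ β ∈ (box α).erase 0, (binom α β : ℝ) * m β * S1 β)
          * (P ^ 2 * a + 2 * P * (Λ * z)) := by
    rw [← Finset.add_sum_erase _ _ (zero_mem_box α), neg_add, Finset.sum_mul]
    refine add_le_add ?_ ?_
    · rw [binom_zero, Nat.cast_one, one_mul, sum_form_lin (fun i j => abarDeriv γ i j 0 v) _ ξ
        (fun j => v j), tsub_zero, ← hξ]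
      have h1 := hA0 v ξ
      have h2 := hA 0 v ξ (fun j => v j)
      rw [sqrt_mform_self, ← hbh] at h2
      simp only [abarDeriv_zero] at h2 ⊢
      have h3 : |2 * P * q * U * ∑ i, ∑ j, abar γ i j v * ξ i * v j| ≤ 2 * K * Λ * (P * a) * z := by
        have h4 : K1 ^ (len 0 + 1) * (multiFactorial 0 : ℝ) ≤ K := by
          have : len 0 = 0 := by simp [len]
          have h5 : multiFactorial 0 = 1 := by simp [multiFactorial]
          rw [this, h5]; simp [hKd]
        calc _ = 2 * P * |q| * |U| * |∑ i, ∑ j, abar γ i j v * ξ i * v j| := by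
              rw [abs_mul, abs_mul, abs_mul, abs_of_nonneg (by positivity : 0 ≤ 2 * P)]
          _ ≤ 2 * P * |q| * |U| * (K * (a * (bh * ‖v‖))) := by
              have := h2.trans (mul_le_mul_of_nonneg_right h4 (by positivity))
              gcongr
          _ = 2 * P * K * a * (|q| * |U| * (bh * ‖v‖)) := by ring
          _ ≤ 2 * P * K * a * (Λ * z) := by gcongr
          _ = _ := by ring
      have h5 : a ^ 2 = mform γ v ξ := Real.sq_sqrt (mform_nonneg γ v ξ)
      have h6 : c * (P * a) ^ 2 ≤ P ^ 2 * ∑ i, ∑ j, abar γ i j v * ξ i * ξ j := by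
        calc c * (P * a) ^ 2 = P ^ 2 * (c * mform γ v ξ) := by rw [mul_pow, h5]; ring
          _ ≤ P ^ 2 * (c0 * mform γ v ξ) := by
              have := mform_nonneg γ v ξ
              gcongr
              exact min_le_left _ _
          _ ≤ _ := by gcongr
      linarith [neg_abs_le (2 * P * q * U * ∑ i, ∑ j, abar γ i j v * ξ i * v j)]
    · rw [← Finset.sum_neg_distrib]
      refine Finset.sum_le_sum fun β _ => ?_
      have := hform β (grad (conv (D (α - β)) (moll n)) v)
      calc _ ≤ (binom α β : ℝ) * |∑ i, ∑ j, abarDeriv γ i j β v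
            * grad (conv (D (α - β)) (moll n)) v i * (P ^ 2 * ξ j + 2 * P * q * U * v j)| := by
            rw [← mul_neg]
            gcongr
            exact neg_le_abs _
        _ ≤ (binom α β : ℝ) * (m β * S1 β * (P ^ 2 * a + 2 * P * (Λ * z))) := by gcongr
        _ = _ := by ring
  have t2 : -(∑ β ∈ box α, (binom α β : ℝ) * ∑ i, ∑ j, friedrichs (abarDeriv γ i j β) i n
      (D (α - β)) v * (P ^ 2 * ξ j + 2 * P * q * U * v j))
      ≤ (bh⁻¹ * ∑ β ∈ box α, (binom α β : ℝ) * F β) * (P ^ 2 * a + 2 * P * (Λ * z)) := by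
    rw [← Finset.sum_neg_distrib, Finset.mul_sum, Finset.sum_mul]
    refine Finset.sum_le_sum fun β _ => ?_
    calc _ ≤ (binom α β : ℝ) * |∑ i, ∑ j, friedrichs (abarDeriv γ i j β) i n
          (D (α - β)) v * (P ^ 2 * ξ j + 2 * P * q * U * v j)| := by
          rw [← mul_neg]
          gcongr
          exact neg_le_abs _
      _ ≤ (binom α β : ℝ) * (F β * (bh⁻¹ * (P ^ 2 * a + 2 * P * (Λ * z)))) := by
          have := hFη β
          gcongr
      _ = _ := by ring
  have t3 : -(∑ β ∈ box α, (binom α β : ℝ) * (P ^ 2 * U * potDeriv γ β v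
      * conv (D (α - β)) (moll n) v))
      ≤ -(c * (P * b) ^ 2) + C1 * z ^ 2
        + (∑ β ∈ (box α).erase 0, (binom α β : ℝ) * m β * S2 β) * (P ^ 2 * b) := by
    rw [← Finset.add_sum_erase _ _ (zero_mem_box α), neg_add, Finset.sum_mul]
    refine add_le_add ?_ ?_
    · rw [binom_zero, Nat.cast_one, one_mul, tsub_zero, potDeriv_zero hγ hγ', ← hU]
      have h1 := hW0 v
      rw [hb2, hbγ] at h1
      have h2 : P ^ 2 * U ^ 2 * (c1 * (bh ^ 2 * bracket v ^ 2) - C1 * bh ^ 2)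
          ≤ P ^ 2 * U ^ 2 * potential γ v := by gcongr
      have h3 : c * (P * b) ^ 2 ≤ P ^ 2 * U ^ 2 * (c1 * (bh ^ 2 * bracket v ^ 2)) := by
        calc c * (P * b) ^ 2 = c * (P ^ 2 * U ^ 2 * (bh ^ 2 * bracket v ^ 2)) := by
              rw [hb, mul_pow, mul_pow, mul_pow, sq_abs]; ring
          _ ≤ c1 * (P ^ 2 * U ^ 2 * (bh ^ 2 * bracket v ^ 2)) := by
              gcongr
              exact min_le_right _ _
          _ = _ := by ring
      have h4 : P ^ 2 * U ^ 2 * (C1 * bh ^ 2) ≤ C1 * z ^ 2 := by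
        calc _ = C1 * (P ^ 2 * (bh ^ 2 * U ^ 2)) := by ring
          _ ≤ C1 * (Ω ^ 2 * (bh ^ 2 * U ^ 2)) := by gcongr
          _ = _ := by rw [hz, mul_pow, mul_pow, sq_abs]; ring
      linarith [h2, h3, h4]
    · rw [← Finset.sum_neg_distrib]
      refine Finset.sum_le_sum fun β _ => ?_
      have h1 := (hW β v).trans (mul_le_mul_of_nonneg_right (hKK K2 β hK2 (le_max_right _ _))
        (Real.rpow_nonneg hbp.le _))
      rw [hb2] at h1
      calc _ ≤ (binom α β : ℝ) * |P ^ 2 * U * potDeriv γ β v * conv (D (α - β)) (moll n) v| := by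
            rw [← mul_neg]
            gcongr
            exact neg_le_abs _
        _ = (binom α β : ℝ) * (P ^ 2 * |U| * |potDeriv γ β v| * |conv (D (α - β)) (moll n) v|) := by
            rw [abs_mul, abs_mul, abs_mul, abs_of_nonneg (sq_nonneg P)]
        _ ≤ (binom α β : ℝ) * (P ^ 2 * |U| * (m β * (bh ^ 2 * bracket v ^ 2))
            * |conv (D (α - β)) (moll n) v|) := by gcongr
        _ = _ := by simp only [hS2, hb]; ring
  have t4 : -(∑ β ∈ box α, (binom α β : ℝ) * (P ^ 2 * U * mulComm (potDeriv γ β) n (D (α - β)) v))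
      ≤ (bh⁻¹ * ∑ β ∈ box α, (binom α β : ℝ) * G β) * (P ^ 2 * b) := by
    rw [← Finset.sum_neg_distrib, Finset.mul_sum, Finset.sum_mul]
    refine Finset.sum_le_sum fun β _ => ?_
    have h1 : |U| ≤ bh⁻¹ * b := by
      rw [hb, ← mul_assoc, ← mul_assoc, inv_mul_cancel₀ hbh0.ne', one_mul]
      exact le_mul_of_one_le_left (abs_nonneg U) hbr
    calc _ ≤ (binom α β : ℝ) * |P ^ 2 * U * mulComm (potDeriv γ β) n (D (α - β)) v| := by
          rw [← mul_neg]
          gcongr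
          exact neg_le_abs _
      _ = (binom α β : ℝ) * (P ^ 2 * |U| * G β) := by
          rw [abs_mul, abs_mul, abs_of_nonneg (sq_nonneg P)]
      _ ≤ (binom α β : ℝ) * (P ^ 2 * (bh⁻¹ * b) * G β) := by
          have := hG0 β
          gcongr
      _ = _ := by ring
  set l1 := ∑ β ∈ (box α).erase 0, (binom α β : ℝ) * m β * S1 β with hl1
  set l2 := ∑ β ∈ (box α).erase 0, (binom α β : ℝ) * m β * S2 β with hl2
  set f1 := bh⁻¹ * ∑ β ∈ box α, (binom α β : ℝ) * F β with hf1
  set f2 := bh⁻¹ * ∑ β ∈ box α, (binom α β : ℝ) * G β with hf2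
  have hl10 : 0 ≤ l1 := Finset.sum_nonneg fun β _ =>
    mul_nonneg (mul_nonneg (Nat.cast_nonneg _) (hm0 β)) (hS10 β)
  have hl20 : 0 ≤ l2 := Finset.sum_nonneg fun β _ =>
    mul_nonneg (mul_nonneg (Nat.cast_nonneg _) (hm0 β)) (hS20 β)
  have hf10 : 0 ≤ f1 := mul_nonneg (inv_nonneg.2 hbh0.le) (Finset.sum_nonneg fun β _ =>
    mul_nonneg (Nat.cast_nonneg _) (hF0 β))
  have hf20 : 0 ≤ f2 := mul_nonneg (inv_nonneg.2 hbh0.le) (Finset.sum_nonneg fun β _ =>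
    mul_nonneg (Nat.cast_nonneg _) (hG0 β))
  have hLs : L = l1 + l2 := by
    rw [hL, hl1, hl2, ← Finset.sum_add_distrib]
    exact Finset.sum_congr rfl fun β _ => by ring
  have hMs : M = f1 + f2 := by
    rw [hCm, hf1, hf2, ← mul_add, ← Finset.sum_add_distrib]
    congr 1
    exact Finset.sum_congr rfl fun β _ => by ring
  have hsum : (l1 + f1) * (P ^ 2 * a + 2 * P * (Λ * z)) + (l2 + f2) * (P ^ 2 * b)
      ≤ (P * a + 2 * Λ * z + P * b) * (P * (L + M)) := by
    have h1 : l1 + f1 ≤ L + M := by rw [hLs, hMs]; linarith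
    have h2 : l2 + f2 ≤ L + M := by rw [hLs, hMs]; linarith
    have h3 : 0 ≤ P ^ 2 * a + 2 * P * (Λ * z) := by positivity
    have h4 : 0 ≤ P ^ 2 * b := by positivity
    calc _ ≤ (L + M) * (P ^ 2 * a + 2 * P * (Λ * z)) + (L + M) * (P ^ 2 * b) := by gcongr
      _ = _ := by ring
  have hy := young_energy' (K := K) (Λ := Λ) (P := P) (a := a) (b := b) (z := z) (L := L) (M := M)
    hc hC1.le
  have hed : edens γ v ξ U = a ^ 2 + b ^ 2 := by
    rw [edens, ha, Real.sq_sqrt (mform_nonneg γ v ξ), hb, hb2, mul_pow, mul_pow, sq_abs]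
  have hz2 : Ω ^ 2 * bracket v ^ γ * U ^ 2 = z ^ 2 := by
    rw [hz, hbγ, mul_pow, mul_pow, sq_abs]
  rw [hflux, hpot, hed, hz2]
  refine le_trans ?_ hy
  have e9 : (l1 + f1) * (P ^ 2 * a + 2 * P * (Λ * z)) = l1 * (P ^ 2 * a + 2 * P * (Λ * z))
    + f1 * (P ^ 2 * a + 2 * P * (Λ * z)) := add_mul _ _ _
  have e10 : (l2 + f2) * (P ^ 2 * b) = l2 * (P ^ 2 * b) + f2 * (P ^ 2 * b) := add_mul _ _ _
  rw [e9, e10] at hsum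
  clear hy hflux hpot hform hη hFη hed hz2 hL hCm hPz
  linarith only [t1, t2, t3, t4, hsum]

end

section

/-! ### Radial weights with compact support -/

/-- The weight `⟨v⟩^θ`, smoothly cut off between the radii `R` and `2 R`. -/
def cutoff (θ R : ℝ) (v : V) : ℝ := bracket v ^ θ * Real.smoothTransition (2 - ‖v‖ ^ 2 / R ^ 2)

lemma contDiff_cutoff (θ R : ℝ) : ContDiff ℝ ∞ (cutoff θ R) :=
  (contDiff_bracket_rpow θ).mul (Real.smoothTransition.contDiff.comp
    (contDiff_const.sub ((contDiff_norm_sq ℝ).div_const _)))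

lemma cutoff_nonneg (θ R : ℝ) (v : V) : 0 ≤ cutoff θ R v :=
  mul_nonneg (Real.rpow_nonneg (bracket_pos v).le _) (Real.smoothTransition.nonneg _)

lemma cutoff_le (θ R : ℝ) (v : V) : cutoff θ R v ≤ bracket v ^ θ :=
  mul_le_of_le_one_right (Real.rpow_nonneg (bracket_pos v).le _) (Real.smoothTransition.le_one _)

lemma cutoff_eq_zero {θ R : ℝ} (hR : 0 < R) {v : V} (hv : v ∉ Metric.ball (0 : V) (2 * R)) :
    cutoff θ R v = 0 := by
  rw [cutoff, Real.smoothTransition.zero_of_nonpos, mul_zero]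
  simp only [Metric.mem_ball, dist_zero_right, not_lt] at hv
  have : 2 ≤ ‖v‖ ^ 2 / R ^ 2 := by
    rw [le_div_iff₀ (by positivity)]
    nlinarith
  linarith

lemma cutoff_eq {θ R : ℝ} (hR : 0 < R) {v : V} (hv : v ∈ Metric.ball (0 : V) R) :
    cutoff θ R v = bracket v ^ θ := by
  rw [cutoff, Real.smoothTransition.one_of_one_le, mul_one]
  simp only [Metric.mem_ball, dist_zero_right] at hv
  have : ‖v‖ ^ 2 / R ^ 2 ≤ 1 := by
    rw [div_le_one (by positivity)]
    exact pow_le_pow_left₀ (norm_nonneg v) hv.le 2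
  linarith

lemma cutoff_mono {θ R R' : ℝ} (hR : 0 < R) (h : R ≤ R') (v : V) :
    cutoff θ R v ≤ cutoff θ R' v := by
  rw [cutoff, cutoff]
  have : 0 ≤ bracket v ^ θ := Real.rpow_nonneg (bracket_pos v).le _
  gcongr
  exact Real.smoothTransition.monotone (by gcongr)

lemma hasCompactSupport_cutoff {θ R : ℝ} (hR : 0 < R) : HasCompactSupport (cutoff θ R) :=
  HasCompactSupport.of_support_subset_isCompact (isCompact_closedBall (0 : V) (2 * R))
    fun v hv => by
      by_contra h
      exact hv (cutoff_eq_zero hR fun h2 => h (Metric.ball_subset_closedBall h2))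

lemma exists_deriv_smoothTransition_le : ∃ S, 0 ≤ S ∧ ∀ x, |deriv Real.smoothTransition x| ≤ S := by
  have hc : Continuous (deriv Real.smoothTransition) :=
    (Real.smoothTransition.contDiff (n := 1)).continuous_deriv le_rfl
  obtain ⟨S, hS⟩ := (isCompact_Icc (a := (0 : ℝ)) (b := 1)).exists_bound_of_continuousOn
    hc.continuousOn
  refine ⟨max S 0, le_max_right _ _, fun x => ?_⟩
  by_cases h0 : x < 0
  · have : Real.smoothTransition =ᶠ[𝓝 x] fun _ => 0 := by
      filter_upwards [Iio_mem_nhds h0] with y hy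
      exact Real.smoothTransition.zero_of_nonpos (le_of_lt hy)
    rw [this.deriv_eq]; simp
  by_cases h1 : 1 < x
  · have : Real.smoothTransition =ᶠ[𝓝 x] fun _ => 1 := by
      filter_upwards [Ioi_mem_nhds h1] with y hy
      exact Real.smoothTransition.one_of_one_le (le_of_lt hy)
    rw [this.deriv_eq]; simp
  · exact (hS x ⟨not_lt.1 h0, not_lt.1 h1⟩).trans (le_max_left _ _)

/-- The weight that dominates the cutoff and its radial derivative. -/
def outer (θ R : ℝ) (v : V) : ℝ := (Metric.ball (0 : V) (2 * R)).indicator (fun v => bracket v ^ θ) v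

lemma cutoff_le_outer {θ R : ℝ} (hR : 0 < R) (v : V) : cutoff θ R v ≤ outer θ R v := by
  by_cases hv : v ∈ Metric.ball (0 : V) (2 * R)
  · rw [outer, indicator_of_mem hv]; exact cutoff_le θ R v
  · rw [outer, indicator_of_notMem hv, cutoff_eq_zero hR hv]

lemma hasFDerivAt_norm_sq (v : V) :
    HasFDerivAt (fun w : V => ‖w‖ ^ 2) (∑ j, (2 * v j) • coord j) v := by
  have h : ∀ j, HasFDerivAt (fun w : V => w j ^ 2) ((2 * v j) • coord j) v := fun j => by
    have := ((coord j).hasFDerivAt (x := v)).pow 2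
    simpa [coord] using! this
  have := HasFDerivAt.fun_sum fun j (_ : j ∈ Finset.univ) => h j
  simpa only [norm_sq_eq_sum] using this

/-- The constant is linear in `|θ|` and uniform in `R ≥ 1`. Differentiating `⟨v⟩^θ` costs `|θ|`, and
the cutoff varies on the scale `R`, where `‖v‖ < 2R`. With `θ = γ|α|/2`, the squared constant grows
like `|α|²`, which the factorials can absorb. -/
lemma exists_pd_cutoff : ∃ S, 0 ≤ S ∧ ∀ θ R : ℝ, 1 ≤ R → ∀ v, ∃ q : ℝ,
    (∀ j, pd j (cutoff θ R) v = q * v j) ∧ |q| * ‖v‖ ≤ (|θ| + S) * outer θ R v := by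
  obtain ⟨S, hS, hSb⟩ := exists_deriv_smoothTransition_le
  refine ⟨4 * S, by positivity, fun θ R hR v => ?_⟩
  have hR0 : 0 < R := by linarith
  by_cases hv : v ∈ Metric.ball (0 : V) (2 * R)
  · have hp := one_add_norm_sq_pos v
    set x := 2 - ‖v‖ ^ 2 / R ^ 2 with hx
    have h1 : HasFDerivAt (fun w : V => bracket w ^ θ)
        ((θ / 2 * (1 + ‖v‖ ^ 2) ^ (θ / 2 - 1)) • ∑ j, (2 * v j) • coord j) v := by
      simp only [bracket_rpow]
      exact ((hasFDerivAt_norm_sq v).const_add 1).rpow_const (Or.inl hp.ne')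
    have h2 : HasFDerivAt (fun w : V => Real.smoothTransition (2 - ‖w‖ ^ 2 / R ^ 2))
        (deriv Real.smoothTransition x • -((R ^ 2)⁻¹ • ∑ j, (2 * v j) • coord j)) v := by
      have h3 : HasFDerivAt (fun w : V => 2 - ‖w‖ ^ 2 / R ^ 2)
          (-((R ^ 2)⁻¹ • ∑ j, (2 * v j) • coord j)) v := by
        simp only [div_eq_mul_inv]
        exact ((hasFDerivAt_norm_sq v).mul_const _).const_sub 2
      have h4 : HasDerivAt Real.smoothTransition (deriv Real.smoothTransition x) x :=
        ((Real.smoothTransition.contDiff (n := 1)).differentiable one_ne_zero x).hasDerivAt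
      exact h4.comp_hasFDerivAt v h3
    set q := bracket v ^ θ * (deriv Real.smoothTransition x * -((R ^ 2)⁻¹ * 2))
      + Real.smoothTransition x * (θ * (1 + ‖v‖ ^ 2) ^ (θ / 2 - 1)) with hq
    refine ⟨q, fun j => ?_, ?_⟩
    · refine pd_eq_of_hasFDerivAt (c := fun j => q * v j) ?_ j
      refine (h1.mul h2).congr_fderiv ?_
      simp only [Finset.smul_sum, ← Finset.sum_neg_distrib, ← Finset.sum_add_distrib]
      refine Finset.sum_congr rfl fun j _ => ?_
      rw [← neg_smul]
      simp only [smul_smul]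
      rw [← add_smul]
      congr 1
      rw [hq]; ring
    · rw [outer, indicator_of_mem hv]
      have hb := bracket_pos v
      have hbθ : 0 ≤ bracket v ^ θ := Real.rpow_nonneg hb.le _
      have hvR : ‖v‖ < 2 * R := by simpa using hv
      have e1 : (1 + ‖v‖ ^ 2) ^ (θ / 2 - 1) * ‖v‖ ≤ bracket v ^ θ := by
        rw [Real.rpow_sub hp, Real.rpow_one, bracket_rpow, div_mul_eq_mul_div, div_le_iff₀ hp]
        have := Real.rpow_nonneg hp.le (θ / 2)
        refine mul_le_mul_of_nonneg_left ?_ this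
        nlinarith [sq_nonneg (‖v‖ - 1), norm_nonneg v]
      have e2 : (R ^ 2)⁻¹ * 2 * ‖v‖ ≤ 4 := by
        rw [mul_assoc, inv_mul_le_iff₀ (by positivity)]
        nlinarith
      have e3 := Real.smoothTransition.nonneg x
      have e4 := Real.smoothTransition.le_one x
      have e5 : |q| ≤ bracket v ^ θ * (S * ((R ^ 2)⁻¹ * 2))
          + |θ| * (1 + ‖v‖ ^ 2) ^ (θ / 2 - 1) := by
        refine (abs_add_le _ _).trans (add_le_add ?_ ?_)
        · rw [abs_mul, abs_mul, abs_neg, abs_of_nonneg hbθ,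
            abs_of_nonneg (by positivity : 0 ≤ (R ^ 2)⁻¹ * 2)]
          gcongr
          exact hSb x
        · have := Real.rpow_nonneg hp.le (θ / 2 - 1)
          rw [abs_mul, abs_mul, abs_of_nonneg e3, abs_of_nonneg this]
          exact mul_le_of_le_one_left (by positivity) e4
      calc |q| * ‖v‖ ≤ (bracket v ^ θ * (S * ((R ^ 2)⁻¹ * 2))
            + |θ| * (1 + ‖v‖ ^ 2) ^ (θ / 2 - 1)) * ‖v‖ := by gcongr
        _ = bracket v ^ θ * S * ((R ^ 2)⁻¹ * 2 * ‖v‖)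
            + |θ| * ((1 + ‖v‖ ^ 2) ^ (θ / 2 - 1) * ‖v‖) := by ring
        _ ≤ bracket v ^ θ * S * 4 + |θ| * bracket v ^ θ := by gcongr
        _ = _ := by ring
  · refine ⟨0, fun j => ?_, ?_⟩
    -- Outside the support the nonnegative weight attains its minimum, so its gradient vanishes;
    -- this also covers the boundary sphere.
    · have h1 : IsLocalMin (cutoff θ R) v := by
        refine Eventually.of_forall fun w => ?_
        rw [cutoff_eq_zero hR0 hv]; exact cutoff_nonneg θ R w
      rw [pd, h1.fderiv_eq_zero]; simp
    · rw [outer, indicator_of_notMem hv]; simp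

/-! ### Inequalities between an extended energy and an integral -/

/-- `A + Φ ≤ B`, for a real number `Φ` of any sign. -/
def EnergyLe (A : ℝ≥0∞) (Φ : ℝ) (B : ℝ≥0∞) : Prop :=
  A + ENNReal.ofReal Φ ≤ B + ENNReal.ofReal (-Φ)

lemma energyLe_of_le {a b Φ : ℝ} (ha : 0 ≤ a) (h : Φ ≤ -a + b) :
    EnergyLe (ENNReal.ofReal a) Φ (ENNReal.ofReal b) := by
  rw [EnergyLe]
  rcases le_total 0 Φ with h0 | h0
  · rw [ENNReal.ofReal_of_nonpos (neg_nonpos.2 h0), add_zero, ← ENNReal.ofReal_add ha h0]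
    exact ENNReal.ofReal_le_ofReal (by linarith)
  · rw [ENNReal.ofReal_of_nonpos h0, add_zero]
    refine le_trans ?_ (ENNReal.ofReal_add_le)
    exact ENNReal.ofReal_le_ofReal (by linarith)

/-- Any splitting of `Φ` into a difference of nonnegative reals gives the same inequality: the
splittings differ by a finite quantity added to both sides. -/
lemma energyLe_iff {A B : ℝ≥0∞} {Φ p m : ℝ} (hp : 0 ≤ p) (hm : 0 ≤ m) (h : Φ = p - m) :
    EnergyLe A Φ B ↔ A + ENNReal.ofReal p ≤ B + ENNReal.ofReal m := by
  rw [EnergyLe]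
  rcases le_total 0 Φ with h0 | h0
  · have : ENNReal.ofReal p = ENNReal.ofReal Φ + ENNReal.ofReal m := by
      rw [← ENNReal.ofReal_add h0 hm]; congr 1; linarith
    rw [this, ← add_assoc, ENNReal.add_le_add_iff_right ENNReal.ofReal_ne_top,
      ENNReal.ofReal_of_nonpos (neg_nonpos.2 h0), add_zero]
  · have : ENNReal.ofReal m = ENNReal.ofReal (-Φ) + ENNReal.ofReal p := by
      rw [← ENNReal.ofReal_add (neg_nonneg.2 h0) hp]; congr 1; linarith
    rw [this, ← add_assoc, ENNReal.add_le_add_iff_right ENNReal.ofReal_ne_top,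
      ENNReal.ofReal_of_nonpos h0, add_zero]

lemma EnergyLe.mono {A A' B B' : ℝ≥0∞} {Φ : ℝ} (h : EnergyLe A Φ B) (hA : A' ≤ A) (hB : B ≤ B') :
    EnergyLe A' Φ B' :=
  (add_le_add_left hA _).trans (h.trans (add_le_add_left hB _))

/-- Only `Φ` has to be integrable. The energies `A` and `B` may be infinite, and no measurability of
them is used. -/
lemma EnergyLe.integral {X : Type*} [MeasurableSpace X] {μ : Measure X} {A B : X → ℝ≥0∞} {Φ : X → ℝ}
    (hΦ : Integrable Φ μ) (h : ∀ᵐ x ∂μ, EnergyLe (A x) (Φ x) (B x)) :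
    EnergyLe (∫⁻ x, A x ∂μ) (∫ x, Φ x ∂μ) (∫⁻ x, B x ∂μ) := by
  have hp := hΦ.1.aemeasurable.ennreal_ofReal
  have hm := hΦ.neg.1.aemeasurable.ennreal_ofReal
  have hpT : ∫⁻ x, ENNReal.ofReal (Φ x) ∂μ ≠ ⊤ :=
    ((lintegral_mono fun x => ENNReal.ofReal_le_ofReal (le_abs_self _)).trans_lt
      (by simpa only [hasFiniteIntegral_iff_norm, Real.norm_eq_abs] using hΦ.2)).ne
  have hmT : ∫⁻ x, ENNReal.ofReal (-Φ x) ∂μ ≠ ⊤ :=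
    ((lintegral_mono fun x => ENNReal.ofReal_le_ofReal (neg_le_abs _)).trans_lt
      (by simpa only [hasFiniteIntegral_iff_norm, Real.norm_eq_abs] using hΦ.2)).ne
  rw [energyLe_iff ENNReal.toReal_nonneg ENNReal.toReal_nonneg
    (integral_eq_lintegral_pos_part_sub_lintegral_neg_part hΦ), ENNReal.ofReal_toReal hpT,
    ENNReal.ofReal_toReal hmT, ← lintegral_add_right' _ hp]
  refine le_trans ?_ (lintegral_add_right' _ hm).le
  exact lintegral_mono_ae h

lemma EnergyLe.const_mul {A B : ℝ≥0∞} {Φ c : ℝ} (h : EnergyLe A Φ B) (hc : 0 ≤ c) :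
    EnergyLe (ENNReal.ofReal c * A) (c * Φ) (ENNReal.ofReal c * B) := by
  rw [EnergyLe, ENNReal.ofReal_mul hc, ← mul_add, ← mul_neg, ENNReal.ofReal_mul hc, ← mul_add]
  exact mul_le_mul_right h _

lemma EnergyLe.add_const {A B : ℝ≥0∞} {Φ r : ℝ} (h : EnergyLe A Φ B) (hr : 0 ≤ r) :
    EnergyLe A (r + Φ) (ENNReal.ofReal r + B) := by
  have h1 : r + Φ = (r + max Φ 0) - max (-Φ) 0 := by
    rcases le_total 0 Φ with h0 | h0
    · rw [max_eq_left h0, max_eq_right (by linarith)]; ring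
    · rw [max_eq_right h0, max_eq_left (by linarith)]; ring
  rw [energyLe_iff (by positivity) (le_max_right _ _) h1, ENNReal.ofReal_add hr (le_max_right _ _)]
  have e : ∀ x : ℝ, ENNReal.ofReal (max x 0) = ENNReal.ofReal x := fun x => by
    rw [ENNReal.ofReal_max]; simp
  rw [e, e]
  calc _ = ENNReal.ofReal r + (A + ENNReal.ofReal Φ) := by ring
    _ ≤ ENNReal.ofReal r + (B + ENNReal.ofReal (-Φ)) := add_le_add_right h _
    _ = _ := by ring

lemma EnergyLe.le {A B : ℝ≥0∞} {y y0 Φ : ℝ} (h : EnergyLe A Φ B) (hy : 0 ≤ y) (hy0 : 0 ≤ y0)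
    (e : y = y0 + Φ) : ENNReal.ofReal y + A ≤ ENNReal.ofReal y0 + B := by
  have := (energyLe_iff hy hy0 (show Φ = y - y0 by linarith)).1 h
  rwa [add_comm A, add_comm B] at this

end

section

/-! ### The integrated energy inequality at a fixed time -/

lemma enorm_sq_eq (x : ℝ) : ‖x‖ₑ ^ 2 = ENNReal.ofReal (x ^ 2) := by
  rw [← ofReal_norm, ← ENNReal.ofReal_pow (norm_nonneg _), norm_sq_real]

/-- The weighted energy of a function `x` with gradient `ξ`. -/
def eInt (γ : ℝ) (P : V → ℝ) (ξ : Fin 3 → V → ℝ) (x : V → ℝ) : ℝ≥0∞ :=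
  ∫⁻ v, ENNReal.ofReal (P v ^ 2 * edens γ v (fun i => ξ i v) (x v))

/-- The weighted `L²` norm. -/
def wInt (γ : ℝ) (P : V → ℝ) (x : V → ℝ) : ℝ≥0∞ :=
  ∫⁻ v, ENNReal.ofReal (P v ^ 2 * bracket v ^ γ * x v ^ 2)

lemma edens_nonneg (γ : ℝ) (v : V) (ξ : Fin 3 → ℝ) (x : ℝ) : 0 ≤ edens γ v ξ x :=
  add_nonneg (mform_nonneg γ v ξ) (mul_nonneg (Real.rpow_nonneg (bracket_pos v).le _) (sq_nonneg x))

/-- The difference of the two sides is the same quadratic form evaluated at `(ξ - 2η, x - 2y)`. -/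
lemma edens_le_add (γ : ℝ) (v : V) (ξ η : Fin 3 → ℝ) (x y : ℝ) :
    edens γ v ξ x ≤ 2 * edens γ v η y + 2 * edens γ v (fun i => ξ i - η i) (x - y) := by
  have h1 := edens_nonneg γ v (fun i => ξ i - 2 * η i) (x - 2 * y)
  have e : 2 * edens γ v η y + 2 * edens γ v (fun i => ξ i - η i) (x - y) - edens γ v ξ x
      = edens γ v (fun i => ξ i - 2 * η i) (x - 2 * y) := by
    simp only [edens, mform, bform, Fin.sum_univ_three]
    ring
  linarith

lemma edens_le (γ : ℝ) (v : V) (ξ : Fin 3 → ℝ) (x : ℝ) :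
    edens γ v ξ x ≤ bracket v ^ (γ + 2) * ((∑ i, ξ i ^ 2) + x ^ 2) := by
  have hb := bracket_pos v
  have h0 : 0 ≤ bracket v ^ γ := Real.rpow_nonneg hb.le _
  have h1 : bracket v ^ (γ + 2) = bracket v ^ γ * (1 + ‖v‖ ^ 2) := by
    rw [← bracket_sq, Real.rpow_add hb]; norm_num
  have h2 : bform v ξ ξ ≤ ‖v‖ ^ 2 * ∑ i, ξ i ^ 2 := by
    rw [bform, norm_sq_eq_sum]
    have := mul_self_nonneg (∑ i, v i * ξ i)
    simp only [← sq] at this ⊢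
    linarith
  have h3 := mul_le_mul_of_nonneg_left h2 h0
  rw [edens, mform, h1]
  generalize (∑ i, ξ i ^ 2) = s at *
  linarith

lemma aemeasurable_enorm_sq {h : V → ℝ} (hh : AEStronglyMeasurable h) (R : ℝ) :
    AEMeasurable (fun v => ‖h v‖ₑ ^ 2) ((volume : Measure V).restrict (Metric.ball 0 R)) :=
  hh.restrict.enorm.pow_const 2

lemma lintegral_le_of_le_on_ball {F G H : V → ℝ≥0∞} {R : ℝ} {A : ℝ≥0∞} (hA : A ≠ ⊤)
    (hH : AEMeasurable H ((volume : Measure V).restrict (Metric.ball 0 R)))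
    (h1 : ∀ v ∈ Metric.ball (0 : V) R, F v ≤ 2 * G v + A * H v)
    (h0 : ∀ v ∉ Metric.ball (0 : V) R, F v = 0) :
    ∫⁻ v, F v ≤ 2 * (∫⁻ v, G v) + A * ∫⁻ v in Metric.ball (0 : V) R, H v := by
  calc ∫⁻ v, F v = ∫⁻ v in Metric.ball (0 : V) R, F v := by
        rw [← lintegral_indicator Metric.isOpen_ball.measurableSet]
        refine lintegral_congr fun v => ?_
        by_cases hv : v ∈ Metric.ball (0 : V) R
        · rw [indicator_of_mem hv]
        · rw [indicator_of_notMem hv, h0 v hv]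
    _ ≤ ∫⁻ v in Metric.ball (0 : V) R, (2 * G v + A * H v) :=
        setLIntegral_mono' Metric.isOpen_ball.measurableSet h1
    _ = 2 * (∫⁻ v in Metric.ball (0 : V) R, G v) + A * ∫⁻ v in Metric.ball (0 : V) R, H v := by
        rw [lintegral_add_right' _ (hH.const_mul _), lintegral_const_mul' _ _ (by norm_num),
          lintegral_const_mul' _ _ hA]
    _ ≤ _ := by
        gcongr
        exact Measure.restrict_le_self

/-- The square of the distance in `L²` of a ball. -/
def distSq (R : ℝ) (x y : V → ℝ) : ℝ≥0∞ := ballSq R fun v => x v - y v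

lemma distSq_comm (R : ℝ) (x y : V → ℝ) : distSq R x y = distSq R y x := by
  refine lintegral_congr fun v => ?_
  simp only [enorm_sq_eq]
  congr 1; ring

lemma exists_eInt_le (γ : ℝ) {P : V → ℝ} (hP : Continuous P) {R : ℝ}
    (hs : ∀ v, v ∉ Metric.ball (0 : V) R → P v = 0) : ∃ A : ℝ≥0∞, A ≠ ⊤ ∧
    ∀ (ξ η : Fin 3 → V → ℝ) (x y : V → ℝ), (∀ i, AEStronglyMeasurable fun v => ξ i v - η i v) →
      (AEStronglyMeasurable fun v => x v - y v) →
      eInt γ P ξ x ≤ 2 * eInt γ P η y + A * ((∑ i, distSq R (ξ i) (η i)) + distSq R x y) := by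
  obtain ⟨A, hA, hAb⟩ := exists_ball_bound
    ((hP.pow 2).mul (contDiff_bracket_rpow (γ + 2)).continuous) R
  refine ⟨ENNReal.ofReal (2 * A), ENNReal.ofReal_ne_top, fun ξ η x y hξ hx => ?_⟩
  have hm : ∀ i, AEMeasurable (fun v => ‖ξ i v - η i v‖ₑ ^ 2)
      ((volume : Measure V).restrict (Metric.ball 0 R)) := fun i => aemeasurable_enorm_sq (hξ i) R
  have hm2 := aemeasurable_enorm_sq hx R
  have hH : AEMeasurable (fun v => (∑ i, ‖ξ i v - η i v‖ₑ ^ 2) + ‖x v - y v‖ₑ ^ 2)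
      ((volume : Measure V).restrict (Metric.ball 0 R)) :=
    (Finset.aemeasurable_fun_sum _ fun i _ => hm i).add hm2
  have e : (∑ i, distSq R (ξ i) (η i)) + distSq R x y
      = ∫⁻ v in Metric.ball (0 : V) R, ((∑ i, ‖ξ i v - η i v‖ₑ ^ 2) + ‖x v - y v‖ₑ ^ 2) := by
    rw [lintegral_add_right' _ hm2, lintegral_finsetSum' _ fun i _ => hm i]
    rfl
  rw [e]
  refine lintegral_le_of_le_on_ball ENNReal.ofReal_ne_top hH (fun v hv => ?_) fun v hv => ?_
  · simp only [enorm_sq_eq]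
    rw [← ENNReal.ofReal_sum_of_nonneg fun i _ => sq_nonneg _,
      ← ENNReal.ofReal_add (Finset.sum_nonneg fun i _ => sq_nonneg _) (sq_nonneg _),
      ← ENNReal.ofReal_mul (by positivity), show (2 : ℝ≥0∞) = ENNReal.ofReal 2 by simp,
      ← ENNReal.ofReal_mul (by norm_num), ← ENNReal.ofReal_add
        (mul_nonneg zero_le_two (mul_nonneg (sq_nonneg _) (edens_nonneg _ _ _ _)))
        (mul_nonneg (by positivity) (add_nonneg (Finset.sum_nonneg fun i _ => sq_nonneg _)
          (sq_nonneg _)))]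
    refine ENNReal.ofReal_le_ofReal ?_
    have h1 := edens_le_add γ v (fun i => ξ i v) (fun i => η i v) (x v) (y v)
    have h2 := edens_le γ v (fun i => ξ i v - η i v) (x v - y v)
    have h3 := (abs_le.1 (hAb v hv)).2
    set X := (∑ i, (ξ i v - η i v) ^ 2) + (x v - y v) ^ 2 with hX
    have hX0 : 0 ≤ X := add_nonneg (Finset.sum_nonneg fun i _ => sq_nonneg _) (sq_nonneg _)
    calc _ ≤ P v ^ 2 * (2 * edens γ v (fun i => η i v) (y v) + 2 * (bracket v ^ (γ + 2) * X)) := by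
          gcongr
          linarith
      _ = 2 * (P v ^ 2 * edens γ v (fun i => η i v) (y v))
          + 2 * ((P v ^ 2 * bracket v ^ (γ + 2)) * X) := by ring
      _ ≤ 2 * (P v ^ 2 * edens γ v (fun i => η i v) (y v)) + 2 * (A * X) := by
          gcongr; exact h3
      _ = _ := by ring
  · rw [hs v hv]; simp

lemma exists_wInt_le (γ θ R : ℝ) : ∃ A : ℝ≥0∞, A ≠ ⊤ ∧
    ∀ (x y : V → ℝ), (AEStronglyMeasurable fun v => x v - y v) →
      wInt γ (outer θ R) x ≤ 2 * wInt γ (outer θ R) y + A * distSq (2 * R) x y := by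
  obtain ⟨A, hA, hAb⟩ := exists_ball_bound
    (((contDiff_bracket_rpow θ).continuous.pow 2).mul (contDiff_bracket_rpow γ).continuous) (2 * R)
  refine ⟨ENNReal.ofReal (2 * A), ENNReal.ofReal_ne_top, fun x y hx => ?_⟩
  refine lintegral_le_of_le_on_ball ENNReal.ofReal_ne_top (aemeasurable_enorm_sq hx _)
    (fun v hv => ?_) fun v hv => ?_
  · have hb : 0 ≤ bracket v ^ γ := Real.rpow_nonneg (bracket_pos v).le _
    rw [enorm_sq_eq, ← ENNReal.ofReal_mul (by positivity), show (2 : ℝ≥0∞) = ENNReal.ofReal 2 by simp,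
      ← ENNReal.ofReal_mul (by norm_num), ← ENNReal.ofReal_add (by positivity) (by positivity)]
    refine ENNReal.ofReal_le_ofReal ?_
    have h3 := (abs_le.1 (hAb v hv)).2
    rw [outer, indicator_of_mem hv]
    have h4 : x v ^ 2 ≤ 2 * y v ^ 2 + 2 * (x v - y v) ^ 2 := by nlinarith [sq_nonneg (x v - 2 * y v)]
    calc _ ≤ (bracket v ^ θ) ^ 2 * bracket v ^ γ * (2 * y v ^ 2 + 2 * (x v - y v) ^ 2) := by gcongr
      _ = 2 * ((bracket v ^ θ) ^ 2 * bracket v ^ γ * y v ^ 2)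
          + 2 * (((bracket v ^ θ) ^ 2 * bracket v ^ γ) * (x v - y v) ^ 2) := by ring
      _ ≤ 2 * ((bracket v ^ θ) ^ 2 * bracket v ^ γ * y v ^ 2) + 2 * (A * (x v - y v) ^ 2) := by
          gcongr; exact h3
      _ = _ := by ring
  · rw [outer, indicator_of_notMem hv]; simp

lemma continuous_edens {γ : ℝ} {ξ : Fin 3 → V → ℝ} {x : V → ℝ} (hξ : ∀ i, Continuous (ξ i))
    (hx : Continuous x) : Continuous fun v => edens γ v (fun i => ξ i v) (x v) := by
  have h1 := (contDiff_bracket_rpow γ).continuous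
  have h2 := (contDiff_bracket_rpow (γ + 2)).continuous
  have h3 : ∀ i : Fin 3, Continuous fun v : V => v i := fun i => (contDiff_coord i).continuous
  simp only [edens, mform, bform]
  fun_prop

/-- The coefficients of the lower order terms. -/
def lowCoeff (K : ℝ) (α β : Fin 3 → ℕ) : ℝ := binom α β * (K ^ (len β + 1) * multiFactorial β)

lemma lowCoeff_nonneg {K : ℝ} (hK : 0 ≤ K) (α β : Fin 3 → ℕ) : 0 ≤ lowCoeff K α β := by
  rw [lowCoeff]; positivity

/-- Cauchy–Schwarz for the lower order terms, with weights `x`. -/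
lemma lowerTerms_sq_le {γ K : ℝ} (hK : 0 ≤ K) (n : ℕ) (D : (Fin 3 → ℕ) → V → ℝ) (α : Fin 3 → ℕ)
    (v : V) {x : (Fin 3 → ℕ) → ℝ} (hx : ∀ β, 0 < x β) :
    lowerTerms γ K n D α v ^ 2 ≤ (∑ β ∈ (box α).erase 0, lowCoeff K α β * x (α - β)) *
      ∑ β ∈ (box α).erase 0, lowCoeff K α β / x (α - β) *
        (2 * edens γ v (grad (conv (D (α - β)) (moll n)) v) (conv (D (α - β)) (moll n) v)) := by
  have hc := lowCoeff_nonneg hK α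
  have h1 := Finset.sum_sq_le_sum_mul_sum_of_sq_eq_mul ((box α).erase 0)
    (r := fun β => lowCoeff K α β * (√(mform γ v (grad (conv (D (α - β)) (moll n)) v))
      + bracket v ^ (γ / 2 + 1) * |conv (D (α - β)) (moll n) v|))
    (f := fun β => lowCoeff K α β * x (α - β))
    (g := fun β => lowCoeff K α β / x (α - β) *
      (√(mform γ v (grad (conv (D (α - β)) (moll n)) v))
      + bracket v ^ (γ / 2 + 1) * |conv (D (α - β)) (moll n) v|) ^ 2)
    (fun β _ => mul_nonneg (hc β) (hx _).le)
    (fun β _ => mul_nonneg (div_nonneg (hc β) (hx _).le) (sq_nonneg _))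
    (fun β _ => by have := (hx (α - β)).ne'; field_simp)
  refine h1.trans (mul_le_mul_of_nonneg_left ?_
    (Finset.sum_nonneg fun β _ => mul_nonneg (hc β) (hx _).le))
  refine Finset.sum_le_sum fun β _ => mul_le_mul_of_nonneg_left ?_ (div_nonneg (hc β) (hx _).le)
  rw [edens]
  have hb : bracket v ^ (γ + 2) = (bracket v ^ (γ / 2 + 1)) ^ 2 := by
    rw [← Real.rpow_natCast, ← Real.rpow_mul (bracket_pos v).le]; ring_nf
  have h2 := Real.sq_sqrt (mform_nonneg γ v (grad (conv (D (α - β)) (moll n)) v))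
  rw [hb]
  nlinarith [sq_nonneg (√(mform γ v (grad (conv (D (α - β)) (moll n)) v))
      - bracket v ^ (γ / 2 + 1) * |conv (D (α - β)) (moll n) v|),
      sq_abs (conv (D (α - β)) (moll n) v)]

/-- The factor 18 is 2 · 9: nine flux commutators for each `β`, and a factor 2 to separate them from
the potential commutator. Its growth with `α` is harmless, because these terms vanish in the limit.
-/
lemma commTerms_sq_le (γ : ℝ) (n : ℕ) (D : (Fin 3 → ℕ) → V → ℝ) (α : Fin 3 → ℕ) (v : V) :
    commTerms γ n D α v ^ 2 ≤ bracket v ^ (-γ) * (18 * ∑ β ∈ box α, (binom α β : ℝ) ^ 2) *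
      ∑ β ∈ box α, ((∑ i, ∑ j, friedrichs (abarDeriv γ i j β) i n (D (α - β)) v ^ 2)
        + mulComm (potDeriv γ β) n (D (α - β)) v ^ 2) := by
  have hb : bracket v ^ (-γ) = (bracket v ^ (-(γ / 2))) ^ 2 := by
    rw [← Real.rpow_natCast, ← Real.rpow_mul (bracket_pos v).le]; ring_nf
  rw [commTerms, mul_pow, hb, mul_assoc]
  refine mul_le_mul_of_nonneg_left ?_ (sq_nonneg _)
  refine (Finset.sum_mul_sq_le_sq_mul_sq _ _ _).trans ?_
  rw [mul_comm (18 : ℝ), mul_assoc, Finset.mul_sum (box α) _ (18 : ℝ)]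
  refine mul_le_mul_of_nonneg_left ?_ (Finset.sum_nonneg fun _ _ => sq_nonneg _)
  refine Finset.sum_le_sum fun β _ => ?_
  have h1 : (∑ i, ∑ j, |friedrichs (abarDeriv γ i j β) i n (D (α - β)) v|) ^ 2
      ≤ 9 * ∑ i, ∑ j, friedrichs (abarDeriv γ i j β) i n (D (α - β)) v ^ 2 := by
    refine (sq_sum_le_card_mul_sum_sq (s := Finset.univ)).trans ?_
    simp only [Finset.card_univ, Fintype.card_fin, Nat.cast_ofNat]
    have : ∀ i, (∑ j, |friedrichs (abarDeriv γ i j β) i n (D (α - β)) v|) ^ 2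
        ≤ 3 * ∑ j, friedrichs (abarDeriv γ i j β) i n (D (α - β)) v ^ 2 := fun i => by
      refine (sq_sum_le_card_mul_sum_sq (s := Finset.univ)).trans ?_
      simp only [Finset.card_univ, Fintype.card_fin, Nat.cast_ofNat, sq_abs, le_refl]
    have h2 := Finset.sum_le_sum fun i (_ : i ∈ Finset.univ) => this i
    rw [← Finset.mul_sum] at h2
    linarith
  set a := ∑ i, ∑ j, |friedrichs (abarDeriv γ i j β) i n (D (α - β)) v|
  have h3 := sq_abs (mulComm (potDeriv γ β) n (D (α - β)) v)
  nlinarith [sq_nonneg (a - |mulComm (potDeriv γ β) n (D (α - β)) v|),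
    sq_nonneg (mulComm (potDeriv γ β) n (D (α - β)) v)]

/-- The commutator part of the approximation error. -/
def commErr (γ R : ℝ) (α : Fin 3 → ℕ) (n : ℕ) (D : (Fin 3 → ℕ) → V → ℝ) : ℝ≥0∞ :=
  ∑ β ∈ box α, ((∑ i, ∑ j, ballSq R (friedrichs (abarDeriv γ i j β) i n (D (α - β))))
    + ballSq R (mulComm (potDeriv γ β) n (D (α - β))))

/-- The approximation error in the energy inequality. -/
def errTerm (γ R : ℝ) (α : Fin 3 → ℕ) (n : ℕ) (D : (Fin 3 → ℕ) → V → ℝ) : ℝ≥0∞ :=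
  distSq R (conv (D α) (moll n)) (D α)
    + (∑ β ∈ (box α).erase 0, ((∑ i, distSq R (conv (D (α - β + unitIdx i)) (moll n))
        (D (α - β + unitIdx i))) + distSq R (conv (D (α - β)) (moll n)) (D (α - β))))
    + commErr γ R α n D

lemma continuous_mulComm {a D : V → ℝ} (ha : Continuous a) (hD : L2Loc D) (n : ℕ) :
    Continuous (mulComm a n D) :=
  (continuous_conv (hD.mul ha) n).sub (ha.mul (continuous_conv hD n))

lemma exists_commTerms_le {γ : ℝ} (hγ : -3 < γ) (hγ' : γ < 0) {P : V → ℝ} (hP : Continuous P) {R : ℝ}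
    (hs : ∀ v, v ∉ Metric.ball (0 : V) R → P v = 0) (α : Fin 3 → ℕ) : ∃ A : ℝ≥0∞, A ≠ ⊤ ∧
    ∀ (D : (Fin 3 → ℕ) → V → ℝ), (∀ δ ≤ α, L2Loc (D δ)) → ∀ n,
      ∫⁻ v, ENNReal.ofReal (P v ^ 2 * commTerms γ n D α v ^ 2) ≤ A * commErr γ R α n D := by
  obtain ⟨A, hA, hAb⟩ := exists_ball_bound
    ((hP.pow 2).mul ((contDiff_bracket_rpow (-γ)).continuous.mul
      (continuous_const (y := 18 * ∑ β ∈ box α, (binom α β : ℝ) ^ 2)))) R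
  refine ⟨ENNReal.ofReal A, ENNReal.ofReal_ne_top, fun D hD n => ?_⟩
  have m1 : ∀ β i j, AEMeasurable
      (fun v => ‖friedrichs (abarDeriv γ i j β) i n (D (α - β)) v‖ₑ ^ 2)
      ((volume : Measure V).restrict (Metric.ball 0 R)) := fun β i j =>
    aemeasurable_enorm_sq (continuous_friedrichs ((isDerivFamily_abarDeriv hγ hγ' i j).contDiff β)
      (hD _ tsub_le_self) i n).aestronglyMeasurable R
  have m2 : ∀ β, AEMeasurable (fun v => ‖mulComm (potDeriv γ β) n (D (α - β)) v‖ₑ ^ 2)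
      ((volume : Measure V).restrict (Metric.ball 0 R)) := fun β =>
    aemeasurable_enorm_sq (continuous_mulComm ((isDerivFamily_potDeriv hγ hγ').contDiff β).continuous
      (hD _ tsub_le_self) n).aestronglyMeasurable R
  have m3 : ∀ β i, AEMeasurable
      (fun v => ∑ j, ‖friedrichs (abarDeriv γ i j β) i n (D (α - β)) v‖ₑ ^ 2)
      ((volume : Measure V).restrict (Metric.ball 0 R)) := fun β i =>
    Finset.aemeasurable_fun_sum _ fun j _ => m1 β i j
  have m4 : ∀ β, AEMeasurable
      (fun v => ∑ i, ∑ j, ‖friedrichs (abarDeriv γ i j β) i n (D (α - β)) v‖ₑ ^ 2)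
      ((volume : Measure V).restrict (Metric.ball 0 R)) := fun β =>
    Finset.aemeasurable_fun_sum _ fun i _ => m3 β i
  have m5 : ∀ β, AEMeasurable
      (fun v => (∑ i, ∑ j, ‖friedrichs (abarDeriv γ i j β) i n (D (α - β)) v‖ₑ ^ 2)
        + ‖mulComm (potDeriv γ β) n (D (α - β)) v‖ₑ ^ 2)
      ((volume : Measure V).restrict (Metric.ball 0 R)) := fun β => (m4 β).add (m2 β)
  have e : commErr γ R α n D = ∫⁻ v in Metric.ball (0 : V) R, ∑ β ∈ box α,
      ((∑ i, ∑ j, ‖friedrichs (abarDeriv γ i j β) i n (D (α - β)) v‖ₑ ^ 2)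
        + ‖mulComm (potDeriv γ β) n (D (α - β)) v‖ₑ ^ 2) := by
    rw [lintegral_finsetSum' _ fun β _ => m5 β, commErr]
    refine Finset.sum_congr rfl fun β _ => ?_
    rw [lintegral_add_right' _ (m2 β), lintegral_finsetSum' _ fun i _ => m3 β i]
    congr 1
    refine Finset.sum_congr rfl fun i _ => ?_
    rw [lintegral_finsetSum' _ fun j _ => m1 β i j]
    rfl
  have h := lintegral_le_of_le_on_ball (F := fun v => ENNReal.ofReal (P v ^ 2 * commTerms γ n D α v ^ 2))
    (G := fun _ => 0) (H := fun v => ∑ β ∈ box α,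
      ((∑ i, ∑ j, ‖friedrichs (abarDeriv γ i j β) i n (D (α - β)) v‖ₑ ^ 2)
        + ‖mulComm (potDeriv γ β) n (D (α - β)) v‖ₑ ^ 2)) (R := R) (A := ENNReal.ofReal A)
    ENNReal.ofReal_ne_top
    (Finset.aemeasurable_fun_sum _ fun β _ => m5 β) (fun v hv => ?_) (fun v hv => ?_)
  · rw [e]
    simpa using h
  · rw [mul_zero, zero_add]
    have e2 : (∑ β ∈ box α, ((∑ i, ∑ j, ‖friedrichs (abarDeriv γ i j β) i n (D (α - β)) v‖ₑ ^ 2)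
        + ‖mulComm (potDeriv γ β) n (D (α - β)) v‖ₑ ^ 2))
        = ENNReal.ofReal (∑ β ∈ box α,
        ((∑ i, ∑ j, friedrichs (abarDeriv γ i j β) i n (D (α - β)) v ^ 2)
        + mulComm (potDeriv γ β) n (D (α - β)) v ^ 2)) := by
      have n1 : ∀ β i, 0 ≤ ∑ j, friedrichs (abarDeriv γ i j β) i n (D (α - β)) v ^ 2 :=
        fun β i => Finset.sum_nonneg fun j _ => sq_nonneg _
      have n2 : ∀ β, 0 ≤ ∑ i, ∑ j, friedrichs (abarDeriv γ i j β) i n (D (α - β)) v ^ 2 :=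
        fun β => Finset.sum_nonneg fun i _ => n1 β i
      rw [ENNReal.ofReal_sum_of_nonneg fun β _ => add_nonneg (n2 β) (sq_nonneg _)]
      refine Finset.sum_congr rfl fun β _ => ?_
      rw [ENNReal.ofReal_add (n2 β) (sq_nonneg _), ENNReal.ofReal_sum_of_nonneg fun i _ => n1 β i,
        enorm_sq_eq]
      congr 1
      refine Finset.sum_congr rfl fun i _ => ?_
      rw [ENNReal.ofReal_sum_of_nonneg fun j _ => sq_nonneg _]
      simp only [enorm_sq_eq]
    rw [e2, ← ENNReal.ofReal_mul hA]
    refine ENNReal.ofReal_le_ofReal ?_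
    refine (mul_le_mul_of_nonneg_left (commTerms_sq_le γ n D α v) (sq_nonneg _)).trans ?_
    rw [← mul_assoc]
    refine mul_le_mul_of_nonneg_right ((abs_le.1 (hAb v hv)).2) ?_
    exact Finset.sum_nonneg fun β _ => add_nonneg (Finset.sum_nonneg fun i _ =>
      Finset.sum_nonneg fun j _ => sq_nonneg _) (sq_nonneg _)
  · rw [hs v hv]; simp

end

/-! ### The static energy inequality and its error terms -/

section

lemma continuous_friedrichs' {γ : ℝ} (hγ : -3 < γ) (hγ' : γ < 0) {D : V → ℝ} (hD : L2Loc D)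
    (i j : Fin 3) (β : Fin 3 → ℕ) (n : ℕ) : Continuous (friedrichs (abarDeriv γ i j β) i n D) :=
  continuous_friedrichs ((isDerivFamily_abarDeriv hγ hγ' i j).contDiff β) hD i n

lemma contDiff_conv_moll {D : V → ℝ} (hD : L2Loc D) (n : ℕ) : ContDiff ℝ ∞ (conv D (moll n)) :=
  contDiff_conv hD.locallyIntegrable (contDiff_moll n) (hasCompactSupport_moll n)

lemma continuous_mform_grad {γ : ℝ} {u : V → ℝ} (hu : ContDiff ℝ ∞ u) :
    Continuous fun v => mform γ v (grad u v) := by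
  have h1 := (contDiff_bracket_rpow γ).continuous
  have h3 : ∀ i : Fin 3, Continuous fun v : V => v i := fun i => (contDiff_coord i).continuous
  have h4 : ∀ i, Continuous fun v => grad u v i := fun i => (contDiff_pd hu i).continuous
  simp only [mform, bform]
  fun_prop

lemma continuous_commTerms {γ : ℝ} (hγ : -3 < γ) (hγ' : γ < 0) {D : (Fin 3 → ℕ) → V → ℝ}
    {α : Fin 3 → ℕ} (hD : ∀ δ ≤ α, L2Loc (D δ)) (n : ℕ) : Continuous (commTerms γ n D α) := by
  have h1 : ∀ β i j, Continuous (friedrichs (abarDeriv γ i j β) i n (D (α - β))) := fun β i j =>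
    continuous_friedrichs' hγ hγ' (hD _ tsub_le_self) i j β n
  have h2 : ∀ β, Continuous (mulComm (potDeriv γ β) n (D (α - β))) := fun β =>
    continuous_mulComm ((isDerivFamily_potDeriv hγ hγ').contDiff β).continuous
      (hD _ tsub_le_self) n
  exact (contDiff_bracket_rpow _).continuous.mul (continuous_finsetSum _ fun β _ =>
    continuous_const.mul ((continuous_finsetSum _ fun i _ => continuous_finsetSum _ fun j _ =>
      (h1 β i j).abs).add (h2 β).abs))

lemma continuous_lowerTerms {γ K : ℝ} {D : (Fin 3 → ℕ) → V → ℝ}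
    {α : Fin 3 → ℕ} (hD : ∀ δ ≤ α, L2Loc (D δ)) (n : ℕ) : Continuous (lowerTerms γ K n D α) := by
  refine continuous_finsetSum _ fun β _ => continuous_const.mul
    ((continuous_mform_grad (contDiff_conv_moll (hD _ tsub_le_self) n)).sqrt.add
    ((contDiff_bracket_rpow _).continuous.mul (continuous_conv (hD _ tsub_le_self) n).abs))

/-- The static energy inequality for mollified functions, up to a negligible error. -/
lemma exists_energyLe {γ : ℝ} (hγ : -3 < γ) (hγ' : γ < 0) : ∃ c C K S : ℝ, 0 < c ∧ 0 < C ∧ 1 ≤ K ∧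
    0 ≤ S ∧ ∀ (α : Fin 3 → ℕ) (θ R : ℝ) (x : (Fin 3 → ℕ) → ℝ), 1 ≤ R → (∀ β, 0 < x β) →
      ∃ A : ℝ≥0∞, A ≠ ⊤ ∧ ∀ (g : V → ℝ) (D : (Fin 3 → ℕ) → V → ℝ), L2Loc g →
        HasWeakDerivsUpTo α g D →
        (∀ β ∈ (box α).erase 0, ∀ i, HasWeakDeriv (unitIdx i) (D (α - β)) (D (α - β + unitIdx i)) ∧
          L2Loc (D (α - β + unitIdx i))) → ∀ n,
        EnergyLe (ENNReal.ofReal c * eInt γ (cutoff θ R) (fun i => pd i (conv (D α) (moll n)))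
            (conv (D α) (moll n)))
          (∫ v, cutoff θ R v ^ 2 * conv (D α) (moll n) v * rate γ n g α v)
          (ENNReal.ofReal C * (ENNReal.ofReal (1 + (|θ| + S) ^ 2) * wInt γ (outer θ R) (D α)
            + ENNReal.ofReal (∑ β ∈ (box α).erase 0, lowCoeff K α β * x (α - β)) *
              ∑ β ∈ (box α).erase 0, ENNReal.ofReal (lowCoeff K α β / x (α - β)) *
                eInt γ (cutoff θ R) (fun i => D (α - β + unitIdx i)) (D (α - β)))
            + A * errTerm γ (2 * R) α n D) := by
  obtain ⟨c, C, K, hc, hC, hK, hpt⟩ := exists_energy_pointwise hγ hγ'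
  obtain ⟨S, hS, hcut⟩ := exists_pd_cutoff
  -- One factor 2 comes from Cauchy–Schwarz on the lower order terms, another from replacing
  -- mollified derivatives by the derivatives themselves.
  refine ⟨c, 4 * C, K, S, hc, by positivity, hK, hS, fun α θ R x hR hx => ?_⟩
  have hR0 : 0 < R := by linarith
  have hK0 : 0 ≤ K := by linarith
  set p := cutoff θ R with hp
  have hpc := contDiff_cutoff θ R
  have hps : ∀ v, v ∉ Metric.ball (0 : V) (2 * R) → p v = 0 := fun v hv => cutoff_eq_zero hR0 hv
  obtain ⟨A1, hA1, hE⟩ := exists_eInt_le γ hpc.continuous hps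
  obtain ⟨A2, hA2, hW⟩ := exists_wInt_le γ θ R
  obtain ⟨A3, hA3, hM⟩ := exists_commTerms_le hγ hγ' hpc.continuous hps α
  set Λ := |θ| + S with hΛ
  have hΛ0 : 0 ≤ Λ := by positivity
  set s : ℝ := ∑ β ∈ (box α).erase 0, lowCoeff K α β * x (α - β) with hs
  have hs0 : 0 ≤ s := Finset.sum_nonneg fun β _ => mul_nonneg (lowCoeff_nonneg hK0 α β) (hx _).le
  set y : (Fin 3 → ℕ) → ℝ := fun β => lowCoeff K α β / x (α - β) with hy
  have hy0 : ∀ β, 0 ≤ y β := fun β => div_nonneg (lowCoeff_nonneg hK0 α β) (hx _).le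
  set Y : ℝ≥0∞ := ∑ β ∈ (box α).erase 0, ENNReal.ofReal (y β) with hY
  have hYT : Y ≠ ⊤ := by simp [hY]
  refine ⟨ENNReal.ofReal C * (ENNReal.ofReal (1 + Λ ^ 2) * A2 + 2 * ENNReal.ofReal s * (Y * A1) + A3),
    by finiteness, fun g D hg hD hD' n => ?_⟩
  have hDl : ∀ δ ≤ α, L2Loc (D δ) := fun δ h => (hD δ h).2
  set U := conv (D α) (moll n) with hU
  have hUc : ContDiff ℝ ∞ U := contDiff_conv_moll (hDl α le_rfl) n
  have hpsupp : HasCompactSupport p := hasCompactSupport_cutoff hR0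
  -- the pointwise inequality, integrated
  rw [integral_mul_rate hγ hγ' hg hD n (hpc.of_le (by exact_mod_cast le_top)) hpsupp hUc]
  have hcont : Continuous fun v => -((∑ i, ∑ j, fluxPart γ n D α i j v *
      (p v ^ 2 * pd j U v + 2 * p v * pd j p v * U v)) + p v ^ 2 * U v * potPart γ n D α v) := by
    have h1 := fun i j => (contDiff_fluxPart hγ hγ' hg hD n i j).continuous
    have h2 := (contDiff_potPart hγ hγ' hg hD n).continuous
    have h3 := hUc.continuous
    have h4 := hpc.continuous
    have h5 := fun j => (contDiff_pd hUc j).continuous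
    have h6 := fun j => (contDiff_pd hpc j).continuous
    fun_prop
  have hsupp : HasCompactSupport fun v => -((∑ i, ∑ j, fluxPart γ n D α i j v *
      (p v ^ 2 * pd j U v + 2 * p v * pd j p v * U v)) + p v ^ 2 * U v * potPart γ n D α v) := by
    refine hpsupp.mono fun v hv => ?_
    contrapose! hv
    rw [Function.notMem_support] at hv ⊢
    simp [hv]
  have hint := EnergyLe.integral (μ := volume) (hcont.integrable_of_hasCompactSupport hsupp)
    (A := fun v => ENNReal.ofReal (c * (p v ^ 2 * edens γ v (grad U v) (U v))))
    (B := fun v => ENNReal.ofReal (C * ((1 + Λ ^ 2) * (outer θ R v ^ 2 * bracket v ^ γ * U v ^ 2)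
          + p v ^ 2 * (lowerTerms γ K n D α v ^ 2 + commTerms γ n D α v ^ 2))))
    (Eventually.of_forall fun v => by
      obtain ⟨q, hq, hqb⟩ := hcut θ R hR v
      refine energyLe_of_le (mul_nonneg hc.le (mul_nonneg (sq_nonneg _) (edens_nonneg _ _ _ _))) ?_
      have := hpt α D n v (p v) q (outer θ R v) Λ (cutoff_nonneg θ R v) (cutoff_le_outer hR0 v) hΛ0
        hqb
      rw [← hU] at this
      simp only [← hq] at this
      exact this)
  refine hint.mono (le_of_eq ?_) ?_
  · rw [eInt, ← lintegral_const_mul' _ _ ENNReal.ofReal_ne_top]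
    refine lintegral_congr fun v => ?_
    rw [← ENNReal.ofReal_mul hc.le]; rfl
  -- estimate of the right-hand side
  have hm1 : Measurable fun v => ENNReal.ofReal (p v ^ 2 * commTerms γ n D α v ^ 2) :=
    ((hpc.continuous.pow 2).mul ((continuous_commTerms hγ hγ' hDl n).pow 2)).measurable.ennreal_ofReal
  have hm2 : Measurable fun v => ENNReal.ofReal (p v ^ 2 * lowerTerms γ K n D α v ^ 2) :=
    ((hpc.continuous.pow 2).mul ((continuous_lowerTerms hDl n).pow 2)).measurable.ennreal_ofReal
  have b1 : ∫⁻ v, ENNReal.ofReal (C * ((1 + Λ ^ 2) * (outer θ R v ^ 2 * bracket v ^ γ * U v ^ 2)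
      + p v ^ 2 * (lowerTerms γ K n D α v ^ 2 + commTerms γ n D α v ^ 2)))
      = ENNReal.ofReal C * (ENNReal.ofReal (1 + Λ ^ 2) * wInt γ (outer θ R) U
        + (∫⁻ v, ENNReal.ofReal (p v ^ 2 * lowerTerms γ K n D α v ^ 2))
        + ∫⁻ v, ENNReal.ofReal (p v ^ 2 * commTerms γ n D α v ^ 2)) := by
    rw [wInt, ← lintegral_const_mul' (ENNReal.ofReal (1 + Λ ^ 2)) _ ENNReal.ofReal_ne_top,
      ← lintegral_add_right _ hm2, ← lintegral_add_right _ hm1,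
      ← lintegral_const_mul' _ _ ENNReal.ofReal_ne_top]
    refine lintegral_congr fun v => ?_
    have hb : 0 ≤ bracket v ^ γ := Real.rpow_nonneg (bracket_pos v).le _
    rw [ENNReal.ofReal_mul hC.le, mul_add (p v ^ 2), ← add_assoc,
      ENNReal.ofReal_add (by positivity) (by positivity),
      ENNReal.ofReal_add (by positivity) (by positivity), ENNReal.ofReal_mul (by positivity)]
  have b2 : wInt γ (outer θ R) U ≤ 2 * wInt γ (outer θ R) (D α) + A2 * distSq (2 * R) U (D α) :=
    hW U (D α) (hUc.continuous.aestronglyMeasurable.sub (hDl α le_rfl).1)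
  -- As `β ≠ 0`, the gradient of `D (α - β)` is itself one of the known derivatives of order at most
  -- `|α|`, so the lower order energies need no mollification.
  have hgr : ∀ β ∈ (box α).erase 0, ∀ i, pd i (conv (D (α - β)) (moll n))
      = conv (D (α - β + unitIdx i)) (moll n) := fun β hβ i => by
    rw [pd_eq_multiPd (contDiff_conv_moll (hDl _ tsub_le_self) n), (hD' β hβ i).1.multiPd_conv_eq
      (hDl _ tsub_le_self).locallyIntegrable (contDiff_moll n) (hasCompactSupport_moll n)]
  have b3 : ∫⁻ v, ENNReal.ofReal (p v ^ 2 * lowerTerms γ K n D α v ^ 2)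
      ≤ 2 * ENNReal.ofReal s * ∑ β ∈ (box α).erase 0, ENNReal.ofReal (y β) *
        eInt γ p (fun i => pd i (conv (D (α - β)) (moll n))) (conv (D (α - β)) (moll n)) := by
    have hme : ∀ β, Measurable fun v => ENNReal.ofReal (y β) * ENNReal.ofReal (p v ^ 2 * edens γ v
        (grad (conv (D (α - β)) (moll n)) v) (conv (D (α - β)) (moll n) v)) := fun β =>
      (((hpc.continuous.pow 2).mul (continuous_edens
        (ξ := fun i => pd i (conv (D (α - β)) (moll n)))
        (fun i => (contDiff_pd (contDiff_conv_moll (hDl _ tsub_le_self) n) i).continuous)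
        (continuous_conv (hDl _ tsub_le_self) n))).measurable.ennreal_ofReal).const_mul _
    have e : (2 * ENNReal.ofReal s * ∑ β ∈ (box α).erase 0, ENNReal.ofReal (y β) *
        eInt γ p (fun i => pd i (conv (D (α - β)) (moll n))) (conv (D (α - β)) (moll n)))
        = ∫⁻ v, 2 * ENNReal.ofReal s * ∑ β ∈ (box α).erase 0, ENNReal.ofReal (y β) *
          ENNReal.ofReal (p v ^ 2 * edens γ v
            (grad (conv (D (α - β)) (moll n)) v) (conv (D (α - β)) (moll n) v)) := by
      rw [lintegral_const_mul' _ _ (by finiteness), lintegral_finsetSum _ fun β _ => hme β]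
      congr 1
      refine Finset.sum_congr rfl fun β _ => ?_
      rw [lintegral_const_mul' _ _ ENNReal.ofReal_ne_top]
      rfl
    rw [e]
    refine lintegral_mono fun v => ?_
    have h1 := lowerTerms_sq_le (γ := γ) hK0 n D α v hx
    have h2 : ∀ β ∈ (box α).erase 0, 0 ≤ y β * (p v ^ 2 * edens γ v
            (grad (conv (D (α - β)) (moll n)) v) (conv (D (α - β)) (moll n) v)) := fun β _ =>
      mul_nonneg (hy0 β) (mul_nonneg (sq_nonneg _) (edens_nonneg _ _ _ _))
    simp only [← ENNReal.ofReal_mul (hy0 _)]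
    rw [← ENNReal.ofReal_sum_of_nonneg h2, show (2 : ℝ≥0∞) = ENNReal.ofReal 2 by simp,
      ← ENNReal.ofReal_mul (by norm_num), ← ENNReal.ofReal_mul (by positivity)]
    refine ENNReal.ofReal_le_ofReal ?_
    refine (mul_le_mul_of_nonneg_left h1 (sq_nonneg _)).trans (le_of_eq ?_)
    rw [← hs, Finset.mul_sum, Finset.mul_sum, Finset.mul_sum]
    refine Finset.sum_congr rfl fun β _ => ?_
    simp only [hy]; ring
  set ErB := ∑ β ∈ (box α).erase 0, ((∑ i, distSq (2 * R) (conv (D (α - β + unitIdx i)) (moll n))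
        (D (α - β + unitIdx i))) + distSq (2 * R) (conv (D (α - β)) (moll n)) (D (α - β))) with hErB
  have b4 : ∑ β ∈ (box α).erase 0, ENNReal.ofReal (y β) *
        eInt γ p (fun i => pd i (conv (D (α - β)) (moll n))) (conv (D (α - β)) (moll n))
      ≤ 2 * (∑ β ∈ (box α).erase 0, ENNReal.ofReal (y β) *
          eInt γ p (fun i => D (α - β + unitIdx i)) (D (α - β))) + Y * A1 * ErB := by
    rw [Finset.mul_sum, hY, mul_assoc, Finset.sum_mul, ← Finset.sum_add_distrib]
    refine Finset.sum_le_sum fun β hβ => ?_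
    simp only [hgr β hβ]
    have h1 := hE (fun i => conv (D (α - β + unitIdx i)) (moll n)) (fun i => D (α - β + unitIdx i))
      (conv (D (α - β)) (moll n)) (D (α - β))
      (fun i => (continuous_conv (hD' β hβ i).2 n).aestronglyMeasurable.sub (hD' β hβ i).2.1)
      ((continuous_conv (hDl _ tsub_le_self) n).aestronglyMeasurable.sub (hDl _ tsub_le_self).1)
    have h2 := Finset.single_le_sum (f := fun β => (∑ i, distSq (2 * R)
      (conv (D (α - β + unitIdx i)) (moll n)) (D (α - β + unitIdx i)))
      + distSq (2 * R) (conv (D (α - β)) (moll n)) (D (α - β))) (fun _ _ => zero_le) hβ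
    calc _ ≤ ENNReal.ofReal (y β) * (2 * eInt γ p (fun i => D (α - β + unitIdx i)) (D (α - β))
          + A1 * ErB) := by
          gcongr
          exact h1.trans (by gcongr)
      _ = _ := by ring
  have b5 := hM D hDl n
  rw [b1]
  set W := wInt γ (outer θ R) (D α)
  set Q := ∑ β ∈ (box α).erase 0, ENNReal.ofReal (y β) *
          eInt γ p (fun i => D (α - β + unitIdx i)) (D (α - β))
  have he1 : distSq (2 * R) U (D α) ≤ errTerm γ (2 * R) α n D := by
    rw [errTerm, add_assoc]; exact le_self_add
  have he2 : ErB ≤ errTerm γ (2 * R) α n D := by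
    rw [errTerm]; exact le_add_right le_add_self
  have he3 : commErr γ (2 * R) α n D ≤ errTerm γ (2 * R) α n D := by
    rw [errTerm]; exact le_add_self
  set Er := errTerm γ (2 * R) α n D
  have h4C : ENNReal.ofReal (4 * C) = 4 * ENNReal.ofReal C := by
    rw [ENNReal.ofReal_mul (by norm_num)]; simp
  calc _ ≤ ENNReal.ofReal C * (ENNReal.ofReal (1 + Λ ^ 2) * (2 * W + A2 * Er)
        + (2 * ENNReal.ofReal s * (2 * Q + Y * A1 * Er)) + A3 * Er) := by
        gcongr
        · exact b2.trans (by gcongr)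
        · exact b3.trans (mul_le_mul_right (b4.trans (by gcongr)) _)
        · exact b5.trans (by gcongr)
    _ = ENNReal.ofReal C * (2 * (ENNReal.ofReal (1 + Λ ^ 2) * W) + 4 * (ENNReal.ofReal s * Q))
        + ENNReal.ofReal C * (ENNReal.ofReal (1 + Λ ^ 2) * A2 + 2 * ENNReal.ofReal s * (Y * A1) + A3)
          * Er := by ring
    _ ≤ ENNReal.ofReal C * (4 * (ENNReal.ofReal (1 + Λ ^ 2) * W) + 4 * (ENNReal.ofReal s * Q))
        + ENNReal.ofReal C * (ENNReal.ofReal (1 + Λ ^ 2) * A2 + 2 * ENNReal.ofReal s * (Y * A1) + A3)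
          * Er := by
        gcongr
        norm_num
    _ = _ := by rw [h4C]; ring

/-! ### The error terms vanish -/

/-- Error functionals that vanish in the limit, and are bounded by local `L²` norms of the
derivatives of order at most `N`. -/
def Vanishing (N : ℕ) (R : ℝ) (E : ℕ → ((Fin 3 → ℕ) → V → ℝ) → ℝ≥0∞) : Prop :=
  ∃ (A : ℝ≥0∞) (I : Finset (Fin 3 → ℕ)), A ≠ ⊤ ∧ (∀ δ ∈ I, len δ ≤ N) ∧
    ∀ D : (Fin 3 → ℕ) → V → ℝ, (∀ δ, len δ ≤ N → L2Loc (D δ)) →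
      (∀ n, E n D ≤ A * ∑ δ ∈ I, ballSq R (D δ)) ∧ Tendsto (fun n => E n D) atTop (𝓝 0)

lemma Negligible.vanishing {S : ℕ → (V → ℝ) → V → ℝ} (hS : Negligible S) (R : ℝ) {N : ℕ}
    {δ : Fin 3 → ℕ} (hδ : len δ ≤ N) : Vanishing N (R + 1) fun n D => ballSq R (S n (D δ)) := by
  obtain ⟨A, hA, h⟩ := hS R
  refine ⟨A, {δ}, hA, by simpa using hδ, fun D hD => ⟨fun n => ?_, (h _ (hD δ hδ)).2⟩⟩
  simpa using (h _ (hD δ hδ)).1 n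

lemma Vanishing.add {N : ℕ} {R : ℝ} {E F : ℕ → ((Fin 3 → ℕ) → V → ℝ) → ℝ≥0∞}
    (hE : Vanishing N R E) (hF : Vanishing N R F) : Vanishing N R fun n D => E n D + F n D := by
  obtain ⟨A, I, hA, hI, h1⟩ := hE
  obtain ⟨B, J, hB, hJ, h2⟩ := hF
  refine ⟨A + B, I ∪ J, by finiteness, fun δ hδ => ?_, fun D hD => ⟨fun n => ?_, ?_⟩⟩
  · rcases Finset.mem_union.1 hδ with h | h
    exacts [hI δ h, hJ δ h]
  · change E n D + F n D ≤ _
    rw [add_mul]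
    gcongr
    · exact ((h1 D hD).1 n).trans (mul_le_mul_right
        (Finset.sum_le_sum_of_subset Finset.subset_union_left) _)
    · exact ((h2 D hD).1 n).trans (mul_le_mul_right
        (Finset.sum_le_sum_of_subset Finset.subset_union_right) _)
  · simpa using (h1 D hD).2.add (h2 D hD).2

lemma vanishing_zero (N : ℕ) (R : ℝ) : Vanishing N R fun _ _ => 0 :=
  ⟨0, ∅, by simp, by simp, fun D _ => ⟨fun n => by simp, tendsto_const_nhds⟩⟩

lemma Vanishing.sum {ι : Type*} {N : ℕ} {R : ℝ} (s : Finset ι)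
    {E : ι → ℕ → ((Fin 3 → ℕ) → V → ℝ) → ℝ≥0∞} (hE : ∀ i ∈ s, Vanishing N R (E i)) :
    Vanishing N R fun n D => ∑ i ∈ s, E i n D := by
  classical
  induction s using Finset.induction_on with
  | empty => simpa using vanishing_zero N R
  | insert a s ha ih =>
    simp only [Finset.sum_insert ha]
    exact (hE a (Finset.mem_insert_self _ _)).add
      (ih fun i hi => hE i (Finset.mem_insert_of_mem hi))

lemma len_mono {α β : Fin 3 → ℕ} (h : β ≤ α) : len β ≤ len α := Finset.sum_le_sum fun i _ => h i

lemma len_sub_add_len {α β : Fin 3 → ℕ} (h : β ≤ α) : len (α - β) + len β = len α := by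
  rw [← len_add, tsub_add_cancel_of_le h]

lemma one_le_len {β : Fin 3 → ℕ} (h : β ≠ 0) : 1 ≤ len β := by
  by_contra h0
  refine h (funext fun i => ?_)
  have : β i ≤ len β := Finset.single_le_sum (fun _ _ => Nat.zero_le _) (Finset.mem_univ i)
  simp only [Pi.zero_apply]
  omega

lemma mem_erase_box {α β : Fin 3 → ℕ} (h : β ∈ (box α).erase 0) :
    β ≤ α ∧ 1 ≤ len β ∧ len (α - β) + len β = len α :=
  have h1 := mem_box.1 (Finset.mem_of_mem_erase h)
  ⟨h1, one_le_len (Finset.ne_of_mem_erase h), len_sub_add_len h1⟩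

/-- For `β ≠ 0` the index `α - β + e_i` has length at most `|α|`. Thus no derivative beyond order
`|α|` enters the error, although the energy on the left is of order `|α| + 1`. -/
lemma vanishing_errTerm {γ : ℝ} (hγ : -3 < γ) (hγ' : γ < 0) (R : ℝ) (α : Fin 3 → ℕ) :
    Vanishing (len α) (R + 1) fun n D => errTerm γ R α n D := by
  have hd : ∀ δ, len δ ≤ len α →
      Vanishing (len α) (R + 1) fun n D => distSq R (conv (D δ) (moll n)) (D δ) :=
    fun δ hδ => negligible_conv_sub.vanishing R hδ
  refine ((hd α le_rfl).add (Vanishing.sum _ fun β hβ => ?_)).add ?_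
  · obtain ⟨-, h2, h3⟩ := mem_erase_box hβ
    refine (Vanishing.sum _ fun i _ => hd _ ?_).add (hd _ (by omega))
    rw [len_add, len_unitIdx]; omega
  · refine Vanishing.sum _ fun β hβ => (Vanishing.sum _ fun i _ => Vanishing.sum _ fun j _ => ?_).add ?_
    · exact (negligible_friedrichs ((isDerivFamily_abarDeriv hγ hγ' i j).contDiff β) i).vanishing R
        (len_mono tsub_le_self)
    · exact (negligible_comm ((isDerivFamily_potDeriv hγ hγ').contDiff β).continuous).vanishing R
        (len_mono tsub_le_self)

end

/-! ### From weak solutions to weakly continuous flows -/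

section

lemma contDiff_primitive {ζ : ℝ → ℝ} (hζ : ContDiff ℝ ∞ ζ) (a : ℝ) :
    ContDiff ℝ ∞ fun t => ∫ s in a..t, ζ s := by
  have hd : ∀ t, HasDerivAt (fun t => ∫ s in a..t, ζ s) (ζ t) t := fun t =>
    (hζ.continuous.integral_hasStrictDerivAt a t).hasDerivAt
  rw [contDiff_infty_iff_deriv]
  refine ⟨fun t => (hd t).differentiableAt, ?_⟩
  rwa [show deriv (fun t => ∫ s in a..t, ζ s) = ζ from funext fun t => (hd t).deriv]

/-- A weak formulation in time determines a function up to a null set. -/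
lemma ae_eq_of_forall_test {T : ℝ} (hT : 0 < T) {F G : ℝ → ℝ} (hF : IntegrableOn F (Ioo 0 T))
    (hG : IntegrableOn G (Ioo 0 T)) (c : ℝ)
    (h : ∀ η : ℝ → ℝ, ContDiff ℝ ∞ η → HasCompactSupport η → η T = 0 →
      ∫ t in Ioo 0 T, (-(deriv η t) * F t + η t * G t) = η 0 * c) :
    ∀ᵐ t ∂volume.restrict (Ioo 0 T), F t = c - ∫ s in (0 : ℝ)..t, G s := by
  have hGi : IntervalIntegrable G volume 0 T := by
    rwa [intervalIntegrable_iff_integrableOn_Ioo_of_le hT.le]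
  set H : ℝ → ℝ := fun t => c - ∫ s in (0 : ℝ)..t, G s with hH
  have hHac : AbsolutelyContinuousOnInterval H 0 T :=
    ((contDiff_const (n := 1)).contDiffOn.absolutelyContinuousOnInterval).sub
      (hGi.absolutelyContinuousOnInterval_intervalIntegral (by simp))
  have hHd : ∀ᵐ t, t ∈ Ioo 0 T → deriv H t = -G t := by
    filter_upwards [hGi.ae_hasDerivAt_integral] with t ht h1
    have h2 : t ∈ uIcc 0 T := by rw [uIcc_of_le hT.le]; exact Ioo_subset_Icc_self h1
    exact ((ht h2 0 (by simp)).const_sub c).deriv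
  have hHc : ContinuousOn H (Icc 0 T) := by simpa [uIcc_of_le hT.le] using hHac.continuousOn
  have hHi : IntegrableOn H (Ioo 0 T) :=
    (hHc.integrableOn_compact isCompact_Icc).mono_set Ioo_subset_Icc_self
  have hd : LocallyIntegrableOn (fun t => F t - H t) (Ioo 0 T) :=
    (IntegrableOn.locallyIntegrableOn (hF.sub hHi))
  have key := isOpen_Ioo.ae_eq_zero_of_integral_contDiff_smul_eq_zero hd ?_
  · rw [ae_restrict_iff' measurableSet_Ioo]
    filter_upwards [key] with t ht h1
    linarith [ht h1]
  intro ζ hζ hζc hζs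
  -- The primitive of an arbitrary `ζ` that vanishes at `T`, as the weak formulation demands of test
  -- functions.
  set Z : ℝ → ℝ := fun t => ∫ s in T..t, ζ s with hZ
  have hZd : ∀ t, HasDerivAt Z (ζ t) t := fun t =>
    (hζ.continuous.integral_hasStrictDerivAt T t).hasDerivAt
  have hZs : ContDiff ℝ ∞ Z := contDiff_primitive hζ T
  -- A cutoff equal to 1 near `[0, T]` makes the primitive compactly supported without changing it
  -- or its derivative on that interval.
  let χ : ContDiffBump (T / 2) := ⟨T, 2 * T, hT, by linarith⟩
  have hχ : ∀ t ∈ Icc 0 T, (χ : ℝ → ℝ) =ᶠ[𝓝 t] fun _ => 1 := fun t ht => by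
    refine χ.eventuallyEq_one_of_mem_ball ?_
    rw [Metric.mem_ball, Real.dist_eq, abs_lt]
    change -T < t - T / 2 ∧ t - T / 2 < T
    constructor <;> linarith [ht.1, ht.2]
  set η : ℝ → ℝ := fun t => χ t * Z t with hη
  have hηZ : ∀ t ∈ Icc 0 T, η =ᶠ[𝓝 t] Z := fun t ht => by
    filter_upwards [hχ t ht] with s hs
    simp [hη, hs]
  have hηs : ContDiff ℝ ∞ η := χ.contDiff.mul hZs
  have hT0 : Z T = 0 := by simp [hZ]
  have h1 := h η hηs (χ.hasCompactSupport.mul_right) (by simp [hη, hT0])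
  have e1 : ∫ t in Ioo 0 T, (-(deriv η t) * F t + η t * G t)
      = ∫ t in Ioo 0 T, (-(ζ t) * F t + Z t * G t) := by
    refine setIntegral_congr_fun measurableSet_Ioo fun t ht => ?_
    have h2 := hηZ t (Ioo_subset_Icc_self ht)
    change -(deriv η t) * F t + η t * G t = -(ζ t) * F t + Z t * G t
    rw [h2.deriv_eq, h2.eq_of_nhds, (hZd t).deriv]
  have hZac : AbsolutelyContinuousOnInterval Z 0 T :=
    (hZs.contDiffOn.of_le (by norm_num)).absolutelyContinuousOnInterval
  have h3 := AbsolutelyContinuousOnInterval.integral_mul_deriv_eq_deriv_mul hZac hHac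
  rw [intervalIntegral.integral_of_le hT.le, intervalIntegral.integral_of_le hT.le,
    integral_Ioc_eq_integral_Ioo, integral_Ioc_eq_integral_Ioo, hT0]
    at h3
  rw [(hηZ 0 (by simp [hT.le])).eq_of_nhds] at h1
  have e2 : ∫ t in Ioo 0 T, Z t * deriv H t = -∫ t in Ioo 0 T, Z t * G t := by
    rw [← integral_neg]
    refine setIntegral_congr_ae measurableSet_Ioo ?_
    filter_upwards [hHd] with t ht h1
    rw [ht h1, mul_neg]
  have e3 : ∫ t in Ioo 0 T, deriv Z t * H t = ∫ t in Ioo 0 T, ζ t * H t := by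
    simp only [(hZd _).deriv]
  have mulI : ∀ {u w : ℝ → ℝ}, Continuous u → IntegrableOn w (Ioo 0 T) →
      IntegrableOn (fun t => u t * w t) (Ioo 0 T) := fun {u w} hu hw => by
    obtain ⟨B, hB⟩ := isCompact_Icc.exists_bound_of_continuousOn (hu.continuousOn (s := Icc 0 T))
    refine hw.bdd_mul (c := B) hu.aestronglyMeasurable ?_
    rw [ae_restrict_iff' measurableSet_Ioo]
    exact Eventually.of_forall fun t ht => hB t (Ioo_subset_Icc_self ht)
  have i1 := mulI hζ.continuous hF
  have i2 := mulI hZs.continuous hG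
  have i3 := mulI hζ.continuous hHi
  have e4 : ∫ t in Ioo 0 T, (-(ζ t) * F t + Z t * G t)
      = -(∫ t in Ioo 0 T, ζ t * F t) + ∫ t in Ioo 0 T, Z t * G t := by
    rw [← integral_neg, ← integral_add (f := fun t => -(ζ t * F t)) i1.neg i2]
    simp only [neg_mul]
  have e5 : ∫ t, ζ t • (F t - H t) = (∫ t in Ioo 0 T, ζ t * F t) - ∫ t in Ioo 0 T, ζ t * H t := by
    rw [← integral_sub i1 i3]
    have hs : Function.support (fun t => ζ t * F t - ζ t * H t) ⊆ Ioo 0 T := by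
      intro t ht
      refine hζs (subset_tsupport _ ?_)
      intro h0
      exact ht (by simp [h0])
    rw [setIntegral_eq_integral_of_forall_compl_eq_zero fun t ht => by
      by_contra h0; exact ht (hs h0)]
    simp only [smul_eq_mul, mul_sub]
  have hH0 : H 0 = c := by simp [hH]
  rw [e5]
  rw [e2, e3, hH0] at h3
  rw [e1, e4] at h1
  linarith

lemma landauOp_add {γ : ℝ} (hγ : -3 < γ) (hγ' : γ < 0) {u w : V → ℝ} (hu : ContDiff ℝ ∞ u)
    (hw : ContDiff ℝ ∞ w) (v : V) :
    landauOp γ (fun x => u x + w x) v = landauOp γ u v + landauOp γ w v := by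
  have hd : ∀ {y : V → ℝ}, ContDiff ℝ ∞ y → ∀ i j, Differentiable ℝ fun x => abar γ i j x * pd j y x :=
    fun hy i j => ((contDiff_abar hγ hγ' i j).mul (contDiff_pd hy j)).differentiable (by simp)
  have e : ∀ i j, pd i (fun x => abar γ i j x * pd j (fun x => u x + w x) x) v
      = pd i (fun x => abar γ i j x * pd j u x) v + pd i (fun x => abar γ i j x * pd j w x) v := by
    intro i j
    rw [← pd_add i (hd hu i j v) (hd hw i j v)]
    congr 1; ext x
    rw [pd_add j (hu.differentiable (by simp) x) (hw.differentiable (by simp) x), mul_add]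
  simp only [landauOp_eq, e, Finset.sum_add_distrib]
  ring

lemma landauOp_const_mul {γ : ℝ} (hγ : -3 < γ) (hγ' : γ < 0) (c : ℝ) {u : V → ℝ}
    (hu : ContDiff ℝ ∞ u) (v : V) : landauOp γ (fun x => c * u x) v = c * landauOp γ u v := by
  have hd : ∀ i j, Differentiable ℝ fun x => abar γ i j x * pd j u x :=
    fun i j => ((contDiff_abar hγ hγ' i j).mul (contDiff_pd hu j)).differentiable (by simp)
  have e : ∀ i j, pd i (fun x => abar γ i j x * pd j (fun x => c * u x) x) v
      = c * pd i (fun x => abar γ i j x * pd j u x) v := by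
    intro i j
    rw [← pd_const_mul i c (hd i j v)]
    congr 1; ext x
    rw [pd_const_mul j c (hu.differentiable (by simp) x)]; ring
  simp only [landauOp_eq, e, ← Finset.mul_sum]
  ring

lemma landauOp_mem_testSpace {γ : ℝ} (hγ : -3 < γ) (hγ' : γ < 0) (φ : testSpace) :
    landauOp γ φ.1 ∈ testSpace := by
  have e : landauOp γ φ.1 = fun v => -(∑ i, ∑ j, pd i (fun w => abar γ i j w * pd j φ.1 w) v)
      + potential γ v * φ.1 v := funext (landauOp_eq γ φ.1)
  have e2 : landauOp γ φ.1 = ((-∑ i, ∑ j, pd i (fun w => abar γ i j w * pd j φ.1 w))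
      + fun v => potential γ v * φ.1 v) := by
    rw [e]; ext v; simp
  rw [e2]
  refine testSpace.add_mem (testSpace.neg_mem (testSpace.sum_mem fun i _ =>
    testSpace.sum_mem fun j _ => ⟨?_, ?_⟩)) ⟨?_, ?_⟩
  · exact contDiff_pd ((contDiff_abar hγ hγ' i j).mul (contDiff_pd φ.2.1 j)) i
  · exact hasCompactSupport_pd ((hasCompactSupport_pd φ.2.2 j).mul_left) i
  · exact (contDiff_potential hγ hγ').mul φ.2.1
  · exact φ.2.2.mul_left

/-- The linearized Landau operator on test functions. -/
def landauTest {γ : ℝ} (hγ : -3 < γ) (hγ' : γ < 0) : testSpace →ₗ[ℝ] testSpace where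
  toFun φ := ⟨landauOp γ φ.1, landauOp_mem_testSpace hγ hγ' φ⟩
  map_add' φ ψ := Subtype.ext (funext fun v => landauOp_add hγ hγ' φ.2.1 ψ.2.1 v)
  map_smul' c φ := Subtype.ext (funext fun v => landauOp_const_mul hγ hγ' c φ.2.1 v)

lemma inner_weightEmb_zero (F : L2V) (φ : testSpace) :
    inner ℝ F (weightEmb 0 φ) = ∫ v, F v * φ.1 v := by
  rw [L2.inner_def]
  refine integral_congr_ae ?_
  filter_upwards [(memLp_weight_test 0 φ).coeFn_toLp] with v hv
  change inner ℝ (F v) (((memLp_weight_test 0 φ).toLp) v) = _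
  rw [hv]
  simp [mul_comm]

lemma integrable_mul_test (F : L2V) (φ : testSpace) : Integrable fun v => F v * φ.1 v :=
  integrable_mul_of_hasCompactSupport ((Lp.memLp F).locallyIntegrable (by norm_num))
    φ.2.1.continuous φ.2.2

/-- `g` is a bounded, weakly continuous solution of the linear Landau equation on `[0,T]`. -/
structure IsFlow (γ T : ℝ) (f₀ : L2V) (g : ℝ → L2V) : Prop where
  zero : g 0 = f₀
  bound : ∃ M, ∀ t, ‖g t‖ ≤ M
  cont : ∀ h : L2V, Continuous fun t => inner ℝ (g t) h
  eq : ∀ φ, ContDiff ℝ ∞ φ → HasCompactSupport φ → ∀ t ∈ Icc 0 T,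
    ∫ v, g t v * φ v = (∫ v, f₀ v * φ v) - ∫ s in (0 : ℝ)..t, ∫ v, g s v * landauOp γ φ v

section

variable {γ T : ℝ} {f₀ : L2V} {f : ℝ → L2V}

lemma IsWeakSolution.ae_inner_eq (hγ : -3 < γ) (hγ' : γ < 0) (hT : 0 < T)
    (hf : IsWeakSolution γ T f₀ f) (φ : testSpace) :
    ∀ᵐ t ∂volume.restrict (Ioo 0 T), inner ℝ (f t) (weightEmb 0 φ) = inner ℝ f₀ (weightEmb 0 φ)
      - ∫ s in (0 : ℝ)..t, inner ℝ (f s) (weightEmb 0 (landauTest hγ hγ' φ)) := by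
  have hfi : Integrable f (volume.restrict (Ioo 0 T)) := hf.memLp.integrable (by simp)
  refine ae_eq_of_forall_test hT (hfi.inner_const _) (hfi.inner_const _) _ fun η h1 h2 h3 => ?_
  have h4 := hf.weak_eq (fun t v => η t * φ.1 v) ?_ ?_ (fun v => by simp [h3])
  · rw [inner_weightEmb_zero, ← integral_const_mul]
    have e0 : ∀ v, η 0 * (f₀ v * φ.1 v) = f₀ v * (η 0 * φ.1 v) := fun v => by ring
    simp only [e0]
    rw [← h4]
    refine integral_congr_ae (Eventually.of_forall fun t => ?_)
    simp only [inner_weightEmb_zero]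
    rw [← integral_const_mul, ← integral_const_mul, ← integral_add
      ((integrable_mul_test _ φ).const_mul _) ((integrable_mul_test _ _).const_mul _)]
    congr 1; ext v
    have hd : deriv (fun s => η s * φ.1 v) t = deriv η t * φ.1 v :=
      deriv_mul_const (h1.differentiable (by simp) t) _
    rw [hd, landauOp_const_mul hγ hγ' _ φ.2.1]
    change _ * _ + η t * (f t v * landauOp γ φ.1 v) = _
    ring
  · exact (h1.comp contDiff_fst).mul (φ.2.1.comp contDiff_snd)
  · refine HasCompactSupport.intro (h2.isCompact.prod φ.2.2.isCompact) fun x hx => ?_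
    simp only [mem_prod, not_and_or] at hx
    change η x.1 * φ.1 x.2 = 0
    rcases hx with hx | hx
    · rw [image_eq_zero_of_notMem_tsupport hx, zero_mul]
    · rw [image_eq_zero_of_notMem_tsupport hx, mul_zero]

/-- The weakly continuous representative of a weak solution. -/
theorem IsWeakSolution.exists_isFlow (hγ : -3 < γ) (hγ' : γ < 0) (hT : 0 < T)
    (hf : IsWeakSolution γ T f₀ f) :
    ∃ g, IsFlow γ T f₀ g ∧ ∀ᵐ t ∂volume.restrict (Ioo 0 T), g t = f t := by
  have hfi : Integrable f (volume.restrict (Ioo 0 T)) := hf.memLp.integrable (by simp)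
  have hI : Ioo 0 T =ᵐ[volume] Icc (0 : ℝ) T := Ioo_ae_eq_Icc
  set M := (eLpNorm f ⊤ (volume.restrict (Ioo 0 T))).toReal with hM
  have hM0 : 0 ≤ M := ENNReal.toReal_nonneg
  have hfM : ∀ᵐ t ∂volume.restrict (Ioo 0 T), ‖f t‖ ≤ M := by
    filter_upwards [ae_le_eLpNormEssSup (f := f) (μ := volume.restrict (Ioo 0 T))] with t ht
    rw [← eLpNorm_exponent_top] at ht
    have := ENNReal.toReal_mono hf.memLp.2.ne ht
    rwa [toReal_enorm] at this
  set e := weightEmb 0 with he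
  have hde : DenseRange e := denseRange_weightEmb 0
  set H : testSpace → ℝ → ℝ := fun φ t => inner ℝ f₀ (e φ)
      - ∫ s in (0 : ℝ)..t, inner ℝ (f s) (e (landauTest hγ hγ' φ)) with hH
  have hii : ∀ h : L2V, IntervalIntegrable (fun s => inner ℝ (f s) h) volume 0 T := fun h => by
    rw [intervalIntegrable_iff_integrableOn_Ioo_of_le hT.le]
    exact hfi.inner_const h
  have hii' : ∀ (h : L2V) {t : ℝ}, t ∈ Icc 0 T →
      IntervalIntegrable (fun s => inner ℝ (f s) h) volume 0 t := fun h t ht =>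
    (hii h).mono_set (by
      rw [uIcc_of_le ht.1, uIcc_of_le hT.le]
      exact Icc_subset_Icc_right ht.2)
  have hHc : ∀ φ, ContinuousOn (H φ) (Icc 0 T) := fun φ => by
    have := intervalIntegral.continuousOn_primitive_interval'
      (hii (e (landauTest hγ hγ' φ))) (a := 0) (by simp)
    rw [uIcc_of_le hT.le] at this
    exact continuousOn_const.sub this
  have hae := fun φ => hf.ae_inner_eq hγ hγ' hT φ
  have hHb : ∀ φ, ∀ t ∈ Icc 0 T, |H φ t| ≤ M * ‖e φ‖ := by
    intro φ
    -- The bound holds almost everywhere, hence everywhere by continuity. It is written as an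
    -- equality of two continuous functions because that is what extends from almost every point.
    have h1 : (fun t => max |H φ t| (M * ‖e φ‖)) =ᵐ[volume.restrict (Icc 0 T)]
        fun _ => M * ‖e φ‖ := by
      rw [← Measure.restrict_congr_set hI]
      filter_upwards [hae φ, hfM] with t h1 h2
      refine max_eq_right ?_
      change |inner ℝ f₀ (e φ) - ∫ s in (0 : ℝ)..t, inner ℝ (f s) (e (landauTest hγ hγ' φ))| ≤ _
      rw [← h1]
      exact (abs_real_inner_le_norm _ _).trans (by gcongr)
    have h2 := Measure.eqOn_Icc_of_ae_eq volume hT.ne h1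
      ((hHc φ).abs.sup continuousOn_const) continuousOn_const
    intro t ht
    exact max_eq_right_iff.1 (h2 ht)
  -- Times outside `[0, T]` are clamped to it, so that the representative is bounded and weakly
  -- continuous on the whole line.
  have hex : ∀ t : ℝ, ∃ w : L2V, ‖w‖ ≤ M ∧
      ∀ φ, inner ℝ w (e φ) = H φ (max 0 (min t T)) := by
    intro t
    set s := max 0 (min t T) with hs
    have hsm : s ∈ Icc 0 T := ⟨le_max_left _ _, max_le hT.le (min_le_right _ _)⟩
    let L : testSpace →ₗ[ℝ] ℝ :=
      { toFun := fun φ => H φ s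
        map_add' := fun φ ψ => by
          simp only [hH, map_add, inner_add_right]
          rw [intervalIntegral.integral_add (hii' _ hsm) (hii' _ hsm)]
          ring
        map_smul' := fun c φ => by
          simp only [hH, map_smul, inner_smul_right, intervalIntegral.integral_const_mul,
            RingHom.id_apply, smul_eq_mul]
          ring }
    have hL : ∀ φ, ‖L φ‖ ≤ M * ‖e φ‖ := fun φ => hHb φ s hsm
    refine ⟨(InnerProductSpace.toDual ℝ L2V).symm (L.extendOfNorm e), ?_, fun φ => ?_⟩
    · rw [LinearIsometryEquiv.norm_map]
      exact LinearMap.opNorm_extendOfNorm_le hde hM0 hL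
    · rw [InnerProductSpace.toDual_symm_apply, LinearMap.extendOfNorm_eq hde ⟨M, hL⟩]
      rfl
  choose g hgM hg using hex
  have hclamp : ∀ t ∈ Icc 0 T, max 0 (min t T) = t := fun t ht => by
    rw [min_eq_left ht.2, max_eq_right ht.1]
  have hgf : ∀ᵐ t ∂volume.restrict (Ioo 0 T), g t = f t := by
    -- The null set of times depends on the test function. Separability reduces to countably many
    -- test vectors, hence to one null set.
    have : Fact ((2 : ℝ≥0∞) ≠ ⊤) := ⟨by norm_num⟩
    have : TopologicalSpace.SeparableSpace (range e) :=
      (TopologicalSpace.IsSeparable.of_separableSpace (range e)).separableSpace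
    obtain ⟨s, hs1, hs2, hs3⟩ :=
      (show Dense (range e) from hde).exists_countable_dense_subset
    have h1 : ∀ᵐ t ∂volume.restrict (Ioo 0 T), ∀ x ∈ s, inner ℝ (g t) x = inner ℝ (f t) x := by
      rw [ae_ball_iff hs2]
      intro x hx
      obtain ⟨φ, rfl⟩ := hs1 hx
      filter_upwards [hae φ, ae_restrict_mem measurableSet_Ioo] with t h1 h2
      rw [hg, hclamp t (Ioo_subset_Icc_self h2), h1]
    filter_upwards [h1] with t ht
    have h2 : (fun x => inner ℝ (g t) x) = fun x => inner ℝ (f t) x :=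
      Continuous.ext_on hs3 (by fun_prop) (by fun_prop) ht
    exact ext_inner_right ℝ fun x => congrFun h2 x
  refine ⟨g, ⟨?_, ⟨M, hgM⟩, fun h => ?_, fun φ h1 h2 t ht => ?_⟩, hgf⟩
  · have h2 : (fun x => inner ℝ (g 0) x) = fun x => inner ℝ f₀ x := by
      refine hde.equalizer (by fun_prop) (by fun_prop) (funext fun φ => ?_)
      change inner ℝ (g 0) (e φ) = inner ℝ f₀ (e φ)
      rw [hg, hclamp 0 ⟨le_rfl, hT.le⟩]
      simp [hH]
    exact ext_inner_right ℝ fun x => congrFun h2 x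
  -- Continuity is known against the dense set of test functions; the uniform bound `M` extends it
  -- to every `h`.
  · refine continuous_of_uniform_approx_of_continuous fun u hu => ?_
    obtain ⟨ε, hε, hu⟩ := Metric.mem_uniformity_dist.1 hu
    obtain ⟨φ, hφ⟩ := hde.exists_dist_lt h (ε := ε / (M + 1)) (by positivity)
    refine ⟨fun t => inner ℝ (g t) (e φ), ?_, fun t => hu ?_⟩
    · simp only [hg]
      exact (hHc φ).comp_continuous (by fun_prop)
        fun t => ⟨le_max_left _ _, max_le hT.le (min_le_right _ _)⟩
    · rw [Real.dist_eq, ← inner_sub_right]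
      refine (abs_real_inner_le_norm _ _).trans_lt ?_
      rw [dist_eq_norm, lt_div_iff₀ (by positivity)] at hφ
      nlinarith [hgM t, norm_nonneg (h - e φ), norm_nonneg (g t)]
  · have h3 := hg t ⟨φ, h1, h2⟩
    rw [hclamp t ht, inner_weightEmb_zero, hH] at h3
    simp only at h3
    rw [h3, inner_weightEmb_zero]
    congr 1
    refine intervalIntegral.integral_congr_ae ?_
    rw [ae_restrict_iff' measurableSet_Ioo] at hgf
    have h4 : ∀ᵐ s : ℝ, s ≠ t := by simp [ae_iff, measure_singleton]
    filter_upwards [hgf, h4] with s h4 h5 h6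
    rw [uIoc_of_le ht.1] at h6
    rw [h4 ⟨h6.1, (lt_of_le_of_ne h6.2 h5).trans_le ht.2⟩, inner_weightEmb_zero]
    rfl

end

end

/-! ### Time evolution of mollified solutions -/

section

lemma L2Loc.of_L2V (F : L2V) : L2Loc F := by
  refine ⟨(Lp.memLp F).1, fun R => ne_top_of_le_ne_top (b := ∫⁻ v, ‖F v‖ₑ ^ 2) ?_
    (lintegral_mono' Measure.restrict_le_self le_rfl)⟩
  simp only [enorm_sq_eq, lintegral_sq_eq_norm_sq]
  exact ENNReal.ofReal_ne_top

lemma ballSq_le_norm_sq (R : ℝ) (F : L2V) : ballSq R F ≤ ENNReal.ofReal (‖F‖ ^ 2) := by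
  rw [← lintegral_sq_eq_norm_sq]
  simp only [← enorm_sq_eq]
  exact lintegral_mono' Measure.restrict_le_self le_rfl

/-- The translated reflection of a test function. -/
def shiftTest (σ : testSpace) (v : V) : testSpace :=
  ⟨fun w => σ.1 (v - w), σ.2.1.comp (by fun_prop), hasCompactSupport_comp_sub_left σ.2.2 v⟩

/-- The derivative of a mollifier as a test function. -/
def mollTest (α : Fin 3 → ℕ) (n : ℕ) : testSpace :=
  ⟨multiPd α (moll n), contDiff_multiPd (contDiff_moll n) α,
    hasCompactSupport_multiPd (hasCompactSupport_moll n) α⟩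

/-- The constant does not depend on `F`. Along a bounded flow this bounds the mollified quantities
uniformly in time, which justifies Fubini in the energy balance. -/
lemma exists_conv_bound {a : V → ℝ} (ha : Continuous a) (σ : testSpace) (R : ℝ) :
    ∃ B, 0 ≤ B ∧ ∀ (F : L2V) (v : V), v ∈ Metric.ball 0 R →
      |conv (fun w => a w * F w) σ.1 v| ≤ B * ‖F‖ := by
  obtain ⟨r, hr, hσ⟩ := exists_ball_support σ.2.2
  obtain ⟨C, hC, hb⟩ := exists_ball_bound ha (R + r)
  set N := ∫ v, (bracket v ^ (0 : ℝ) * σ.1 v) ^ 2 with hN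
  have hN0 : 0 ≤ N := integral_nonneg fun v => sq_nonneg _
  have hNe : ∀ v, ∫⁻ w, ‖σ.1 (v - w)‖ₑ ^ 2 = ENNReal.ofReal N := fun v => by
    rw [lintegral_sub_left_eq_self (fun w => ‖σ.1 w‖ₑ ^ 2) v, hN,
      ofReal_integral_eq_lintegral_ofReal (memLp_weight_test 0 σ).integrable_sq
      (Eventually.of_forall fun v => sq_nonneg _)]
    simp [enorm_sq_eq]
  refine ⟨C * √N, by positivity, fun F v hv => ?_⟩
  have h1 := sq_integral_mul_le (h := fun w => a w * F w) (ψ := fun w => σ.1 (v - w)) (R := R + r)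
    (((L2Loc.of_L2V F).mul ha).1) (σ.2.1.continuous.comp (by fun_prop)) (fun w hw => by
      refine hσ _ fun h2 => hw ?_
      rw [Metric.mem_ball, dist_zero_right] at *
      calc ‖w‖ = ‖v - (v - w)‖ := by congr 1; abel
        _ ≤ ‖v‖ + ‖v - w‖ := norm_sub_le _ _
        _ < R + r := by linarith)
  rw [hNe] at h1
  have h2 : ‖∫ w, a w * F w * σ.1 (v - w)‖ₑ ^ 2
      ≤ ENNReal.ofReal ((C * √N * ‖F‖) ^ 2) := by
    refine (h1.trans (mul_le_mul_left ((ballSq_mul_le hb).trans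
      (mul_le_mul_right (ballSq_le_norm_sq _ F) _)) _)).trans (le_of_eq ?_)
    rw [← ENNReal.ofReal_pow hC, ← ENNReal.ofReal_mul (by positivity),
      ← ENNReal.ofReal_mul (by positivity)]
    congr 1
    rw [mul_pow, mul_pow, Real.sq_sqrt hN0]; ring
  rw [enorm_sq_eq, ENNReal.ofReal_le_ofReal_iff (by positivity)] at h2
  exact abs_le_of_sq_le_sq h2 (by positivity)

section

variable {γ T : ℝ} {f₀ : L2V} {g : ℝ → L2V}

lemma exists_rate_bound (hγ : -3 < γ) (hγ' : γ < 0) (α : Fin 3 → ℕ) (n : ℕ) (R : ℝ) :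
    ∃ B, 0 ≤ B ∧ ∀ (F : L2V) (v : V), v ∈ Metric.ball 0 R → |rate γ n F α v| ≤ B * ‖F‖ := by
  have hσ := (mollTest α n).2.1
  have hs := (mollTest α n).2.2
  have h1 := fun i j => exists_conv_bound (contDiff_abar hγ hγ' i j).continuous
    ⟨pd j (pd i (multiPd α (moll n))), contDiff_pd (contDiff_pd hσ i) j,
      hasCompactSupport_pd (hasCompactSupport_pd hs i) j⟩ R
  have h2 := fun i j => exists_conv_bound (contDiff_pd (contDiff_abar hγ hγ' i j) i).continuous
    ⟨pd j (multiPd α (moll n)), contDiff_pd hσ j, hasCompactSupport_pd hs j⟩ R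
  obtain ⟨B3, hB3, h3⟩ := exists_conv_bound (contDiff_potential hγ hγ').continuous
    (mollTest α n) R
  choose B1 hB1 h1 using h1
  choose B2 hB2 h2 using h2
  refine ⟨(∑ i, ∑ j, (B1 i j + B2 i j)) + B3, add_nonneg (Finset.sum_nonneg fun i _ =>
    Finset.sum_nonneg fun j _ => add_nonneg (hB1 i j) (hB2 i j)) hB3, fun F v hv => ?_⟩
  rw [rate_eq_raw hγ hγ' (L2Loc.of_L2V F), add_mul]
  refine (abs_sub _ _).trans (add_le_add ?_ (h3 F v hv))
  rw [Finset.sum_mul]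
  refine (Finset.abs_sum_le_sum_abs _ _).trans (Finset.sum_le_sum fun i _ => ?_)
  rw [Finset.sum_mul]
  refine (Finset.abs_sum_le_sum_abs _ _).trans (Finset.sum_le_sum fun j _ => ?_)
  rw [pd_fluxRaw hγ hγ' (L2Loc.of_L2V F), add_mul]
  exact (abs_sub _ _).trans (add_le_add (h1 i j F v hv) (h2 i j F v hv))

lemma IsFlow.continuous_integral (hg : IsFlow γ T f₀ g) (φ : testSpace) :
    Continuous fun s => ∫ v, g s v * φ.1 v := by
  simp only [← inner_weightEmb_zero]
  exact hg.cont _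

lemma IsFlow.continuous_conv (hg : IsFlow γ T f₀ g) (α : Fin 3 → ℕ) (n : ℕ) (v : V) :
    Continuous fun s => conv (g s) (multiPd α (moll n)) v :=
  hg.continuous_integral (shiftTest (mollTest α n) v)

lemma IsFlow.continuous_rate (hγ : -3 < γ) (hγ' : γ < 0) (hg : IsFlow γ T f₀ g) (α : Fin 3 → ℕ)
    (n : ℕ) (v : V) : Continuous fun s => rate γ n (g s) α v :=
  (hg.continuous_integral (landauTest hγ hγ' (shiftTest (mollTest α n) v))).neg

lemma IsFlow.hasDerivAt_conv (hγ : -3 < γ) (hγ' : γ < 0) (hg : IsFlow γ T f₀ g) (α : Fin 3 → ℕ)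
    (n : ℕ) (v : V) {s : ℝ} (hs : s ∈ Ioo 0 T) :
    HasDerivAt (fun s => conv (g s) (multiPd α (moll n)) v) (rate γ n (g s) α v) s := by
  have hc := hg.continuous_rate hγ hγ' α n v
  have h1 : HasDerivAt (fun t => conv f₀ (multiPd α (moll n)) v
      + ∫ s in (0 : ℝ)..t, rate γ n (g s) α v) (rate γ n (g s) α v) s :=
    (hc.integral_hasStrictDerivAt 0 s).hasDerivAt.const_add _
  refine h1.congr_of_eventuallyEq ?_
  filter_upwards [isOpen_Ioo.mem_nhds hs] with t ht
  have h2 := hg.eq _ (shiftTest (mollTest α n) v).2.1 (shiftTest (mollTest α n) v).2.2 t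
    (Ioo_subset_Icc_self ht)
  simp only [conv, rate]
  rw [intervalIntegral.integral_neg, ← sub_eq_add_neg]
  exact h2

/-- The evolution of the localized, time-weighted energy of a mollified solution. -/
theorem IsFlow.energy_eq (hγ : -3 < γ) (hγ' : γ < 0) (hg : IsFlow γ T f₀ g) (α : Fin 3 → ℕ)
    (n k : ℕ) {p : V → ℝ} (hp : Continuous p) (hpc : HasCompactSupport p) {t : ℝ}
    (ht : t ∈ Icc 0 T) :
    IntegrableOn (fun s => k * s ^ (k - 1) * (∫ v, p v ^ 2 * conv (g s) (multiPd α (moll n)) v ^ 2)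
      + 2 * s ^ k * ∫ v, p v ^ 2 * conv (g s) (multiPd α (moll n)) v * rate γ n (g s) α v)
      (Ioo 0 t) ∧
    t ^ k * (∫ v, p v ^ 2 * conv (g t) (multiPd α (moll n)) v ^ 2)
      = 0 ^ k * (∫ v, p v ^ 2 * conv f₀ (multiPd α (moll n)) v ^ 2) + ∫ s in Ioo 0 t,
        (k * s ^ (k - 1) * (∫ v, p v ^ 2 * conv (g s) (multiPd α (moll n)) v ^ 2)
        + 2 * s ^ k * ∫ v, p v ^ 2 * conv (g s) (multiPd α (moll n)) v * rate γ n (g s) α v) := by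
  set U : ℝ → V → ℝ := fun s v => conv (g s) (multiPd α (moll n)) v with hU
  set E : ℝ → V → ℝ := fun s v => rate γ n (g s) α v with hE
  have hUs : ∀ v, Continuous fun s => U s v := hg.continuous_conv α n
  have hEs : ∀ v, Continuous fun s => E s v := hg.continuous_rate hγ hγ' α n
  have hUv : ∀ s, Continuous (U s) := fun s =>
    (contDiff_conv (L2Loc.of_L2V (g s)).locallyIntegrable (mollTest α n).2.1
      (mollTest α n).2.2).continuous
  have hEv : ∀ s, Continuous (E s) := fun s =>
    (contDiff_rate hγ hγ' (L2Loc.of_L2V (g s)) α n).continuous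
  have mU : Measurable (Function.uncurry U) :=
    measurable_uncurry_of_continuous_of_measurable hUs fun s => (hUv s).measurable
  have mE : Measurable (Function.uncurry E) :=
    measurable_uncurry_of_continuous_of_measurable hEs fun s => (hEv s).measurable
  obtain ⟨R, hR0, hR⟩ := exists_ball_support hpc
  obtain ⟨M, hM⟩ := hg.bound
  have hM0 : 0 ≤ M := (norm_nonneg _).trans (hM 0)
  obtain ⟨B1, hB1, hb1⟩ := exists_conv_bound (continuous_const (y := (1 : ℝ))) (mollTest α n) R
  obtain ⟨B2, hB2, hb2⟩ := exists_rate_bound hγ hγ' α n R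
  obtain ⟨B3, hB3, hb3⟩ := exists_ball_bound hp R
  have hUb : ∀ s, ∀ v ∈ Metric.ball (0 : V) R, |U s v| ≤ B1 * M := fun s v hv => by
    have := hb1 (g s) v hv
    simp only [one_mul] at this
    exact this.trans (mul_le_mul_of_nonneg_left (hM s) hB1)
  have hEb : ∀ s, ∀ v ∈ Metric.ball (0 : V) R, |E s v| ≤ B2 * M := fun s v hv =>
    (hb2 (g s) v hv).trans (mul_le_mul_of_nonneg_left (hM s) hB2)
  have hfin : IsFiniteMeasure ((volume : Measure V).restrict (Metric.ball 0 R)) :=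
    ⟨by rw [Measure.restrict_apply_univ]; exact measure_ball_lt_top⟩
  set Φ1 : ℝ → V → ℝ := fun s v => p v ^ 2 * U s v ^ 2 with hΦ1
  set Φ2 : ℝ → V → ℝ := fun s v => p v ^ 2 * U s v * E s v with hΦ2
  have hsm : ∀ s ∈ Ioo 0 t, |s| ≤ T := fun s hs => by
    rw [abs_of_pos hs.1]; exact hs.2.le.trans ht.2
  have hT : 0 ≤ T := ht.1.trans ht.2
  set Ψ : ℝ → V → ℝ := fun s v => k * s ^ (k - 1) * Φ1 s v + 2 * s ^ k * Φ2 s v with hΨ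
  have mp : Measurable fun x : ℝ × V => p x.2 := hp.measurable.comp measurable_snd
  have ms : Measurable fun x : ℝ × V => x.1 := measurable_fst
  have mΦ1 : Measurable (Function.uncurry Φ1) := (mp.pow_const 2).mul (mU.pow_const 2)
  have mΦ2 : Measurable (Function.uncurry Φ2) := ((mp.pow_const 2).mul mU).mul mE
  have mΨ : Measurable (Function.uncurry Ψ) :=
    (((ms.pow_const (k - 1)).const_mul (k : ℝ)).mul mΦ1).add
      (((ms.pow_const k).const_mul 2).mul mΦ2)
  have bΦ1 : ∀ s, ∀ v ∈ Metric.ball (0 : V) R, |Φ1 s v| ≤ B3 ^ 2 * (B1 * M) ^ 2 := fun s v hv => by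
    rw [hΦ1, abs_mul, abs_pow, abs_pow]
    gcongr
    exacts [hb3 v hv, hUb s v hv]
  have bΦ2 : ∀ s, ∀ v ∈ Metric.ball (0 : V) R, |Φ2 s v| ≤ B3 ^ 2 * (B1 * M) * (B2 * M) :=
    fun s v hv => by
      rw [hΦ2, abs_mul, abs_mul, abs_pow]
      gcongr
      exacts [hb3 v hv, hUb s v hv, hEb s v hv]
  have hΨi : Integrable (Function.uncurry Ψ)
      ((volume.restrict (Ioo 0 t)).prod (volume.restrict (Metric.ball (0 : V) R))) := by
    refine Integrable.of_bound mΨ.aestronglyMeasurable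
      (k * T ^ (k - 1) * (B3 ^ 2 * (B1 * M) ^ 2) + 2 * T ^ k * (B3 ^ 2 * (B1 * M) * (B2 * M))) ?_
    rw [Measure.prod_restrict, ae_restrict_iff' (measurableSet_Ioo.prod Metric.isOpen_ball.measurableSet)]
    refine Eventually.of_forall fun x hx => ?_
    have h1 := bΦ1 x.1 x.2 hx.2
    have h2 := bΦ2 x.1 x.2 hx.2
    have h3 := hsm x.1 hx.1
    change |k * x.1 ^ (k - 1) * Φ1 x.1 x.2 + 2 * x.1 ^ k * Φ2 x.1 x.2| ≤ _
    refine (abs_add_le _ _).trans ?_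
    rw [abs_mul (_ * _) (Φ1 _ _), abs_mul (_ * _) (Φ2 _ _), abs_mul (k : ℝ), abs_mul (2 : ℝ),
      abs_pow, abs_pow, Nat.abs_cast, abs_two]
    gcongr
  have hz1 : ∀ s, ∀ v ∉ Metric.ball (0 : V) R, Φ1 s v = 0 := fun s v hv => by
    simp [hΦ1, hR v hv]
  have hz2 : ∀ s, ∀ v ∉ Metric.ball (0 : V) R, Φ2 s v = 0 := fun s v hv => by
    simp [hΦ2, hR v hv]
  have i1 : ∀ s, Integrable (Φ1 s) := fun s =>
    (show Continuous (Φ1 s) from (hp.pow 2).mul ((hUv s).pow 2)).integrable_of_hasCompactSupport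
      (HasCompactSupport.mul_right (f := fun v => p v ^ 2)
        (hpc.comp_left (g := fun x => x ^ 2) (by simp)))
  have i2 : ∀ s, Integrable (Φ2 s) := fun s =>
    (show Continuous (Φ2 s) from
      ((hp.pow 2).mul (hUv s)).mul (hEv s)).integrable_of_hasCompactSupport
      (HasCompactSupport.mul_right (HasCompactSupport.mul_right (f := fun v => p v ^ 2)
        (hpc.comp_left (g := fun x => x ^ 2) (by simp))))
  have hin : ∀ s, ∫ v in Metric.ball (0 : V) R, Ψ s v
      = k * s ^ (k - 1) * (∫ v, Φ1 s v) + 2 * s ^ k * ∫ v, Φ2 s v := fun s => by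
    rw [setIntegral_eq_integral_of_forall_compl_eq_zero fun v hv => by
      simp [hΨ, hz1 s v hv, hz2 s v hv], ← integral_const_mul, ← integral_const_mul,
      ← integral_add ((i1 s).const_mul _) ((i2 s).const_mul _)]
  have hI := hΨi.integral_prod_left
  simp only [Function.uncurry_apply_pair, hin] at hI
  refine ⟨hI, ?_⟩
  have hswap := integral_integral_swap hΨi
  simp only [hin] at hswap
  refine Eq.trans ?_ (congrArg _ hswap.symm)
  -- For fixed `v` the integrand is the time derivative of `s^k p² U²`, so the fundamental theorem
  -- of calculus applies pointwise, before integrating in `v`. For `k = 0` the truncated exponent `k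
  -- - 1` has coefficient zero.
  have hft : ∀ v, ∫ s in Ioo 0 t, Ψ s v = t ^ k * Φ1 t v - 0 ^ k * Φ1 0 v := fun v => by
    rw [← integral_Ioc_eq_integral_Ioo, ← intervalIntegral.integral_of_le ht.1]
    refine intervalIntegral.integral_eq_sub_of_hasDerivAt_of_le (f := fun s => s ^ k * Φ1 s v)
      ht.1 ?_ (fun s hs => ?_) ?_
    · have := hUs v
      exact Continuous.continuousOn ((continuous_pow k).mul (continuous_const.mul (this.pow 2)))
    · have h1 := hg.hasDerivAt_conv hγ hγ' α n v ⟨hs.1, hs.2.trans_le ht.2⟩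
      convert! (hasDerivAt_pow k s).mul ((h1.pow 2).const_mul (p v ^ 2)) using 1
      simp only [hΨ, hΦ1, hΦ2, hU, hE, Pi.pow_apply]
      push_cast
      ring
    · have h1 := hUs v
      have h2 := hEs v
      refine Continuous.intervalIntegrable ?_ _ _
      exact (((continuous_const.mul (continuous_pow (k - 1)))).mul
        (continuous_const.mul (h1.pow 2))).add ((continuous_const.mul (continuous_pow k)).mul
          ((continuous_const.mul h1).mul h2))
  simp only [hft]
  rw [setIntegral_eq_integral_of_forall_compl_eq_zero fun v hv => by
      simp [hz1 _ v hv], integral_sub ((i1 t).const_mul _) ((i1 0).const_mul _),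
    integral_const_mul, integral_const_mul]
  have : ∀ v, Φ1 0 v = p v ^ 2 * conv f₀ (multiPd α (moll n)) v ^ 2 := fun v => by
    simp only [hΦ1, hU, hg.zero]
  simp only [this]
  ring

end

end

section

/-! ### Pointwise limits of mollifications -/

/-- The mollifiers as normalized bump functions. -/
def bumpSeq (n : ℕ) : ContDiffBump (0 : V) :=
  ⟨1 / 2 / ((n : ℝ) + 2), 1 / ((n : ℝ) + 2), by positivity, by gcongr; norm_num⟩

/-- It identifies the mollifiers with normalised bumps of comparable inner and outer radii, to which
the Lebesgue differentiation theorem applies. -/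
lemma normed_bumpSeq (n : ℕ) : (bumpSeq n).normed volume = moll n := by
  have hn : (0 : ℝ) < (n : ℝ) + 2 := by positivity
  have e : ∀ x, bumpSeq n x = bump0 (((n : ℝ) + 2) • x) := fun x => by
    rw [ContDiffBump.apply, ContDiffBump.apply, sub_zero, sub_zero, smul_smul]
    congr 1
    · simp only [bumpSeq, bump0]; field_simp
    · simp only [bumpSeq, bump0]; congr 1; field_simp
  funext x
  rw [ContDiffBump.normed_def, moll, moll0, ContDiffBump.normed_def]
  simp only [e]
  rw [Measure.integral_comp_smul]
  simp only [finrank_euclideanSpace, Fintype.card_fin, smul_eq_mul]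
  rw [abs_of_pos (by positivity)]
  have h0 : ∫ x, bump0 x ≠ 0 := (bump0.integral_pos (μ := volume)).ne'
  field_simp

lemma ae_tendsto_conv_moll {D : V → ℝ} (hD : LocallyIntegrable D) :
    ∀ᵐ v, Tendsto (fun n => conv D (moll n) v) atTop (𝓝 (D v)) := by
  have h := ContDiffBump.ae_convolution_tendsto_right_of_locallyIntegrable (φ := bumpSeq)
    (l := atTop) (K := 2) (μ := volume) (g := D) ?_ (Eventually.of_forall fun n => ?_) hD
  · filter_upwards [h] with v hv
    refine hv.congr fun n => ?_
    rw [convolution_eq_swap, normed_bumpSeq]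
    simp only [ContinuousLinearMap.lsmul_apply, smul_eq_mul, conv, mul_comm]
  · simp only [bumpSeq]
    refine (tendsto_const_div_atTop_nhds_zero_nat 1).comp (tendsto_add_atTop_nat 2) |>.congr
      fun n => ?_
    simp
  · simp only [bumpSeq]
    apply le_of_eq; field_simp

/-- The pointwise limit of `∂^δ (ρ_n * u)`. -/
def dlim (δ : Fin 3 → ℕ) (u : V → ℝ) (v : V) : ℝ :=
  (limsup (fun n => ((conv u (multiPd δ (moll n)) v : ℝ) : EReal)) atTop).toReal

/-- Any weak derivative agrees almost everywhere with a limsup built from `u` alone. Along a flow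
this canonical choice is jointly measurable in time and velocity, which separate choices at each
time would not guarantee. -/
lemma HasWeakDeriv.dlim_ae_eq {δ : Fin 3 → ℕ} {u D : V → ℝ} (h : HasWeakDeriv δ u D) :
    D =ᵐ[volume] dlim δ u := by
  filter_upwards [ae_tendsto_conv_moll h.locallyIntegrable] with v hv
  have h1 : ∀ n, conv u (multiPd δ (moll n)) v = conv D (moll n) v := fun n => by
    rw [h.conv_multiPd (contDiff_moll n) (hasCompactSupport_moll n)]
  rw [dlim]
  simp only [h1]
  rw [show limsup (fun n => (conv D (moll n) v : EReal)) atTop = (D v : EReal) from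
    ((continuous_coe_real_ereal.tendsto _).comp hv).limsup_eq, EReal.toReal_coe]

lemma HasWeakDeriv.dlim {δ : Fin 3 → ℕ} {u D : V → ℝ} (h : HasWeakDeriv δ u D) :
    HasWeakDeriv δ u (dlim δ u) :=
  h.congr h.dlim_ae_eq

lemma sqNormTwo_congr {θ : ℝ} {u w : V → ℝ} (h : u =ᵐ[volume] w) :
    sqNormTwo θ u = sqNormTwo θ w := by
  refine lintegral_congr_ae ?_
  filter_upwards [h] with v hv
  rw [hv]

lemma IsFlow.measurable_dlim {γ T : ℝ} {f₀ : L2V} {g : ℝ → L2V} (hg : IsFlow γ T f₀ g)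
    (δ : Fin 3 → ℕ) : Measurable (Function.uncurry fun τ => dlim δ (g τ)) := by
  have h : ∀ n, Measurable (Function.uncurry fun τ v => conv (g τ) (multiPd δ (moll n)) v) :=
    fun n => measurable_uncurry_of_continuous_of_measurable (hg.continuous_conv δ n) fun τ =>
      (contDiff_conv (L2Loc.of_L2V (g τ)).locallyIntegrable (mollTest δ n).2.1
        (mollTest δ n).2.2).continuous.measurable
  exact (Measurable.limsup fun n => (h n).coe_real_ereal).ereal_toReal

lemma measurable_dlim (δ : Fin 3 → ℕ) {u : V → ℝ} (hu : L2Loc u) : Measurable (dlim δ u) :=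
  (Measurable.limsup fun n => ((contDiff_conv hu.locallyIntegrable (mollTest δ n).2.1
        (mollTest δ n).2.2).continuous.measurable).coe_real_ereal).ereal_toReal

/-! ### Measurable families -/

section

variable {h : ℝ → V → ℝ}

lemma measurable_conv_family (hh : Measurable (Function.uncurry h)) {ρ : V → ℝ}
    (hρ : Continuous ρ) : Measurable (Function.uncurry fun τ => conv (h τ) ρ) := by
  have h1 : Measurable fun x : (ℝ × V) × V => h x.1.1 x.2 * ρ (x.1.2 - x.2) :=
    (hh.comp ((measurable_fst.comp measurable_fst).prodMk measurable_snd)).mul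
      (hρ.measurable.comp ((measurable_snd.comp measurable_fst).sub measurable_snd))
  exact (h1.stronglyMeasurable.integral_prod_right' (ν := (volume : Measure V))).measurable

lemma measurable_mul_family (hh : Measurable (Function.uncurry h)) {a : V → ℝ}
    (ha : Continuous a) : Measurable (Function.uncurry fun τ v => a v * h τ v) :=
  (ha.measurable.comp measurable_snd).mul hh

lemma measurable_ballSq (hh : Measurable (Function.uncurry h)) (R : ℝ) :
    Measurable fun τ => ballSq R (h τ) :=
  (hh.enorm.pow_const 2).lintegral_prod_right'
    (ν := (volume : Measure V).restrict (Metric.ball 0 R))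

lemma measurable_eInt (γ : ℝ) {P : V → ℝ} (hP : Continuous P) {ξ : Fin 3 → ℝ → V → ℝ}
    (hξ : ∀ i, Measurable (Function.uncurry (ξ i))) (hh : Measurable (Function.uncurry h)) :
    Measurable fun τ => eInt γ P (fun i => ξ i τ) (h τ) := by
  have h1 : Measurable fun x : ℝ × V => bracket x.2 ^ γ :=
    (contDiff_bracket_rpow γ).continuous.measurable.comp measurable_snd
  have h2 : Measurable fun x : ℝ × V => bracket x.2 ^ (γ + 2) :=
    (contDiff_bracket_rpow (γ + 2)).continuous.measurable.comp measurable_snd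
  have h3 : ∀ i : Fin 3, Measurable fun x : ℝ × V => x.2 i := fun i =>
    (contDiff_coord i).continuous.measurable.comp measurable_snd
  have h4 : Measurable fun x : ℝ × V => P x.2 := hP.measurable.comp measurable_snd
  have h5 : ∀ i, Measurable fun x : ℝ × V => ξ i x.1 x.2 := hξ
  have h6 : Measurable fun x : ℝ × V => h x.1 x.2 := hh
  have h7 : Measurable fun x : ℝ × V => ‖x.2‖ := measurable_norm.comp measurable_snd
  refine Measurable.lintegral_prod_right' (ν := (volume : Measure V))
    (f := fun x : ℝ × V => ENNReal.ofReal (P x.2 ^ 2 * edens γ x.2 (fun i => ξ i x.1 x.2) (h x.1 x.2)))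
    (Measurable.ennreal_ofReal ?_)
  simp only [edens, mform, bform]
  fun_prop

end

lemma friedrichs_eq {a D : V → ℝ} (ha : ContDiff ℝ ∞ a) (hD : L2Loc D) (i : Fin 3) (n : ℕ) :
    friedrichs a i n D = fun v => conv (fun w => a w * D w) (pd i (moll n)) v
      - conv (fun w => pd i a w * D w) (moll n) v - a v * conv D (pd i (moll n)) v := by
  funext v
  rw [friedrichs, pd_conv (hD.mul ha.continuous).locallyIntegrable (contDiff_moll n)
    (hasCompactSupport_moll n), pd_conv hD.locallyIntegrable (contDiff_moll n)
    (hasCompactSupport_moll n)]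

lemma measurable_distSq {D : ℝ → V → ℝ} (hD : Measurable (Function.uncurry D)) (R : ℝ) (n : ℕ) :
    Measurable fun τ => distSq R (conv (D τ) (moll n)) (D τ) :=
  measurable_ballSq (h := fun τ v => conv (D τ) (moll n) v - D τ v)
    ((measurable_conv_family hD (contDiff_moll n).continuous).sub hD) R

lemma aemeasurable_errTerm {γ : ℝ} (hγ : -3 < γ) (hγ' : γ < 0) {μ : Measure ℝ}
    {D : (Fin 3 → ℕ) → ℝ → V → ℝ} (hD : ∀ δ, Measurable (Function.uncurry (D δ)))
    (α : Fin 3 → ℕ) (hl : ∀ᵐ τ ∂μ, ∀ δ ≤ α, L2Loc (D δ τ)) (R : ℝ) (n : ℕ) :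
    AEMeasurable (fun τ => errTerm γ R α n fun δ => D δ τ) μ := by
  have hρ := contDiff_moll n
  refine ((measurable_distSq (hD α) R n).aemeasurable.add (Finset.aemeasurable_fun_sum _ fun β _ =>
    ((Finset.aemeasurable_fun_sum _ fun i _ =>
      (measurable_distSq (hD (α - β + unitIdx i)) R n).aemeasurable).add
      (measurable_distSq (hD (α - β)) R n).aemeasurable))).add ?_
  refine Finset.aemeasurable_fun_sum _ fun β _ => (Finset.aemeasurable_fun_sum _ fun i _ =>
    Finset.aemeasurable_fun_sum _ fun j _ => ?_).add ?_
  · have ha := (isDerivFamily_abarDeriv hγ hγ' i j).contDiff β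
    have hm : Measurable (Function.uncurry fun τ v =>
        conv (fun w => abarDeriv γ i j β w * D (α - β) τ w) (pd i (moll n)) v
        - conv (fun w => pd i (abarDeriv γ i j β) w * D (α - β) τ w) (moll n) v
        - abarDeriv γ i j β v * conv (D (α - β) τ) (pd i (moll n)) v) :=
      ((measurable_conv_family (measurable_mul_family (hD _) ha.continuous)
        (contDiff_pd hρ i).continuous).sub
        (measurable_conv_family (measurable_mul_family (hD _) (contDiff_pd ha i).continuous)
          hρ.continuous)).sub
        (measurable_mul_family (measurable_conv_family (hD _) (contDiff_pd hρ i).continuous)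
          ha.continuous)
    refine (measurable_ballSq hm R).aemeasurable.congr ?_
    filter_upwards [hl] with τ hτ
    rw [friedrichs_eq ha (hτ _ tsub_le_self)]
  · have ha := ((isDerivFamily_potDeriv hγ hγ').contDiff β).continuous
    exact (measurable_ballSq (h := fun τ => mulComm (potDeriv γ β) n (D (α - β) τ))
      ((measurable_conv_family (measurable_mul_family (hD _) ha) hρ.continuous).sub
        (measurable_mul_family (measurable_conv_family (hD _) hρ.continuous) ha)) R).aemeasurable

end

/-! ### Regularity classes and the evolution inequality -/

section

/-- `u` has locally square integrable weak derivatives up to order `k`. -/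
def Reg (k : ℕ) (u : V → ℝ) : Prop :=
  ∀ δ, len δ ≤ k → HasWeakDeriv δ u (dlim δ u) ∧ L2Loc (dlim δ u)

/-- The weighted `L²` norm of the derivative of order `δ`. -/
def normD (γ : ℝ) (δ : Fin 3 → ℕ) (u : V → ℝ) : ℝ≥0∞ := sqNormTwo (γ * len δ / 2) (dlim δ u)

/-- The weighted energy of the derivative of order `δ`. -/
def energyD (γ : ℝ) (δ : Fin 3 → ℕ) (u : V → ℝ) : ℝ≥0∞ :=
  eInt γ (fun v => bracket v ^ (γ * len δ / 2)) (fun i => dlim (δ + unitIdx i) u) (dlim δ u)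

/-- The constants in the static energy inequality. -/
structure EnergyConst (γ c C K S : ℝ) : Prop where
  c_pos : 0 < c
  C_pos : 0 < C
  one_le : 1 ≤ K
  S_nonneg : 0 ≤ S
  energyLe : ∀ (α : Fin 3 → ℕ) (θ R : ℝ) (x : (Fin 3 → ℕ) → ℝ), 1 ≤ R → (∀ β, 0 < x β) →
    ∃ A : ℝ≥0∞, A ≠ ⊤ ∧ ∀ (g : V → ℝ) (D : (Fin 3 → ℕ) → V → ℝ), L2Loc g →
      HasWeakDerivsUpTo α g D →
      (∀ β ∈ (box α).erase 0, ∀ i, HasWeakDeriv (unitIdx i) (D (α - β)) (D (α - β + unitIdx i)) ∧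
        L2Loc (D (α - β + unitIdx i))) → ∀ n,
      EnergyLe (ENNReal.ofReal c * eInt γ (cutoff θ R) (fun i => pd i (conv (D α) (moll n)))
          (conv (D α) (moll n)))
        (∫ v, cutoff θ R v ^ 2 * conv (D α) (moll n) v * rate γ n g α v)
        (ENNReal.ofReal C * (ENNReal.ofReal (1 + (|θ| + S) ^ 2) * wInt γ (outer θ R) (D α)
          + ENNReal.ofReal (∑ β ∈ (box α).erase 0, lowCoeff K α β * x (α - β)) *
            ∑ β ∈ (box α).erase 0, ENNReal.ofReal (lowCoeff K α β / x (α - β)) *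
              eInt γ (cutoff θ R) (fun i => D (α - β + unitIdx i)) (D (α - β)))
          + A * errTerm γ (2 * R) α n D)

lemma exists_energyConst {γ : ℝ} (hγ : -3 < γ) (hγ' : γ < 0) :
    ∃ c C K S, EnergyConst γ c C K S := by
  obtain ⟨c, C, K, S, h1, h2, h3, h4, h5⟩ := exists_energyLe hγ hγ'
  exact ⟨c, C, K, S, h1, h2, h3, h4, h5⟩

/-- The right-hand side of the static energy inequality. -/
def staticRhs (γ C K S : ℝ) (x : (Fin 3 → ℕ) → ℝ) (α : Fin 3 → ℕ) (u : V → ℝ) : ℝ≥0∞ :=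
  ENNReal.ofReal C * (ENNReal.ofReal (1 + (|γ * len α / 2| + S) ^ 2) * normD γ α u
    + ENNReal.ofReal (∑ β ∈ (box α).erase 0, lowCoeff K α β * x (α - β)) *
      ∑ β ∈ (box α).erase 0, ENNReal.ofReal (lowCoeff K α β / x (α - β)) * energyD γ (α - β) u)

/-- The integrand on the right-hand side of the evolution inequality. -/
def evolRhs (γ C K S : ℝ) (x : (Fin 3 → ℕ) → ℝ) (α : Fin 3 → ℕ) (u : V → ℝ) (s : ℝ) : ℝ≥0∞ :=
  ENNReal.ofReal (len α * s ^ (len α - 1)) * (2 * normD γ α u)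
    + ENNReal.ofReal (2 * s ^ len α) * staticRhs γ C K S x α u

lemma eInt_mono {γ : ℝ} {P P' : V → ℝ} (h0 : ∀ v, 0 ≤ P v) (h : ∀ v, P v ≤ P' v)
    (ξ : Fin 3 → V → ℝ) (x : V → ℝ) : eInt γ P ξ x ≤ eInt γ P' ξ x := by
  refine lintegral_mono fun v => ENNReal.ofReal_le_ofReal ?_
  have := edens_nonneg γ v (fun i => ξ i v) (x v)
  have h1 := h0 v
  have h2 := h v
  gcongr

lemma wInt_le {γ : ℝ} (hγ' : γ < 0) (θ R : ℝ) (x : V → ℝ) :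
    wInt γ (outer θ R) x ≤ sqNormTwo θ x := by
  refine lintegral_mono fun v => ENNReal.ofReal_le_ofReal ?_
  have h1 : 0 ≤ bracket v ^ θ := Real.rpow_nonneg (bracket_pos v).le _
  have h2 : bracket v ^ γ ≤ 1 := Real.rpow_le_one_of_one_le_of_nonpos (one_le_bracket v) hγ'.le
  have h3 : 0 ≤ bracket v ^ γ := Real.rpow_nonneg (bracket_pos v).le _
  have h4 : outer θ R v ^ 2 ≤ (bracket v ^ θ) ^ 2 := by
    rw [outer]
    by_cases hv : v ∈ Metric.ball (0 : V) (2 * R)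
    · rw [indicator_of_mem hv]
    · rw [indicator_of_notMem hv, zero_pow two_ne_zero]; positivity
  rw [mul_pow]
  have h5 : outer θ R v ^ 2 * bracket v ^ γ ≤ (bracket v ^ θ) ^ 2 * 1 :=
    mul_le_mul h4 h2 h3 (by positivity)
  rw [mul_one] at h5
  exact mul_le_mul_of_nonneg_right h5 (sq_nonneg _)

lemma cutoff_le_of_le {θ θ' : ℝ} (h : θ ≤ θ') (R : ℝ) (v : V) : cutoff θ R v ≤ bracket v ^ θ' :=
  (cutoff_le θ R v).trans (Real.rpow_le_rpow_of_exponent_le (one_le_bracket v) h)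

lemma exists_cutoff_sq_le (θ : ℝ) {R : ℝ} (hR : 0 < R) : ∃ A : ℝ≥0∞, A ≠ ⊤ ∧ ∀ x y : V → ℝ,
    (AEStronglyMeasurable fun v => x v - y v) →
    ∫⁻ v, ENNReal.ofReal (cutoff θ R v ^ 2 * x v ^ 2) ≤ 2 * sqNormTwo θ y
      + A * distSq (2 * R) x y := by
  obtain ⟨A, hA, hAb⟩ := exists_ball_bound ((contDiff_cutoff θ R).continuous.pow 2) (2 * R)
  refine ⟨ENNReal.ofReal (2 * A), ENNReal.ofReal_ne_top, fun x y hx => ?_⟩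
  refine lintegral_le_of_le_on_ball ENNReal.ofReal_ne_top (aemeasurable_enorm_sq hx _)
    (fun v hv => ?_) fun v hv => by rw [cutoff_eq_zero hR hv]; simp
  rw [enorm_sq_eq, ← ENNReal.ofReal_mul (by positivity), show (2 : ℝ≥0∞) = ENNReal.ofReal 2 by simp,
    ← ENNReal.ofReal_mul (by norm_num), ← ENNReal.ofReal_add (by positivity) (by positivity)]
  refine ENNReal.ofReal_le_ofReal ?_
  have h3 : cutoff θ R v ^ 2 ≤ A := (abs_le.1 (hAb v hv)).2
  have h4 : x v ^ 2 ≤ 2 * y v ^ 2 + 2 * (x v - y v) ^ 2 := by nlinarith [sq_nonneg (x v - 2 * y v)]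
  have h5 : cutoff θ R v ^ 2 ≤ (bracket v ^ θ) ^ 2 :=
    pow_le_pow_left₀ (cutoff_nonneg _ _ _) (cutoff_le _ _ _) 2
  rw [mul_pow]
  nlinarith [mul_le_mul_of_nonneg_left h4 (sq_nonneg (cutoff θ R v)),
    mul_le_mul_of_nonneg_right h3 (sq_nonneg (x v - y v)),
    mul_le_mul_of_nonneg_right h5 (sq_nonneg (y v))]

lemma ofReal_integral_cutoff {θ R : ℝ} (hR : 0 < R) {x : V → ℝ} (hx : Continuous x) :
    ENNReal.ofReal (∫ v, cutoff θ R v ^ 2 * x v ^ 2)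
      = ∫⁻ v, ENNReal.ofReal (cutoff θ R v ^ 2 * x v ^ 2) := by
  refine ofReal_integral_eq_lintegral_ofReal ?_ (Eventually.of_forall fun v => by positivity)
  exact Continuous.integrable_of_hasCompactSupport
    (((contDiff_cutoff θ R).continuous.pow 2).mul (hx.pow 2))
    (HasCompactSupport.mul_right (f := fun v => cutoff θ R v ^ 2)
      ((hasCompactSupport_cutoff hR).comp_left (g := fun x => x ^ 2) (by simp)))

lemma distSq_le_errTerm (γ R : ℝ) (α : Fin 3 → ℕ) (n : ℕ) (D : (Fin 3 → ℕ) → V → ℝ) :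
    distSq R (conv (D α) (moll n)) (D α) ≤ errTerm γ R α n D :=
  le_self_add.trans le_self_add

section

variable {γ T : ℝ} {f₀ : L2V} {g : ℝ → L2V}

/-- The evolution inequality for mollified derivatives. -/
lemma IsFlow.exists_evolution_le {c C K S : ℝ} (hγ : -3 < γ) (hγ' : γ < 0)
    (hE : EnergyConst γ c C K S) (hg : IsFlow γ T f₀ g) (α : Fin 3 → ℕ)
    (hreg : ∀ᵐ s ∂volume.restrict (Ioo 0 (min 1 T)), Reg (len α) (g s))
    {x : (Fin 3 → ℕ) → ℝ} (hx : ∀ β, 0 < x β) {R : ℝ} (hR : 1 ≤ R) :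
    ∃ A : ℝ≥0∞, A ≠ ⊤ ∧ ∀ t, 0 < t → t ≤ min 1 T → ∀ n,
      ENNReal.ofReal (t ^ len α * ∫ v, cutoff (γ * len α / 2) R v ^ 2
          * conv (g t) (multiPd α (moll n)) v ^ 2)
        + ∫⁻ s in Ioo 0 t, ENNReal.ofReal (2 * s ^ len α) * (ENNReal.ofReal c *
          eInt γ (cutoff (γ * len α / 2) R) (fun i => pd i (conv (g s) (multiPd α (moll n))))
            (conv (g s) (multiPd α (moll n))))
      ≤ ENNReal.ofReal (0 ^ len α * ∫ v, cutoff (γ * len α / 2) R v ^ 2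
          * conv f₀ (multiPd α (moll n)) v ^ 2)
        + ∫⁻ s in Ioo 0 t, (evolRhs γ C K S x α (g s) s
          + A * (ENNReal.ofReal (len α * s ^ (len α - 1) + 2 * s ^ len α)
            * errTerm γ (2 * R) α n fun δ => dlim δ (g s))) := by
  set k := len α with hk
  set θ := γ * k / 2 with hθ
  have hR0 : 0 < R := by linarith
  obtain ⟨A1, hA1, h1⟩ := hE.energyLe α θ R x hR hx
  obtain ⟨A2, hA2, h2⟩ := exists_cutoff_sq_le θ hR0
  refine ⟨max A1 A2, by simp [hA1, hA2], fun t ht0 ht n => ?_⟩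
  have htT : t ≤ T := ht.trans (min_le_right _ _)
  obtain ⟨hI, hEq⟩ := hg.energy_eq hγ hγ' α n k (contDiff_cutoff θ R).continuous
    (hasCompactSupport_cutoff hR0) ⟨ht0.le, htT⟩
  have hreg' : ∀ᵐ s ∂volume.restrict (Ioo 0 t), Reg k (g s) :=
    ae_restrict_of_ae_restrict_of_subset (Ioo_subset_Ioo_right ht) hreg
  have hsq : ∀ u : V → ℝ, 0 ≤ ∫ v, cutoff θ R v ^ 2 * u v ^ 2 := fun u =>
    integral_nonneg fun v => by positivity
  have hmain : ∀ᵐ s ∂volume.restrict (Ioo 0 t), EnergyLe (ENNReal.ofReal (2 * s ^ k) *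
      (ENNReal.ofReal c * eInt γ (cutoff θ R) (fun i => pd i (conv (g s) (multiPd α (moll n))))
            (conv (g s) (multiPd α (moll n)))))
      (k * s ^ (k - 1) * (∫ v, cutoff θ R v ^ 2 * conv (g s) (multiPd α (moll n)) v ^ 2)
      + 2 * s ^ k * ∫ v, cutoff θ R v ^ 2 * conv (g s) (multiPd α (moll n)) v * rate γ n (g s) α v)
      (evolRhs γ C K S x α (g s) s + max A1 A2 * (ENNReal.ofReal (k * s ^ (k - 1) + 2 * s ^ k)
            * errTerm γ (2 * R) α n fun δ => dlim δ (g s))) := by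
    filter_upwards [hreg', ae_restrict_mem measurableSet_Ioo] with s hs hs0
    have hs1 : 0 ≤ s := hs0.1.le
    have hU : conv (g s) (multiPd α (moll n)) = conv (dlim α (g s)) (moll n) :=
      (hs α le_rfl).1.conv_multiPd (contDiff_moll n) (hasCompactSupport_moll n)
    have hl := (hs α le_rfl).2
    have h3 := h1 (g s) (fun δ => dlim δ (g s)) (L2Loc.of_L2V _)
      (fun δ hδ => hs δ (len_mono hδ)) (fun β hβ i => by
        obtain ⟨-, h4, h5⟩ := mem_erase_box hβ
        have h6 := hs (α - β) (by omega)
        have h7 := hs (α - β + unitIdx i) (by rw [len_add, len_unitIdx]; omega)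
        exact ⟨h6.1.of_add h7.1, h7.2⟩) n
    rw [← hU] at h3
    have h4 := (h3.const_mul (c := 2 * s ^ k) (by positivity)).add_const
      (r := k * s ^ (k - 1) * (∫ v, cutoff θ R v ^ 2 * conv (g s) (multiPd α (moll n)) v ^ 2))
      (mul_nonneg (by positivity) (hsq _))
    refine h4.mono le_rfl ?_
    have hcont : Continuous (conv (g s) (multiPd α (moll n))) := by
      rw [hU]; exact Landau.continuous_conv hl n
    have h5 := h2 (conv (g s) (multiPd α (moll n))) (dlim α (g s))
      (hcont.aestronglyMeasurable.sub hl.1)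
    rw [← ofReal_integral_cutoff hR0 hcont] at h5
    set err := errTerm γ (2 * R) α n fun δ => dlim δ (g s) with herr
    have h6 : distSq (2 * R) (conv (g s) (multiPd α (moll n))) (dlim α (g s)) ≤ err := by
      rw [hU]; exact distSq_le_errTerm γ (2 * R) α n fun δ => dlim δ (g s)
    have h7 : wInt γ (outer θ R) (dlim α (g s)) ≤ normD γ α (g s) := wInt_le hγ' _ _ _
    -- As `γ < 0` and `|α - β| ≤ |α|`, the weight of order `α` is below the weight of order `α - β`,
    -- so the lower order terms are bounded by their own natural energies.
    have h8 : ∀ β ∈ (box α).erase 0, eInt γ (cutoff θ R) (fun i => dlim (α - β + unitIdx i) (g s))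
        (dlim (α - β) (g s)) ≤ energyD γ (α - β) (g s) := fun β hβ => by
      refine eInt_mono (cutoff_nonneg _ _) (fun v => cutoff_le_of_le ?_ R v) _ _
      have h9 : (len (α - β) : ℝ) ≤ k := by exact_mod_cast len_mono tsub_le_self
      rw [hθ]
      nlinarith
    have h9 : ENNReal.ofReal C * (ENNReal.ofReal (1 + (|θ| + S) ^ 2) * wInt γ (outer θ R) (dlim α (g s))
          + ENNReal.ofReal (∑ β ∈ (box α).erase 0, lowCoeff K α β * x (α - β)) *
            ∑ β ∈ (box α).erase 0, ENNReal.ofReal (lowCoeff K α β / x (α - β)) *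
              eInt γ (cutoff θ R) (fun i => dlim (α - β + unitIdx i) (g s)) (dlim (α - β) (g s)))
        ≤ staticRhs γ C K S x α (g s) := by
      rw [staticRhs]
      gcongr with β hβ
      exact h8 β hβ
    calc _ ≤ ENNReal.ofReal (k * s ^ (k - 1)) * (2 * normD γ α (g s) + max A1 A2 * err)
          + ENNReal.ofReal (2 * s ^ k) * (staticRhs γ C K S x α (g s) + max A1 A2 * err) := by
          rw [ENNReal.ofReal_mul (by positivity)]
          refine add_le_add (mul_le_mul_right (h5.trans (add_le_add le_rfl ?_)) _)
            (mul_le_mul_right (add_le_add h9 ?_) _)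
          · exact mul_le_mul' (le_max_right _ _) h6
          · exact mul_le_mul' (le_max_left _ _) le_rfl
      _ = _ := by
          rw [ENNReal.ofReal_add (by positivity) (by positivity), evolRhs]
          ring
  exact (EnergyLe.integral hI hmain).le (mul_nonneg (by positivity) (hsq _))
    (mul_nonneg (by positivity) (hsq _)) hEq

end

end

/-! ### Control of the mollification error, uniformly in time -/

section

lemma exists_ballSq_le (θ R : ℝ) : ∃ A : ℝ≥0∞, A ≠ ⊤ ∧ ∀ D : V → ℝ,
    ballSq R D ≤ A * sqNormTwo θ D := by
  obtain ⟨A, hA, hAb⟩ := exists_ball_bound (contDiff_bracket_rpow (-θ)).continuous R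
  refine ⟨ENNReal.ofReal A ^ 2, ENNReal.pow_ne_top ENNReal.ofReal_ne_top, fun D => ?_⟩
  calc ballSq R D = ballSq R (fun v => bracket v ^ (-θ) * (bracket v ^ θ * D v)) := by
        congr 1; ext v
        rw [← mul_assoc, ← Real.rpow_add (bracket_pos v), neg_add_cancel, Real.rpow_zero, one_mul]
    _ ≤ ENNReal.ofReal A ^ 2 * ballSq R (fun v => bracket v ^ θ * D v) := ballSq_mul_le hAb
    _ ≤ _ := by
        gcongr
        rw [ballSq, sqNormTwo]
        simp only [enorm_sq_eq]
        exact lintegral_mono' Measure.restrict_le_self le_rfl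

lemma L2Loc.of_sqNormTwo {θ : ℝ} {D : V → ℝ} (hD : AEStronglyMeasurable D)
    (h : sqNormTwo θ D ≠ ⊤) : L2Loc D :=
  ⟨hD, fun R => by
    obtain ⟨A, hA, hb⟩ := exists_ballSq_le θ R
    exact ne_top_of_le_ne_top (ENNReal.mul_ne_top hA h) (hb D)⟩

lemma le_edens (γ : ℝ) (v : V) (ξ : Fin 3 → ℝ) (x : ℝ) (i : Fin 3) :
    bracket v ^ γ * ξ i ^ 2 ≤ edens γ v ξ x := by
  have hb : 0 ≤ bracket v ^ γ := Real.rpow_nonneg (bracket_pos v).le _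
  have hb2 : 0 ≤ bracket v ^ (γ + 2) := Real.rpow_nonneg (bracket_pos v).le _
  have h1 : ξ i ^ 2 ≤ ∑ j, ξ j ^ 2 :=
    Finset.single_le_sum (f := fun j => ξ j ^ 2) (fun j _ => sq_nonneg _) (Finset.mem_univ i)
  have h2 : 0 ≤ mform γ v ξ - bracket v ^ γ * ∑ j, ξ j ^ 2 := by
    have e : mform γ v ξ - bracket v ^ γ * ∑ j, ξ j ^ 2
        = bracket v ^ γ * ((v 0 * ξ 1 - v 1 * ξ 0) ^ 2 + (v 0 * ξ 2 - v 2 * ξ 0) ^ 2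
          + (v 1 * ξ 2 - v 2 * ξ 1) ^ 2) := by
      simp only [mform, bform, norm_sq_eq_sum, Fin.sum_univ_three]
      ring
    rw [e]; positivity
  rw [edens]
  have h3 := mul_le_mul_of_nonneg_left h1 hb
  have h4 := mul_nonneg hb2 (sq_nonneg x)
  linarith

/-- The reason for the weights `⟨v⟩^{γ|δ|/2}`: one more derivative changes the squared weight by
`⟨v⟩^γ`, exactly the worst ellipticity of the energy density. -/
lemma normD_le_energyD (γ : ℝ) (δ : Fin 3 → ℕ) (i : Fin 3) (u : V → ℝ) :
    normD γ (δ + unitIdx i) u ≤ energyD γ δ u := by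
  refine lintegral_mono fun v => ENNReal.ofReal_le_ofReal ?_
  have h1 := le_edens γ v (fun i => dlim (δ + unitIdx i) u v) (dlim δ u v) i
  refine le_trans (le_of_eq ?_) (mul_le_mul_of_nonneg_left h1 (sq_nonneg _))
  have e : ∀ a : ℝ, (bracket v ^ a) ^ 2 = bracket v ^ (a * 2) := fun a => by
    rw [Real.rpow_mul (bracket_pos v).le, Real.rpow_ofNat]
  rw [mul_pow, ← mul_assoc, e, e, ← Real.rpow_add (bracket_pos v), len_add, len_unitIdx]
  congr 2
  push_cast; ring

lemma exists_eq_add_unitIdx {δ : Fin 3 → ℕ} {l : Fin 3} (h : 1 ≤ δ l) :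
    ∃ δ', δ = δ' + unitIdx l ∧ len δ' + 1 = len δ := by
  have h1 : unitIdx l ≤ δ := fun i => by
    rw [unitIdx]
    by_cases hi : i = l
    · subst hi; simpa using h
    · simp [hi]
  refine ⟨δ - unitIdx l, (tsub_add_cancel_of_le h1).symm, ?_⟩
  have := len_sub_add_len h1
  rwa [len_unitIdx] at this

lemma exists_one_le_of_len {δ : Fin 3 → ℕ} (h : 1 ≤ len δ) : ∃ l, 1 ≤ δ l := by
  by_contra hn
  push Not at hn
  have : len δ = 0 := Finset.sum_eq_zero fun i _ => by have := hn i; omega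
  omega

lemma eq_zero_of_len {δ : Fin 3 → ℕ} (h : len δ = 0) : δ = 0 := by
  by_contra h0
  have := one_le_len h0
  omega

lemma dlim_zero_ae_eq {u : V → ℝ} (hu : LocallyIntegrable u) : u =ᵐ[volume] dlim 0 u :=
  (HasWeakDeriv.zero hu).dlim_ae_eq

lemma ballSq_congr {R : ℝ} {u w : V → ℝ} (h : u =ᵐ[volume] w) : ballSq R u = ballSq R w := by
  refine lintegral_congr_ae (ae_restrict_of_ae ?_)
  filter_upwards [h] with v hv
  rw [hv]

section

variable {γ T : ℝ} {f₀ : L2V} {g : ℝ → L2V}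

/-- A derivative of order `m ≥ 1` is controlled by the energy of order `m - 1`, whose time weight
`s^{m-1}` dominates `s^{k-1}` on `(0, 1)`. Order zero uses the uniform `L²` bound. This is the
integrable majorant for the error. -/
lemma IsFlow.lintegral_ballSq_ne_top (hg : IsFlow γ T f₀ g) {k : ℕ}
    (hfin : ∀ δ, len δ < k → ∫⁻ s in Ioo 0 (min 1 T),
      ENNReal.ofReal (s ^ len δ) * energyD γ δ (g s) ≠ ⊤) {δ : Fin 3 → ℕ} (hδ : len δ ≤ k) (R : ℝ) :
    ∫⁻ s in Ioo 0 (min 1 T), ENNReal.ofReal (k * s ^ (k - 1) + 2 * s ^ k)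
      * ballSq R (dlim δ (g s)) ≠ ⊤ := by
  have hw : ∀ s ∈ Ioo 0 (min 1 T), ∀ m, m ≤ k - 1 →
      k * s ^ (k - 1) + 2 * s ^ k ≤ (k + 2) * s ^ m := by
    intro s hs m hm
    have h0 := hs.1.le
    have h1 : s ≤ 1 := hs.2.le.trans (min_le_left _ _)
    have h2 : s ^ (k - 1) ≤ s ^ m := pow_le_pow_of_le_one h0 h1 hm
    have h3 : s ^ k ≤ s ^ m := pow_le_pow_of_le_one h0 h1 (hm.trans (Nat.sub_le _ _))
    have : (0 : ℝ) ≤ k := Nat.cast_nonneg k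
    nlinarith
  rcases Nat.eq_zero_or_pos (len δ) with h0 | h0
  · obtain ⟨M, hM⟩ := hg.bound
    rw [eq_zero_of_len h0]
    refine ne_top_of_le_ne_top (b := ∫⁻ s in Ioo 0 (min 1 T),
      ENNReal.ofReal (k + 2) * ENNReal.ofReal (M ^ 2)) ?_ (setLIntegral_mono' measurableSet_Ioo
        fun s hs => ?_)
    · rw [setLIntegral_const, Real.volume_Ioo]
      finiteness
    · have h1 := hw s hs 0 (Nat.zero_le _)
      rw [pow_zero, mul_one] at h1
      refine mul_le_mul' (ENNReal.ofReal_le_ofReal h1) ?_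
      rw [← ballSq_congr (dlim_zero_ae_eq (L2Loc.of_L2V (g s)).locallyIntegrable)]
      refine (ballSq_le_norm_sq R (g s)).trans (ENNReal.ofReal_le_ofReal ?_)
      exact pow_le_pow_left₀ (norm_nonneg _) (hM s) 2
  · obtain ⟨l, hl⟩ := exists_one_le_of_len h0
    obtain ⟨δ', rfl, h2⟩ := exists_eq_add_unitIdx hl
    obtain ⟨A, hA, hb⟩ := exists_ballSq_le (γ * len (δ' + unitIdx l) / 2) R
    refine ne_top_of_le_ne_top (b := ∫⁻ s in Ioo 0 (min 1 T), (ENNReal.ofReal (k + 2) * A) *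
      (ENNReal.ofReal (s ^ len δ') * energyD γ δ' (g s))) ?_ (setLIntegral_mono' measurableSet_Ioo
        fun s hs => ?_)
    · rw [lintegral_const_mul' _ _ (by finiteness)]
      exact ENNReal.mul_ne_top (by finiteness) (hfin δ' (by omega))
    · have h1 := hw s hs (len δ') (by omega)
      calc _ ≤ ENNReal.ofReal ((k + 2) * s ^ len δ') * (A * energyD γ δ' (g s)) :=
            mul_le_mul' (ENNReal.ofReal_le_ofReal h1)
              ((hb _).trans (mul_le_mul_right (normD_le_energyD γ δ' l _) _))
        _ = _ := by rw [ENNReal.ofReal_mul (by positivity)]; ring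

/-- Dominated convergence in time: at almost every time the error tends to zero, and it is bounded
by finitely many local norms with the integrability just shown. -/
lemma IsFlow.tendsto_error (hγ : -3 < γ) (hγ' : γ < 0) (hg : IsFlow γ T f₀ g) (α : Fin 3 → ℕ)
    (hreg : ∀ᵐ s ∂volume.restrict (Ioo 0 (min 1 T)), Reg (len α) (g s))
    (hfin : ∀ δ, len δ < len α → ∫⁻ s in Ioo 0 (min 1 T),
      ENNReal.ofReal (s ^ len δ) * energyD γ δ (g s) ≠ ⊤) (R : ℝ) :
    Tendsto (fun n => ∫⁻ s in Ioo 0 (min 1 T), ENNReal.ofReal (len α * s ^ (len α - 1)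
      + 2 * s ^ len α) * errTerm γ R α n fun δ => dlim δ (g s)) atTop (𝓝 0) := by
  set k := len α with hk
  obtain ⟨A, I, hA, hI, hv⟩ := vanishing_errTerm hγ hγ' R α
  have hw : Measurable fun s : ℝ => ENNReal.ofReal (k * s ^ (k - 1) + 2 * s ^ k) := by fun_prop
  have hm : ∀ n, AEMeasurable (fun s => ENNReal.ofReal (k * s ^ (k - 1) + 2 * s ^ k) *
      errTerm γ R α n fun δ => dlim δ (g s)) (volume.restrict (Ioo 0 (min 1 T))) := fun n =>
    hw.aemeasurable.mul (aemeasurable_errTerm hγ hγ' (fun δ => hg.measurable_dlim δ) α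
      (hreg.mono fun s hs δ hδ => (hs δ (len_mono hδ)).2) R n)
  have h := tendsto_lintegral_of_dominated_convergence'
    (μ := volume.restrict (Ioo 0 (min 1 T))) (f := fun _ => 0)
    (fun s => A * ∑ δ ∈ I, ENNReal.ofReal (k * s ^ (k - 1) + 2 * s ^ k)
      * ballSq (R + 1) (dlim δ (g s))) hm (fun n => ?_) ?_ ?_
  · simpa using h
  · filter_upwards [hreg] with s hs
    have h1 := (hv (fun δ => dlim δ (g s)) fun δ hδ => (hs δ hδ).2).1 n
    rw [← Finset.mul_sum, mul_left_comm]
    exact mul_le_mul_right h1 _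
  · have hb : ∀ δ ∈ I, AEMeasurable (fun s => ENNReal.ofReal (k * s ^ (k - 1) + 2 * s ^ k)
        * ballSq (R + 1) (dlim δ (g s))) (volume.restrict (Ioo 0 (min 1 T))) := fun δ _ =>
      (hw.mul (measurable_ballSq (hg.measurable_dlim δ) _)).aemeasurable
    rw [lintegral_const_mul' _ _ hA, lintegral_finsetSum' _ hb]
    exact ENNReal.mul_ne_top hA (ENNReal.sum_ne_top.2 fun δ hδ =>
      hg.lintegral_ballSq_ne_top hfin (hI δ hδ) _)
  · filter_upwards [hreg] with s hs
    have h1 := (hv (fun δ => dlim δ (g s)) fun δ hδ => (hs δ hδ).2).2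
    have := ENNReal.Tendsto.const_mul (a := ENNReal.ofReal (k * s ^ (k - 1) + 2 * s ^ k)) h1
      (Or.inr ENNReal.ofReal_ne_top)
    simpa using this

/-- The contribution of the initial datum, present only at order zero. -/
def initTerm (f₀ : L2V) (k : ℕ) : ℝ≥0∞ := ENNReal.ofReal (0 ^ k * (2 * ‖f₀‖ ^ 2))

/-- For `|α| ≥ 1` the time weight vanishes at the initial time, so the data contribute nothing,
however large the mollified derivatives of `f₀` may be. -/
lemma exists_initTerm (γ : ℝ) (f₀ : L2V) (α : Fin 3 → ℕ) {R : ℝ} (hR : 0 < R) :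
    ∃ ε : ℕ → ℝ≥0∞, Tendsto ε atTop (𝓝 0) ∧ ∀ n,
      ENNReal.ofReal (0 ^ len α * ∫ v, cutoff (γ * len α / 2) R v ^ 2
          * conv f₀ (multiPd α (moll n)) v ^ 2) ≤ initTerm f₀ (len α) + ε n := by
  rcases Nat.eq_zero_or_pos (len α) with h0 | h0
  · obtain ⟨A, hA, hb⟩ := exists_cutoff_sq_le (γ * len α / 2) hR
    have hl := L2Loc.of_L2V f₀
    obtain ⟨B, -, h⟩ := negligible_conv_sub (2 * R)
    refine ⟨fun n => A * distSq (2 * R) (conv f₀ (moll n)) f₀, ?_, fun n => ?_⟩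
    · have := ENNReal.Tendsto.const_mul (a := A) (h f₀ hl).2 (Or.inr hA)
      simpa [distSq] using this
    · have h1 := hb (conv f₀ (moll n)) f₀ ((continuous_conv hl n).aestronglyMeasurable.sub hl.1)
      rw [← ofReal_integral_cutoff hR (continuous_conv hl n)] at h1
      have e : sqNormTwo (γ * len α / 2) f₀ = ENNReal.ofReal (‖f₀‖ ^ 2) := by
        rw [h0, ← lintegral_sq_eq_norm_sq, sqNormTwo]
        simp
      rw [e] at h1
      rw [initTerm]
      rw [h0] at h1 ⊢
      rw [eq_zero_of_len h0, multiPd_zero, pow_zero, one_mul, one_mul,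
        ENNReal.ofReal_mul (by norm_num)]
      simpa using h1
  · refine ⟨fun _ => 0, tendsto_const_nhds, fun n => ?_⟩
    rw [zero_pow (by omega)]; simp

/-- The evolution inequality for mollified derivatives, with an error that tends to zero. -/
theorem IsFlow.evolution_le {c C K S : ℝ} (hγ : -3 < γ) (hγ' : γ < 0)
    (hE : EnergyConst γ c C K S) (hg : IsFlow γ T f₀ g) (α : Fin 3 → ℕ)
    (hreg : ∀ᵐ s ∂volume.restrict (Ioo 0 (min 1 T)), Reg (len α) (g s))
    (hfin : ∀ δ, len δ < len α → ∫⁻ s in Ioo 0 (min 1 T),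
      ENNReal.ofReal (s ^ len δ) * energyD γ δ (g s) ≠ ⊤)
    {x : (Fin 3 → ℕ) → ℝ} (hx : ∀ β, 0 < x β) {R : ℝ} (hR : 1 ≤ R) :
    ∃ ε : ℕ → ℝ≥0∞, Tendsto ε atTop (𝓝 0) ∧ ∀ t, 0 < t → t ≤ min 1 T → ∀ n,
      ENNReal.ofReal (t ^ len α * ∫ v, cutoff (γ * len α / 2) R v ^ 2
          * conv (g t) (multiPd α (moll n)) v ^ 2)
        + ∫⁻ s in Ioo 0 t, ENNReal.ofReal (2 * s ^ len α) * (ENNReal.ofReal c *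
          eInt γ (cutoff (γ * len α / 2) R) (fun i => pd i (conv (g s) (multiPd α (moll n))))
            (conv (g s) (multiPd α (moll n))))
      ≤ initTerm f₀ (len α) + (∫⁻ s in Ioo 0 t, evolRhs γ C K S x α (g s) s) + ε n := by
  obtain ⟨A, hA, h⟩ := hg.exists_evolution_le hγ hγ' hE α hreg hx hR
  obtain ⟨ε, hε, hi⟩ := exists_initTerm γ f₀ α (R := R) (by linarith)
  have hlim := hg.tendsto_error hγ hγ' α hreg hfin (2 * R)
  refine ⟨fun n => ε n + A * ∫⁻ s in Ioo 0 (min 1 T), ENNReal.ofReal (len α * s ^ (len α - 1)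
      + 2 * s ^ len α) * errTerm γ (2 * R) α n fun δ => dlim δ (g s), ?_, fun t h0 ht n => ?_⟩
  · have := hε.add (ENNReal.Tendsto.const_mul (a := A) hlim (Or.inr hA))
    simpa using this
  · have hsub : Ioo 0 t ⊆ Ioo 0 (min 1 T) := Ioo_subset_Ioo_right ht
    have hm : AEMeasurable (fun s => A * (ENNReal.ofReal (len α * s ^ (len α - 1) + 2 * s ^ len α)
        * errTerm γ (2 * R) α n fun δ => dlim δ (g s))) (volume.restrict (Ioo 0 t)) := by
      have hw : Measurable fun s : ℝ =>
        ENNReal.ofReal (len α * s ^ (len α - 1) + 2 * s ^ len α) := by fun_prop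
      exact (hw.aemeasurable.mul (aemeasurable_errTerm hγ hγ' (fun δ => hg.measurable_dlim δ) α
        ((ae_restrict_of_ae_restrict_of_subset hsub hreg).mono
          fun s hs δ hδ => (hs δ (len_mono hδ)).2) (2 * R) n)).const_mul _
    refine (h t h0 ht n).trans ?_
    rw [lintegral_add_right' _ hm, lintegral_const_mul' _ _ hA]
    calc _ ≤ (initTerm f₀ (len α) + ε n) + ((∫⁻ s in Ioo 0 t, evolRhs γ C K S x α (g s) s)
          + A * ∫⁻ s in Ioo 0 (min 1 T), ENNReal.ofReal (len α * s ^ (len α - 1)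
      + 2 * s ^ len α) * errTerm γ (2 * R) α n fun δ => dlim δ (g s)) := by
          gcongr
          exact hi n
      _ = _ := by ring

end

end

/-! ### Removing the mollification and the cutoff -/

section

lemma le_two_mul_liminf {y : ℝ≥0∞} {a e : ℕ → ℝ≥0∞} (h : ∀ n, y ≤ 2 * a n + e n)
    (he : Tendsto e atTop (𝓝 0)) : y ≤ 2 * liminf a atTop := by
  by_contra hc
  rw [not_le, mul_comm, ← ENNReal.lt_div_iff_mul_lt (by simp) (by simp)] at hc
  obtain ⟨b, hb1, hb2⟩ := exists_between hc
  have hb3 : 2 * b < y := by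
    rwa [ENNReal.lt_div_iff_mul_lt (by simp) (by simp), mul_comm] at hb2
  have h1 : ∃ᶠ n in atTop, a n < b := frequently_lt_of_liminf_lt (h := hb1)
  have h2 : ∀ᶠ n in atTop, e n < y - 2 * b := he.eventually_lt_const (tsub_pos_of_lt hb3)
  obtain ⟨n, h3, h4⟩ := (h1.and_eventually h2).exists
  have h5 : 2 * a n + e n < 2 * b + (y - 2 * b) :=
    ENNReal.add_lt_add_of_le_of_lt (ENNReal.mul_ne_top (by simp) h3.ne_top)
      (mul_le_mul_right h3.le 2) h4
  rw [add_tsub_cancel_of_le hb3.le] at h5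
  exact absurd (h n) (not_le.2 h5)

lemma continuous_cutoff (θ R : ℝ) : Continuous (cutoff θ R) := (contDiff_cutoff θ R).continuous

lemma eInt_le_iSup {γ θ : ℝ} {ξ : Fin 3 → V → ℝ} {x : V → ℝ} (hξ : ∀ i, Measurable (ξ i))
    (hx : Measurable x) :
    eInt γ (fun v => bracket v ^ θ) ξ x ≤ ⨆ m : ℕ, eInt γ (cutoff θ (m + 1)) ξ x := by
  have hm : Measurable fun v => edens γ v (fun i => ξ i v) (x v) := by
    have h1 := (contDiff_bracket_rpow γ).continuous.measurable
    have h2 := (contDiff_bracket_rpow (γ + 2)).continuous.measurable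
    have h3 : ∀ i : Fin 3, Measurable fun v : V => v i := fun i =>
      (contDiff_coord i).continuous.measurable
    simp only [edens, mform, bform]
    fun_prop
  simp only [eInt]
  have hm' : ∀ m : ℕ, Measurable fun v =>
      ENNReal.ofReal (cutoff θ (m + 1) v ^ 2 * edens γ v (fun i => ξ i v) (x v)) := fun m =>
    (((continuous_cutoff θ (m + 1)).measurable.pow_const 2).mul hm).ennreal_ofReal
  rw [← lintegral_iSup hm']
  · refine lintegral_mono fun v => ?_
    obtain ⟨m, hm⟩ := exists_nat_gt ‖v‖
    refine le_trans (le_of_eq ?_) (le_iSup _ m)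
    have hv : v ∈ Metric.ball (0 : V) (m + 1) := by
      rw [Metric.mem_ball, dist_zero_right]; linarith
    rw [cutoff_eq (by positivity) hv]
  · intro m m' hmm v
    refine ENNReal.ofReal_le_ofReal ?_
    have h1 : cutoff θ (m + 1) v ≤ cutoff θ (m' + 1) v :=
      cutoff_mono (by positivity) (by have : (m : ℝ) ≤ m' := by exact_mod_cast hmm
                                      linarith) v
    have h2 := edens_nonneg γ v (fun i => ξ i v) (x v)
    have h3 := cutoff_nonneg θ (m + 1) v
    gcongr

lemma sq_le_energy {γ θ R r : ℝ} (hR : 0 < R) (hr : r ≤ R) (ξ : Fin 3 → V → ℝ) (x : V → ℝ)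
    (i : Fin 3) : ∫⁻ v in Metric.ball (0 : V) r, ENNReal.ofReal ((bracket v ^ (θ + γ / 2) * ξ i v) ^ 2)
      ≤ eInt γ (cutoff θ R) ξ x := by
  refine (setLIntegral_mono' Metric.isOpen_ball.measurableSet fun v hv => ?_).trans
    (lintegral_mono' Measure.restrict_le_self le_rfl)
  refine ENNReal.ofReal_le_ofReal ?_
  rw [cutoff_eq hR (Metric.ball_subset_ball hr hv)]
  refine le_trans (le_of_eq ?_) (mul_le_mul_of_nonneg_left
    (le_edens γ v (fun i => ξ i v) (x v) i) (sq_nonneg _))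
  have e : ∀ a : ℝ, (bracket v ^ a) ^ 2 = bracket v ^ (a * 2) := fun a => by
    rw [Real.rpow_mul (bracket_pos v).le, Real.rpow_ofNat]
  rw [mul_pow, ← mul_assoc, e, e, ← Real.rpow_add (bracket_pos v)]
  congr 2
  ring

section

variable {γ T : ℝ} {f₀ : L2V} {g : ℝ → L2V}

lemma pd_conv_multiPd_moll {u : V → ℝ} (hu : L2Loc u) (α : Fin 3 → ℕ) (n : ℕ) (i : Fin 3) :
    pd i (conv u (multiPd α (moll n))) = conv u (multiPd (α + unitIdx i) (moll n)) := by
  rw [pd_conv hu.locallyIntegrable (contDiff_multiPd (contDiff_moll n) α)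
    (hasCompactSupport_multiPd (hasCompactSupport_moll n) α),
    pd_multiPd (contDiff_moll n)]

/-- The energy of the mollified derivative, localized. -/
def mollEnergy (γ : ℝ) (α : Fin 3 → ℕ) (R : ℝ) (n : ℕ) (u : V → ℝ) : ℝ≥0∞ :=
  eInt γ (cutoff (γ * len α / 2) R) (fun i => conv u (multiPd (α + unitIdx i) (moll n)))
    (conv u (multiPd α (moll n)))

lemma IsFlow.measurable_mollEnergy (hg : IsFlow γ T f₀ g) (α : Fin 3 → ℕ) (R : ℝ) (n : ℕ) :
    Measurable fun s => mollEnergy γ α R n (g s) := by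
  have h : ∀ δ, Measurable (Function.uncurry fun s => conv (g s) (multiPd δ (moll n))) :=
    fun δ => measurable_uncurry_of_continuous_of_measurable (hg.continuous_conv δ n) fun τ =>
      (contDiff_conv (L2Loc.of_L2V (g τ)).locallyIntegrable (mollTest δ n).2.1
        (mollTest δ n).2.2).continuous.measurable
  exact measurable_eInt γ (continuous_cutoff _ _) (ξ := fun i s =>
    conv (g s) (multiPd (α + unitIdx i) (moll n))) (fun i => h _) (h α)

/-- On a fixed ball the mollified derivatives converge strongly, so replacing the true ones by them
costs a factor 2 and a vanishing error. Monotone convergence then removes the cutoff. -/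
lemma two_mul_energyD_le {α : Fin 3 → ℕ} {u : V → ℝ} (hu : L2Loc u)
    (h0 : HasWeakDeriv α u (dlim α u)) (hl0 : L2Loc (dlim α u))
    (h1 : ∀ i, HasWeakDeriv (α + unitIdx i) u (dlim (α + unitIdx i) u))
    (hl1 : ∀ i, L2Loc (dlim (α + unitIdx i) u)) {w : ℝ≥0∞} (hw : w ≠ ⊤) :
    w * energyD γ α u ≤ 2 * ⨆ m : ℕ, liminf (fun n => w * mollEnergy γ α (m + 1) n u) atTop := by
  refine (mul_le_mul_right (eInt_le_iSup (fun i => measurable_dlim _ hu) (measurable_dlim _ hu)) w).trans ?_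
  rw [ENNReal.mul_iSup, ENNReal.mul_iSup]
  refine iSup_mono fun m => ?_
  have hm : (0 : ℝ) < m + 1 := by positivity
  obtain ⟨A, hA, hb⟩ := exists_eInt_le γ (continuous_cutoff (γ * len α / 2) (m + 1))
    (fun v hv => cutoff_eq_zero hm hv)
  have hc : ∀ {δ}, HasWeakDeriv δ u (dlim δ u) → ∀ n,
      conv u (multiPd δ (moll n)) = conv (dlim δ u) (moll n) := fun h n =>
    h.conv_multiPd (contDiff_moll n) (hasCompactSupport_moll n)
  obtain ⟨B, -, hn⟩ := negligible_conv_sub (2 * ((m : ℝ) + 1))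
  refine le_two_mul_liminf (e := fun n => w * (A * ((∑ i, distSq (2 * (m + 1))
    (conv (dlim (α + unitIdx i) u) (moll n)) (dlim (α + unitIdx i) u))
    + distSq (2 * (m + 1)) (conv (dlim α u) (moll n)) (dlim α u)))) (fun n => ?_) ?_
  · have h2 := hb (fun i => dlim (α + unitIdx i) u)
      (fun i => conv (dlim (α + unitIdx i) u) (moll n)) (dlim α u) (conv (dlim α u) (moll n))
      (fun i => (hl1 i).1.sub (continuous_conv (hl1 i) n).aestronglyMeasurable)
      (hl0.1.sub (continuous_conv hl0 n).aestronglyMeasurable)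
    simp only [distSq_comm _ (dlim _ u)] at h2
    rw [mollEnergy, hc h0 n]
    simp only [hc (h1 _) n]
    refine (mul_le_mul_right h2 w).trans (le_of_eq ?_)
    rw [mul_add, mul_left_comm]
  · have h2 : Tendsto (fun n => (∑ i, distSq (2 * (m + 1))
        (conv (dlim (α + unitIdx i) u) (moll n)) (dlim (α + unitIdx i) u))
        + distSq (2 * (m + 1)) (conv (dlim α u) (moll n)) (dlim α u)) atTop (𝓝 ((∑ _i : Fin 3, 0) + 0)) :=
      (tendsto_finsetSum _ fun i _ => (hn _ (hl1 i)).2).add (hn _ hl0).2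
    have := ENNReal.Tendsto.const_mul (a := w) (ENNReal.Tendsto.const_mul (a := A) h2 (Or.inr hA))
      (Or.inr hw)
    simpa using this

/-- The existence of derivatives at a fixed time. -/
lemma IsFlow.hasWeakDeriv_of_evolution {c C K S : ℝ} (hγ : -3 < γ) (hγ' : γ < 0)
    (hE : EnergyConst γ c C K S) (hg : IsFlow γ T f₀ g) (α : Fin 3 → ℕ)
    (hreg : ∀ᵐ s ∂volume.restrict (Ioo 0 (min 1 T)), Reg (len α) (g s))
    (hfin : ∀ δ, len δ < len α → ∫⁻ s in Ioo 0 (min 1 T),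
      ENNReal.ofReal (s ^ len δ) * energyD γ δ (g s) ≠ ⊤)
    {x : (Fin 3 → ℕ) → ℝ} (hx : ∀ β, 0 < x β) {t : ℝ} (ht0 : 0 < t) (ht : t ≤ min 1 T)
    (hH : ∫⁻ s in Ioo 0 t, evolRhs γ C K S x α (g s) s ≠ ⊤) :
    HasWeakDeriv α (g t) (dlim α (g t)) ∧ ENNReal.ofReal (t ^ len α) * normD γ α (g t)
      ≤ initTerm f₀ (len α) + ∫⁻ s in Ioo 0 t, evolRhs γ C K S x α (g s) s := by
  set k := len α with hk
  set θ := γ * k / 2 with hθ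
  set H := initTerm f₀ k + ∫⁻ s in Ioo 0 t, evolRhs γ C K S x α (g s) s with hHd
  have hHT : H ≠ ⊤ := ENNReal.add_ne_top.2 ⟨ENNReal.ofReal_ne_top, hH⟩
  have htk : 0 < t ^ k := pow_pos ht0 k
  have hl := L2Loc.of_L2V (g t)
  have hex := exists_hasWeakDeriv_of_frequently_le hl α θ (B := H.toReal / t ^ k) (by positivity)
    (fun r b hb => by
      have hR : 1 ≤ max r 1 := le_max_right _ _
      obtain ⟨ε, hε, h⟩ := hg.evolution_le hγ hγ' hE α hreg hfin hx hR
      have hb' : H < ENNReal.ofReal (t ^ k * b) := by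
        rw [div_lt_iff₀ htk, mul_comm] at hb
        exact (ENNReal.lt_ofReal_iff_toReal_lt hHT).2 hb
      have h1 : ∀ᶠ n in atTop, H + ε n < ENNReal.ofReal (t ^ k * b) := by
        have : Tendsto (fun n => H + ε n) atTop (𝓝 (H + 0)) := tendsto_const_nhds.add hε
        rw [add_zero] at this
        exact this.eventually_lt_const hb'
      refine (h1.mono fun n hn => ?_).frequently
      have h2 := (le_self_add.trans (h t ht0 ht n)).trans hn.le
      have hcont : Continuous (conv (g t) (multiPd α (moll n))) :=
        (contDiff_conv hl.locallyIntegrable (mollTest α n).2.1 (mollTest α n).2.2).continuous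
      rw [ENNReal.ofReal_mul htk.le, ENNReal.ofReal_mul htk.le, ENNReal.mul_le_mul_iff_right
        (by simpa using htk) ENNReal.ofReal_ne_top, ofReal_integral_cutoff (by linarith) hcont] at h2
      refine le_trans ?_ h2
      rw [multiPd_conv hl.locallyIntegrable (contDiff_moll n) (hasCompactSupport_moll n)]
      refine (setLIntegral_mono' Metric.isOpen_ball.measurableSet fun v hv => ?_).trans
        (lintegral_mono' Measure.restrict_le_self le_rfl)
      rw [cutoff_eq (by linarith) (Metric.ball_subset_ball (le_max_left _ _) hv), mul_pow])
  obtain ⟨D, hD, hDn⟩ := hex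
  refine ⟨hD.dlim, ?_⟩
  rw [normD, ← sqNormTwo_congr hD.dlim_ae_eq]
  calc _ ≤ ENNReal.ofReal (t ^ k) * ENNReal.ofReal (H.toReal / t ^ k) := mul_le_mul_right hDn _
    _ = H := by
      rw [← ENNReal.ofReal_mul htk.le, mul_div_cancel₀ _ htk.ne', ENNReal.ofReal_toReal hHT]

/-- The gain of one derivative at almost every time. -/
lemma IsFlow.energyD_of_evolution {c C K S : ℝ} (hγ : -3 < γ) (hγ' : γ < 0) (hT : 0 < T)
    (hE : EnergyConst γ c C K S) (hg : IsFlow γ T f₀ g) (α : Fin 3 → ℕ)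
    (hreg : ∀ᵐ s ∂volume.restrict (Ioo 0 (min 1 T)), Reg (len α) (g s))
    (hfin : ∀ δ, len δ < len α → ∫⁻ s in Ioo 0 (min 1 T),
      ENNReal.ofReal (s ^ len δ) * energyD γ δ (g s) ≠ ⊤)
    {x : (Fin 3 → ℕ) → ℝ} (hx : ∀ β, 0 < x β)
    (hH : ∫⁻ s in Ioo 0 (min 1 T), evolRhs γ C K S x α (g s) s ≠ ⊤) :
    (∀ᵐ s ∂volume.restrict (Ioo 0 (min 1 T)), ∀ i,
      HasWeakDeriv (α + unitIdx i) (g s) (dlim (α + unitIdx i) (g s))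
        ∧ L2Loc (dlim (α + unitIdx i) (g s))) ∧
    ∫⁻ s in Ioo 0 (min 1 T), ENNReal.ofReal (s ^ len α) * (ENNReal.ofReal c * energyD γ α (g s))
      ≤ initTerm f₀ (len α) + ∫⁻ s in Ioo 0 (min 1 T), evolRhs γ C K S x α (g s) s := by
  set k := len α with hk
  set T1 := min 1 T with hT1
  have hT10 : 0 < T1 := by positivity
  set H := initTerm f₀ k + ∫⁻ s in Ioo 0 T1, evolRhs γ C K S x α (g s) s with hHd
  have hHT : H ≠ ⊤ := ENNReal.add_ne_top.2 ⟨ENNReal.ofReal_ne_top, hH⟩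
  set w : ℝ → ℝ≥0∞ := fun s => ENNReal.ofReal (2 * s ^ k) * ENNReal.ofReal c with hw
  have hwm : Measurable w := by fun_prop
  have hwT : ∀ s, w s ≠ ⊤ := fun s => ENNReal.mul_ne_top ENNReal.ofReal_ne_top ENNReal.ofReal_ne_top
  have hw0 : ∀ s ∈ Ioo 0 T1, w s ≠ 0 := fun s hs => by
    simp [hw, hE.c_pos, pow_pos hs.1 k]
  set Z : ℕ → ℝ → ℝ≥0∞ := fun m s =>
    liminf (fun n => w s * mollEnergy γ α (m + 1) n (g s)) atTop with hZ
  have hmm : ∀ m n, Measurable fun s => w s * mollEnergy γ α (m + 1) n (g s) := fun m n =>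
    hwm.mul (hg.measurable_mollEnergy α _ n)
  have hZm : ∀ m, Measurable (Z m) := fun m => Measurable.liminf (hmm m)
  -- Fatou's lemma in `n` at a fixed cutoff radius; the error of the evolution inequality disappears
  -- in the limit.
  have hZi : ∀ m, ∫⁻ s in Ioo 0 T1, Z m s ≤ H := fun m => by
    obtain ⟨ε, hε, h⟩ := hg.evolution_le hγ hγ' hE α hreg hfin hx (R := m + 1) (by simp)
    refine (lintegral_liminf_le (hmm m)).trans ?_
    have h1 : Tendsto (fun n => H + ε n) atTop (𝓝 (H + 0)) := tendsto_const_nhds.add hε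
    rw [add_zero] at h1
    rw [← h1.liminf_eq]
    refine liminf_le_liminf (Eventually.of_forall fun n => ?_)
    refine le_trans (le_of_eq ?_) (le_add_self.trans (h T1 hT10 le_rfl n))
    refine lintegral_congr fun s => ?_
    rw [hw, mollEnergy, mul_assoc]
    simp only [pd_conv_multiPd_moll (L2Loc.of_L2V (g s)), hk]
  have hZmono : Monotone Z := by
    intro m m' h s
    refine liminf_le_liminf (Eventually.of_forall fun n => mul_le_mul_right ?_ _)
    refine eInt_mono (cutoff_nonneg _ _) (fun v => cutoff_mono (by positivity) ?_ v) _ _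
    have : (m : ℝ) ≤ m' := by exact_mod_cast h
    linarith
  have hZs : ∫⁻ s in Ioo 0 T1, ⨆ m, Z m s ≤ H := by
    rw [lintegral_iSup hZm hZmono]
    exact iSup_le hZi
  have hZfin : ∀ᵐ s ∂volume.restrict (Ioo 0 T1), ⨆ m, Z m s < ⊤ :=
    ae_lt_top (.iSup hZm) (ne_top_of_le_ne_top hHT hZs)
  have hder : ∀ᵐ s ∂volume.restrict (Ioo 0 T1), ∀ i,
      HasWeakDeriv (α + unitIdx i) (g s) (dlim (α + unitIdx i) (g s))
        ∧ L2Loc (dlim (α + unitIdx i) (g s)) := by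
    filter_upwards [hZfin, ae_restrict_mem measurableSet_Ioo] with s hs hs0 i
    have hl := L2Loc.of_L2V (g s)
    have hex := exists_hasWeakDeriv_of_frequently_le hl (α + unitIdx i) (γ * k / 2 + γ / 2)
      (B := ((⨆ m, Z m s) / w s).toReal) ENNReal.toReal_nonneg (fun r b hb => by
        obtain ⟨m, hm⟩ := exists_nat_ge r
        have hq : (⨆ m, Z m s) / w s ≠ ⊤ := ENNReal.div_ne_top hs.ne (hw0 s hs0)
        have h1 : Z m s < w s * ENNReal.ofReal b := by
          refine (le_iSup (fun m => Z m s) m).trans_lt ?_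
          have := (ENNReal.lt_ofReal_iff_toReal_lt hq).2 hb
          rwa [ENNReal.div_lt_iff (Or.inl (hw0 s hs0)) (Or.inl (hwT s)), mul_comm] at this
        -- A finite liminf bounds a subsequence only, and the subsequence depends on `s`. This
        -- suffices for the duality criterion.
        have h2 : ∃ᶠ n in atTop, w s * mollEnergy γ α (m + 1) n (g s) < w s * ENNReal.ofReal b :=
          frequently_lt_of_liminf_lt (h := h1)
        refine h2.mono fun n hn => ?_
        have h3 := (ENNReal.mul_le_mul_iff_right (hw0 s hs0) (hwT s)).1 hn.le
        refine le_trans ?_ h3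
        rw [multiPd_conv hl.locallyIntegrable (contDiff_moll n) (hasCompactSupport_moll n)]
        exact sq_le_energy (by positivity) (by linarith)
          (fun i => conv (g s) (multiPd (α + unitIdx i) (moll n))) _ i)
    obtain ⟨D, hD, hDn⟩ := hex
    refine ⟨hD.dlim, L2Loc.of_sqNormTwo (θ := γ * k / 2 + γ / 2)
      (Landau.measurable_dlim _ hl).aestronglyMeasurable ?_⟩
    rw [← sqNormTwo_congr hD.dlim_ae_eq]
    exact ne_top_of_le_ne_top ENNReal.ofReal_ne_top hDn
  refine ⟨hder, ?_⟩
  have h2 : ∫⁻ s in Ioo 0 T1, w s * energyD γ α (g s) ≤ 2 * H := by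
    calc _ ≤ ∫⁻ s in Ioo 0 T1, 2 * ⨆ m, Z m s := by
          refine lintegral_mono_ae ?_
          filter_upwards [hder, hreg] with s hs hr
          exact two_mul_energyD_le (L2Loc.of_L2V (g s)) (hr α le_rfl).1 (hr α le_rfl).2
            (fun i => (hs i).1) (fun i => (hs i).2) (hwT s)
      _ ≤ 2 * H := by
          rw [lintegral_const_mul' _ _ (by simp)]
          exact mul_le_mul_right hZs 2
  -- The factor 2 in the weight, from differentiating a square, cancels the factor 2 lost in
  -- comparing with the mollified energy.
  have h3 : ∫⁻ s in Ioo 0 T1, w s * energyD γ α (g s)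
      = 2 * ∫⁻ s in Ioo 0 T1, ENNReal.ofReal (s ^ k) * (ENNReal.ofReal c * energyD γ α (g s)) := by
    rw [← lintegral_const_mul' _ _ (by simp)]
    refine lintegral_congr fun s => ?_
    simp only [hw]
    rw [ENNReal.ofReal_mul (by norm_num), ENNReal.ofReal_ofNat]
    ring
  rw [h3] at h2
  exact (ENNReal.mul_le_mul_iff_right (by simp) (by simp)).1 h2

end

end

/-! ### Gronwall's inequality and the estimate of order zero -/

section

/-- A form of Gronwall's inequality without measurability assumptions. -/
lemma gronwall_lintegral {T M a l : ℝ} (hT : 0 < T) {y : ℝ → ℝ} (hl : 0 < l) (hy0 : ∀ t, 0 ≤ y t)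
    (hyM : ∀ t, y t ≤ M) (ha : 0 ≤ a)
    (h : ∀ t, 0 < t → t ≤ T → ENNReal.ofReal (y t)
      ≤ ENNReal.ofReal a + ∫⁻ s in Ioo 0 t, ENNReal.ofReal (l * y s)) :
    ∀ t, 0 < t → t ≤ T → y t ≤ 2 * a * Real.exp (2 * l * t) := by
  -- With the exponential rate `2l`, twice the coefficient in the hypothesis, the integral term
  -- contributes at most half of the supremum and can be absorbed. The supremum is finite by the
  -- bound `M`.
  set Y : Set ℝ := (fun t => y t * Real.exp (-(2 * l * t))) '' Ioc 0 T with hY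
  have hbdd : BddAbove Y := by
    refine ⟨M, ?_⟩
    rintro _ ⟨t, ht, rfl⟩
    have h1 : Real.exp (-(2 * l * t)) ≤ 1 := Real.exp_le_one_iff.2 (by
      have := ht.1; have : 0 < 2 * l * t := by positivity
      linarith)
    exact (mul_le_of_le_one_right (hy0 t) h1).trans (hyM t)
  have hne : Y.Nonempty := ⟨_, T, ⟨hT, le_rfl⟩, rfl⟩
  set s0 := sSup Y with hs0
  have hle : ∀ t, 0 < t → t ≤ T → y t ≤ s0 * Real.exp (2 * l * t) := fun t h0 h1 => by
    have h2 : y t * Real.exp (-(2 * l * t)) ≤ s0 := le_csSup hbdd ⟨t, ⟨h0, h1⟩, rfl⟩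
    rw [Real.exp_neg, ← div_eq_mul_inv, div_le_iff₀ (Real.exp_pos _)] at h2
    exact h2
  have hs00 : 0 ≤ s0 := (mul_nonneg (hy0 T) (Real.exp_pos _).le).trans
    (le_csSup hbdd ⟨T, ⟨hT, le_rfl⟩, rfl⟩)
  have key : s0 ≤ a + s0 / 2 := by
    refine csSup_le hne ?_
    rintro _ ⟨t, ht, rfl⟩
    have h1 : ∫⁻ s in Ioo 0 t, ENNReal.ofReal (l * y s)
        ≤ ENNReal.ofReal (s0 / 2 * Real.exp (2 * l * t) - s0 / 2) := by
      have hc : Continuous fun s => l * (s0 * Real.exp (2 * l * s)) := by fun_prop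
      have e : ∫ s in Ioo 0 t, l * (s0 * Real.exp (2 * l * s))
          = s0 / 2 * Real.exp (2 * l * t) - s0 / 2 := by
        rw [← integral_Ioc_eq_integral_Ioo, ← intervalIntegral.integral_of_le ht.1.le,
          intervalIntegral.integral_eq_sub_of_hasDerivAt
          (f := fun s => s0 / 2 * Real.exp (2 * l * s)) (fun s _ => ?_) (hc.intervalIntegrable _ _)]
        · simp
        · convert! ((((hasDerivAt_id s).const_mul (2 * l)).exp).const_mul (s0 / 2)) using 1
          simp only [id]; ring
      rw [← e, ofReal_integral_eq_lintegral_ofReal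
        ((hc.integrableOn_Icc).mono_set Ioo_subset_Icc_self)
        (Eventually.of_forall fun s => by positivity)]
      refine setLIntegral_mono' measurableSet_Ioo fun s hs => ENNReal.ofReal_le_ofReal ?_
      exact mul_le_mul_of_nonneg_left (hle s hs.1 (hs.2.le.trans ht.2)) hl.le
    have hexp : 1 ≤ Real.exp (2 * l * t) := Real.one_le_exp (by have := ht.1; positivity)
    have h2 := (h t ht.1 ht.2).trans (add_le_add_right h1 _)
    have h3 : 0 ≤ s0 / 2 * Real.exp (2 * l * t) - s0 / 2 := by nlinarith
    rw [← ENNReal.ofReal_add ha h3, ENNReal.ofReal_le_ofReal_iff (by linarith)] at h2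
    simp only
    rw [Real.exp_neg, ← div_eq_mul_inv, div_le_iff₀ (Real.exp_pos _)]
    nlinarith
  intro t h0 h1
  refine (hle t h0 h1).trans ?_
  have := Real.exp_pos (2 * l * t)
  nlinarith

lemma L2Loc.congr {u w : V → ℝ} (hu : L2Loc u) (h : u =ᵐ[volume] w) : L2Loc w :=
  ⟨hu.1.congr h, fun R => by rw [← ballSq_congr h]; exact hu.2 R⟩

lemma reg_zero {u : V → ℝ} (hu : L2Loc u) : Reg 0 u := by
  intro δ hδ
  rw [eq_zero_of_len (Nat.le_zero.1 hδ)]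
  have h := HasWeakDeriv.zero hu.locallyIntegrable
  exact ⟨h.dlim, hu.congr h.dlim_ae_eq⟩

lemma len_zero : len 0 = 0 := by simp [len]

lemma normD_zero (γ : ℝ) (F : L2V) : normD γ 0 F = ENNReal.ofReal (‖F‖ ^ 2) := by
  rw [normD, ← sqNormTwo_congr (dlim_zero_ae_eq (L2Loc.of_L2V F).locallyIntegrable),
    ← lintegral_sq_eq_norm_sq, sqNormTwo, len_zero]
  simp

lemma box_zero_erase : (box (0 : Fin 3 → ℕ)).erase 0 = ∅ := by
  refine Finset.eq_empty_of_forall_notMem fun β hβ => ?_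
  obtain ⟨-, h1, h2⟩ := mem_erase_box hβ
  rw [len_zero] at h2
  omega

lemma evolRhs_zero {γ C K S : ℝ} (hC : 0 ≤ C) (x : (Fin 3 → ℕ) → ℝ) (F : L2V) (s : ℝ) :
    evolRhs γ C K S x 0 F s = ENNReal.ofReal (2 * C * (1 + S ^ 2) * ‖F‖ ^ 2) := by
  rw [evolRhs, staticRhs, box_zero_erase, normD_zero, len_zero]
  simp only [Nat.cast_zero, zero_mul, ENNReal.ofReal_zero, zero_add, Finset.sum_empty, mul_zero,
    add_zero, pow_zero, mul_one, zero_div, abs_zero]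
  rw [← ENNReal.ofReal_mul (by positivity), ← ENNReal.ofReal_mul hC,
    ← ENNReal.ofReal_mul (by norm_num)]
  congr 1; ring

section

variable {γ T : ℝ} {f₀ : L2V} {g : ℝ → L2V}

/-- The basic energy estimate. -/
lemma IsFlow.level_zero {c C K S : ℝ} (hγ : -3 < γ) (hγ' : γ < 0) (hT : 0 < T)
    (hE : EnergyConst γ c C K S) (hg : IsFlow γ T f₀ g) :
    (∀ t, 0 < t → t ≤ min 1 T →
      ‖g t‖ ^ 2 ≤ 4 * ‖f₀‖ ^ 2 * Real.exp (4 * C * (1 + S ^ 2))) ∧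
    (∀ᵐ s ∂volume.restrict (Ioo 0 (min 1 T)), Reg 1 (g s)) ∧
    ∫⁻ s in Ioo 0 (min 1 T), ENNReal.ofReal c * energyD γ 0 (g s)
      ≤ ENNReal.ofReal (2 * ‖f₀‖ ^ 2 + 8 * C * (1 + S ^ 2) * ‖f₀‖ ^ 2
        * Real.exp (4 * C * (1 + S ^ 2))) := by
  have hC := hE.C_pos
  have hT1 : 0 < min 1 T := by positivity
  set l := 2 * C * (1 + S ^ 2) with hl
  have hl0 : 0 < l := by positivity
  obtain ⟨M, hM⟩ := hg.bound
  have hM2 : ∀ t, ‖g t‖ ^ 2 ≤ M ^ 2 := fun t => pow_le_pow_left₀ (norm_nonneg _) (hM t) 2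
  have hreg : ∀ᵐ s ∂volume.restrict (Ioo 0 (min 1 T)), Reg (len 0) (g s) :=
    Eventually.of_forall fun s => by rw [len_zero]; exact reg_zero (L2Loc.of_L2V _)
  have hfin : ∀ δ, len δ < len 0 → ∫⁻ s in Ioo 0 (min 1 T),
      ENNReal.ofReal (s ^ len δ) * energyD γ δ (g s) ≠ ⊤ := fun δ hδ => by
    rw [len_zero] at hδ; omega
  -- At order zero the sum over `β` is empty, so the Cauchy–Schwarz weights are immaterial and are
  -- set to 1.
  have hx : ∀ β : Fin 3 → ℕ, (0 : ℝ) < (fun _ => 1) β := fun _ => one_pos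
  have hrhs : ∀ s, evolRhs γ C K S (fun _ => 1) 0 (g s) s = ENNReal.ofReal (l * ‖g s‖ ^ 2) :=
    fun s => evolRhs_zero hC.le _ _ _
  have hint : ∀ (N t : ℝ), (∀ s ∈ Ioo 0 t, ‖g s‖ ^ 2 ≤ N) → 0 ≤ N → t ≤ 1 →
      ∫⁻ s in Ioo 0 t, evolRhs γ C K S (fun _ => 1) 0 (g s) s ≤ ENNReal.ofReal (l * N) := by
    intro N t hN hN0 ht
    calc _ ≤ ∫⁻ s in Ioo 0 t, ENNReal.ofReal (l * N) :=
          setLIntegral_mono' measurableSet_Ioo fun s hs => by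
            rw [hrhs]
            exact ENNReal.ofReal_le_ofReal (mul_le_mul_of_nonneg_left (hN s hs) hl0.le)
      _ ≤ _ := by
          rw [setLIntegral_const, Real.volume_Ioo, ← ENNReal.ofReal_mul (by positivity)]
          refine ENNReal.ofReal_le_ofReal (mul_le_of_le_one_right (by positivity) (by linarith))
  have h1 : ∀ t, 0 < t → t ≤ min 1 T → ‖g t‖ ^ 2 ≤ 2 * (2 * ‖f₀‖ ^ 2) * Real.exp (2 * l * t) := by
    refine gronwall_lintegral (M := M ^ 2) hT1 hl0 (fun _ => sq_nonneg _) hM2 (by positivity)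
      fun t h0 ht => ?_
    have := (hg.hasWeakDeriv_of_evolution hγ hγ' hE 0 hreg hfin hx h0 ht
      (ne_top_of_le_ne_top ENNReal.ofReal_ne_top
        (hint (M ^ 2) t (fun s _ => hM2 s) (sq_nonneg _) (ht.trans (min_le_left _ _))))).2
    rw [len_zero, normD_zero, initTerm] at this
    simpa [hrhs] using this
  have h2 : ∀ t, 0 < t → t ≤ min 1 T → ‖g t‖ ^ 2 ≤ 4 * ‖f₀‖ ^ 2 * Real.exp (2 * l) :=
    fun t h0 ht => by
      have h3 : Real.exp (2 * l * t) ≤ Real.exp (2 * l) := Real.exp_le_exp.2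
        (mul_le_of_le_one_right (by positivity) (ht.trans (min_le_left _ _)))
      have := mul_le_mul_of_nonneg_left h3 (show 0 ≤ 2 * (2 * ‖f₀‖ ^ 2) by positivity)
      linarith [h1 t h0 ht]
  have e1 : 4 * C * (1 + S ^ 2) = 2 * l := by rw [hl]; ring
  rw [e1]
  refine ⟨h2, ?_⟩
  have h3 := hint (4 * ‖f₀‖ ^ 2 * Real.exp (2 * l)) (min 1 T)
    (fun s hs => h2 s hs.1 hs.2.le) (by positivity) (min_le_left _ _)
  obtain ⟨h4, h5⟩ := hg.energyD_of_evolution hγ hγ' hT hE 0 hreg hfin hx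
    (ne_top_of_le_ne_top ENNReal.ofReal_ne_top h3)
  constructor
  · filter_upwards [h4] with s hs δ hδ
    rcases Nat.eq_zero_or_pos (len δ) with h0 | h0
    · exact reg_zero (L2Loc.of_L2V (g s)) δ (by omega)
    · obtain ⟨i, hi⟩ := exists_one_le_of_len h0
      obtain ⟨δ', rfl, h6⟩ := exists_eq_add_unitIdx hi
      rw [eq_zero_of_len (show len δ' = 0 by omega)]
      exact hs i
  · rw [len_zero] at h5
    simp only [pow_zero, ENNReal.ofReal_one, one_mul] at h5
    refine (h5.trans (add_le_add_right h3 _)).trans (le_of_eq ?_)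
    rw [initTerm, ← ENNReal.ofReal_add (by positivity) (by positivity)]
    congr 1
    rw [hl]; ring

end

end

/-! ### Factorial weights and the closing of the induction step -/

section

lemma binom_mul_factorial {α β : Fin 3 → ℕ} (h : β ≤ α) :
    binom α β * multiFactorial β * multiFactorial (α - β) = multiFactorial α := by
  simp only [binom, multiFactorial, ← Finset.prod_mul_distrib]
  exact Finset.prod_congr rfl fun i _ => Nat.choose_mul_factorial_mul_factorial (h i)

/-- The sum over the box factors into three geometric sums, each at most `1 + 2q`. Removing `β = 0`
leaves `(1 + 2q)³ - 1 ≤ 14 q` for `q ≤ 1/2`. -/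
lemma sum_box_pow_le {q : ℝ} (h0 : 0 ≤ q) (h1 : q ≤ 1 / 2) (α : Fin 3 → ℕ) :
    ∑ β ∈ (box α).erase 0, q ^ len β ≤ 14 * q := by
  have h2 : ∑ β ∈ box α, q ^ len β = ∏ i, ∑ j ∈ Finset.range (α i + 1), q ^ j := by
    rw [Finset.prod_univ_sum]
    refine Finset.sum_congr rfl fun β _ => ?_
    rw [len, Finset.prod_pow_eq_pow_sum]
  have h3 : ∀ n, ∑ j ∈ Finset.range n, q ^ j ≤ 1 + 2 * q := fun n => by
    have h4 := mul_neg_geom_sum q n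
    have h5 : 0 ≤ q ^ n := pow_nonneg h0 n
    by_contra hc
    push Not at hc
    nlinarith
  have h4 : ∏ i, ∑ j ∈ Finset.range (α i + 1), q ^ j ≤ (1 + 2 * q) ^ 3 := by
    have := Finset.prod_le_prod (s := Finset.univ)
      (f := fun i => ∑ j ∈ Finset.range (α i + 1), q ^ j) (g := fun _ : Fin 3 => 1 + 2 * q)
      (fun i _ => Finset.sum_nonneg fun j _ => pow_nonneg h0 j) (fun i _ => h3 _)
    simpa using this
  have h5 := Finset.add_sum_erase (box α) (fun β => q ^ len β) (zero_mem_box α)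
  simp only [len_zero, pow_zero] at h5
  nlinarith [mul_nonneg h0 h0]

/-- The weights in the induction over the order of the derivative. -/
def wgt (L : ℝ) (α : Fin 3 → ℕ) : ℝ := L ^ (len α + 1) * multiFactorial α

lemma wgt_pos {L : ℝ} (hL : 0 < L) (α : Fin 3 → ℕ) : 0 < wgt L α :=
  mul_pos (pow_pos hL _) (by exact_mod_cast multiFactorial_pos α)

/-- The binomial coefficient and the two factorials multiply to `α!`, so the Leibniz sum becomes a
geometric sum in `K / L`. -/
lemma lowCoeff_mul_wgt {K L : ℝ} (hL : 0 < L) {α β : Fin 3 → ℕ} (h : β ≤ α) :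
    lowCoeff K α β * wgt L (α - β) = K * (K / L) ^ len β * wgt L α := by
  have h1 : (binom α β : ℝ) * multiFactorial β * multiFactorial (α - β) = multiFactorial α := by
    exact_mod_cast binom_mul_factorial h
  have h2 : L ^ (len α + 1) = L ^ (len (α - β) + 1) * L ^ len β := by
    rw [← pow_add, ← len_sub_add_len h]; congr 1; ring
  rw [lowCoeff, wgt, wgt, ← h1, h2, div_pow]
  have := pow_pos hL (len β)
  field_simp
  ring

lemma sum_lowCoeff_mul_wgt_le {K L : ℝ} (hK : 0 ≤ K) (hL : 0 < L) (hKL : 2 * K ≤ L)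
    (α : Fin 3 → ℕ) : ∑ β ∈ (box α).erase 0, lowCoeff K α β * wgt L (α - β)
      ≤ 14 * K ^ 2 / L * wgt L α := by
  calc _ = ∑ β ∈ (box α).erase 0, K * (K / L) ^ len β * wgt L α :=
        Finset.sum_congr rfl fun β hβ => lowCoeff_mul_wgt hL (mem_erase_box hβ).1
    _ = K * (∑ β ∈ (box α).erase 0, (K / L) ^ len β) * wgt L α := by
        rw [Finset.mul_sum, Finset.sum_mul]
    _ ≤ K * (14 * (K / L)) * wgt L α := by
        have := (wgt_pos hL α).le
        gcongr
        exact sum_box_pow_le (by positivity) (by rw [div_le_iff₀ hL]; linarith) α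
    _ = _ := by ring

lemma exists_large_index (α : Fin 3 → ℕ) : ∃ l, len α ≤ 3 * α l := by
  by_contra h
  push Not at h
  have h0 := h 0
  have h1 := h 1
  have h2 := h 2
  simp only [len, Fin.sum_univ_three] at h0 h1 h2
  omega

lemma multiFactorial_add_unitIdx (α : Fin 3 → ℕ) (l : Fin 3) :
    multiFactorial (α + unitIdx l) = (α l + 1) * multiFactorial α := by
  rw [multiFactorial, multiFactorial, ← Finset.mul_prod_erase _ _ (Finset.mem_univ l),
    ← Finset.mul_prod_erase Finset.univ (fun i => (α i).factorial) (Finset.mem_univ l), ← mul_assoc]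
  congr 1
  · simp [unitIdx, Nat.factorial_succ]
  · refine Finset.prod_congr rfl fun i hi => ?_
    have : i ≠ l := Finset.ne_of_mem_erase hi
    simp [unitIdx, this]

/-- A large index can be lowered with a gain of `|α|`. -/
lemma exists_lower {L : ℝ} (hL : 0 < L) {α : Fin 3 → ℕ} (hα : 1 ≤ len α) :
    ∃ α' l, α = α' + unitIdx l ∧ len α' + 1 = len α ∧ len α * wgt L α' ≤ 3 / L * wgt L α := by
  obtain ⟨l, hl⟩ := exists_large_index α
  obtain ⟨α', h1, h2⟩ := exists_eq_add_unitIdx (δ := α) (l := l) (by omega)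
  refine ⟨α', l, h1, h2, ?_⟩
  have h3 : α l = α' l + 1 := by rw [h1]; simp [unitIdx]
  have h4 : wgt L α = L * (α l) * wgt L α' := by
    rw [wgt, wgt, ← h2, h3]
    conv_lhs => rw [h1, multiFactorial_add_unitIdx]
    push_cast; ring
  rw [h4]
  have h5 : (len α : ℝ) ≤ 3 * α l := by exact_mod_cast hl
  have h6 := (wgt_pos hL α').le
  calc (len α : ℝ) * wgt L α' ≤ 3 * α l * wgt L α' := by gcongr
    _ = _ := by field_simp

section

variable {γ T : ℝ} {f₀ : L2V} {g : ℝ → L2V}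

lemma IsFlow.measurable_energyD (hg : IsFlow γ T f₀ g) (δ : Fin 3 → ℕ) :
    Measurable fun s => energyD γ δ (g s) :=
  measurable_eInt γ (contDiff_bracket_rpow _).continuous (ξ := fun i s => dlim (δ + unitIdx i) (g s))
    (fun i => hg.measurable_dlim _) (hg.measurable_dlim δ)

/-- The total weight of the lower-order terms. -/
def lowSum (K L : ℝ) (α : Fin 3 → ℕ) : ℝ :=
  ∑ β ∈ (box α).erase 0, lowCoeff K α β * wgt L (α - β)

lemma lowSum_nonneg {K L : ℝ} (hK : 0 ≤ K) (hL : 0 < L) (α : Fin 3 → ℕ) : 0 ≤ lowSum K L α :=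
  Finset.sum_nonneg fun β _ => mul_nonneg (lowCoeff_nonneg hK _ _) (wgt_pos hL _).le

/-- Everything is expressed by time-weighted energies of lower order. The term from the time weight
matches because `|α| - 1 = |α'|`; the others use `s ≤ 1` to lower the power of `s`. -/
lemma evolRhs_le {C K S L : ℝ} (hC : 0 < C) (hK : 0 ≤ K) (hL : 0 < L) (α α' : Fin 3 → ℕ)
    (l : Fin 3) (hα : α = α' + unitIdx l) (hlen : len α' + 1 = len α) (u : L2V) {s : ℝ}
    (h0 : 0 ≤ s) (h1 : s ≤ 1) : evolRhs γ C K S (wgt L) α u s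
      ≤ ENNReal.ofReal (2 * len α + 2 * C * (1 + (|γ * len α / 2| + S) ^ 2)) *
          (ENNReal.ofReal (s ^ len α') * energyD γ α' u)
        + ENNReal.ofReal (2 * C * lowSum K L α) * ∑ β ∈ (box α).erase 0,
          ENNReal.ofReal (lowCoeff K α β / wgt L (α - β)) *
            (ENNReal.ofReal (s ^ len (α - β)) * energyD γ (α - β) u) := by
  have hn : normD γ α u ≤ energyD γ α' u := by
    rw [hα]
    exact normD_le_energyD γ α' l u
  have hp : s ^ len α ≤ s ^ len α' := pow_le_pow_of_le_one h0 h1 (by omega)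
  have hp1 : s ^ (len α - 1) = s ^ len α' := by congr 1; omega
  have hs10 := lowSum_nonneg hK hL α
  rw [evolRhs, staticRhs, ← lowSum]
  generalize |γ * len α / 2| + S = Λ
  set k := len α with hk
  have e1 : ENNReal.ofReal (k * s ^ (k - 1)) * (2 * normD γ α u)
      ≤ ENNReal.ofReal (2 * k) * (ENNReal.ofReal (s ^ len α') * energyD γ α' u) := by
    rw [hp1, ENNReal.ofReal_mul (by positivity), ENNReal.ofReal_mul (by norm_num),
      ENNReal.ofReal_ofNat]
    calc _ ≤ ENNReal.ofReal k * ENNReal.ofReal (s ^ len α') * (2 * energyD γ α' u) := by gcongr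
      _ = _ := by ring
  have e2 : ENNReal.ofReal (2 * s ^ k) * (ENNReal.ofReal C * (ENNReal.ofReal (1 + Λ ^ 2)
      * normD γ α u)) ≤ ENNReal.ofReal (2 * C * (1 + Λ ^ 2)) *
        (ENNReal.ofReal (s ^ len α') * energyD γ α' u) := by
    rw [ENNReal.ofReal_mul (p := 2 * C) (by positivity), ENNReal.ofReal_mul (p := 2) (by norm_num),
      ENNReal.ofReal_mul (p := 2) (by norm_num)]
    calc _ ≤ ENNReal.ofReal 2 * ENNReal.ofReal (s ^ len α') * (ENNReal.ofReal C *
          (ENNReal.ofReal (1 + Λ ^ 2) * energyD γ α' u)) := by gcongr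
      _ = _ := by ring
  have e3 : ENNReal.ofReal (2 * s ^ k) * (ENNReal.ofReal C * (ENNReal.ofReal (lowSum K L α) *
      ∑ β ∈ (box α).erase 0, ENNReal.ofReal (lowCoeff K α β / wgt L (α - β))
        * energyD γ (α - β) u)) ≤ ENNReal.ofReal (2 * C * lowSum K L α) *
        ∑ β ∈ (box α).erase 0, ENNReal.ofReal (lowCoeff K α β / wgt L (α - β)) *
          (ENNReal.ofReal (s ^ len (α - β)) * energyD γ (α - β) u) := by
    rw [ENNReal.ofReal_mul (p := 2 * C) (by positivity), ENNReal.ofReal_mul (p := 2) (by norm_num),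
      ENNReal.ofReal_mul (p := 2) (by norm_num)]
    calc _ = ENNReal.ofReal 2 * ENNReal.ofReal C * ENNReal.ofReal (lowSum K L α) *
          ∑ β ∈ (box α).erase 0, ENNReal.ofReal (lowCoeff K α β / wgt L (α - β)) *
          (ENNReal.ofReal (s ^ k) * energyD γ (α - β) u) := by
          simp only [mul_left_comm _ (ENNReal.ofReal (s ^ k)), ← Finset.mul_sum]
          ring
      _ ≤ _ := mul_le_mul_right (Finset.sum_le_sum fun β _ => mul_le_mul_right (mul_le_mul'
          (ENNReal.ofReal_le_ofReal (pow_le_pow_of_le_one h0 h1 (len_mono tsub_le_self))) le_rfl)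
          _) _
  rw [ENNReal.ofReal_add (p := 2 * k) (by positivity) (by positivity), add_mul, mul_add, mul_add,
    ← add_assoc]
  exact add_le_add (add_le_add e1 e2) e3

/-- With the weights `wgt` in Cauchy–Schwarz and the inductive bounds `wgt²` for the energies, the
second factor reproduces `lowSum`, so the Leibniz contribution is quadratic in that single sum. -/
lemma lowSum_identity {a b K L : ℝ} (ha : 0 ≤ a) (hb : 0 ≤ b) (hK : 0 ≤ K) (hL : 0 < L)
    (α α' : Fin 3 → ℕ) : ENNReal.ofReal a * ENNReal.ofReal (wgt L α' ^ 2) + ENNReal.ofReal b *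
      ∑ β ∈ (box α).erase 0, ENNReal.ofReal (lowCoeff K α β / wgt L (α - β)) *
        ENNReal.ofReal (wgt L (α - β) ^ 2)
      = ENNReal.ofReal (a * wgt L α' ^ 2 + b * lowSum K L α) := by
  have h1 : ∀ β, ENNReal.ofReal (lowCoeff K α β / wgt L (α - β)) *
      ENNReal.ofReal (wgt L (α - β) ^ 2) = ENNReal.ofReal (lowCoeff K α β * wgt L (α - β)) := by
    intro β
    have h2 := wgt_pos hL (α - β)
    rw [← ENNReal.ofReal_mul (div_nonneg (lowCoeff_nonneg hK _ _) h2.le)]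
    congr 1; field_simp
  have h3 := lowSum_nonneg hK hL α
  simp only [h1]
  rw [← ENNReal.ofReal_sum_of_nonneg fun β _ =>
    mul_nonneg (lowCoeff_nonneg hK _ _) (wgt_pos hL _).le, ← lowSum,
    ← ENNReal.ofReal_mul ha, ← ENNReal.ofReal_mul hb,
    ← ENNReal.ofReal_add (by positivity) (by positivity)]

lemma weight_coeff_le {C S k : ℝ} (hγ : -3 < γ) (hγ' : γ < 0) (hC : 0 < C) (hS : 0 ≤ S)
    (hk : 1 ≤ k) : 2 * k + 2 * C * (1 + (|γ * k / 2| + S) ^ 2)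
      ≤ 2 * (1 + C * (3 + S) ^ 2) * k ^ 2 := by
  have h1 : |γ * k / 2| ≤ 3 / 2 * k := by
    rw [abs_le]; constructor <;> nlinarith
  have h2 : |γ * k / 2| + S ≤ (3 / 2 + S) * k := by
    have : S * 1 ≤ S * k := by gcongr
    linarith
  have h3 : (|γ * k / 2| + S) ^ 2 ≤ ((3 / 2 + S) * k) ^ 2 :=
    pow_le_pow_left₀ (by positivity) h2 2
  have h4 : k ≤ k ^ 2 := by rw [sq]; exact le_mul_of_one_le_left (by linarith) hk
  have h5 : 1 + (|γ * k / 2| + S) ^ 2 ≤ (3 + S) ^ 2 * k ^ 2 :=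
    calc 1 + (|γ * k / 2| + S) ^ 2 ≤ k ^ 2 + ((3 / 2 + S) * k) ^ 2 := by linarith
      _ = (1 + (3 / 2 + S) ^ 2) * k ^ 2 := by ring
      _ ≤ _ := by
        gcongr
        nlinarith
  calc _ ≤ 2 * k ^ 2 + 2 * C * ((3 + S) ^ 2 * k ^ 2) := by gcongr
    _ = _ := by ring

/-- The weights cost `|α|²`, which two factors of `|α| wgt α' ≤ (3/L) wgt α` absorb; the Leibniz sum
is at most `(14 K²/L) wgt α`, and it enters squared. Hence 18 = 2 · 9 and 392 = 2 · 14², and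
everything carries `1 / L²`. -/
lemma weight_sum_le {c C K S L : ℝ} (hγ : -3 < γ) (hγ' : γ < 0) (hC : 0 < C) (hK : 0 ≤ K)
    (hS : 0 ≤ S) {α α' : Fin 3 → ℕ} (hα : 1 ≤ len α) (hL0 : 0 < L) (hKL : 2 * K ≤ L)
    (hL : 18 * (1 + C * (3 + S) ^ 2) + 392 * C * K ^ 4 ≤ min 1 c * L ^ 2)
    (hw : len α * wgt L α' ≤ 3 / L * wgt L α) :
    (2 * len α + 2 * C * (1 + (|γ * len α / 2| + S) ^ 2)) * wgt L α' ^ 2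
      + 2 * C * lowSum K L α * lowSum K L α ≤ min 1 c * wgt L α ^ 2 := by
  have hs0 := lowSum_nonneg hK hL0 α
  have hs1 : lowSum K L α ≤ 14 * K ^ 2 / L * wgt L α := sum_lowCoeff_mul_wgt_le hK hL0 hKL α
  have h0 := wgt_pos hL0 α'
  have h3 : (2 * len α + 2 * C * (1 + (|γ * len α / 2| + S) ^ 2)) * wgt L α' ^ 2
      ≤ 18 * (1 + C * (3 + S) ^ 2) / L ^ 2 * wgt L α ^ 2 := by
    calc _ ≤ 2 * (1 + C * (3 + S) ^ 2) * len α ^ 2 * wgt L α' ^ 2 := by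
          gcongr
          exact weight_coeff_le hγ hγ' hC hS (by exact_mod_cast hα)
      _ = 2 * (1 + C * (3 + S) ^ 2) * (len α * wgt L α') ^ 2 := by ring
      _ ≤ 2 * (1 + C * (3 + S) ^ 2) * (3 / L * wgt L α) ^ 2 := by gcongr
      _ = _ := by ring
  have h4 : 2 * C * lowSum K L α * lowSum K L α ≤ 392 * C * K ^ 4 / L ^ 2 * wgt L α ^ 2 := by
    calc _ = 2 * C * lowSum K L α ^ 2 := by ring
      _ ≤ 2 * C * (14 * K ^ 2 / L * wgt L α) ^ 2 := by gcongr
      _ = _ := by ring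
  calc _ ≤ (18 * (1 + C * (3 + S) ^ 2) + 392 * C * K ^ 4) / L ^ 2 * wgt L α ^ 2 :=
        (add_le_add h3 h4).trans_eq (by ring)
    _ ≤ _ := by
        gcongr
        rw [div_le_iff₀ (by positivity)]
        exact hL

/-- The integrated right-hand side of the evolution inequality under the induction hypothesis. -/
lemma IsFlow.lintegral_evolRhs_le {c C K S L : ℝ} (hγ : -3 < γ) (hγ' : γ < 0)
    (hE : EnergyConst γ c C K S) (hg : IsFlow γ T f₀ g) {α : Fin 3 → ℕ} (hα : 1 ≤ len α)
    (hL0 : 0 < L) (hKL : 2 * K ≤ L)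
    (hL : 18 * (1 + C * (3 + S) ^ 2) + 392 * C * K ^ 4 ≤ min 1 c * L ^ 2)
    (hlow : ∀ δ, len δ < len α → ∫⁻ s in Ioo 0 (min 1 T),
      ENNReal.ofReal (s ^ len δ) * energyD γ δ (g s) ≤ ENNReal.ofReal (wgt L δ ^ 2)) :
    ∫⁻ s in Ioo 0 (min 1 T), evolRhs γ C K S (wgt L) α (g s) s
      ≤ ENNReal.ofReal (min 1 c * wgt L α ^ 2) := by
  have hC := hE.C_pos
  have hK : 0 ≤ K := by linarith [hE.one_le]
  have hS := hE.S_nonneg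
  obtain ⟨α', l, hαl, hlen, hw⟩ := exists_lower hL0 hα
  have hs0 := lowSum_nonneg hK hL0 α
  have hm : ∀ δ, Measurable fun s : ℝ => ENNReal.ofReal (s ^ len δ) * energyD γ δ (g s) :=
    fun δ => Measurable.mul (by fun_prop) (hg.measurable_energyD δ)
  refine (setLIntegral_mono' measurableSet_Ioo fun s hs => evolRhs_le hC hK hL0 α α' l hαl hlen
    (g s) hs.1.le (hs.2.le.trans (min_le_left _ _))).trans ?_
  have hs' : Measurable fun s => ∑ β ∈ (box α).erase 0,
      ENNReal.ofReal (lowCoeff K α β / wgt L (α - β)) *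
        (ENNReal.ofReal (s ^ len (α - β)) * energyD γ (α - β) (g s)) :=
    Finset.measurable_fun_sum _ fun β _ => (hm (α - β)).const_mul _
  rw [lintegral_add_left ((hm α').const_mul _), lintegral_const_mul _ (hm α'),
    lintegral_const_mul _ hs', lintegral_finsetSum _ fun β _ => (hm (α - β)).const_mul _]
  simp only [lintegral_const_mul _ (hm _)]
  refine (add_le_add (mul_le_mul_right (hlow α' (by omega)) _) (mul_le_mul_right
    (Finset.sum_le_sum fun β hβ => mul_le_mul_right (hlow (α - β) ?_) _) _)).trans
    ((lowSum_identity (by positivity) (by positivity) hK hL0 α α').le.trans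
      (ENNReal.ofReal_le_ofReal (weight_sum_le hγ hγ' hC hK hS hα hL0 hKL hL hw)))
  obtain ⟨-, h3, h4⟩ := mem_erase_box hβ
  omega

end

end

/-! ### Induction on the order of the derivative and conclusion -/

section

section

variable {γ T : ℝ} {f₀ : L2V} {g : ℝ → L2V}

/-- The constants for which the induction over the order of the derivative closes. -/
structure AnalyticConst (c C K S M L : ℝ) : Prop where
  pos : 0 < L
  large : 2 * K ≤ L
  step : 18 * (1 + C * (3 + S) ^ 2) + 392 * C * K ^ 4 ≤ min 1 c * L ^ 2
  norm : 4 * M ^ 2 * Real.exp (4 * C * (1 + S ^ 2)) ≤ L ^ 2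
  energy : 2 * M ^ 2 + 8 * C * (1 + S ^ 2) * M ^ 2 * Real.exp (4 * C * (1 + S ^ 2)) ≤ c * L ^ 2

lemma exists_analyticConst {c C K S : ℝ} (hE : EnergyConst γ c C K S) (M : ℝ) :
    ∃ L, AnalyticConst c C K S M L := by
  have hc := hE.c_pos
  have hC := hE.C_pos
  have hK := hE.one_le
  have hS := hE.S_nonneg
  have hm : 0 < min 1 c := by positivity
  set X1 := (18 * (1 + C * (3 + S) ^ 2) + 392 * C * K ^ 4) / min 1 c with h1
  set X2 := 4 * M ^ 2 * Real.exp (4 * C * (1 + S ^ 2)) with h2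
  set X3 := (2 * M ^ 2 + 8 * C * (1 + S ^ 2) * M ^ 2 * Real.exp (4 * C * (1 + S ^ 2))) / c with h3
  have p1 : 0 ≤ X1 := by positivity
  have p2 : 0 ≤ X2 := by positivity
  have p3 : 0 ≤ X3 := by positivity
  -- As `K ≥ 1` this `L` exceeds 1, so `L ≤ L²`, and a sum of the lower bounds required of `L²`
  -- suffices.
  set L := 2 * K + X1 + X2 + X3 with hL
  have hL2 : L ≤ L ^ 2 := by rw [sq]; exact le_mul_of_one_le_left (by positivity) (by linarith)
  refine ⟨L, by positivity, by linarith, ?_, by linarith, ?_⟩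
  · have := (div_le_iff₀ hm).1 (show X1 ≤ L ^ 2 by linarith)
    linarith
  · have := (div_le_iff₀ hc).1 (show X3 ≤ L ^ 2 by linarith)
    linarith

lemma wgt_zero (L : ℝ) : wgt L 0 = L := by
  simp [wgt, len_zero, multiFactorial]

/-- The estimates of order `k` for the solution and its derivatives. -/
structure LevelBound (γ T L : ℝ) (g : ℝ → L2V) (k : ℕ) : Prop where
  deriv : ∀ δ, len δ = k → ∀ t, 0 < t → t ≤ min 1 T → HasWeakDeriv δ (g t) (dlim δ (g t))
  norm : ∀ δ, len δ = k → ∀ t, 0 < t → t ≤ min 1 T →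
    ENNReal.ofReal (t ^ k) * normD γ δ (g t) ≤ ENNReal.ofReal (wgt L δ ^ 2)
  energy : ∀ δ, len δ = k → ∫⁻ s in Ioo 0 (min 1 T), ENNReal.ofReal (s ^ k) * energyD γ δ (g s)
    ≤ ENNReal.ofReal (wgt L δ ^ 2)
  reg : ∀ᵐ s ∂volume.restrict (Ioo 0 (min 1 T)), Reg (k + 1) (g s)

lemma le_ofReal_of_const_mul {c X : ℝ} (hc : 0 < c) {a : ℝ≥0∞}
    (h : ENNReal.ofReal c * a ≤ ENNReal.ofReal (c * X)) : a ≤ ENNReal.ofReal X := by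
  rw [ENNReal.ofReal_mul hc.le] at h
  exact (ENNReal.mul_le_mul_iff_right (by simpa using hc) ENNReal.ofReal_ne_top).1 h

lemma IsFlow.levelBound_zero {c C K S M L : ℝ} (hγ : -3 < γ) (hγ' : γ < 0) (hT : 0 < T)
    (hE : EnergyConst γ c C K S) (hL : AnalyticConst c C K S M L) (hM : ‖f₀‖ ≤ M)
    (hg : IsFlow γ T f₀ g) : LevelBound γ T L g 0 := by
  have hC := hE.C_pos
  have hM2 : ‖f₀‖ ^ 2 ≤ M ^ 2 := pow_le_pow_left₀ (norm_nonneg _) hM 2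
  obtain ⟨h1, h2, h3⟩ := hg.level_zero hγ hγ' hT hE
  refine ⟨fun δ hδ t _ _ => ((reg_zero (L2Loc.of_L2V (g t))) δ hδ.le).1, fun δ hδ t h0 ht => ?_,
    fun δ hδ => ?_, h2⟩
  · rw [eq_zero_of_len hδ, normD_zero, wgt_zero, pow_zero, ENNReal.ofReal_one, one_mul]
    refine ENNReal.ofReal_le_ofReal ((h1 t h0 ht).trans (le_trans ?_ hL.norm))
    gcongr
  · rw [eq_zero_of_len hδ, wgt_zero]
    simp only [pow_zero, ENNReal.ofReal_one, one_mul]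
    refine le_ofReal_of_const_mul hE.c_pos ?_
    rw [← lintegral_const_mul _ (hg.measurable_energyD 0)]
    refine h3.trans (ENNReal.ofReal_le_ofReal (le_trans ?_ hL.energy))
    gcongr

lemma reg_succ_of_forall {k : ℕ} {u : V → ℝ} (h : Reg k u)
    (h' : ∀ α, len α = k → ∀ i, HasWeakDeriv (α + unitIdx i) u (dlim (α + unitIdx i) u) ∧
      L2Loc (dlim (α + unitIdx i) u)) : Reg (k + 1) u := by
  intro δ hδ
  rcases Nat.lt_or_ge k (len δ) with h0 | h0
  · obtain ⟨i, hi⟩ := exists_one_le_of_len (show 1 ≤ len δ by omega)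
    obtain ⟨δ', rfl, h6⟩ := exists_eq_add_unitIdx hi
    exact h' δ' (by omega) i
  · exact h δ h0

/-- The right-hand side is made at most `min 1 c` times `wgt²`: the factor 1 serves the bound at
each time, the factor `c` pays for the coercivity constant in front of the energy. At positive order
there is no initial term, so the same `L` reproduces itself. The gain of one derivative supplies the
regularity for the next order. -/
lemma IsFlow.levelBound_step {c C K S M L : ℝ} (hγ : -3 < γ) (hγ' : γ < 0) (hT : 0 < T)
    (hE : EnergyConst γ c C K S) (hL : AnalyticConst c C K S M L)
    (hg : IsFlow γ T f₀ g) {k : ℕ} (ih : ∀ m ≤ k, LevelBound γ T L g m) :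
    LevelBound γ T L g (k + 1) := by
  have hreg : ∀ᵐ s ∂volume.restrict (Ioo 0 (min 1 T)), Reg (k + 1) (g s) := (ih k le_rfl).reg
  have hx : ∀ β, 0 < wgt L β := wgt_pos hL.pos
  have hlow : ∀ α, len α = k + 1 → ∀ δ, len δ < len α → ∫⁻ s in Ioo 0 (min 1 T),
      ENNReal.ofReal (s ^ len δ) * energyD γ δ (g s) ≤ ENNReal.ofReal (wgt L δ ^ 2) :=
    fun α hα δ hδ => (ih (len δ) (by omega)).energy δ rfl
  have hfin : ∀ α, len α = k + 1 → ∀ δ, len δ < len α → ∫⁻ s in Ioo 0 (min 1 T),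
      ENNReal.ofReal (s ^ len δ) * energyD γ δ (g s) ≠ ⊤ :=
    fun α hα δ hδ => ne_top_of_le_ne_top ENNReal.ofReal_ne_top (hlow α hα δ hδ)
  have hrhs : ∀ α, len α = k + 1 → ∫⁻ s in Ioo 0 (min 1 T), evolRhs γ C K S (wgt L) α (g s) s
      ≤ ENNReal.ofReal (min 1 c * wgt L α ^ 2) := fun α hα =>
    hg.lintegral_evolRhs_le hγ hγ' hE (by omega) hL.pos hL.large hL.step (hlow α hα)
  have hinit : ∀ α, len α = k + 1 → initTerm f₀ (len α) = 0 := fun α hα => by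
    simp [initTerm, hα]
  have hpt : ∀ α, len α = k + 1 → ∀ t, 0 < t → t ≤ min 1 T →
      HasWeakDeriv α (g t) (dlim α (g t)) ∧
      ENNReal.ofReal (t ^ len α) * normD γ α (g t) ≤ ENNReal.ofReal (wgt L α ^ 2) := by
    intro α hα t h0 ht
    have h1 := (lintegral_mono_set (Ioo_subset_Ioo_right ht)).trans (hrhs α hα)
    obtain ⟨h2, h3⟩ := hg.hasWeakDeriv_of_evolution hγ hγ' hE α (by rwa [hα]) (hfin α hα) hx h0 ht
      (ne_top_of_le_ne_top ENNReal.ofReal_ne_top h1)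
    refine ⟨h2, h3.trans ?_⟩
    rw [hinit α hα, zero_add]
    refine h1.trans (ENNReal.ofReal_le_ofReal ?_)
    exact mul_le_of_le_one_left (sq_nonneg _) (min_le_left _ _)
  have hen : ∀ α, len α = k + 1 → (∀ᵐ s ∂volume.restrict (Ioo 0 (min 1 T)), ∀ i,
      HasWeakDeriv (α + unitIdx i) (g s) (dlim (α + unitIdx i) (g s)) ∧
        L2Loc (dlim (α + unitIdx i) (g s))) ∧
      ∫⁻ s in Ioo 0 (min 1 T), ENNReal.ofReal (s ^ len α) * energyD γ α (g s)
        ≤ ENNReal.ofReal (wgt L α ^ 2) := by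
    intro α hα
    obtain ⟨h2, h3⟩ := hg.energyD_of_evolution hγ hγ' hT hE α (by rwa [hα]) (hfin α hα) hx
      (ne_top_of_le_ne_top ENNReal.ofReal_ne_top (hrhs α hα))
    refine ⟨h2, le_ofReal_of_const_mul hE.c_pos ?_⟩
    rw [hinit α hα, zero_add] at h3
    rw [← lintegral_const_mul' _ _ ENNReal.ofReal_ne_top]
    simp only [mul_left_comm (ENNReal.ofReal c)]
    refine (h3.trans (hrhs α hα)).trans (ENNReal.ofReal_le_ofReal ?_)
    exact mul_le_mul_of_nonneg_right (min_le_right _ _) (sq_nonneg _)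
  refine ⟨fun δ hδ t h0 ht => (hpt δ hδ t h0 ht).1, fun δ hδ t h0 ht => ?_, fun δ hδ => ?_, ?_⟩
  · rw [← hδ]; exact (hpt δ hδ t h0 ht).2
  · rw [← hδ]; exact (hen δ hδ).2
  · have h4 : ∀ᵐ s ∂volume.restrict (Ioo 0 (min 1 T)), ∀ α, len α = k + 1 → ∀ i,
        HasWeakDeriv (α + unitIdx i) (g s) (dlim (α + unitIdx i) (g s)) ∧
        L2Loc (dlim (α + unitIdx i) (g s)) := by
      rw [ae_all_iff]
      intro α
      by_cases hα : len α = k + 1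
      · exact (hen α hα).1.mono fun s hs _ => hs
      · exact Eventually.of_forall fun s h => absurd h hα
    filter_upwards [hreg, h4] with s h5 h6
    exact reg_succ_of_forall h5 h6

lemma IsFlow.levelBound {c C K S M L : ℝ} (hγ : -3 < γ) (hγ' : γ < 0) (hT : 0 < T)
    (hE : EnergyConst γ c C K S) (hL : AnalyticConst c C K S M L) (hM : ‖f₀‖ ≤ M)
    (hg : IsFlow γ T f₀ g) (k : ℕ) : LevelBound γ T L g k := by
  induction k using Nat.strong_induction_on with
  | _ k ih =>
    cases k with
    | zero => exact hg.levelBound_zero hγ hγ' hT hE hL hM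
    | succ k => exact hg.levelBound_step hγ hγ' hT hE hL fun m hm => ih m (by omega)

end

/-- The norm `sqNormA` is controlled by the energy density. -/
lemma exists_sqNormA_le {γ : ℝ} (hγ : -3 < γ) (hγ' : γ < 0) : ∃ K : ℝ, 1 ≤ K ∧
    ∀ (θ r : ℝ) (u : V → ℝ) (Du : Fin 3 → V → ℝ),
      sqNormA γ θ (fun v => r * u v) (fun j v => r * Du j v)
        ≤ ENNReal.ofReal K * (ENNReal.ofReal (r ^ 2) * eInt γ (fun v => bracket v ^ θ) Du u) := by
  obtain ⟨K, hK, h⟩ := exists_abarDeriv_form_le hγ hγ'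
  refine ⟨K, hK, fun θ r u Du => ?_⟩
  rw [← mul_assoc, ← ENNReal.ofReal_mul (by linarith), eInt,
    ← lintegral_const_mul' _ _ ENNReal.ofReal_ne_top]
  refine lintegral_mono fun v => ?_
  rw [← ENNReal.ofReal_mul (by positivity)]
  refine ENNReal.ofReal_le_ofReal ?_
  have hb := bracket_pos v
  have h0 : ∀ ξ : Fin 3 → ℝ, ∑ i, ∑ j, abar γ i j v * ξ i * ξ j ≤ K * mform γ v ξ := by
    intro ξ
    have h1 := (le_abs_self _).trans (h 0 v ξ ξ)
    simp only [abarDeriv_zero, len_zero, Real.mul_self_sqrt (mform_nonneg γ v ξ)] at h1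
    simpa [multiFactorial] using h1
  have h1 := h0 (fun i => Du i v)
  have h2 := h0 (fun i => v i)
  have h3 : mform γ v (fun i => v i) ≤ bracket v ^ (γ + 2) := by
    rw [Real.rpow_add hb, Real.rpow_two, bracket_sq]
    simp only [mform, bform, norm_sq_eq_sum, Fin.sum_univ_three]
    have := Real.rpow_pos_of_pos hb γ
    nlinarith
  have h4 : bracket v ^ (2 * θ) = (bracket v ^ θ) ^ 2 := by
    rw [← Real.rpow_natCast, ← Real.rpow_mul hb.le]; congr 1; push_cast; ring
  have h5 : ∑ j, ∑ k, bracket v ^ (2 * θ) *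
      (abar γ j k v * (r * Du j v) * (r * Du k v) + 1 / 4 * abar γ j k v * v j * v k *
        (r * u v) ^ 2) = (bracket v ^ θ) ^ 2 * r ^ 2 * ((∑ i, ∑ j, abar γ i j v * Du i v * Du j v)
          + 1 / 4 * (∑ i, ∑ j, abar γ i j v * v i * v j) * u v ^ 2) := by
    rw [h4]
    simp only [Fin.sum_univ_three]
    ring
  rw [h5]
  have h6 : 1 / 4 * (∑ i, ∑ j, abar γ i j v * v i * v j) * u v ^ 2
      ≤ K * (bracket v ^ (γ + 2) * u v ^ 2) := by
    have h7 := mul_le_mul_of_nonneg_left h3 (show 0 ≤ K by linarith)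
    have h8 : 0 ≤ K * bracket v ^ (γ + 2) := by positivity
    rw [← mul_assoc]
    exact mul_le_mul_of_nonneg_right (by linarith) (sq_nonneg _)
  calc _ ≤ (bracket v ^ θ) ^ 2 * r ^ 2 * (K * mform γ v (fun i => Du i v)
        + K * (bracket v ^ (γ + 2) * u v ^ 2)) := by gcongr
    _ = _ := by rw [edens]; ring

lemma sqNormTwo_const_mul {θ r : ℝ} (u : V → ℝ) :
    sqNormTwo θ (fun v => r * u v) = ENNReal.ofReal (r ^ 2) * sqNormTwo θ u := by
  rw [sqNormTwo, sqNormTwo, ← lintegral_const_mul' _ _ ENNReal.ofReal_ne_top]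
  refine lintegral_congr fun v => ?_
  rw [← ENNReal.ofReal_mul (by positivity)]
  congr 1; ring

lemma sq_rpow_half {t : ℝ} (ht : 0 < t) (k : ℕ) : (t ^ ((k : ℝ) / 2)) ^ 2 = t ^ k := by
  rw [← Real.rpow_natCast, ← Real.rpow_mul ht.le, ← Real.rpow_natCast]
  congr 1; push_cast; ring

lemma LevelBound.estimate {γ T L K : ℝ} {g : ℝ → L2V} {α : Fin 3 → ℕ} (hL : 0 < L) (hK : 1 ≤ K)
    (hA : ∀ (θ r : ℝ) (u : V → ℝ) (Du : Fin 3 → V → ℝ),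
      sqNormA γ θ (fun v => r * u v) (fun j v => r * Du j v)
        ≤ ENNReal.ofReal K * (ENNReal.ofReal (r ^ 2) * eInt γ (fun v => bracket v ^ θ) Du u))
    (h : LevelBound γ T L g (len α)) {t : ℝ} (h0 : 0 < t) (ht : t ≤ min 1 T) :
    sqNormTwo (γ * len α / 2) (fun v => t ^ ((len α : ℝ) / 2) * dlim α (g t) v)
      + ∫⁻ τ in Ioo 0 t, sqNormA γ (γ * len α / 2)
          (fun v => τ ^ ((len α : ℝ) / 2) * dlim α (g τ) v)
          (fun j v => τ ^ ((len α : ℝ) / 2) * dlim (α + Pi.single j 1) (g τ) v)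
      ≤ ENNReal.ofReal (((1 + K) * L) ^ (2 * len α + 2) * (multiFactorial α : ℝ) ^ 2) := by
  have h1 : sqNormTwo (γ * len α / 2) (fun v => t ^ ((len α : ℝ) / 2) * dlim α (g t) v)
      ≤ ENNReal.ofReal (wgt L α ^ 2) := by
    rw [sqNormTwo_const_mul, sq_rpow_half h0]
    exact h.norm α rfl t h0 ht
  have h2 : ∫⁻ τ in Ioo 0 t, sqNormA γ (γ * len α / 2)
          (fun v => τ ^ ((len α : ℝ) / 2) * dlim α (g τ) v)
          (fun j v => τ ^ ((len α : ℝ) / 2) * dlim (α + Pi.single j 1) (g τ) v)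
      ≤ ENNReal.ofReal (K * wgt L α ^ 2) := by
    calc _ ≤ ∫⁻ τ in Ioo 0 t, ENNReal.ofReal K *
          (ENNReal.ofReal (τ ^ len α) * energyD γ α (g τ)) :=
          setLIntegral_mono' measurableSet_Ioo fun τ hτ => by
            have := hA (γ * len α / 2) (τ ^ ((len α : ℝ) / 2)) (dlim α (g τ))
              (fun j => dlim (α + Pi.single j 1) (g τ))
            rw [sq_rpow_half hτ.1] at this
            exact this
      _ ≤ ∫⁻ τ in Ioo 0 (min 1 T), ENNReal.ofReal K *
          (ENNReal.ofReal (τ ^ len α) * energyD γ α (g τ)) :=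
          lintegral_mono_set (Ioo_subset_Ioo_right ht)
      _ ≤ _ := by
          rw [lintegral_const_mul' _ _ ENNReal.ofReal_ne_top, ENNReal.ofReal_mul (by linarith)]
          exact mul_le_mul_right (h.energy α rfl) _
  refine (add_le_add h1 h2).trans ?_
  rw [← ENNReal.ofReal_add (by positivity) (by positivity)]
  refine ENNReal.ofReal_le_ofReal ?_
  -- A single factor `1 + K`, from comparing the norm `sqNormA` with the energy density, is hidden
  -- in the power allowed by the statement.
  have h3 : 1 + K ≤ (1 + K) ^ (2 * len α + 2) := le_self_pow₀ (by linarith) (by omega)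
  calc wgt L α ^ 2 + K * wgt L α ^ 2 = (1 + K) * wgt L α ^ 2 := by ring
    _ ≤ (1 + K) ^ (2 * len α + 2) * wgt L α ^ 2 := by gcongr
    _ = _ := by rw [wgt, mul_pow (1 + K) L]; ring

end

end Landau

end

theorem proposition5p1 (γ : ℝ) (hγ : -3 < γ) (hγ' : γ < 0) (M : ℝ) :
    ∃ C : ℝ, 0 < C ∧
      ∀ (T : ℝ) (f₀ : Landau.L2V) (f : ℝ → Landau.L2V), 0 < T → ‖f₀‖ ≤ M →
        Landau.IsWeakSolution γ T f₀ f →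
        -- `g` is the weakly continuous representative of `f`
        ∃ g : ℝ → Landau.L2V,
          (∀ᵐ t ∂(volume.restrict (Ioo 0 T)), g t = f t) ∧
          (∀ h : Landau.L2V, ContinuousOn (fun t => inner ℝ (g t) h) (Icc 0 T)) ∧
          g 0 = f₀ ∧
          -- `D α t` is the weak derivative `∂^α f(t)`
          ∃ D : (Fin 3 → ℕ) → ℝ → Landau.V → ℝ,
            (∀ (α : Fin 3 → ℕ) (t : ℝ), 0 < t → t ≤ 1 → t ≤ T →
              Landau.HasWeakDeriv α (g t) (D α t)) ∧
            ∀ (α : Fin 3 → ℕ) (t : ℝ), 0 < t → t ≤ 1 → t ≤ T →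
              Landau.sqNormTwo (γ * Landau.len α / 2)
                  (fun v => t ^ ((Landau.len α : ℝ) / 2) * D α t v)
                + ∫⁻ τ in Ioo 0 t, Landau.sqNormA γ (γ * Landau.len α / 2)
                    (fun v => τ ^ ((Landau.len α : ℝ) / 2) * D α τ v)
                    (fun j v => τ ^ ((Landau.len α : ℝ) / 2) * D (α + Pi.single j 1) τ v)
              ≤ ENNReal.ofReal
                  (C ^ (2 * Landau.len α + 2) * (Landau.multiFactorial α : ℝ) ^ 2) := by
  obtain ⟨c, C, K, S, hE⟩ := Landau.exists_energyConst hγ hγ'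
  obtain ⟨L, hL⟩ := Landau.exists_analyticConst hE M
  obtain ⟨A, hA1, hA⟩ := Landau.exists_sqNormA_le hγ hγ'
  have hL0 := hL.pos
  refine ⟨(1 + A) * L, by positivity, fun T f₀ f hT hM hf => ?_⟩
  obtain ⟨g, hg, hgf⟩ := hf.exists_isFlow hγ hγ' hT
  have hlev := hg.levelBound hγ hγ' hT hE hL hM
  exact ⟨g, hgf, fun h => (hg.cont h).continuousOn, hg.zero, fun α t => Landau.dlim α (g t),
    fun α t h0 h1 h2 => (hlev _).deriv α rfl t h0 (le_min h1 h2),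
    fun α t h0 h1 h2 => (hlev _).estimate hL0 hA1 hA h0 (le_min h1 h2)⟩
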